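/- **Setting.** Let $0<n<d$ be integers; for $x\in\mathbb R^d$ let $\widetilde x\in\mathbb R^n$ be the first $n$ coordinates. Let $K:\mathbb R^d\setminus\{0\}\to\mathbb R$ be odd, with partial derivatives up to order two, such that for some $C>0$ $$|K(x)|\le \tfrac{C}{|x|^{n}},\qquad |\partial_iK(x)|\le \tfrac{C}{|x|^{n+1}},\qquad |\partial_i\partial_jK(x)|\le \tfrac{C}{|x|^{n+2}}\qquad(x\ne0,\ 1\le i,j\le d).$$ Fix a nondecreasing $\mathcal C^2$ function $\varphi_{\mathbb R}:[0,\infty)\to[0,\infty)$ with $\chi_{[3\sqrt n,\infty)}\le\varphi_{\mathbb R}\le\chi_{[2.1\sqrt n,\infty)}$ and put $\varphi_\epsilon(x)=\varphi_{\mathbb R}(|\widetilde x|/\epsilon)$ for $\epsilon>0$. Let $\widetilde P\subset\mathbb R^n$ be a cube (half-open, sides parallel to the axes, positive side length), $A:\mathbb R^n\to\mathbb R^{d-n}$ a Lipschitz function vanishing outside $\widetilde P$, $\Gamma=\{x\in\mathbb R^d: x=(\widetilde x,A(\widetilde x))\}$, and $\mu=f\,\mathcal H^n_\Gamma$, where $f$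 is Borel, $f(x)=1$ for $x\in\Gamma$ with $\widetilde x\notin\widetilde P$, and $C_0^{-1}\le f(x)\le C_0$ for $x\in\Gamma$ with $\widetilde x\in\widetilde P$, for a constant $C_0>0$. Here $\mathcal H^n$ is normalized to agree with Lebesgue measure on $n$-planes. Integrals of $K$ over unbounded sets are understood as $\lim_{M\to\infty}$ of the integrals over the points $y$ at distance less than $M$ from the first variable of the kernel. Put $$(K\varphi_\epsilon*\mu)(x)=\int\varphi_\epsilon(x-y)K(x-y)\,d\mu(y).$$ For $m\in\mathbb Z$ and $a\in\mathbb R^n$ let $D_m^a=(a+[0,2^{-m})^n)\times\mathbb R^{d-n}$ and $\mathcal D_m^a=\{D_m^{a+2^{-m}q}:q\in\mathbb Z^n\}$. For $x\in D\in\mathcal D_m^a$ put $$E_m^a\mu(x)=\frac1{\mu(D)}\int_D\int_{D^c}K(z-y)\,d\mu(y)\,d\mu(z),\qquad\text{and}\qquad E_m\mu(x)=2^{mn}\int_{\{a:\,x\in D_m^a\}}E_m^a\mu(x)\,da .$$ A v-cube is a set $Q=\widetilde Q\times\mathbb R^{d-n}$ with $\widetilde Q\subset\mathbb R^n$ a cube,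 of side length $\ell(Q)$ and center $\widetilde z_Q$; $\lambda Q=\lambda\widetilde Q\times\mathbb R^{d-n}$, where $\lambda\widetilde Q$ has the same center as $\widetilde Q$ and side length $\lambda\ell(Q)$. Let $\mathcal D$ be the family of v-cubes over the standard dyadic cubes of $\mathbb R^n$ of all sizes $2^{-m}$, $m\in\mathbb Z$. Given $C_\Gamma$, put for a v-cube $Q$ $$\beta_{2,\mu}(Q)=\inf_L\Big\{\frac1{\ell(Q)^n}\int_{C_\Gamma Q}\Big(\frac{\operatorname{dist}(y,L)}{\ell(Q)}\Big)^2d\mu(y)\Big\}^{1/2},$$ $$\alpha_\mu(Q)=\frac1{\ell(Q)^{n+1}}\inf_{c\ge0,\,L}\ \sup\Big\{\Big|\int g\,d\mu-c\int g\,d\mathcal H^n_L\Big|:\ \operatorname{Lip}(g)\le1,\ \operatorname{supp}g\subset \overline B(\widetilde z_Q,C_\Gamma\ell(Q))\times\mathbb R^{d-n}\Big\},$$ where $L$ runs over the $n$-planes of $\mathbb R^d$ and $g$ over real functions on $\mathbb R^d$. **Theorem.** There are constants $C_1,C_2>0$, depending only on $C_0$, $n$, $d$, $K$, $\varphi_{\mathbb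 R}$ and (an upper bound for) $\operatorname{Lip}(A)$, such that, for every $C_\Gamma>10\sqrt n\,(1+\operatorname{Lip}(A))$ (with the same upper bound in place of $\operatorname{Lip}(A)$) and all $\widetilde P$, $A$, $f$ as above, the limits and integrals defining $(K\varphi_\epsilon*\mu)(x)$, for $x\in\Gamma$ and $\epsilon>0$, and $E_m\mu$ exist (those over $D^c$ for $\mu$-almost every $z\in D$), and the square function $$W\mu(x)=\Big(\sum_{m\in\mathbb Z}|(K\varphi_{2^{-m}}*\mu)(x)-E_m\mu(x)|^2\Big)^{1/2}$$ satisfies $$\|W\mu\|_{L^2(\mu)}^2\le C_1\sum_{Q\in\mathcal D}\big(\alpha_\mu(C_2Q)^2+\beta_{2,\mu}(Q)^2\big)\,\mu(Q).$$ -/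

import Mathlib

open Set Filter Topology MeasureTheory
open scoped ENNReal NNReal

noncomputable section

namespace LipGraph

/-- `ℝⁿ` with its Euclidean norm. -/
abbrev Eu (n : ℕ) : Type := EuclideanSpace ℝ (Fin n)

/-- For `x ∈ ℝᵈ`, `d = n + k`, the point `x̃ ∈ ℝⁿ` of its first `n` coordinates. -/
def tilde {n k : ℕ} (x : Eu (n + k)) : Eu n :=
  WithLp.toLp 2 fun i => x (Fin.castAdd k i)

/-- The last `k = d - n` coordinates of `x ∈ ℝᵈ`. -/
def vert {n k : ℕ} (x : Eu (n + k)) : Eu k :=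
  WithLp.toLp 2 fun j => x (Fin.natAdd n j)

/-- The graph `Γ = {x : x = (x̃, A(x̃))}`. -/
def graph {n k : ℕ} (A : Eu n → Eu k) : Set (Eu (n + k)) :=
  {x | vert x = A (tilde x)}

/-- The measure `f 𝓗ⁿ_Γ`, with `𝓗ⁿ` normalized to agree with Lebesgue measure on `n`-planes. -/
def graphMeasure {n k : ℕ} (A : Eu n → Eu k) (f : Eu (n + k) → ℝ) : Measure (Eu (n + k)) :=
  ((μHE[n] : Measure (Eu (n + k))).restrict (graph A)).withDensity fun x => ENNReal.ofReal (f x)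

/-! ### Cubes and v-cubes -/

/-- The cube `corner + [0, side)ⁿ` of `ℝⁿ`; it is only used with `side > 0`. -/
structure Cube (n : ℕ) where
  corner : Eu n
  side : ℝ

/-- The cube as a subset `Q̃` of `ℝⁿ`. -/
def Cube.base {n : ℕ} (Q : Cube n) : Set (Eu n) :=
  {u | ∀ i, Q.corner i ≤ u i ∧ u i < Q.corner i + Q.side}

/-- The v-cube `Q̃ × ℝᵈ⁻ⁿ` over the cube. -/
def Cube.vset {n : ℕ} (Q : Cube n) (k : ℕ) : Set (Eu (n + k)) :=
  {x | tilde x ∈ Q.base}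

/-- The centre of the cube. -/
def Cube.center {n : ℕ} (Q : Cube n) : Eu n :=
  WithLp.toLp 2 fun i => Q.corner i + Q.side / 2

/-- The cube `t Q`: same centre, side length multiplied by `t`. -/
def Cube.scale {n : ℕ} (Q : Cube n) (t : ℝ) : Cube n where
  corner := WithLp.toLp 2 fun i => Q.center i - t * Q.side / 2
  side := t * Q.side

/-- The cube `a + [0, 2⁻ᵐ)ⁿ`. -/
def cubeAt {n : ℕ} (m : ℤ) (a : Eu n) : Cube n where
  corner := a
  side := (2 : ℝ) ^ (-m)

/-- The vector `2⁻ᵐ q`, for `q ∈ ℤⁿ`. -/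
def gridPoint {n : ℕ} (m : ℤ) (q : Fin n → ℤ) : Eu n :=
  WithLp.toLp 2 fun i => (2 : ℝ) ^ (-m) * (q i : ℝ)

/-- The standard dyadic cubes of side `2⁻ᵐ`; each dyadic cube is obtained from exactly one
pair `(m, q)`. -/
def dyadic {n : ℕ} (m : ℤ) (q : Fin n → ℤ) : Cube n :=
  cubeAt m (gridPoint m q)

/-! ### Kernels and smooth truncations -/

/-- Odd kernels `K` on `ℝᵈ ∖ {0}` whose partial derivatives up to order two exist and satisfy
`|∇ʲ K(x)| ≤ C |x|^(-n-j)` for `j = 0, 1, 2`. -/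
def IsKernel (n k : ℕ) (K : Eu (n + k) → ℝ) : Prop :=
  (∀ x, x ≠ 0 → K (-x) = -K x) ∧
  ∃ C : ℝ, 0 < C ∧ ∀ x : Eu (n + k), x ≠ 0 →
    |K x| ≤ C / ‖x‖ ^ n ∧
    (∀ i : Fin (n + k),
      LineDifferentiableAt ℝ K x (EuclideanSpace.single i 1) ∧
      |lineDeriv ℝ K x (EuclideanSpace.single i 1)| ≤ C / ‖x‖ ^ (n + 1)) ∧
    (∀ i j : Fin (n + k),
      LineDifferentiableAt ℝ (fun y => lineDeriv ℝ K y (EuclideanSpace.single j 1)) x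
        (EuclideanSpace.single i 1) ∧
      |lineDeriv ℝ (fun y => lineDeriv ℝ K y (EuclideanSpace.single j 1)) x
        (EuclideanSpace.single i 1)| ≤ C / ‖x‖ ^ (n + 2))

/-- The profile `φ_ℝ : [0,∞) → [0,∞)`: nondecreasing, `C²`, and
`χ_[3√n,∞) ≤ φ_ℝ ≤ χ_[2.1√n,∞)`. -/
def IsProfile (n : ℕ) (φ : ℝ → ℝ) : Prop :=
  MonotoneOn φ (Ici 0) ∧ ContDiffOn ℝ 2 φ (Ici 0) ∧
  ∀ t, 0 ≤ t →
    (Ici (3 * √(n : ℝ))).indicator (fun _ => (1 : ℝ)) t ≤ φ t ∧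
    φ t ≤ (Ici (2.1 * √(n : ℝ))).indicator (fun _ => (1 : ℝ)) t

/-- `φ_ε(x) = φ_ℝ(|x̃| / ε)`. -/
def phiEps {n k : ℕ} (φ : ℝ → ℝ) (ε : ℝ) (x : Eu (n + k)) : ℝ :=
  φ (‖tilde x‖ / ε)

/-- `∫ g dμ`, understood as `lim_{M → ∞} ∫_{|z - y| < M} g(y) dμ(y)`. -/
def limInt {n k : ℕ} (μ : Measure (Eu (n + k))) (g : Eu (n + k) → ℝ) (z : Eu (n + k)) : ℝ :=
  limUnder atTop fun M : ℝ => ∫ y in Metric.ball z M, g y ∂μ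

/-- The integral `limInt μ g z` makes sense: the truncated integrals converge absolutely
and have a (finite) limit. -/
def HasLimInt {n k : ℕ} (μ : Measure (Eu (n + k))) (g : Eu (n + k) → ℝ)
    (z : Eu (n + k)) : Prop :=
  (∀ M : ℝ, IntegrableOn g (Metric.ball z M) μ) ∧
  ∃ l : ℝ, Tendsto (fun M : ℝ => ∫ y in Metric.ball z M, g y ∂μ) atTop (𝓝 l)

/-- `(K φ_ε * μ)(x)`. -/
def smoothTrunc {n k : ℕ} (K : Eu (n + k) → ℝ) (φ : ℝ → ℝ) (μ : Measure (Eu (n + k)))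
    (ε : ℝ) (x : Eu (n + k)) : ℝ :=
  limInt μ (fun y => phiEps φ ε (x - y) * K (x - y)) x

/-! ### The averaged martingale -/

/-- `∫_{Dᶜ} K(z - y) dμ(y)`. -/
def outerInt {n k : ℕ} (K : Eu (n + k) → ℝ) (μ : Measure (Eu (n + k)))
    (D : Set (Eu (n + k))) (z : Eu (n + k)) : ℝ :=
  limInt (μ.restrict Dᶜ) (fun y => K (z - y)) z

/-- `E_D μ = μ(D)⁻¹ ∫_D ∫_{Dᶜ} K(z - y) dμ(y) dμ(z)`. -/
def cubeMean {n k : ℕ} (K : Eu (n + k) → ℝ) (μ : Measure (Eu (n + k)))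
    (D : Set (Eu (n + k))) : ℝ :=
  (μ.real D)⁻¹ * ∫ z in D, outerInt K μ D z ∂μ

/-- `E_m^a μ(x) = ∑_D χ_D(x) E_D μ`, the sum over the v-cubes `D` of side `2⁻ᵐ` of the
dyadic lattice translated by `a`. -/
def martingale {n k : ℕ} (K : Eu (n + k) → ℝ) (μ : Measure (Eu (n + k)))
    (m : ℤ) (a : Eu n) (x : Eu (n + k)) : ℝ :=
  ∑' q : Fin n → ℤ, ((cubeAt m (a + gridPoint m q)).vset k).indicator
    (fun _ => cubeMean K μ ((cubeAt m (a + gridPoint m q)).vset k)) x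

/-- `E_m μ(x) = 2^{mn} ∫_{a : x ∈ D_m^a} E_m^a μ(x) da`. -/
def avgMartingale {n k : ℕ} (K : Eu (n + k) → ℝ) (μ : Measure (Eu (n + k)))
    (m : ℤ) (x : Eu (n + k)) : ℝ :=
  (2 : ℝ) ^ (m * (n : ℤ)) *
    ∫ a in {a : Eu n | x ∈ (cubeAt m a).vset k}, martingale K μ m a x

/-- All the limits and integrals that enter `K φ_ε * μ` (on the graph of `A`) and `E_m μ` exist. -/
def WellDefined {n k : ℕ} (K : Eu (n + k) → ℝ) (φ : ℝ → ℝ) (A : Eu n → Eu k)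
    (μ : Measure (Eu (n + k))) : Prop :=
  (∀ x ∈ graph A, ∀ ε : ℝ, 0 < ε →
    HasLimInt μ (fun y => phiEps φ ε (x - y) * K (x - y)) x) ∧
  (∀ (m : ℤ) (a : Eu n),
    (∀ᵐ z ∂(μ.restrict ((cubeAt m a).vset k)),
      HasLimInt (μ.restrict ((cubeAt m a).vset k)ᶜ) (fun y => K (z - y)) z) ∧
    IntegrableOn (outerInt K μ ((cubeAt m a).vset k)) ((cubeAt m a).vset k) μ) ∧
  (∀ (m : ℤ) (x : Eu (n + k)),
    IntegrableOn (fun a : Eu n => martingale K μ m a x) {a | x ∈ (cubeAt m a).vset k})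

/-- `Wμ(x) = (∑_m |(K φ_{2⁻ᵐ} * μ)(x) - E_m μ(x)|²)^{1/2}`. -/
def squareFun {n k : ℕ} (K : Eu (n + k) → ℝ) (φ : ℝ → ℝ) (μ : Measure (Eu (n + k)))
    (x : Eu (n + k)) : ℝ≥0∞ :=
  (∑' m : ℤ, ENNReal.ofReal
    (|smoothTrunc K φ μ ((2 : ℝ) ^ (-m)) x - avgMartingale K μ m x| ^ 2)) ^ (1 / 2 : ℝ)

/-! ### The coefficients `α` and `β` -/

/-- `L` is an (affine) `n`-plane of `ℝᵈ`. -/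
def IsPlane (n : ℕ) {d : ℕ} (L : AffineSubspace ℝ (Eu d)) : Prop :=
  (L : Set (Eu d)).Nonempty ∧ Module.finrank ℝ L.direction = n

/-- `β_{p,μ}(Q)` for the v-cube `Q`, with integration over `c Q` (where `c = C_Γ`). -/
def betaCoeff {n k : ℕ} (c p : ℝ) (μ : Measure (Eu (n + k))) (Q : Cube n) : ℝ≥0∞ :=
  ⨅ (L : AffineSubspace ℝ (Eu (n + k))) (_ : IsPlane n L),
    ((ENNReal.ofReal Q.side ^ n)⁻¹ *
      ∫⁻ y in (Q.scale c).vset k,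
        (Metric.infEDist y (L : Set (Eu (n + k))) / ENNReal.ofReal Q.side) ^ p ∂μ) ^ (1 / p)

/-- `dist_F(σ, ν) = sup {|∫ f dσ - ∫ f dν| : Lip(f) ≤ 1, supp f ⊂ F}`. -/
def lipDist {d : ℕ} (F : Set (Eu d)) (σ ν : Measure (Eu d)) : ℝ≥0∞ :=
  ⨆ (f : Eu d → ℝ) (_ : LipschitzWith 1 f) (_ : tsupport f ⊆ F),
    ENNReal.ofReal |∫ x, f x ∂σ - ∫ x, f x ∂ν|

/-- `B_Q = B(z̃_Q, c ℓ(Q)) × ℝᵈ⁻ⁿ` (where `c = C_Γ`). -/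
def Cube.cyl {n : ℕ} (Q : Cube n) (c : ℝ) (k : ℕ) : Set (Eu (n + k)) :=
  {x | tilde x ∈ Metric.closedBall Q.center (c * Q.side)}

/-- `α_μ(Q)` for the v-cube `Q`. Every v-cube meets `Γ = supp μ` for the measures `μ`
considered here, so no convention is needed for v-cubes that miss the support. -/
def alphaCoeff {n k : ℕ} (c : ℝ) (μ : Measure (Eu (n + k))) (Q : Cube n) : ℝ≥0∞ :=
  (ENNReal.ofReal Q.side ^ (n + 1))⁻¹ *
    ⨅ (t : ℝ≥0) (L : AffineSubspace ℝ (Eu (n + k))) (_ : IsPlane n L),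
      lipDist (Q.cyl c k) μ
        (t • (μHE[n] : Measure (Eu (n + k))).restrict (L : Set (Eu (n + k))))

end LipGraph

end

/-!
Everything is transported to `ℝⁿ` by `tilde`: the measure becomes a measure `ν` comparable with
Lebesgue measure, equal to it outside a ball, and `μ` is the image of `ν` under
`graphMap A : u ↦ (u, A u)`. The constant `C₂` is `1`.

*Flatness on `ℝⁿ`.* To each cube `Q` are attached an affine approximation `affPart Q A`, given by
explicit averages of `A` (hence linear in `A`, and exact on affine maps), with error `affErr Q A`,
and a density `dens Q ν`. The number `gam Q A ν` adds the Lipschitz distance between `ν` and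
`dens Q ν` times Lebesgue measure to the mean of the error. It is controlled by the
coefficients: testing `α` on functions of `tilde` alone shows that every plane that is not vertical
projects to a multiple of Lebesgue measure (`exists_osc_le_alpha`), and a plane that is close to
the graph in mean square cannot be vertical, so that `β₂` bounds the mean square of the
error (`exists_affErr_le_beta`). The function `jones A ν j` collects these quantities at scale
`2⁻ʲ`, and `exists_lintegral_jones_le` bounds its square integral by the `j`-th part of the
right-hand side.

*Cancellation.* The kernel is cut into odd pieces `piece K φ r`, each living at one
scale (`exists_isPiece`). Write `ε = 2⁻ᵐ`, and let `D` be the cubes of side `ε`. The integral of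
`K` over the complement of `D` is the integral truncated at radius `ε` plus the pieces of smaller
scale, and since the pieces are odd, the interaction of `D` with itself vanishes
(`integral_outInt_eq`, `cubeMean_eq`). Averaging over the translates of `D` that contain a given
point replaces the indicators of the cubes by a Lipschitz weight `avgWeight`
(`average_cubeMean`). So the `m`-th term of the square function is a sum of two parts.
* For the scales larger than `ε`: a mean of the differences, at two nearby points, of the integrals
  of the pieces. Over an affine graph with a constant density these integrals vanish, so the
  differences are bounded by the deviation from flatness, with a gain given by the ratio of
  the scales that comes from the second derivatives of `K` (`exists_far_le`).
* For the scales smaller than `ε`: integrals of the pieces against the Lipschitz weight, which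
  after antisymmetrization again vanish in the flat case (`exists_weighted_le`).

In both parts the flat models at different scales are compared by telescoping. The outcome
is `exists_truncLim_sub_average_le`: each term is at most a sum of the `jones A ν`, evaluated at the
point or averaged over a ball, with weights `2⁻ˡ` where `l` is the distance of the scales.
Cauchy–Schwarz and the boundedness of the averages on `L²` conclude.
-/

namespace LipGraph

variable {n k : ℕ}

/-! ### Coordinates and the graph map -/

/-- The point `(u, v)` of `ℝⁿ⁺ᵏ`. -/
noncomputable def join (u : Eu n) (v : Eu k) : Eu (n + k) :=
  WithLp.toLp 2 (Fin.append (fun i => u i) (fun j => v j))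

@[simp] lemma tilde_join (u : Eu n) (v : Eu k) : tilde (join u v) = u := by
  ext i; simp [tilde, join]

@[simp] lemma vert_join (u : Eu n) (v : Eu k) : vert (join u v) = v := by
  ext i; simp [vert, join]

@[simp] lemma join_tilde_vert (x : Eu (n + k)) : join (tilde x) (vert x) = x := by
  ext i
  refine Fin.addCases (fun i => ?_) (fun i => ?_) i <;> simp [join, tilde, vert]

lemma join_add (u u' : Eu n) (v v' : Eu k) : join (u + u') (v + v') = join u v + join u' v' := by
  ext i
  refine Fin.addCases (fun i => ?_) (fun i => ?_) i <;> simp [join]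

lemma join_neg (u : Eu n) (v : Eu k) : join (-u) (-v) = -join u v := by
  ext i
  refine Fin.addCases (fun i => ?_) (fun i => ?_) i <;> simp [join]

lemma join_sub (u u' : Eu n) (v v' : Eu k) : join (u - u') (v - v') = join u v - join u' v' := by
  simp only [sub_eq_add_neg, join_add, join_neg]

lemma join_smul (c : ℝ) (u : Eu n) (v : Eu k) : join (c • u) (c • v) = c • join u v := by
  ext i
  refine Fin.addCases (fun i => ?_) (fun i => ?_) i <;> simp [join]

lemma norm_join_sq (u : Eu n) (v : Eu k) : ‖join u v‖ ^ 2 = ‖u‖ ^ 2 + ‖v‖ ^ 2 := by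
  simp [EuclideanSpace.norm_sq_eq, Fin.sum_univ_add, join]

lemma norm_join_le (u : Eu n) (v : Eu k) : ‖join u v‖ ≤ ‖u‖ + ‖v‖ := by
  have h := norm_join_sq u v
  refine abs_le_of_sq_le_sq' ?_ (by positivity) |>.2
  nlinarith [norm_nonneg u, norm_nonneg v]

lemma norm_le_norm_join (u : Eu n) (v : Eu k) : ‖u‖ ≤ ‖join u v‖ := by
  have h := norm_join_sq u v
  refine abs_le_of_sq_le_sq' ?_ (by positivity) |>.2
  nlinarith [norm_nonneg u, norm_nonneg v]

lemma norm_vert_le_norm_join (u : Eu n) (v : Eu k) : ‖v‖ ≤ ‖join u v‖ := by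
  have h := norm_join_sq u v
  refine abs_le_of_sq_le_sq' ?_ (by positivity) |>.2
  nlinarith [norm_nonneg u, norm_nonneg v]

/-- The projection `x ↦ x̃` as a continuous linear map. -/
noncomputable def tildeL (n k : ℕ) : Eu (n + k) →L[ℝ] Eu n :=
  LinearMap.toContinuousLinearMap
    { toFun := tilde
      map_add' := fun _ _ => by ext i; simp [tilde]
      map_smul' := fun _ _ => by ext i; simp [tilde] }

@[simp] lemma tildeL_apply (x : Eu (n + k)) : tildeL n k x = tilde x := rfl

/-- The projection onto the last `k` coordinates as a continuous linear map. -/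
noncomputable def vertL (n k : ℕ) : Eu (n + k) →L[ℝ] Eu k :=
  LinearMap.toContinuousLinearMap
    { toFun := vert
      map_add' := fun _ _ => by ext i; simp [vert]
      map_smul' := fun _ _ => by ext i; simp [vert] }

@[simp] lemma vertL_apply (x : Eu (n + k)) : vertL n k x = vert x := rfl

/-- The linear map `u ↦ (u, s u)`, for a linear map `s`. -/
noncomputable def joinL (n k : ℕ) : (Eu n × Eu k) →L[ℝ] Eu (n + k) :=
  LinearMap.toContinuousLinearMap
    { toFun := fun p => join p.1 p.2
      map_add' := fun _ _ => join_add _ _ _ _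
      map_smul' := fun _ _ => join_smul _ _ _ }

@[simp] lemma joinL_apply (p : Eu n × Eu k) : joinL n k p = join p.1 p.2 := rfl

@[fun_prop] lemma continuous_tilde : Continuous (tilde : Eu (n + k) → Eu n) :=
  (tildeL n k).continuous

@[fun_prop] lemma continuous_vert : Continuous (vert : Eu (n + k) → Eu k) :=
  (vertL n k).continuous

@[fun_prop] lemma measurable_tilde : Measurable (tilde : Eu (n + k) → Eu n) :=
  continuous_tilde.measurable

lemma continuous_join : Continuous fun p : Eu n × Eu k => join p.1 p.2 :=
  (joinL n k).continuous

@[fun_prop] lemma Continuous.join' {X : Type*} [TopologicalSpace X] {f : X → Eu n} {g : X → Eu k}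
    (hf : Continuous f) (hg : Continuous g) : Continuous fun x => join (f x) (g x) :=
  continuous_join.comp (hf.prodMk hg)

lemma norm_tilde_le (x : Eu (n + k)) : ‖tilde x‖ ≤ ‖x‖ := by
  conv_rhs => rw [← join_tilde_vert x]
  exact norm_le_norm_join _ _

lemma tilde_sub (x y : Eu (n + k)) : tilde (x - y) = tilde x - tilde y :=
  (tildeL n k).map_sub x y

lemma lipschitz_tilde : LipschitzWith 1 (tilde : Eu (n + k) → Eu n) :=
  LipschitzWith.of_dist_le_mul fun x y => by
    simpa [dist_eq_norm, tilde_sub] using norm_tilde_le (x - y)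

/-- The graph map `u ↦ (u, A u)`. -/
noncomputable def graphMap (A : Eu n → Eu k) (u : Eu n) : Eu (n + k) := join u (A u)

lemma lipschitz_graphMap {A : Eu n → Eu k} {lip : ℝ≥0} (hA : LipschitzWith lip A) :
    LipschitzWith (1 + lip) (graphMap A) :=
  LipschitzWith.of_dist_le_mul fun x y => by
    rw [dist_eq_norm, graphMap, graphMap, ← join_sub]
    refine (norm_join_le _ _).trans ?_
    have := hA.dist_le_mul x y
    rw [dist_eq_norm, dist_eq_norm] at this
    rw [dist_eq_norm]; push_cast; linarith

lemma graphMap_mem (A : Eu n → Eu k) (u : Eu n) : graphMap A u ∈ graph A := by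
  simp [graph, graphMap]

lemma graphMap_tilde {A : Eu n → Eu k} {x : Eu (n + k)} (hx : x ∈ graph A) :
    graphMap A (tilde x) = x := by
  rw [graphMap, ← show vert x = A (tilde x) from hx, join_tilde_vert]

lemma isClosed_graph {A : Eu n → Eu k} (hA : Continuous A) :
    IsClosed (graph A : Set (Eu (n + k))) :=
  isClosed_eq continuous_vert (hA.comp continuous_tilde)

/-! ### The measure of the base -/

lemma LipschitzWith.euclideanHausdorffMeasure_image_le {X Y : Type*} [MetricSpace X]
    [MetricSpace Y] [MeasurableSpace X] [BorelSpace X] [MeasurableSpace Y] [BorelSpace Y]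
    {f : X → Y} {c : ℝ≥0} (hf : LipschitzWith c f) (d : ℕ) (s : Set X) :
    μHE[d] (f '' s) ≤ (c : ℝ≥0∞) ^ d * μHE[d] s := by
  simp_rw [Measure.euclideanHausdorffMeasure_def, Measure.smul_apply]
  have := hf.hausdorffMeasure_image_le (d := d) (by positivity) s
  simp only [ENNReal.smul_def, smul_eq_mul]
  calc _ ≤ _ := mul_le_mul_right this _
    _ = _ := by rw [ENNReal.rpow_natCast]; ring

/-- The pair `(A, ν)` describes a measure on a Lipschitz graph through the base `ℝⁿ`: the function
`A` is Lipschitz, and `ν`, the projection of the measure, is comparable with Lebesgue measure. -/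
structure IsGraphPair (lip : ℝ≥0) (M : ℝ) (A : Eu n → Eu k) (ν : Measure (Eu n)) : Prop where
  lipschitz : LipschitzWith lip A
  one_le : 1 ≤ M
  le_volume : ν ≤ ENNReal.ofReal M • (volume : Measure (Eu n))
  volume_le : (volume : Measure (Eu n)) ≤ ENNReal.ofReal M • ν

lemma graph_inter_preimage (A : Eu n → Eu k) (B : Set (Eu n)) :
    tilde ⁻¹' B ∩ graph A = graphMap A '' B := by
  ext x
  constructor
  · rintro ⟨h1, h2⟩
    exact ⟨tilde x, h1, graphMap_tilde h2⟩
  · rintro ⟨u, hu, rfl⟩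
    exact ⟨by simpa [graphMap] using hu, graphMap_mem A u⟩

section GraphMeasure

variable {A : Eu n → Eu k} {lip : ℝ≥0} {f : Eu (n + k) → ℝ}

lemma measurableSet_graph (hA : LipschitzWith lip A) :
    MeasurableSet (graph A : Set (Eu (n + k))) :=
  (isClosed_graph hA.continuous).measurableSet

lemma map_tilde_graphMeasure_apply {B : Set (Eu n)}
    (hB : MeasurableSet B) :
    (graphMeasure A f).map tilde B =
      ∫⁻ x in graphMap A '' B, ENNReal.ofReal (f x) ∂μHE[n] := by
  rw [Measure.map_apply measurable_tilde hB, graphMeasure,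
    withDensity_apply _ (measurable_tilde hB), Measure.restrict_restrict (measurable_tilde hB),
    graph_inter_preimage]

lemma measurableSet_graphMap_image (hA : LipschitzWith lip A) {B : Set (Eu n)}
    (hB : MeasurableSet B) : MeasurableSet (graphMap A '' B : Set (Eu (n + k))) := by
  rw [← graph_inter_preimage]
  exact (measurable_tilde hB).inter (measurableSet_graph hA)

lemma volume_le_image (A : Eu n → Eu k) (B : Set (Eu n)) :
    volume B ≤ μHE[n] (graphMap A '' B) := by
  have h := LipschitzWith.euclideanHausdorffMeasure_image_le
    (lipschitz_tilde (n := n) (k := k)) n (graphMap A '' B)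
  rw [image_image] at h
  simpa [graphMap, EuclideanSpace.euclideanHausdorffMeasure_eq_volume] using h

lemma image_le_volume (hA : LipschitzWith lip A) (B : Set (Eu n)) :
    μHE[n] (graphMap A '' B) ≤ (1 + lip : ℝ≥0) ^ n * volume B := by
  have h := LipschitzWith.euclideanHausdorffMeasure_image_le (lipschitz_graphMap hA) n B
  rwa [EuclideanSpace.euclideanHausdorffMeasure_eq_volume] at h

/-- The projection of a graph measure with density in `[c⁻¹, c]` is comparable with Lebesgue measure:
`tilde` is `1`-Lipschitz and `graphMap A` is `(1 + lip)`-Lipschitz. -/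
lemma isGraphPair_graphMeasure (hA : LipschitzWith lip A) (hf : Measurable f) {c : ℝ} (hc : 1 ≤ c)
    (hfc : ∀ x ∈ graph A, c⁻¹ ≤ f x ∧ f x ≤ c) :
    IsGraphPair lip (c * (1 + lip) ^ n) A ((graphMeasure A f).map tilde) where
  lipschitz := hA
  one_le := by
    have : (1 : ℝ) ≤ (1 + lip) ^ n := one_le_pow₀ (by simp)
    nlinarith
  le_volume := by
    refine Measure.le_iff.2 fun B hB => ?_
    rw [map_tilde_graphMeasure_apply hB]
    calc _ ≤ ∫⁻ x in graphMap A '' B, ENNReal.ofReal c ∂μHE[n] := by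
          refine setLIntegral_mono measurable_const fun x hx => ?_
          obtain ⟨u, -, rfl⟩ := hx
          exact ENNReal.ofReal_le_ofReal (hfc _ (graphMap_mem A u)).2
      _ = ENNReal.ofReal c * μHE[n] (graphMap A '' B) := by simp
      _ ≤ ENNReal.ofReal c * ((1 + lip : ℝ≥0) ^ n * volume B) := by
          gcongr; exact image_le_volume hA B
      _ = _ := by
          rw [Measure.smul_apply, smul_eq_mul, ← mul_assoc, ENNReal.ofReal_mul (by linarith),
            ENNReal.ofReal_pow (by positivity)]
          congr 3
          rw [← ENNReal.ofReal_coe_nnreal]; simp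
  volume_le := by
    refine Measure.le_iff.2 fun B hB => ?_
    rw [Measure.smul_apply, smul_eq_mul, map_tilde_graphMeasure_apply hB]
    have h1 : ENNReal.ofReal c⁻¹ * μHE[n] (graphMap A '' B) ≤
        ∫⁻ x in graphMap A '' B, ENNReal.ofReal (f x) ∂μHE[n] := by
      calc _ = ∫⁻ x in graphMap A '' B, ENNReal.ofReal c⁻¹ ∂μHE[n] := by simp
        _ ≤ _ := by
          refine setLIntegral_mono (by fun_prop) fun x hx => ?_
          obtain ⟨u, -, rfl⟩ := hx
          exact ENNReal.ofReal_le_ofReal (hfc _ (graphMap_mem A u)).1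
    calc volume B ≤ μHE[n] (graphMap A '' B) := volume_le_image A B
      _ = ENNReal.ofReal c * (ENNReal.ofReal c⁻¹ * μHE[n] (graphMap A '' B)) := by
          rw [← mul_assoc, ← ENNReal.ofReal_mul (by linarith), mul_inv_cancel₀ (by linarith)]
          simp
      _ ≤ ENNReal.ofReal (c * (1 + lip) ^ n) *
          ∫⁻ x in graphMap A '' B, ENNReal.ofReal (f x) ∂μHE[n] := by
          gcongr
          have : (1 : ℝ) ≤ (1 + lip) ^ n := one_le_pow₀ (by simp)
          nlinarith

lemma map_graphMap_map_tilde (hA : LipschitzWith lip A) :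
    ((graphMeasure A f).map tilde).map (graphMap A) = graphMeasure A f := by
  rw [Measure.map_map (lipschitz_graphMap hA).continuous.measurable measurable_tilde]
  conv_rhs => rw [← Measure.map_id (μ := graphMeasure A f)]
  refine Measure.map_congr ?_
  have h : ∀ᵐ x ∂((μHE[n] : Measure (Eu (n + k))).restrict (graph A)), x ∈ graph A :=
    ae_restrict_mem (measurableSet_graph hA)
  filter_upwards [(withDensity_absolutelyContinuous _ _).ae_le h] with x hx
  exact graphMap_tilde hx

/-- Where `A` vanishes and `f = 1`, the projected measure is Lebesgue measure. -/
lemma map_tilde_graphMeasure_restrict (hA : LipschitzWith lip A)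
    {S : Set (Eu n)} (hS : MeasurableSet S) (hAS : ∀ u ∈ S, A u = 0)
    (hfS : ∀ x ∈ graph A, tilde x ∈ S → f x = 1) :
    ((graphMeasure A f).map tilde).restrict S = (volume : Measure (Eu n)).restrict S := by
  ext B hB
  rw [Measure.restrict_apply hB, Measure.restrict_apply hB,
    map_tilde_graphMeasure_apply (hB.inter hS)]
  have h1 : ∫⁻ x in graphMap A '' (B ∩ S), ENNReal.ofReal (f x) ∂μHE[n] =
      ∫⁻ x in graphMap A '' (B ∩ S), 1 ∂μHE[n] := by
    refine setLIntegral_congr_fun (measurableSet_graphMap_image hA (hB.inter hS)) ?_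
    rintro x ⟨u, hu, rfl⟩
    simp [hfS _ (graphMap_mem A u) (by simpa [graphMap] using hu.2)]
  have h2 : graphMap A '' (B ∩ S) = (fun u : Eu n => join u (0 : Eu k)) '' (B ∩ S) := by
    refine image_congr fun u hu => ?_
    simp [graphMap, hAS u hu.2]
  have h3 : Isometry fun u : Eu n => join u (0 : Eu k) := by
    refine Isometry.of_dist_eq fun u v => ?_
    rw [dist_eq_norm, dist_eq_norm, ← join_sub, sub_zero]
    have := norm_join_sq (u - v) (0 : Eu k)
    rw [norm_zero, zero_pow two_ne_zero, add_zero] at this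
    exact (sq_eq_sq₀ (norm_nonneg _) (norm_nonneg _)).1 this
  rw [h1, setLIntegral_one, h2, h3.euclideanHausdorffMeasure_image,
    EuclideanSpace.euclideanHausdorffMeasure_eq_volume]

end GraphMeasure

/-! ### Flat measures -/

/-- The Hausdorff measure of an `n`-plane is the image of Lebesgue measure under an affine
isometry. -/
lemma exists_isometry_plane {d : ℕ} {L : AffineSubspace ℝ (Eu d)} (hL : IsPlane n L) :
    ∃ (ι : Eu n →ₗᵢ[ℝ] Eu d) (p : Eu d), p ∈ L ∧ (∀ u, ι u ∈ L.direction) ∧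
      (μHE[n] : Measure (Eu d)).restrict (L : Set (Eu d)) =
        (volume : Measure (Eu n)).map fun u => ι u + p := by
  obtain ⟨⟨p, hp⟩, hdim⟩ := hL
  subst hdim
  let b := stdOrthonormalBasis ℝ L.direction
  let ι : Eu (Module.finrank ℝ L.direction) →ₗᵢ[ℝ] Eu d :=
    L.direction.subtypeₗᵢ.comp b.repr.symm.toLinearIsometry
  refine ⟨ι, p, hp, fun u => (b.repr.symm u).2, ?_⟩
  have hiso : Isometry fun u => ι u + p := by
    refine Isometry.of_dist_eq fun u v => ?_
    rw [dist_add_right, ι.dist_map]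
  have h := hiso.map_euclideanHausdorffMeasure (d := Module.finrank ℝ L.direction)
  rw [EuclideanSpace.euclideanHausdorffMeasure_eq_volume] at h
  rw [h]
  congr 1
  ext y
  constructor
  · intro hy
    refine ⟨b.repr ⟨y - p, AffineSubspace.vsub_mem_direction hy hp⟩, ?_⟩
    simp [ι]
  · rintro ⟨u, rfl⟩
    exact AffineSubspace.vadd_mem_of_mem_direction (b.repr.symm u).2 hp

lemma integral_comp_linearMap (S : Eu n →ₗ[ℝ] Eu n) (hS : LinearMap.det S ≠ 0) (g : Eu n → ℝ) :
    ∫ u, g (S u) = |(LinearMap.det S)⁻¹| * ∫ u, g u := by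
  have h := Measure.map_linearMap_addHaar_eq_smul_addHaar (volume : Measure (Eu n)) hS
  have hme : MeasurableEmbedding S :=
    (S.equivOfDetNeZero hS).toContinuousLinearEquiv.toHomeomorph.measurableEmbedding
  rw [← hme.integral_map, h, integral_smul_measure, ENNReal.toReal_ofReal (abs_nonneg _),
    smul_eq_mul]

/-- Lebesgue measure projected by a linear endomorphism acts on functions as a multiple of Lebesgue
measure. For a singular endomorphism `B` the multiple is zero, by the convention that the integral
of a function that is not integrable vanishes: `B = B ∘ S` for a transvection `S` of
determinant `2`. -/
lemma exists_integral_comp_linear (B : Eu n →ₗ[ℝ] Eu n) :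
    ∃ κ : ℝ≥0, ∀ (p : Eu n) (h : Eu n → ℝ), ∫ u, h (B u + p) = κ * ∫ u, h u := by
  by_cases hB : LinearMap.det B = 0
  · refine ⟨0, fun p h => ?_⟩
    obtain ⟨v, hv, hv0⟩ : ∃ v ∈ LinearMap.ker B, v ≠ 0 :=
      Submodule.exists_mem_ne_zero_of_ne_bot (LinearMap.bot_lt_ker_of_det_eq_zero hB).ne'
    let ℓ : Module.Dual ℝ (Eu n) := (‖v‖ ^ 2)⁻¹ • (innerSL ℝ v).toLinearMap
    have hℓ : ℓ v = 1 := by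
      simp [ℓ, inv_mul_cancel₀ (pow_ne_zero 2 (norm_ne_zero_iff.2 hv0))]
    let S : Eu n →ₗ[ℝ] Eu n := LinearMap.transvection ℓ v
    have hS : LinearMap.det S = 2 := by
      rw [LinearMap.transvection.det, hℓ]; norm_num
    have hBS : ∀ u, B (S u) = B u := fun u => by
      simp [S, LinearMap.transvection.apply, LinearMap.mem_ker.1 hv]
    have h1 := integral_comp_linearMap S (by rw [hS]; norm_num) (fun u => h (B u + p))
    simp only [hBS, hS] at h1
    norm_num at h1
    simp only [NNReal.coe_zero, zero_mul]
    linarith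
  · refine ⟨⟨|(LinearMap.det B)⁻¹|, abs_nonneg _⟩, fun p h => ?_⟩
    rw [integral_comp_linearMap B hB (fun u => h (u + p))]
    rw [integral_add_right_eq_self h p]
    rfl

/-- Functions of `x̃` integrate over an `n`-plane like a multiple of Lebesgue measure on `ℝⁿ`. -/
lemma exists_integral_plane_eq {L : AffineSubspace ℝ (Eu (n + k))} (hL : IsPlane n L) :
    ∃ κ : ℝ≥0, ∀ h : Eu n → ℝ,
      ∫ y, h (tilde y) ∂((μHE[n] : Measure (Eu (n + k))).restrict (L : Set (Eu (n + k)))) =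
        κ * ∫ u, h u := by
  obtain ⟨ι, p, -, -, hι⟩ := exists_isometry_plane hL
  obtain ⟨κ, hκ⟩ := exists_integral_comp_linear ((tildeL n k).toLinearMap ∘ₗ ι.toLinearMap)
  refine ⟨κ, fun h => ?_⟩
  have hiso : Isometry fun u => ι u + p := by
    refine Isometry.of_dist_eq fun u v => ?_
    rw [dist_add_right, ι.dist_map]
  rw [hι, hiso.isClosedEmbedding.measurableEmbedding.integral_map, ← hκ (tilde p) h]
  rfl

/-! ### Localised kernels -/

lemma sum_abs_coord_le {d : ℕ} (v : Eu d) : ∑ i, |v i| ≤ d * ‖v‖ := by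
  calc ∑ i, |v i| ≤ ∑ _i : Fin d, ‖v‖ := by
        refine Finset.sum_le_sum fun i _ => ?_
        simpa using PiLp.norm_apply_le v i
    _ = _ := by simp

/-- A function with bounded partial derivatives is Lipschitz, even if it is not known to be
differentiable: move along one coordinate at a time. -/
lemma abs_sub_le_of_partial {d : ℕ} {g : Eu d → ℝ} {D : Fin d → Eu d → ℝ} {M : ℝ}
    (hD : ∀ x i, HasLineDerivAt ℝ g (D i x) x (EuclideanSpace.single i 1))
    (hM : ∀ x i, |D i x| ≤ M) (x w : Eu d) : |g (x + w) - g x| ≤ d * M * ‖w‖ := by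
  have step : ∀ (x : Eu d) (i : Fin d) (t : ℝ),
      |g (x + t • EuclideanSpace.single i (1 : ℝ)) - g x| ≤ M * |t| := by
    intro x i t
    have hd : ∀ s : ℝ, HasDerivAt (fun s : ℝ => g (x + s • EuclideanSpace.single i (1 : ℝ)))
        (D i (x + s • EuclideanSpace.single i (1 : ℝ))) s := by
      intro s
      have h := hD (x + s • EuclideanSpace.single i (1 : ℝ)) i
      unfold HasLineDerivAt at h
      have h2 : HasDerivAt (fun s' : ℝ => s' - s) 1 s := (hasDerivAt_id s).sub_const s
      have h3 := HasDerivAt.scomp (h := fun s' : ℝ => s' - s) s (by simpa using h) h2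
      simp only [one_smul] at h3
      refine h3.congr_of_eventuallyEq (Eventually.of_forall fun s' => ?_)
      simp only [Function.comp_apply]
      rw [add_assoc, ← add_smul]; congr 3; ring
    have := Convex.norm_image_sub_le_of_norm_hasDerivWithin_le (s := univ) (C := M) (x := 0) (y := t)
      (fun s _ => (hd s).hasDerivWithinAt) (fun s _ => hM _ _) convex_univ (mem_univ _) (mem_univ _)
    simpa using this
  have hM0 : ∀ _i : Fin d, 0 ≤ M := fun i => (abs_nonneg _).trans (hM x i)
  have key : ∀ s : Finset (Fin d),
      |g (x + ∑ i ∈ s, w i • EuclideanSpace.single i (1 : ℝ)) - g x| ≤ M * ∑ i ∈ s, |w i| := by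
    intro s
    induction s using Finset.induction_on with
    | empty => simp
    | insert i s his ih =>
      rw [Finset.sum_insert his, Finset.sum_insert his, add_comm (w i • _), ← add_assoc]
      calc _ ≤ _ := abs_sub_le _ (g (x + ∑ i ∈ s, w i • EuclideanSpace.single i (1 : ℝ))) _
        _ ≤ M * |w i| + M * ∑ i ∈ s, |w i| := add_le_add (step _ _ _) ih
        _ = _ := by ring
  have hw : ∑ i, w i • EuclideanSpace.single i (1 : ℝ) = w := by
    ext j
    simp [Finset.sum_apply, Pi.single_apply]
  have h := key Finset.univ
  rw [hw] at h
  rcases isEmpty_or_nonempty (Fin d) with hE | ⟨⟨i⟩⟩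
  · have : w = 0 := by ext i; exact hE.elim i
    simp [this]
  · calc _ ≤ _ := h
      _ ≤ M * (d * ‖w‖) := mul_le_mul_of_nonneg_left (sum_abs_coord_le w) (hM0 i)
      _ = _ := by ring

/-- A kernel `H(u, v)` living at scale `ℓ`: it is odd, vanishes for `|u| > (3/2) √n ℓ`, and is
bounded with first and second differences like the part of a kernel homogeneous of degree `-n`
where `|u|` is comparable with `ℓ`. -/
structure IsPiece (n k : ℕ) (B ℓ : ℝ) (H : Eu n → Eu k → ℝ) : Prop where
  odd : ∀ u v, H (-u) (-v) = -H u v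
  supp : ∀ u v, 3 / 2 * √(n : ℝ) * ℓ < ‖u‖ → H u v = 0
  bound : ∀ u v, |H u v| ≤ B / ℓ ^ n
  lip : ∀ u v u' v', |H u v - H u' v'| ≤ B / ℓ ^ (n + 1) * (‖u - u'‖ + ‖v - v'‖)
  lip₂ : ∀ u v a b w t, |H (u + a + w) (v + b + t) - H (u + a) (v + b) -
    (H (u + w) (v + t) - H u v)| ≤ B / ℓ ^ (n + 2) * (‖a‖ + ‖b‖) * (‖w‖ + ‖t‖)

section Profile

variable {φ : ℝ → ℝ}

lemma IsProfile.eq_zero (hφ : IsProfile n φ) {t : ℝ} (h0 : 0 ≤ t) (ht : t < 2.1 * √(n : ℝ)) : φ t = 0 := by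
  obtain ⟨h1, h2⟩ := hφ.2.2 t h0
  rw [indicator_of_notMem (by simpa using ht)] at h2
  exact le_antisymm h2 ((indicator_nonneg (fun _ _ => zero_le_one) t).trans h1)

lemma IsProfile.eq_one (hφ : IsProfile n φ) {t : ℝ} (ht : 3 * √(n : ℝ) ≤ t) : φ t = 1 := by
  have h0 : (0 : ℝ) ≤ √(n : ℝ) := Real.sqrt_nonneg _
  obtain ⟨h1, h2⟩ := hφ.2.2 t (by linarith)
  rw [indicator_of_mem (by simpa using ht)] at h1
  rw [indicator_of_mem (by simp only [mem_Ici]; linarith)] at h2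
  exact le_antisymm h2 h1

lemma IsProfile.nonneg (hφ : IsProfile n φ) {t : ℝ} (h0 : 0 ≤ t) : 0 ≤ φ t :=
  (indicator_nonneg (fun _ _ => zero_le_one) t).trans (hφ.2.2 t h0).1

lemma IsProfile.le_one (hφ : IsProfile n φ) {t : ℝ} (h0 : 0 ≤ t) : φ t ≤ 1 :=
  (hφ.2.2 t h0).2.trans (indicator_le_self' (fun _ _ => zero_le_one) t)

lemma IsProfile.contDiff_norm (hφ : IsProfile n φ) (hn : 0 < n) : ContDiff ℝ 2 fun u : Eu n => φ ‖u‖ := by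
  have hσ : (0 : ℝ) < √(n : ℝ) := Real.sqrt_pos.2 (by exact_mod_cast hn)
  rw [contDiff_iff_contDiffAt]
  intro u
  by_cases hu : ‖u‖ < 2.1 * √(n : ℝ)
  · refine (contDiffAt_const (c := (0 : ℝ))).congr_of_eventuallyEq ?_
    filter_upwards [(isOpen_lt continuous_norm continuous_const).mem_nhds hu] with v hv
    exact hφ.eq_zero (norm_nonneg v) hv
  · have hu0 : 0 < ‖u‖ := by linarith [not_lt.1 hu]
    exact (hφ.2.1.contDiffAt (Ici_mem_nhds hu0)).comp u
      (contDiffAt_norm ℝ (norm_pos_iff.1 hu0))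

end Profile

/-- The cutoff `φ(|u|) - φ(|u|/2)` to an annulus. -/
noncomputable def annulus (φ : ℝ → ℝ) (u : Eu n) : ℝ := φ ‖u‖ - φ (‖u‖ / 2)

/-- The part of the kernel between the smooth truncations at `r` and at `2r`. -/
noncomputable def piece (K : Eu (n + k) → ℝ) (φ : ℝ → ℝ) (r : ℝ) (u : Eu n) (v : Eu k) : ℝ :=
  K (join u v) * (φ (‖u‖ / r) - φ (‖u‖ / (2 * r)))

section Annulus

variable {φ : ℝ → ℝ}

lemma contDiff_annulus (hφ : IsProfile n φ) (hn : 0 < n) : ContDiff ℝ 2 (annulus φ : Eu n → ℝ) := by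
  have h := hφ.contDiff_norm hn
  refine h.sub ?_
  have h2 : (fun u : Eu n => φ (‖u‖ / 2)) = (fun u : Eu n => φ ‖u‖) ∘ fun u => (2⁻¹ : ℝ) • u := by
    ext u; simp [norm_smul, div_eq_inv_mul]
  rw [h2]
  exact h.comp (contDiff_const_smul _)

lemma annulus_eq_zero_of_lt (hφ : IsProfile n φ) {u : Eu n} (hu : ‖u‖ < 2.1 * √(n : ℝ)) : annulus φ u = 0 := by
  rw [annulus, hφ.eq_zero (norm_nonneg u) hu,
    hφ.eq_zero (by positivity) (by linarith [norm_nonneg u]), sub_zero]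

lemma annulus_eq_zero_of_le (hφ : IsProfile n φ) {u : Eu n} (hu : 6 * √(n : ℝ) ≤ ‖u‖) : annulus φ u = 0 := by
  have h0 : (0 : ℝ) ≤ √(n : ℝ) := Real.sqrt_nonneg _
  rw [annulus, hφ.eq_one (by linarith), hφ.eq_one (by linarith), sub_self]

lemma abs_annulus_le (hφ : IsProfile n φ) (u : Eu n) : |annulus φ u| ≤ 1 := by
  have h1 := hφ.nonneg (norm_nonneg u)
  have h2 := hφ.le_one (norm_nonneg u)
  have h3 := hφ.nonneg (t := ‖u‖ / 2) (by positivity)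
  have h4 := hφ.le_one (t := ‖u‖ / 2) (by positivity)
  rw [annulus, abs_le]; constructor <;> linarith

lemma hasCompactSupport_annulus (hφ : IsProfile n φ) : HasCompactSupport (annulus φ : Eu n → ℝ) := by
  refine HasCompactSupport.intro (isCompact_closedBall (0 : Eu n) (6 * √(n : ℝ))) fun u hu => ?_
  refine annulus_eq_zero_of_le hφ ?_
  simp only [Metric.mem_closedBall, dist_zero_right, not_le] at hu
  exact hu.le

lemma exists_fderiv_bound {f : Eu n → ℝ} (h : ContDiff ℝ 2 f) (hs : HasCompactSupport f) :
    ∃ C : ℝ, 0 ≤ C ∧ (∀ u, ‖fderiv ℝ f u‖ ≤ C) ∧ ∀ u, ‖fderiv ℝ (fderiv ℝ f) u‖ ≤ C := by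
  have h1 : ContDiff ℝ 1 (fderiv ℝ f) := h.fderiv_right (by norm_num)
  have h0 : ∀ u, u ∉ tsupport f → fderiv ℝ f u = 0 := fun u hu => fderiv_of_notMem_tsupport ℝ hu
  have h2 : ∀ u, u ∉ tsupport f → fderiv ℝ (fderiv ℝ f) u = 0 := fun u hu =>
    fderiv_of_notMem_tsupport ℝ fun h => hu (tsupport_fderiv_subset ℝ h)
  obtain ⟨C1, hC1⟩ := IsCompact.exists_bound_of_continuousOn hs.isCompact
    h1.continuous.norm.continuousOn
  obtain ⟨C2, hC2⟩ := IsCompact.exists_bound_of_continuousOn hs.isCompact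
    (h1.continuous_fderiv one_ne_zero).norm.continuousOn
  simp only [norm_norm] at hC1 hC2
  refine ⟨max 0 (max C1 C2), le_max_left _ _, fun u => ?_, fun u => ?_⟩
  · by_cases hu : u ∈ tsupport f
    · exact (hC1 u hu).trans ((le_max_left _ _).trans (le_max_right _ _))
    · simp [h0 u hu]
  · by_cases hu : u ∈ tsupport f
    · exact (hC2 u hu).trans ((le_max_right _ _).trans (le_max_right _ _))
    · exact ContinuousLinearMap.opNorm_le_bound _ (le_max_left _ _) fun v => by
        rw [h2 u hu]; simp; positivity

end Annulus

/-- The localised kernel as a function on `ℝⁿ⁺ᵏ`. -/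
noncomputable def pieceFun (K : Eu (n + k) → ℝ) (φ : ℝ → ℝ) (r : ℝ) (x : Eu (n + k)) : ℝ :=
  K x * annulus φ (r⁻¹ • tilde x)

lemma pieceFun_join (K : Eu (n + k) → ℝ) (φ : ℝ → ℝ) {r : ℝ} (hr : 0 < r) (u : Eu n) (v : Eu k) :
    pieceFun K φ r (join u v) = piece K φ r u v := by
  rw [pieceFun, piece, tilde_join, annulus, norm_smul, norm_inv, Real.norm_of_nonneg hr.le]
  congr 3 <;> field_simp

/-- Bounds for a kernel piece and its first and second differences on the whole space. The support of
the annular cutoff avoids the singularity of `K`, so `pieceFun` has first and second partial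
derivatives everywhere, and integrating their bounds gives the differences. -/
lemma exists_pieceFun_bound {φ : ℝ → ℝ} (hφ : IsProfile n φ) (hn : 0 < n)
    {K : Eu (n + k) → ℝ} (hK : IsKernel n k K) :
    ∃ B : ℝ, 1 ≤ B ∧ ∀ r : ℝ, 0 < r →
      (∀ x, |pieceFun K φ r x| ≤ B / r ^ n) ∧
      (∀ x w, |pieceFun K φ r (x + w) - pieceFun K φ r x| ≤ B / r ^ (n + 1) * ‖w‖) ∧
      (∀ x a w, |pieceFun K φ r (x + a + w) - pieceFun K φ r (x + a) -
        (pieceFun K φ r (x + w) - pieceFun K φ r x)| ≤ B / r ^ (n + 2) * ‖a‖ * ‖w‖) := by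
  obtain ⟨-, C, hC, hKC⟩ := hK
  obtain ⟨C', hC', hA1, hA2⟩ := exists_fderiv_bound (contDiff_annulus hφ hn)
    (hasCompactSupport_annulus hφ)
  have hσ : (1 : ℝ) ≤ √(n : ℝ) := by
    rw [Real.one_le_sqrt]; exact_mod_cast hn
  set d : ℝ := ((n + k : ℕ) : ℝ) with hd
  have hd1 : 1 ≤ d := by rw [hd]; exact_mod_cast (by omega : 1 ≤ n + k)
  set N : ℝ := C + 2 * C * C' + C * C' with hN
  have hN0 : 0 ≤ N := by positivity
  refine ⟨d * d * N + 1, by nlinarith [mul_nonneg (mul_nonneg (by linarith : 0 ≤ d) (by linarith : 0 ≤ d)) hN0], fun r hr => ?_⟩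
  let e : Fin (n + k) → Eu (n + k) := fun i => EuclideanSpace.single i 1
  have he : ∀ i, ‖r⁻¹ • tilde (e i)‖ ≤ r⁻¹ := fun i => by
    rw [norm_smul, norm_inv, Real.norm_of_nonneg hr.le]
    have : ‖tilde (e i)‖ ≤ 1 := (norm_tilde_le _).trans (by simp [e])
    have := inv_pos.2 hr
    nlinarith
  let ω : Eu (n + k) → ℝ := fun x => annulus φ (r⁻¹ • tilde x)
  let ω₁ : Fin (n + k) → Eu (n + k) → ℝ := fun j x =>
    fderiv ℝ (annulus φ) (r⁻¹ • tilde x) (r⁻¹ • tilde (e j))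
  let ω₂ : Fin (n + k) → Fin (n + k) → Eu (n + k) → ℝ := fun i j x =>
    fderiv ℝ (fderiv ℝ (annulus φ)) (r⁻¹ • tilde x) (r⁻¹ • tilde (e i)) (r⁻¹ • tilde (e j))
  have hann := contDiff_annulus hφ hn
  have hann1 : ContDiff ℝ 1 (fderiv ℝ (annulus φ : Eu n → ℝ)) := hann.fderiv_right (by norm_num)
  let T : Eu (n + k) →L[ℝ] Eu n := r⁻¹ • tildeL n k
  have hω : ∀ x j, HasLineDerivAt ℝ ω (ω₁ j x) x (e j) := fun x j => by
    have h1 : HasFDerivAt (annulus φ) (fderiv ℝ (annulus φ) (T x)) (T x) :=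
      (hann.differentiable (by norm_num) _).hasFDerivAt
    exact (h1.comp x T.hasFDerivAt).hasLineDerivAt (e j)
  have hω₁ : ∀ x i j, HasLineDerivAt ℝ (ω₁ j) (ω₂ i j x) x (e i) := fun x i j => by
    have h1 : HasFDerivAt (fderiv ℝ (annulus φ)) (fderiv ℝ (fderiv ℝ (annulus φ)) (T x)) (T x) :=
      (hann1.differentiable (by norm_num) _).hasFDerivAt
    have h2 := (h1.comp x T.hasFDerivAt).clm_apply
      (hasFDerivAt_const (r⁻¹ • tilde (e j) : Eu n) x)
    have h3 := h2.hasLineDerivAt (e i)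
    have h4 : HasLineDerivAt ℝ (ω₁ j) _ x (e i) := h3
    convert h4 using 1
    simp [ω₂, T]
  have hb0 : ∀ x, |ω x| ≤ 1 := fun x => abs_annulus_le hφ _
  have hb1 : ∀ x j, |ω₁ j x| ≤ C' / r := fun x j => by
    calc _ ≤ _ := ContinuousLinearMap.le_opNorm _ _
      _ ≤ C' * r⁻¹ := mul_le_mul (hA1 _) (he j) (norm_nonneg _) hC'
      _ = _ := by rw [div_eq_mul_inv]
  have hb2 : ∀ x i j, |ω₂ i j x| ≤ C' / r ^ 2 := fun x i j => by
    have h1 := ContinuousLinearMap.le_opNorm₂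
      (fderiv ℝ (fderiv ℝ (annulus φ)) (r⁻¹ • tilde x)) (r⁻¹ • tilde (e i)) (r⁻¹ • tilde (e j))
    refine h1.trans ?_
    calc _ ≤ C' * r⁻¹ * r⁻¹ := mul_le_mul (mul_le_mul (hA2 _) (he i) (norm_nonneg _) hC')
          (he j) (norm_nonneg _) (by positivity)
      _ = _ := by field_simp
  -- the region where the cutoff vanishes identically
  let U : Set (Eu (n + k)) := {x | ‖r⁻¹ • tilde x‖ < 2.1 * √(n : ℝ)}
  have hU : IsOpen U := isOpen_lt (by fun_prop) continuous_const
  have hωU : ∀ x ∈ U, ω x = 0 := fun x hx => annulus_eq_zero_of_lt hφ hx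
  have hω₁U : ∀ x ∈ U, ∀ j, ω₁ j x = 0 := fun x hx j => by
    have h1 : HasLineDerivAt ℝ ω 0 x (e j) := by
      have : ω =ᶠ[𝓝 x] fun _ => 0 := by
        filter_upwards [hU.mem_nhds hx] with y hy using hωU y hy
      refine HasLineDerivAt.congr_of_eventuallyEq ?_ this
      exact (hasFDerivAt_const (0 : ℝ) x).hasLineDerivAt (e j)
    exact (hω x j).unique h1
  have hω₂U : ∀ x ∈ U, ∀ i j, ω₂ i j x = 0 := fun x hx i j => by
    have h1 : HasLineDerivAt ℝ (ω₁ j) 0 x (e i) := by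
      have : ω₁ j =ᶠ[𝓝 x] fun _ => 0 := by
        filter_upwards [hU.mem_nhds hx] with y hy using hω₁U y hy j
      refine HasLineDerivAt.congr_of_eventuallyEq ?_ this
      exact (hasFDerivAt_const (0 : ℝ) x).hasLineDerivAt (e i)
    exact (hω₁ x i j).unique h1
  have hnorm : ∀ x, x ∉ U → r ≤ ‖x‖ := fun x hx => by
    have h1 : 2.1 * √(n : ℝ) ≤ ‖r⁻¹ • tilde x‖ := not_lt.1 hx
    rw [norm_smul, norm_inv, Real.norm_of_nonneg hr.le] at h1
    have h2 : 1 ≤ r⁻¹ * ‖tilde x‖ := by linarith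
    have h3 : r ≤ ‖tilde x‖ := by
      have := mul_le_mul_of_nonneg_left h2 hr.le
      rwa [mul_one, ← mul_assoc, mul_inv_cancel₀ hr.ne', one_mul] at this
    exact h3.trans (norm_tilde_le x)
  have hne : ∀ x, x ∉ U → x ≠ 0 := fun x hx h => by
    have := hnorm x hx
    rw [h, norm_zero] at this
    linarith
  have hmono : ∀ x, x ∉ U → ∀ m : ℕ, C / ‖x‖ ^ m ≤ C / r ^ m := fun x hx m => by
    have := hnorm x hx
    gcongr
  -- the partial derivatives of the piece, given by the product rule off the origin; at the origin, where
  -- `lineDeriv` may be a junk value, `D` and `D₂` vanish because `ω`, `ω₁` and `ω₂` do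
  let D : Fin (n + k) → Eu (n + k) → ℝ := fun j x => lineDeriv ℝ K x (e j) * ω x + K x * ω₁ j x
  let D₂ : Fin (n + k) → Fin (n + k) → Eu (n + k) → ℝ := fun i j x =>
    lineDeriv ℝ (fun y => lineDeriv ℝ K y (e j)) x (e i) * ω x + lineDeriv ℝ K x (e j) * ω₁ i x +
      (lineDeriv ℝ K x (e i) * ω₁ j x + K x * ω₂ i j x)
  have hmul : ∀ {f g : Eu (n + k) → ℝ} {f' g' : ℝ} {x v : Eu (n + k)},
      HasLineDerivAt ℝ f f' x v → HasLineDerivAt ℝ g g' x v →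
      HasLineDerivAt ℝ (fun y => f y * g y) (f' * g x + f x * g') x v := by
    intro f g f' g' x v hf hg
    have := HasDerivAt.mul hf hg
    simpa [HasLineDerivAt, Pi.mul_def] using this
  have hadd : ∀ {f g : Eu (n + k) → ℝ} {f' g' : ℝ} {x v : Eu (n + k)},
      HasLineDerivAt ℝ f f' x v → HasLineDerivAt ℝ g g' x v →
      HasLineDerivAt ℝ (fun y => f y + g y) (f' + g') x v := by
    intro f g f' g' x v hf hg
    exact HasDerivAt.add hf hg
  have hD : ∀ x j, HasLineDerivAt ℝ (pieceFun K φ r) (D j x) x (e j) := fun x j => by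
    by_cases hx : x ∈ U
    · have h0 : D j x = 0 := by simp [D, hωU x hx, hω₁U x hx]
      rw [h0]
      have : pieceFun K φ r =ᶠ[𝓝 x] fun _ => 0 := by
        filter_upwards [hU.mem_nhds hx] with y hy
        show K y * ω y = 0
        rw [hωU y hy, mul_zero]
      refine HasLineDerivAt.congr_of_eventuallyEq ?_ this
      exact (hasFDerivAt_const (0 : ℝ) x).hasLineDerivAt (e j)
    · exact hmul ((hKC x (hne x hx)).2.1 j).1.hasLineDerivAt (hω x j)
  have hD₂ : ∀ x i j, HasLineDerivAt ℝ (D j) (D₂ i j x) x (e i) := fun x i j => by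
    by_cases hx : x ∈ U
    · have h0 : D₂ i j x = 0 := by simp [D₂, hωU x hx, hω₁U x hx, hω₂U x hx]
      rw [h0]
      have : D j =ᶠ[𝓝 x] fun _ => 0 := by
        filter_upwards [hU.mem_nhds hx] with y hy
        simp [D, hωU y hy, hω₁U y hy]
      refine HasLineDerivAt.congr_of_eventuallyEq ?_ this
      exact (hasFDerivAt_const (0 : ℝ) x).hasLineDerivAt (e i)
    · obtain ⟨-, h1, h2⟩ := hKC x (hne x hx)
      exact hadd (hmul (h2 i j).1.hasLineDerivAt (hω x i))
        (hmul (h1 i).1.hasLineDerivAt (hω₁ x i j))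
  have hDb : ∀ x j, |D j x| ≤ N / r ^ (n + 1) := fun x j => by
    by_cases hx : x ∈ U
    · have h0 : D j x = 0 := by simp [D, hωU x hx, hω₁U x hx]
      rw [h0, abs_zero]; positivity
    · obtain ⟨h0, h1, -⟩ := hKC x (hne x hx)
      calc |D j x| ≤ |lineDeriv ℝ K x (e j)| * |ω x| + |K x| * |ω₁ j x| := by
            simp only [← abs_mul]; exact abs_add_le _ _
        _ ≤ C / r ^ (n + 1) * 1 + C / r ^ n * (C' / r) := by
            gcongr
            · exact (h1 j).2.trans (hmono x hx _)
            · exact hb0 x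
            · exact h0.trans (hmono x hx _)
            · exact hb1 x j
        _ = (C + C * C') / r ^ (n + 1) := by rw [pow_succ]; field_simp
        _ ≤ _ := by gcongr; rw [hN]; nlinarith [mul_nonneg hC.le hC']
  have hD₂b : ∀ x i j, |D₂ i j x| ≤ N / r ^ (n + 2) := fun x i j => by
    by_cases hx : x ∈ U
    · have h0 : D₂ i j x = 0 := by simp [D₂, hωU x hx, hω₁U x hx, hω₂U x hx]
      rw [h0, abs_zero]; positivity
    · obtain ⟨h0, h1, h2⟩ := hKC x (hne x hx)
      calc |D₂ i j x| ≤ |lineDeriv ℝ (fun y => lineDeriv ℝ K y (e j)) x (e i)| * |ω x| +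
            |lineDeriv ℝ K x (e j)| * |ω₁ i x| +
            (|lineDeriv ℝ K x (e i)| * |ω₁ j x| + |K x| * |ω₂ i j x|) := by
            simp only [← abs_mul]
            exact (abs_add_le _ _).trans (add_le_add (abs_add_le _ _) (abs_add_le _ _))
        _ ≤ C / r ^ (n + 2) * 1 + C / r ^ (n + 1) * (C' / r) +
            (C / r ^ (n + 1) * (C' / r) + C / r ^ n * (C' / r ^ 2)) := by
            gcongr
            · exact (h2 i j).2.trans (hmono x hx _)
            · exact hb0 x
            · exact (h1 j).2.trans (hmono x hx _)
            · exact hb1 x i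
            · exact (h1 i).2.trans (hmono x hx _)
            · exact hb1 x j
            · exact h0.trans (hmono x hx _)
            · exact hb2 x i j
        _ = N / r ^ (n + 2) := by rw [hN]; field_simp; ring
  have hddN : d * N ≤ d * d * N + 1 := by nlinarith [mul_nonneg (by linarith : 0 ≤ d) hN0]
  refine ⟨fun x => ?_, fun x w => ?_, fun x a w => ?_⟩
  · by_cases hx : x ∈ U
    · have : pieceFun K φ r x = 0 := by
        show K x * ω x = 0
        rw [hωU x hx, mul_zero]
      rw [this, abs_zero]; positivity
    · calc |pieceFun K φ r x| = |K x| * |ω x| := abs_mul _ _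
        _ ≤ C / r ^ n * 1 := by
            gcongr
            · exact ((hKC x (hne x hx)).1).trans (hmono x hx _)
            · exact hb0 x
        _ ≤ _ := by
            rw [mul_one]; gcongr
            have : C ≤ N := by rw [hN]; nlinarith [mul_nonneg hC.le hC']
            nlinarith
  · refine (abs_sub_le_of_partial hD hDb x w).trans ?_
    rw [← mul_div_assoc]
    gcongr
  · have hg : ∀ y j, HasLineDerivAt ℝ (fun y => pieceFun K φ r (y + a) - pieceFun K φ r y)
        (D j (y + a) - D j y) y (e j) := fun y j => by
      have h1 := hD (y + a) j
      have h2 : HasLineDerivAt ℝ (fun y => pieceFun K φ r (y + a)) (D j (y + a)) y (e j) := by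
        unfold HasLineDerivAt at h1 ⊢
        simpa only [add_right_comm] using h1
      exact HasDerivAt.sub h2 (hD y j)
    have hgb : ∀ y j, |D j (y + a) - D j y| ≤ d * (N / r ^ (n + 2)) * ‖a‖ := fun y j =>
      abs_sub_le_of_partial (fun x i => hD₂ x i j) (fun x i => hD₂b x i j) y a
    have := abs_sub_le_of_partial hg hgb x w
    simp only [add_right_comm x w a] at this
    have h3 : |pieceFun K φ r (x + a + w) - pieceFun K φ r (x + a) -
        (pieceFun K φ r (x + w) - pieceFun K φ r x)| =
        |pieceFun K φ r (x + a + w) - pieceFun K φ r (x + w) -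
        (pieceFun K φ r (x + a) - pieceFun K φ r x)| := by congr 1; ring
    rw [h3]
    refine this.trans ?_
    calc _ = d * d * N / r ^ (n + 2) * ‖a‖ * ‖w‖ := by rw [hd]; ring
      _ ≤ _ := by gcongr; linarith

/-- The parts of the kernel between consecutive truncations are localised kernels, with uniform
constants. -/
lemma exists_isPiece {φ : ℝ → ℝ} (hφ : IsProfile n φ) (hn : 0 < n)
    {K : Eu (n + k) → ℝ} (hK : IsKernel n k K) :
    ∃ B : ℝ, 1 ≤ B ∧ ∀ r : ℝ, 0 < r → IsPiece n k B (4 * r) (piece K φ r) := by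
  obtain ⟨B, hB, h⟩ := exists_pieceFun_bound hφ hn hK
  have hσ : (1 : ℝ) ≤ √(n : ℝ) := by
    rw [Real.one_le_sqrt]; exact_mod_cast hn
  have h4 : (1 : ℝ) ≤ 4 ^ (n + 2) := one_le_pow₀ (by norm_num)
  refine ⟨4 ^ (n + 2) * B, by nlinarith, fun r hr => ?_⟩
  obtain ⟨h1, h2, h3⟩ := h r hr
  have hm : ∀ m ≤ n + 2, B / r ^ m ≤ 4 ^ (n + 2) * B / (4 * r) ^ m := fun m hm => by
    rw [mul_pow, div_le_div_iff₀ (by positivity) (by positivity)]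
    have : (4 : ℝ) ^ m ≤ 4 ^ (n + 2) := pow_le_pow_right₀ (by norm_num) hm
    calc B * (4 ^ m * r ^ m) = 4 ^ m * (B * r ^ m) := by ring
      _ ≤ 4 ^ (n + 2) * (B * r ^ m) := by gcongr
      _ = _ := by ring
  refine ⟨fun u v => ?_, fun u v hu => ?_, fun u v => ?_, fun u v u' v' => ?_,
    fun u v a b w t => ?_⟩
  · rcases eq_or_ne (join u v) 0 with h0 | h0
    · have hu : u = 0 := by simpa [h0] using (norm_le_norm_join u v)
      have hz : φ 0 = 0 := hφ.eq_zero le_rfl (by linarith)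
      simp [piece, hu, hz]
    · rw [piece, piece, join_neg, hK.1 _ h0, norm_neg, neg_mul]
  · rw [piece, hφ.eq_one, hφ.eq_one, sub_self, mul_zero]
    · rw [le_div_iff₀ (by positivity)]; linarith
    · rw [le_div_iff₀ (by positivity)]; nlinarith [mul_pos (by linarith : 0 < √(n : ℝ)) hr]
  · rw [← pieceFun_join K φ hr]
    exact (h1 _).trans (hm n (by omega))
  · rw [← pieceFun_join K φ hr, ← pieceFun_join K φ hr]
    have := h2 (join u' v') (join (u - u') (v - v'))
    rw [← join_add, add_sub_cancel, add_sub_cancel] at this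
    exact this.trans (mul_le_mul (hm (n + 1) (by omega)) (norm_join_le _ _) (norm_nonneg _)
      (by positivity))
  · simp only [← pieceFun_join K φ hr, join_add]
    exact (h3 _ _ _).trans (mul_le_mul (mul_le_mul (hm (n + 2) le_rfl) (norm_join_le _ _)
      (norm_nonneg _) (by positivity)) (norm_join_le _ _) (norm_nonneg _) (by positivity))

/-! ### Cubes and windows -/

lemma one_le_sqrt_dim (hn : 0 < n) : (1 : ℝ) ≤ √(n : ℝ) := by
  rw [Real.one_le_sqrt]; exact_mod_cast hn

lemma abs_coord_le (u : Eu n) (i : Fin n) : |u i| ≤ ‖u‖ := by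
  simpa using PiLp.norm_apply_le u i

lemma norm_le_of_coord {u : Eu n} {t : ℝ} (ht : 0 ≤ t) (h : ∀ i, |u i| ≤ t) :
    ‖u‖ ≤ √(n : ℝ) * t := by
  rw [EuclideanSpace.norm_eq, Real.sqrt_le_left (by positivity), mul_pow,
    Real.sq_sqrt (Nat.cast_nonneg n)]
  calc ∑ i, ‖u i‖ ^ 2 ≤ ∑ _i : Fin n, t ^ 2 := by
        refine Finset.sum_le_sum fun i _ => ?_
        rw [Real.norm_eq_abs]
        exact pow_le_pow_left₀ (abs_nonneg _) (h i) 2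
    _ = _ := by simp

lemma Cube.base_eq (Q : Cube n) : Q.base = (WithLp.ofLp : Eu n → Fin n → ℝ) ⁻¹'
    (univ.pi fun i => Ico (Q.corner i) (Q.corner i + Q.side)) := by
  ext u; simp [Cube.base]

lemma Cube.measurableSet_base (Q : Cube n) : MeasurableSet Q.base := by
  rw [Q.base_eq]
  exact (PiLp.volume_preserving_ofLp (Fin n)).measurable
    (MeasurableSet.univ_pi fun i => measurableSet_Ico)

lemma Cube.volume_base (Q : Cube n) : volume Q.base = ENNReal.ofReal Q.side ^ n := by
  rw [Q.base_eq, (PiLp.volume_preserving_ofLp (Fin n)).measure_preimage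
    (MeasurableSet.univ_pi fun i => measurableSet_Ico).nullMeasurableSet, Real.volume_pi_Ico]
  simp

lemma Cube.volume_real_base (Q : Cube n) (hQ : 0 ≤ Q.side) :
    (volume : Measure (Eu n)).real Q.base = Q.side ^ n := by
  rw [Measure.real, Q.volume_base, ENNReal.toReal_pow, ENNReal.toReal_ofReal hQ]

@[simp] lemma Cube.center_apply (Q : Cube n) (i : Fin n) :
    Q.center i = Q.corner i + Q.side / 2 := rfl

lemma Cube.abs_sub_center_le {Q : Cube n} {u : Eu n} (hu : u ∈ Q.base) (i : Fin n) :
    |u i - Q.center i| ≤ Q.side / 2 := by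
  have := hu i
  rw [abs_le, Q.center_apply]
  constructor <;> linarith [this.1, this.2]

/-- A ball concentric with the cube, large enough to contain all the points that are compared with
the approximants attached to the cube. -/
def Cube.window (Q : Cube n) : Set (Eu n) := Metric.closedBall Q.center (5 * √(n : ℝ) * Q.side)

lemma Cube.isCompact_window (Q : Cube n) : IsCompact Q.window := isCompact_closedBall _ _

lemma Cube.measurableSet_window (Q : Cube n) : MeasurableSet Q.window :=
  Metric.isClosed_closedBall.measurableSet

lemma Cube.mem_window_of_coord {Q : Cube n} (hQ : 0 ≤ Q.side) {u : Eu n}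
    (h : ∀ i, |u i - Q.center i| ≤ 5 * Q.side) : u ∈ Q.window := by
  rw [Cube.window, Metric.mem_closedBall, dist_eq_norm]
  refine (norm_le_of_coord (t := 5 * Q.side) (by positivity) (fun i => by simpa using h i)).trans ?_
  linarith

lemma Cube.base_subset_window {Q : Cube n} (hQ : 0 ≤ Q.side) : Q.base ⊆ Q.window := fun u hu =>
  Cube.mem_window_of_coord hQ fun i => (Cube.abs_sub_center_le hu i).trans (by linarith)

/-- The unit vector in the direction of the `i`-th axis. -/
noncomputable abbrev unitVec (i : Fin n) : Eu n := EuclideanSpace.single i 1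

lemma abs_smul_unitVec_le {t : ℝ} (ht : 0 ≤ t) (i j : Fin n) : |(t • unitVec i : Eu n) j| ≤ t := by
  simp only [unitVec, PiLp.smul_apply, PiLp.single_apply, smul_eq_mul]
  split_ifs
  · simp [abs_of_nonneg ht]
  · simpa

lemma Cube.shift_mem_window {Q : Cube n} (hQ : 0 ≤ Q.side) {u : Eu n} (hu : u ∈ Q.base)
    (i : Fin n) : u + Q.side • unitVec i ∈ Q.window :=
  Cube.mem_window_of_coord hQ fun j => by
    have h1 := Cube.abs_sub_center_le hu j
    have h2 := abs_smul_unitVec_le hQ i j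
    rw [PiLp.add_apply]
    calc |u j + (Q.side • unitVec i : Eu n) j - Q.center j|
        = |(u j - Q.center j) + (Q.side • unitVec i : Eu n) j| := by congr 1; ring
      _ ≤ _ := abs_add_le _ _
      _ ≤ _ := by linarith

lemma integrableOn_of_continuous {V : Type*} [NormedAddCommGroup V] {f : Eu n → V}
    (hf : Continuous f) {ν : Measure (Eu n)} [IsLocallyFiniteMeasure ν] {s t : Set (Eu n)}
    (ht : IsCompact t) (hst : s ⊆ t) : IntegrableOn f s ν :=
  (hf.continuousOn.integrableOn_compact ht).mono_set hst

/-! ### Affine approximation -/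

section Affine

variable {V : Type*} [NormedAddCommGroup V] [NormedSpace ℝ V]

/-- The mean slope of `f` over the cube in the direction of the `i`-th axis, taken from difference
quotients with step the side of the cube. -/
noncomputable def slope (Q : Cube n) (f : Eu n → V) (i : Fin n) : V :=
  (Q.side ^ (n + 1))⁻¹ • ∫ u in Q.base, (f (u + Q.side • unitVec i) - f u)

/-- The affine function with the mean slopes and the mean value of `f` over the cube. It depends
linearly on `f`, and it reproduces affine functions. -/
noncomputable def affPart (Q : Cube n) (f : Eu n → V) (u : Eu n) : V :=
  (Q.side ^ n)⁻¹ • ∫ v in Q.base, (f v + ∑ i, (u i - v i) • slope Q f i)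

variable {Q : Cube n} {f g : Eu n → V}

lemma integrableOn_shift (hQ : 0 < Q.side) (hf : Continuous f) (i : Fin n) :
    IntegrableOn (fun u => f (u + Q.side • unitVec i) - f u) Q.base :=
  integrableOn_of_continuous (by fun_prop) Q.isCompact_window (Cube.base_subset_window hQ.le)

lemma integrableOn_affPart (hQ : 0 < Q.side) (hf : Continuous f) (u : Eu n) (s : Fin n → V) :
    IntegrableOn (fun v => f v + ∑ i, (u i - v i) • s i) Q.base :=
  integrableOn_of_continuous (by fun_prop) Q.isCompact_window (Cube.base_subset_window hQ.le)

lemma slope_sub (hQ : 0 < Q.side) (hf : Continuous f) (hg : Continuous g) (i : Fin n) :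
    slope Q (fun u => f u - g u) i = slope Q f i - slope Q g i := by
  rw [slope, slope, slope, ← smul_sub,
    ← integral_sub (integrableOn_shift hQ hf i) (integrableOn_shift hQ hg i)]
  congr 2 with u
  abel

lemma affPart_sub (hQ : 0 < Q.side) (hf : Continuous f) (hg : Continuous g) (u : Eu n) :
    affPart Q (fun u => f u - g u) u = affPart Q f u - affPart Q g u := by
  rw [affPart, affPart, affPart, ← smul_sub, ← integral_sub (integrableOn_affPart hQ hf u _)
    (integrableOn_affPart hQ hg u _)]
  congr 2 with v
  simp only [slope_sub hQ hf hg, smul_sub, Finset.sum_sub_distrib]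
  abel

lemma affPart_sub_affPart (hQ : 0 < Q.side) (hf : Continuous f) (u u' : Eu n) :
    affPart Q f u - affPart Q f u' = ∑ i, (u i - u' i) • slope Q f i := by
  rw [affPart, affPart, ← smul_sub, ← integral_sub (integrableOn_affPart hQ hf u _)
    (integrableOn_affPart hQ hf u' _)]
  have : ∀ v : Eu n, (f v + ∑ i, (u i - v i) • slope Q f i -
      (f v + ∑ i, (u' i - v i) • slope Q f i)) = ∑ i, (u i - u' i) • slope Q f i := fun v => by
    rw [add_sub_add_left_eq_sub, ← Finset.sum_sub_distrib]
    refine Finset.sum_congr rfl fun i _ => ?_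
    rw [← sub_smul]; congr 1; ring
  simp only [this]
  rcases eq_or_ne (∑ i, (u i - u' i) • slope Q f i) 0 with h0 | h0
  · simp [h0]
  by_cases hV : CompleteSpace V
  · rw [setIntegral_const, Q.volume_real_base hQ.le, smul_smul, inv_mul_cancel₀ (by positivity),
      one_smul]
  · exact absurd (by simp [slope, integral, hV]) h0

lemma continuous_affPart (hQ : 0 < Q.side) (hf : Continuous f) : Continuous (affPart Q f) := by
  have : affPart Q f = fun u => affPart Q f 0 + ∑ i, (u i - (0 : Eu n) i) • slope Q f i := by
    ext u
    rw [← affPart_sub_affPart hQ hf, add_sub_cancel]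
  rw [this]
  fun_prop

lemma slope_eq_of_affine [CompleteSpace V] (hQ : 0 < Q.side) (s : Fin n → V) (b : V) (i : Fin n) :
    slope Q (fun u => ∑ i, u i • s i + b) i = s i := by
  have : ∀ u : Eu n, (∑ j, (u + Q.side • unitVec i : Eu n) j • s j + b) - (∑ j, u j • s j + b) =
      Q.side • s i := fun u => by
    rw [add_sub_add_right_eq_sub, ← Finset.sum_sub_distrib]
    simp only [← sub_smul, PiLp.add_apply, add_sub_cancel_left, unitVec, PiLp.smul_apply,
      PiLp.single_apply, smul_eq_mul, mul_ite, mul_one, mul_zero, ite_smul, zero_smul]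
    simp
  rw [slope]
  simp only [this]
  rw [setIntegral_const, Q.volume_real_base hQ.le, smul_smul, smul_smul]
  rw [show (Q.side ^ (n + 1))⁻¹ * Q.side ^ n * Q.side = 1 by rw [pow_succ]; field_simp, one_smul]

lemma affPart_eq_of_affine [CompleteSpace V] (hQ : 0 < Q.side) (s : Fin n → V) (b : V) (u : Eu n) :
    affPart Q (fun u => ∑ i, u i • s i + b) u = ∑ i, u i • s i + b := by
  rw [affPart]
  simp only [slope_eq_of_affine hQ]
  have : ∀ v : Eu n, (∑ i, v i • s i + b + ∑ i, (u i - v i) • s i) = ∑ i, u i • s i + b :=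
    fun v => by
      rw [add_right_comm, ← Finset.sum_add_distrib]
      congr 2 with i
      rw [← add_smul]; congr 1; ring
  simp only [this]
  rw [setIntegral_const, Q.volume_real_base hQ.le, smul_smul, inv_mul_cancel₀ (by positivity),
    one_smul]

lemma slope_clm {V' : Type*} [NormedAddCommGroup V'] [NormedSpace ℝ V'] [CompleteSpace V]
    [CompleteSpace V'] (T : V →L[ℝ] V') (hQ : 0 < Q.side) (hf : Continuous f) (i : Fin n) :
    slope Q (fun u => T (f u)) i = T (slope Q f i) := by
  rw [slope, slope, map_smul, ← T.integral_comp_comm (integrableOn_shift hQ hf i)]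
  simp only [map_sub]

lemma affPart_clm {V' : Type*} [NormedAddCommGroup V'] [NormedSpace ℝ V'] [CompleteSpace V]
    [CompleteSpace V'] (T : V →L[ℝ] V') (hQ : 0 < Q.side) (hf : Continuous f) (u : Eu n) :
    affPart Q (fun u => T (f u)) u = T (affPart Q f u) := by
  rw [affPart, affPart, map_smul, ← T.integral_comp_comm (integrableOn_affPart hQ hf u _)]
  simp only [map_add, map_sum, map_smul, slope_clm T hQ hf]

lemma integral_norm_shift_le (hf : Continuous f) {W : Set (Eu n)}
    (hW : IsCompact W) (i : Fin n) (hs : ∀ u ∈ Q.base, u + Q.side • unitVec i ∈ W) :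
    ∫ u in Q.base, ‖f (u + Q.side • unitVec i)‖ ≤ ∫ u in W, ‖f u‖ := by
  have h1 : ∫ u in Q.base, ‖f (u + Q.side • unitVec i)‖ =
      ∫ u in (fun u => u + Q.side • unitVec i) '' Q.base, ‖f u‖ := by
    rw [(measurePreserving_add_right volume (Q.side • unitVec i)).setIntegral_image_emb
      (measurableEmbedding_addRight _)]
  rw [h1]
  refine setIntegral_mono_set (integrableOn_of_continuous hf.norm hW subset_rfl)
    (ae_of_all _ fun u => norm_nonneg _) (LE.le.eventuallyLE ?_)
  rintro _ ⟨u, hu, rfl⟩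
  exact hs u hu

/-- The slope over a cube is controlled by the integral over any compact set that contains the cube
and its translates. -/
lemma norm_slope_le (hQ : 0 < Q.side) (hf : Continuous f) {W : Set (Eu n)}
    (hW : IsCompact W) (hb : Q.base ⊆ W) (i : Fin n)
    (hs : ∀ u ∈ Q.base, u + Q.side • unitVec i ∈ W) :
    ‖slope Q f i‖ ≤ 2 / Q.side ^ (n + 1) * ∫ u in W, ‖f u‖ := by
  rw [slope, norm_smul, norm_inv, Real.norm_of_nonneg (by positivity), div_mul_eq_mul_div,
    ← div_eq_inv_mul]
  gcongr
  have hI1 : IntegrableOn (fun u => ‖f (u + Q.side • unitVec i)‖) Q.base :=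
    integrableOn_of_continuous (by fun_prop) hW hb
  have hI2 : IntegrableOn (fun u => ‖f u‖) Q.base :=
    integrableOn_of_continuous (by fun_prop) hW hb
  calc ‖∫ u in Q.base, (f (u + Q.side • unitVec i) - f u)‖
      ≤ ∫ u in Q.base, ‖f (u + Q.side • unitVec i) - f u‖ := norm_integral_le_integral_norm _
    _ ≤ ∫ u in Q.base, (‖f (u + Q.side • unitVec i)‖ + ‖f u‖) := by
        refine setIntegral_mono_on (integrableOn_shift hQ hf i).norm (hI1.add hI2)
          Q.measurableSet_base fun u _ => norm_sub_le _ _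
    _ = (∫ u in Q.base, ‖f (u + Q.side • unitVec i)‖) + ∫ u in Q.base, ‖f u‖ :=
        integral_add hI1 hI2
    _ ≤ (∫ u in W, ‖f u‖) + ∫ u in W, ‖f u‖ := by
        refine add_le_add (integral_norm_shift_le hf hW i hs) ?_
        exact setIntegral_mono_set (integrableOn_of_continuous hf.norm hW subset_rfl)
          (ae_of_all _ fun u => norm_nonneg _) (LE.le.eventuallyLE hb)
    _ = _ := by ring

lemma norm_slope_window_le (hQ : 0 < Q.side) (hf : Continuous f) (i : Fin n) :
    ‖slope Q f i‖ ≤ 2 / Q.side ^ (n + 1) * ∫ u in Q.window, ‖f u‖ :=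
  norm_slope_le hQ hf Q.isCompact_window (Cube.base_subset_window hQ.le) i
    fun _ hu => Cube.shift_mem_window hQ.le hu i

lemma norm_affPart_le (hQ : 0 < Q.side) (hf : Continuous f) {u : Eu n} (hu : u ∈ Q.window) :
    ‖affPart Q f u‖ ≤ (1 + n * (12 * √(n : ℝ))) / Q.side ^ n * ∫ u in Q.window, ‖f u‖ := by
  set I := ∫ u in Q.window, ‖f u‖ with hI
  have hI0 : 0 ≤ I := integral_nonneg fun u => norm_nonneg _
  rw [affPart, norm_smul, norm_inv, Real.norm_of_nonneg (by positivity), ← div_eq_inv_mul,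
    div_mul_eq_mul_div]
  gcongr
  have hcoord : ∀ v ∈ Q.base, ∀ i, |u i - v i| ≤ 6 * √(n : ℝ) * Q.side := fun v hv i => by
    have h1 := abs_coord_le (u - Q.center) i
    rw [Cube.window, Metric.mem_closedBall, dist_eq_norm] at hu
    have h2 := Cube.abs_sub_center_le hv i
    have hσ : 1 ≤ √(n : ℝ) := one_le_sqrt_dim (by have := i.2; omega)
    have h3 : |u i - v i| ≤ |u i - Q.center i| + |v i - Q.center i| := by
      have := abs_sub_le (u i) (Q.center i) (v i)
      rwa [abs_sub_comm (Q.center i)] at this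
    rw [PiLp.sub_apply] at h1
    nlinarith
  have hI2 : IntegrableOn (fun u => ‖f u‖) Q.base :=
    integrableOn_of_continuous (by fun_prop) Q.isCompact_window (Cube.base_subset_window hQ.le)
  set S := n * (12 * √(n : ℝ)) / Q.side ^ n * I with hS
  have hpt : ∀ v ∈ Q.base, ‖f v + ∑ i, (u i - v i) • slope Q f i‖ ≤ ‖f v‖ + S := fun v hv => by
    refine (norm_add_le _ _).trans (add_le_add le_rfl ((norm_sum_le _ _).trans ?_))
    calc ∑ i, ‖(u i - v i) • slope Q f i‖
        ≤ ∑ _i : Fin n, 6 * √(n : ℝ) * Q.side * (2 / Q.side ^ (n + 1) * I) := by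
          refine Finset.sum_le_sum fun i _ => ?_
          rw [norm_smul]
          exact mul_le_mul (hcoord v hv i) (norm_slope_window_le hQ hf i) (norm_nonneg _)
            (by positivity)
      _ = S := by
          rw [Finset.sum_const, Finset.card_univ, Fintype.card_fin, nsmul_eq_mul, hS, pow_succ]
          field_simp; ring
  have hIS : IntegrableOn (fun _ : Eu n => S) Q.base :=
    integrableOn_of_continuous continuous_const Q.isCompact_window (Cube.base_subset_window hQ.le)
  calc ‖∫ v in Q.base, (f v + ∑ i, (u i - v i) • slope Q f i)‖
      ≤ ∫ v in Q.base, ‖f v + ∑ i, (u i - v i) • slope Q f i‖ := norm_integral_le_integral_norm _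
    _ ≤ ∫ v in Q.base, (‖f v‖ + S) :=
        setIntegral_mono_on (integrableOn_affPart hQ hf u _).norm (hI2.add hIS)
          Q.measurableSet_base hpt
    _ = (∫ v in Q.base, ‖f v‖) + S * Q.side ^ n := by
        rw [integral_add hI2 hIS, setIntegral_const, Q.volume_real_base hQ.le, smul_eq_mul]; ring
    _ ≤ I + S * Q.side ^ n := by
        gcongr
        exact setIntegral_mono_set (integrableOn_of_continuous hf.norm Q.isCompact_window subset_rfl)
          (ae_of_all _ fun u => norm_nonneg _)
          (LE.le.eventuallyLE (Cube.base_subset_window hQ.le))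
    _ = _ := by rw [hS]; field_simp

lemma norm_slope_le_of_lipschitz {lip : ℝ≥0} (hQ : 0 < Q.side) (hf : LipschitzWith lip f)
    (i : Fin n) : ‖slope Q f i‖ ≤ lip := by
  rw [slope, norm_smul, norm_inv, Real.norm_of_nonneg (by positivity), ← div_eq_inv_mul,
    div_le_iff₀ (by positivity)]
  have h : ∀ u ∈ Q.base, ‖f (u + Q.side • unitVec i) - f u‖ ≤ lip * Q.side := fun u _ => by
    have := hf.dist_le_mul (u + Q.side • unitVec i) u
    rw [dist_eq_norm, dist_eq_norm, add_sub_cancel_left, norm_smul, Real.norm_of_nonneg hQ.le]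
      at this
    simpa using this
  have := norm_setIntegral_le_of_norm_le_const (μ := (volume : Measure (Eu n))) (s := Q.base)
    (by rw [Q.volume_base]; finiteness) h
  rw [Q.volume_real_base hQ.le] at this
  calc _ ≤ _ := this
    _ = _ := by rw [pow_succ]; ring

end Affine

/-! ### Affine approximation and `β` -/

/-- The volume of the unit ball of `ℝⁿ`. -/
noncomputable def ballVol (n : ℕ) : ℝ := (volume : Measure (Eu n)).real (Metric.ball 0 1)

lemma ballVol_pos : 0 < ballVol n :=
  ENNReal.toReal_pos (Metric.measure_ball_pos _ _ one_pos).ne' measure_ball_lt_top.ne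

lemma volume_real_closedBall (c : Eu n) {r : ℝ} (hr : 0 ≤ r) :
    (volume : Measure (Eu n)).real (Metric.closedBall c r) = r ^ n * ballVol n := by
  rw [Measure.real, Measure.addHaar_closedBall _ _ hr, ENNReal.toReal_mul,
    ENNReal.toReal_ofReal (by positivity), finrank_euclideanSpace, Fintype.card_fin]
  rfl

lemma Cube.volume_real_window (Q : Cube n) (hQ : 0 ≤ Q.side) :
    (volume : Measure (Eu n)).real Q.window = (5 * √(n : ℝ)) ^ n * ballVol n * Q.side ^ n := by
  rw [Cube.window, volume_real_closedBall _ (by positivity), mul_pow]; ring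

lemma setIntegral_const_window (Q : Cube n) (hQ : 0 ≤ Q.side) (c : ℝ) :
    ∫ _u in Q.window, c = (5 * √(n : ℝ)) ^ n * ballVol n * Q.side ^ n * c := by
  rw [setIntegral_const, Q.volume_real_window hQ, smul_eq_mul]

lemma sq_setIntegral_le {f : Eu n → ℝ} {S : Set (Eu n)} (hS : volume S ≠ ∞)
    (hf : IntegrableOn f S) (hf2 : IntegrableOn (fun u => f u ^ 2) S) :
    (∫ u in S, f u) ^ 2 ≤ volume.real S * ∫ u in S, f u ^ 2 := by
  set m := ∫ u in S, f u with hm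
  set v := (volume : Measure (Eu n)).real S with hv
  have hv0 : 0 ≤ v := measureReal_nonneg
  have hc : IntegrableOn (fun _ : Eu n => m ^ 2) S := by
    rw [integrableOn_const_iff]; exact Or.inr hS.lt_top
  have h0 : 0 ≤ ∫ u in S, (v * f u - m) ^ 2 := integral_nonneg fun u => sq_nonneg _
  have h1 : ∫ u in S, (v * f u - m) ^ 2 =
      v ^ 2 * (∫ u in S, f u ^ 2) - 2 * v * m * m + m ^ 2 * v := by
    have : ∀ u, (v * f u - m) ^ 2 = v ^ 2 * f u ^ 2 - 2 * v * m * f u + m ^ 2 := fun u => by ring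
    simp only [this]
    rw [integral_add (f := fun u => v ^ 2 * f u ^ 2 - 2 * v * m * f u)
      ((hf2.const_mul _).sub (hf.const_mul _)) hc,
      integral_sub (hf2.const_mul _) (hf.const_mul _), integral_const_mul, integral_const_mul,
      setIntegral_const, smul_eq_mul, ← hm, ← hv]
    ring
  rw [h1] at h0
  rcases hv0.eq_or_lt with hv1 | hv1
  · have hS0 : volume S = 0 := by
      have : (volume S).toReal = 0 := hv1.symm
      exact (ENNReal.toReal_eq_zero_iff _).1 this |>.resolve_right hS
    have : m = 0 := by rw [hm, Measure.restrict_eq_zero.2 hS0, integral_zero_measure]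
    rw [this]; simp [← hv1]
  · have h2 : 0 ≤ v * (v * (∫ u in S, f u ^ 2) - m ^ 2) := by nlinarith
    nlinarith [nonneg_of_mul_nonneg_right h2 hv1]

lemma sum_smul_unitVec (u : Eu n) : ∑ i, u i • (unitVec i : Eu n) = u := by
  ext j
  simp [Pi.single_apply]

lemma slope_graphMap {A : Eu n → Eu k} (hA : Continuous A) {Q : Cube n} (hQ : 0 < Q.side)
    (i : Fin n) : slope Q (graphMap A) i = join (unitVec i) (slope Q A i) := by
  have hG : Continuous (graphMap A) := by unfold graphMap; fun_prop
  rw [← join_tilde_vert (slope Q (graphMap A) i), ← tildeL_apply, ← vertL_apply,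
    ← slope_clm _ hQ hG, ← slope_clm _ hQ hG]
  simp only [tildeL_apply, vertL_apply, graphMap, tilde_join, vert_join]
  congr 1
  have h := slope_eq_of_affine hQ (fun i => (unitVec i : Eu n)) 0 i
  rw [← h]
  simp only [sum_smul_unitVec, add_zero]

lemma affPart_graphMap {A : Eu n → Eu k} (hA : Continuous A) {Q : Cube n} (hQ : 0 < Q.side)
    (u : Eu n) : affPart Q (graphMap A) u = join u (affPart Q A u) := by
  have hG : Continuous (graphMap A) := by unfold graphMap; fun_prop
  rw [← join_tilde_vert (affPart Q (graphMap A) u), ← tildeL_apply, ← vertL_apply,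
    ← affPart_clm _ hQ hG, ← affPart_clm _ hQ hG]
  simp only [tildeL_apply, vertL_apply, graphMap, tilde_join, vert_join]
  congr 1
  have h := affPart_eq_of_affine hQ (fun i => (unitVec i : Eu n)) 0 u
  simpa only [sum_smul_unitVec, add_zero] using h

/-- If the linear graph `{(u, s u)}` is close to an `n`-dimensional subspace `V`, then `V` is
transversal to the vertical directions. -/
lemma norm_le_of_transversal (V : Submodule ℝ (Eu (n + k))) (hV : Module.finrank ℝ V = n)
    (s : Eu n →ₗ[ℝ] Eu k) {Λ : ℝ} (hs : ∀ u, ‖s u‖ ≤ Λ * ‖u‖) (hΛ : 0 ≤ Λ)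
    (hP : ∀ u, ‖Vᗮ.starProjection (join u (s u))‖ ≤ 2⁻¹ * ‖u‖) (w : Eu k) :
    ‖w‖ ≤ (2 * Λ + 2) * ‖Vᗮ.starProjection (join 0 w)‖ := by
  have hdec : ∀ x : Eu (n + k), x = V.starProjection x + Vᗮ.starProjection x := fun x =>
    (Submodule.starProjection_add_starProjection_orthogonal x).symm
  let S : Eu n →ₗ[ℝ] Eu (n + k) := (joinL n k).toLinearMap ∘ₗ LinearMap.prod LinearMap.id s
  have hS : ∀ u, S u = join u (s u) := fun u => rfl
  let R : Eu n →ₗ[ℝ] V := V.orthogonalProjectionOnto.toLinearMap ∘ₗ S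
  have hR : ∀ u, (R u : Eu (n + k)) = V.starProjection (join u (s u)) := fun u => rfl
  have hinj : Function.Injective R := by
    rw [injective_iff_map_eq_zero]
    intro u hu
    have h1 := hdec (join u (s u))
    rw [← hR, hu, Submodule.coe_zero, zero_add] at h1
    have h2 := hP u
    rw [← h1] at h2
    have h3 := norm_le_norm_join u (s u)
    have : ‖u‖ ≤ 0 := by linarith
    simpa using this
  -- `R` is injective between spaces of dimension `n`, hence onto: some `(u, s u)` has the same projection
  -- to `V` as `(0, w)`, and the two differ only by their components in `Vᗮ`
  have hsurj : Function.Surjective R :=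
    (LinearMap.injective_iff_surjective_of_finrank_eq_finrank
      (by rw [hV, finrank_euclideanSpace, Fintype.card_fin])).1 hinj
  obtain ⟨u, hu⟩ := hsurj (V.orthogonalProjectionOnto (join 0 w))
  have hu' : V.starProjection (join u (s u)) = V.starProjection (join 0 w) := by
    rw [← hR, hu]; rfl
  set a := Vᗮ.starProjection (join u (s u)) with ha
  set b := Vᗮ.starProjection (join (0 : Eu n) w) with hb
  have hEq : join 0 w = join u (s u) - a + b := by
    rw [ha, hb]
    conv_lhs => rw [hdec (join 0 w)]
    rw [← hu', eq_sub_of_add_eq (hdec (join u (s u))).symm]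
  have ht : (0 : Eu n) = u - tilde a + tilde b := by
    have h1 := congrArg (tildeL n k) hEq
    rwa [map_add, map_sub, tildeL_apply, tildeL_apply, tildeL_apply, tildeL_apply, tilde_join,
      tilde_join] at h1
  have hv : w = s u - vert a + vert b := by
    have h1 := congrArg (vertL n k) hEq
    rwa [map_add, map_sub, vertL_apply, vertL_apply, vertL_apply, vertL_apply, vert_join,
      vert_join] at h1
  have hva : ∀ x : Eu (n + k), ‖vert x‖ ≤ ‖x‖ := fun x => by
    conv_rhs => rw [← join_tilde_vert x]
    exact norm_vert_le_norm_join _ _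
  have ha' : ‖a‖ ≤ 2⁻¹ * ‖u‖ := hP u
  have hu2 : ‖u‖ ≤ 2 * ‖b‖ := by
    have h1 : u = tilde a - tilde b := by
      rw [eq_sub_iff_add_eq, ← sub_eq_zero, ht]; abel
    have h2 : ‖u‖ ≤ ‖tilde a‖ + ‖tilde b‖ := by
      conv_lhs => rw [h1]
      exact norm_sub_le _ _
    linarith [norm_tilde_le a, norm_tilde_le b]
  calc ‖w‖ ≤ ‖s u‖ + ‖vert a‖ + ‖vert b‖ := by
        conv_lhs => rw [hv]
        exact (norm_add_le _ _).trans (add_le_add (norm_sub_le _ _) le_rfl)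
    _ ≤ Λ * ‖u‖ + 2⁻¹ * ‖u‖ + ‖b‖ :=
        add_le_add (add_le_add (hs u) ((hva a).trans ha')) (hva b)
    _ ≤ Λ * (2 * ‖b‖) + 2⁻¹ * (2 * ‖b‖) + ‖b‖ := by gcongr
    _ = _ := by ring

/-- The error of the affine approximation of `A` attached to the cube. -/
noncomputable def affErr (Q : Cube n) (A : Eu n → Eu k) (u : Eu n) : Eu k := A u - affPart Q A u

lemma continuous_affErr {Q : Cube n} (hQ : 0 < Q.side) {A : Eu n → Eu k} (hA : Continuous A) :
    Continuous (affErr Q A) := hA.sub (continuous_affPart hQ hA)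

/-- The bound for the approximation error that uses only the Lipschitz constant of `A`. -/
lemma norm_affErr_le {lip : ℝ≥0} {A : Eu n → Eu k} (hA : LipschitzWith lip A) {Q : Cube n}
    (hQ : 0 < Q.side) {u : Eu n} (hu : u ∈ Q.window) :
    ‖affErr Q A u‖ ≤ (1 + n * (12 * √(n : ℝ))) * ((5 * √(n : ℝ)) ^ n * ballVol n) *
      (10 * √(n : ℝ)) * lip * Q.side := by
  have h1 : affErr Q A u = -affPart Q (fun v => A v - A u) u := by
    rw [affPart_sub hQ hA.continuous continuous_const, affErr]
    have := affPart_eq_of_affine hQ (fun _ => (0 : Eu k)) (A u) u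
    simp only [smul_zero, Finset.sum_const_zero, zero_add] at this
    rw [this]; abel
  rw [h1, norm_neg]
  refine (norm_affPart_le hQ (f := fun v => A v - A u)
    (hA.continuous.sub continuous_const) hu).trans ?_
  have h2 : ∫ v in Q.window, ‖A v - A u‖ ≤
      ∫ _v in Q.window, lip * (10 * √(n : ℝ) * Q.side) := by
    refine setIntegral_mono_on (integrableOn_of_continuous
      ((hA.continuous.sub continuous_const).norm) Q.isCompact_window subset_rfl)
      (integrableOn_of_continuous continuous_const Q.isCompact_window subset_rfl)
      Q.measurableSet_window fun v hv => ?_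
    have h3 := hA.dist_le_mul v u
    rw [dist_eq_norm] at h3
    refine h3.trans ?_
    gcongr
    have h4 := dist_triangle_right v u Q.center
    rw [Cube.window, Metric.mem_closedBall] at hu hv
    linarith
  rw [setIntegral_const_window Q hQ.le] at h2
  calc _ ≤ (1 + n * (12 * √(n : ℝ))) / Q.side ^ n *
        ((5 * √(n : ℝ)) ^ n * ballVol n * Q.side ^ n * (lip * (10 * √(n : ℝ) * Q.side))) := by
        gcongr
    _ = _ := by field_simp

/-- The error of the affine approximation of `A` is controlled by the distances of the graph to any
plane `p + V`: the approximation operator commutes with the projection onto `Vᗮ`, and if the graph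
is close to `p + V` then `V` is transversal to the vertical directions. -/
lemma exists_norm_affErr_le (n k : ℕ) (lip : ℝ≥0) :
    ∃ D : ℝ, 0 < D ∧ ∀ (A : Eu n → Eu k), LipschitzWith lip A → ∀ Q : Cube n, 0 < Q.side →
      ∀ V : Submodule ℝ (Eu (n + k)), Module.finrank ℝ V = n → ∀ p : Eu (n + k),
      ∀ u ∈ Q.window, ‖affErr Q A u‖ ≤ D * (‖Vᗮ.starProjection (graphMap A u - p)‖ +
        (∫ v in Q.window, ‖Vᗮ.starProjection (graphMap A v - p)‖) / Q.side ^ n) := by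
  set c₁ : ℝ := 1 + n * (12 * √(n : ℝ)) with hc₁
  set w₁ : ℝ := (5 * √(n : ℝ)) ^ n * ballVol n with hw₁
  set c₂ : ℝ := c₁ * w₁ * (10 * √(n : ℝ)) * lip with hc₂
  have hbv := ballVol_pos (n := n)
  have hc₁0 : 1 ≤ c₁ := by rw [hc₁]; linarith [show (0 : ℝ) ≤ n * (12 * √(n : ℝ)) by positivity]
  have hw₁0 : 0 ≤ w₁ := by positivity
  have hc₂0 : 0 ≤ c₂ := by positivity
  set D : ℝ := (2 * (n * lip) + 2) * c₁ + 4 * n * c₂ with hD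
  have hD0 : 0 < D := by positivity
  refine ⟨D, hD0, fun A hA Q hQ V hV p => ?_⟩
  set P := Vᗮ.starProjection with hP
  have hG : Continuous (graphMap A) := (lipschitz_graphMap hA).continuous
  let f : Eu n → Eu (n + k) := fun u => P (graphMap A u - p)
  have hf : Continuous f := P.continuous.comp (hG.sub continuous_const)
  set T := ∫ u in Q.window, ‖f u‖ with hT
  have hT0 : 0 ≤ T := integral_nonneg fun u => norm_nonneg _
  have hfsub : ∀ u, f u = P (graphMap A u) - P p := fun u => map_sub _ _ _
  have hslope : ∀ i, slope Q f i = P (join (unitVec i) (slope Q A i)) := fun i => by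
    rw [← slope_graphMap hA.continuous hQ, ← slope_clm P hQ hG]
    have : f = fun u => P (graphMap A u) - P p := funext hfsub
    rw [this, slope_sub (f := fun u => P (graphMap A u)) (g := fun _ => P p) hQ
      (P.continuous.comp hG) continuous_const]
    have := slope_eq_of_affine hQ (fun _ => (0 : Eu (n + k))) (P p) i
    simp only [smul_zero, Finset.sum_const_zero, zero_add] at this
    rw [this, sub_zero]
  have hpart : ∀ u, f u - affPart Q f u = P (join 0 (affErr Q A u)) := fun u => by
    have : f = fun u => P (graphMap A u) - P p := funext hfsub
    rw [this, affPart_sub (f := fun u => P (graphMap A u)) (g := fun _ => P p) hQ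
      (P.continuous.comp hG) continuous_const, affPart_clm P hQ hG,
      affPart_graphMap hA.continuous hQ]
    have := affPart_eq_of_affine hQ (fun _ => (0 : Eu (n + k))) (P p) u
    simp only [smul_zero, Finset.sum_const_zero, zero_add] at this
    rw [this, sub_sub_sub_cancel_right, ← map_sub, graphMap, ← join_sub, sub_self]
    rfl
  intro u hu
  change ‖affErr Q A u‖ ≤ D * (‖f u‖ + T / Q.side ^ n)
  -- if the graph is close to the plane in the mean, the mean slopes are nearly tangent to `V`
  by_cases hsmall : 2 * n * T / Q.side ^ (n + 1) ≤ 2⁻¹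
  · let s : Eu n →ₗ[ℝ] Eu k :=
      { toFun := fun u => ∑ i, u i • slope Q A i
        map_add' := fun u v => by simp [add_smul, Finset.sum_add_distrib]
        map_smul' := fun c u => by simp [mul_smul, Finset.smul_sum] }
    have hs : ∀ u, ‖s u‖ ≤ n * lip * ‖u‖ := fun u => by
      calc ‖s u‖ = ‖∑ i, u i • slope Q A i‖ := rfl
        _ ≤ ∑ i, ‖u i • slope Q A i‖ := norm_sum_le _ _
        _ ≤ ∑ i, |u i| * lip := by
            refine Finset.sum_le_sum fun i _ => ?_
            rw [norm_smul, Real.norm_eq_abs]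
            gcongr
            exact norm_slope_le_of_lipschitz hQ hA i
        _ ≤ _ := by
            rw [← Finset.sum_mul]
            nlinarith [sum_abs_coord_le u, lip.coe_nonneg]
    have hjs : ∀ u, join u (s u) = ∑ i, u i • join (unitVec i) (slope Q A i) := fun u => by
      simp only [← joinL_apply (n := n) (k := k) (_, _), ← map_smul, ← map_sum]
      rw [joinL_apply, joinL_apply]
      congr 1
      · simp only [Prod.fst_sum, Prod.smul_fst, sum_smul_unitVec]
      · simp [s, Prod.snd_sum]
    have hPs : ∀ u, ‖P (join u (s u))‖ ≤ 2⁻¹ * ‖u‖ := fun u => by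
      rw [hjs, map_sum]
      calc _ ≤ ∑ i, ‖P (u i • join (unitVec i) (slope Q A i))‖ := norm_sum_le _ _
        _ ≤ ∑ i, |u i| * (2 / Q.side ^ (n + 1) * T) := by
            refine Finset.sum_le_sum fun i _ => ?_
            rw [map_smul, norm_smul, Real.norm_eq_abs, ← hslope]
            gcongr
            exact norm_slope_window_le hQ hf i
        _ ≤ n * ‖u‖ * (2 / Q.side ^ (n + 1) * T) := by
            rw [← Finset.sum_mul]
            gcongr
            exact sum_abs_coord_le u
        _ = 2 * n * T / Q.side ^ (n + 1) * ‖u‖ := by ring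
        _ ≤ _ := by gcongr
    have h1 := norm_le_of_transversal V hV s hs (by positivity) hPs (affErr Q A u)
    rw [← hP, ← hpart] at h1
    have h2 := norm_affPart_le hQ hf hu
    calc _ ≤ _ := h1
      _ ≤ (2 * (n * lip) + 2) * (‖f u‖ + c₁ / Q.side ^ n * T) := by
          gcongr
          exact (norm_sub_le _ _).trans (add_le_add le_rfl h2)
      _ ≤ (2 * (n * lip) + 2) * (c₁ * ‖f u‖ + c₁ / Q.side ^ n * T) := by
          gcongr
          nlinarith [norm_nonneg (f u)]
      _ = (2 * (n * lip) + 2) * c₁ * (‖f u‖ + T / Q.side ^ n) := by ring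
      _ ≤ _ := by
          gcongr
          rw [hD]; linarith [show 0 ≤ 4 * n * c₂ by positivity]
  · -- the graph is far from the plane: the trivial bound suffices
    have h1 := norm_affErr_le hA hQ hu
    rw [not_le, inv_eq_one_div, div_lt_div_iff₀ (by norm_num) (by positivity)] at hsmall
    have h2 : Q.side ≤ 4 * n * (T / Q.side ^ n) := by
      rw [← mul_div_assoc, le_div_iff₀ (by positivity), ← pow_succ']
      linarith
    calc _ ≤ c₂ * Q.side := h1
      _ ≤ c₂ * (4 * n * (T / Q.side ^ n)) := by gcongr
      _ = 4 * n * c₂ * (0 + T / Q.side ^ n) := by ring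
      _ ≤ D * (‖f u‖ + T / Q.side ^ n) := by
          gcongr
          · rw [hD]; linarith [show 0 ≤ (2 * (n * lip) + 2) * c₁ by positivity]
          · exact norm_nonneg _

/-- The affine approximation of `A` is, in the mean square sense, as good as the approximation of
the graph by any plane `p + V`. -/
lemma exists_integral_affErr_le (n k : ℕ) (lip : ℝ≥0) :
    ∃ C : ℝ, 0 < C ∧ ∀ (A : Eu n → Eu k), LipschitzWith lip A → ∀ Q : Cube n, 0 < Q.side →
      ∀ V : Submodule ℝ (Eu (n + k)), Module.finrank ℝ V = n → ∀ p : Eu (n + k),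
      ∫ u in Q.window, ‖affErr Q A u‖ ^ 2 ≤
        C * ∫ u in Q.window, ‖Vᗮ.starProjection (graphMap A u - p)‖ ^ 2 := by
  obtain ⟨D, hD0, hD⟩ := exists_norm_affErr_le n k lip
  set w₁ : ℝ := (5 * √(n : ℝ)) ^ n * ballVol n with hw₁
  refine ⟨2 * D ^ 2 + 2 * D ^ 2 * w₁ ^ 2, by positivity, fun A hA Q hQ V hV p => ?_⟩
  have hG : Continuous (graphMap A) := (lipschitz_graphMap hA).continuous
  have hpt := hD A hA Q hQ V hV p
  have hw₁0 : 0 ≤ w₁ := by have := ballVol_pos (n := n); positivity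
  have hf : Continuous fun u => Vᗮ.starProjection (graphMap A u - p) :=
    Vᗮ.starProjection.continuous.comp (hG.sub continuous_const)
  set f := fun u => Vᗮ.starProjection (graphMap A u - p) with hfdef
  change ∫ u in Q.window, ‖affErr Q A u‖ ^ 2 ≤ _ * ∫ u in Q.window, ‖f u‖ ^ 2
  change ∀ u ∈ Q.window, ‖affErr Q A u‖ ≤
    D * (‖f u‖ + (∫ u in Q.window, ‖f u‖) / Q.side ^ n) at hpt
  clear_value f
  set T := ∫ u in Q.window, ‖f u‖ with hT
  have hTsq : T ^ 2 ≤ w₁ * Q.side ^ n * ∫ u in Q.window, ‖f u‖ ^ 2 := by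
    have := sq_setIntegral_le (S := Q.window) (f := fun u => ‖f u‖)
      Q.isCompact_window.measure_lt_top.ne
      (integrableOn_of_continuous hf.norm Q.isCompact_window subset_rfl)
      (integrableOn_of_continuous (hf.norm.pow 2) Q.isCompact_window subset_rfl)
    rwa [Q.volume_real_window hQ.le] at this
  have hint2 : IntegrableOn (fun u => ‖f u‖ ^ 2) Q.window :=
    integrableOn_of_continuous (hf.norm.pow 2) Q.isCompact_window subset_rfl
  calc ∫ u in Q.window, ‖affErr Q A u‖ ^ 2
      ≤ ∫ u in Q.window, (2 * D ^ 2 * ‖f u‖ ^ 2 + 2 * D ^ 2 * (T / Q.side ^ n) ^ 2) := by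
        refine setIntegral_mono_on (integrableOn_of_continuous
          ((continuous_affErr hQ hA.continuous).norm.pow 2) Q.isCompact_window subset_rfl)
          (integrableOn_of_continuous (by fun_prop) Q.isCompact_window subset_rfl)
          Q.measurableSet_window fun u hu => ?_
        have h1 := pow_le_pow_left₀ (norm_nonneg _) (hpt u hu) 2
        have h2 : (‖f u‖ + T / Q.side ^ n) ^ 2 ≤ 2 * (‖f u‖ ^ 2 + (T / Q.side ^ n) ^ 2) := by
          nlinarith [sq_nonneg (‖f u‖ - T / Q.side ^ n)]
        rw [mul_pow] at h1
        nlinarith [sq_nonneg D]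
    _ = 2 * D ^ 2 * (∫ u in Q.window, ‖f u‖ ^ 2) +
        w₁ * Q.side ^ n * (2 * D ^ 2 * (T / Q.side ^ n) ^ 2) := by
        rw [integral_add (hint2.const_mul _)
          (integrableOn_of_continuous continuous_const Q.isCompact_window subset_rfl),
          integral_const_mul, setIntegral_const_window Q hQ.le]
    _ = 2 * D ^ 2 * (∫ u in Q.window, ‖f u‖ ^ 2) + 2 * D ^ 2 * w₁ / Q.side ^ n * T ^ 2 := by
        field_simp
    _ ≤ 2 * D ^ 2 * (∫ u in Q.window, ‖f u‖ ^ 2) +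
        2 * D ^ 2 * w₁ / Q.side ^ n * (w₁ * Q.side ^ n * ∫ u in Q.window, ‖f u‖ ^ 2) := by
        gcongr
    _ = _ := by field_simp

lemma Cube.window_subset_scale {Q : Cube n} (hQ : 0 < Q.side) {c : ℝ} (hc : 10 * √(n : ℝ) < c) :
    Q.window ⊆ (Q.scale c).base := by
  intro u hu i
  rw [Cube.window, Metric.mem_closedBall, dist_eq_norm] at hu
  have h1 := (abs_coord_le (u - Q.center) i).trans hu
  rw [PiLp.sub_apply, abs_le] at h1
  have h2 : 5 * √(n : ℝ) * Q.side < c * Q.side / 2 := by nlinarith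
  change Q.center i - c * Q.side / 2 ≤ u i ∧ u i < Q.center i - c * Q.side / 2 + c * Q.side
  constructor <;> linarith [h1.1, h1.2]

lemma ofReal_norm_starProjection_le {L : AffineSubspace ℝ (Eu (n + k))} {p : Eu (n + k)}
    (hp : p ∈ L) (y : Eu (n + k)) :
    ENNReal.ofReal ‖L.directionᗮ.starProjection (y - p)‖ ≤
      Metric.infEDist y (L : Set (Eu (n + k))) := by
  refine Metric.le_infEDist.2 fun q hq => ?_
  have h0 : L.directionᗮ.starProjection (q - p) = 0 := by
    rw [Submodule.starProjection_apply_eq_zero_iff]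
    exact Submodule.le_orthogonal_orthogonal _ (AffineSubspace.vsub_mem_direction hq hp)
  have h1 : L.directionᗮ.starProjection (y - p) = L.directionᗮ.starProjection (y - q) := by
    have : y - p = (y - q) + (q - p) := by abel
    rw [this, map_add, h0, add_zero]
  rw [h1, edist_dist, dist_eq_norm]
  exact ENNReal.ofReal_le_ofReal (Submodule.norm_starProjection_apply_le _ _)

/-- The mean square error of the affine approximation is controlled by `β₂`. -/
lemma exists_affErr_le_beta (n k : ℕ) (lip : ℝ≥0) (M : ℝ) (hM : 1 ≤ M) :
    ∃ C : ℝ, 0 < C ∧ ∀ (A : Eu n → Eu k) (ν : Measure (Eu n)), IsGraphPair lip M A ν →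
      ∀ Q : Cube n, 0 < Q.side → ∀ c : ℝ, 10 * √(n : ℝ) < c →
      ENNReal.ofReal ((∫ u in Q.window, ‖affErr Q A u‖ ^ 2) / Q.side ^ (n + 2)) ≤
        ENNReal.ofReal C * betaCoeff c 2 (ν.map (graphMap A)) Q ^ 2 := by
  obtain ⟨C, hC, h⟩ := exists_integral_affErr_le n k lip
  refine ⟨C * M, by positivity, fun A ν hν Q hQ c hc => ?_⟩
  have hA := hν.lipschitz
  set X := ENNReal.ofReal ((∫ u in Q.window, ‖affErr Q A u‖ ^ 2) / Q.side ^ (n + 2)) with hX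
  have hG : Continuous (graphMap A) := (lipschitz_graphMap hA).continuous
  have hD0 : ENNReal.ofReal (C * M) ≠ 0 := by
    rw [Ne, ENNReal.ofReal_eq_zero, not_le]; positivity
  have key : ∀ L : AffineSubspace ℝ (Eu (n + k)), IsPlane n L →
      X / ENNReal.ofReal (C * M) ≤ (ENNReal.ofReal Q.side ^ n)⁻¹ *
        ∫⁻ y in (Q.scale c).vset k,
        (Metric.infEDist y (L : Set (Eu (n + k))) / ENNReal.ofReal Q.side) ^ (2 : ℝ)
          ∂(ν.map (graphMap A)) := by
    intro L hL
    obtain ⟨⟨p, hp⟩, hdim⟩ := hL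
    set I := ∫⁻ y in (Q.scale c).vset k, Metric.infEDist y (L : Set (Eu (n + k))) ^ 2
      ∂(ν.map (graphMap A)) with hI
    have hmI : Measurable fun y : Eu (n + k) => Metric.infEDist y (L : Set (Eu (n + k))) :=
      Metric.continuous_infEDist.measurable
    have hvs : MeasurableSet ((Q.scale c).vset k) :=
      measurable_tilde (Q.scale c).measurableSet_base
    have h1 : ENNReal.ofReal (∫ u in Q.window,
        ‖L.directionᗮ.starProjection (graphMap A u - p)‖ ^ 2) ≤ ENNReal.ofReal M * I := by
      rw [ofReal_integral_eq_lintegral_ofReal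
        (integrableOn_of_continuous (by fun_prop) Q.isCompact_window subset_rfl)
        (ae_of_all _ fun u => sq_nonneg _)]
      calc _ ≤ ∫⁻ u in Q.window,
            Metric.infEDist (graphMap A u) (L : Set (Eu (n + k))) ^ 2 := by
            refine lintegral_mono fun u => ?_
            rw [ENNReal.ofReal_pow (norm_nonneg _)]
            exact pow_le_pow_left' (ofReal_norm_starProjection_le hp _) 2
        _ ≤ ∫⁻ u in Q.window,
            Metric.infEDist (graphMap A u) (L : Set (Eu (n + k))) ^ 2 ∂(ENNReal.ofReal M • ν) :=
            lintegral_mono' (Measure.restrict_mono subset_rfl hν.volume_le) le_rfl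
        _ = ENNReal.ofReal M * ∫⁻ u in Q.window,
            Metric.infEDist (graphMap A u) (L : Set (Eu (n + k))) ^ 2 ∂ν := by
            rw [Measure.restrict_smul, lintegral_smul_measure, smul_eq_mul]
        _ ≤ ENNReal.ofReal M * I := by
            gcongr
            rw [hI, setLIntegral_map hvs (hmI.pow_const 2) hG.measurable]
            refine lintegral_mono_set fun u hu => ?_
            change tilde (graphMap A u) ∈ (Q.scale c).base
            rw [graphMap, tilde_join]
            exact Cube.window_subset_scale hQ hc hu
    have h2 : X ≤ ENNReal.ofReal (C * M) * (I / ENNReal.ofReal Q.side ^ (n + 2)) := by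
      rw [hX, ENNReal.ofReal_div_of_pos (by positivity), ENNReal.ofReal_pow hQ.le,
        ← mul_div_assoc]
      gcongr
      rw [ENNReal.ofReal_mul hC.le, mul_assoc]
      refine (ENNReal.ofReal_le_ofReal (h A hA Q hQ L.direction hdim p)).trans ?_
      rw [ENNReal.ofReal_mul hC.le]
      gcongr
    have hs0 : ENNReal.ofReal Q.side ≠ 0 := by simpa using hQ
    have h3 : (ENNReal.ofReal Q.side ^ n)⁻¹ * ∫⁻ y in (Q.scale c).vset k,
        (Metric.infEDist y (L : Set (Eu (n + k))) / ENNReal.ofReal Q.side) ^ (2 : ℝ)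
          ∂(ν.map (graphMap A)) = I / ENNReal.ofReal Q.side ^ (n + 2) := by
      simp only [ENNReal.rpow_two, div_eq_mul_inv, mul_pow]
      rw [lintegral_mul_const _ (hmI.pow_const 2), ← hI, pow_add, ENNReal.mul_inv
        (Or.inr (by finiteness)) (Or.inl (by finiteness)), ENNReal.inv_pow, ENNReal.inv_pow]
      ring
    rw [h3]
    exact ENNReal.div_le_of_le_mul' h2
  have h4 : (X / ENNReal.ofReal (C * M)) ^ (1 / 2 : ℝ) ≤
      betaCoeff c 2 (ν.map (graphMap A)) Q :=
    le_iInf₂ fun L hL => ENNReal.rpow_le_rpow (key L hL) (by norm_num)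
  have h5 : X / ENNReal.ofReal (C * M) ≤ betaCoeff c 2 (ν.map (graphMap A)) Q ^ 2 := by
    calc _ = ((X / ENNReal.ofReal (C * M)) ^ (1 / 2 : ℝ)) ^ 2 := by
          rw [← ENNReal.rpow_two, ← ENNReal.rpow_mul]; norm_num
      _ ≤ _ := pow_le_pow_left' h4 2
  rwa [ENNReal.div_le_iff_le_mul (Or.inl hD0) (Or.inl (by finiteness)), mul_comm] at h5

/-! ### Oscillation of the density and `α` -/

lemma IsGraphPair.isLocallyFiniteMeasure {lip : ℝ≥0} {M : ℝ} {A : Eu n → Eu k}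
    {ν : Measure (Eu n)} (hν : IsGraphPair lip M A ν) : IsLocallyFiniteMeasure ν := by
  refine ⟨fun x => ⟨Metric.ball x 1, Metric.ball_mem_nhds x one_pos, ?_⟩⟩
  refine (hν.le_volume _).trans_lt ?_
  rw [Measure.smul_apply, smul_eq_mul]
  exact ENNReal.mul_lt_top ENNReal.ofReal_lt_top measure_ball_lt_top

lemma IsGraphPair.integral_le {lip : ℝ≥0} {M : ℝ} {A : Eu n → Eu k}
    {ν : Measure (Eu n)} (hν : IsGraphPair lip M A ν) {g : Eu n → ℝ} (hg : ∀ u, 0 ≤ g u)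
    {S : Set (Eu n)} (hi : IntegrableOn g S) : ∫ u in S, g u ∂ν ≤ M * ∫ u in S, g u := by
  have hM : 0 ≤ M := zero_le_one.trans hν.one_le
  have h1 : ν.restrict S ≤ ENNReal.ofReal M • (volume.restrict S) := by
    rw [← Measure.restrict_smul]; exact Measure.restrict_mono subset_rfl hν.le_volume
  refine (integral_mono_measure h1 (ae_of_all _ hg) (hi.smul_measure (by finiteness))).trans ?_
  rw [integral_smul_measure, ENNReal.toReal_ofReal hM, smul_eq_mul]

lemma IsGraphPair.volume_real_le {lip : ℝ≥0} {M : ℝ} {A : Eu n → Eu k}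
    {ν : Measure (Eu n)} (hν : IsGraphPair lip M A ν) {S : Set (Eu n)} (hS : volume S ≠ ∞) :
    (volume : Measure (Eu n)).real S ≤ M * ν.real S := by
  have hM : 0 ≤ M := zero_le_one.trans hν.one_le
  have hS' : ν S ≠ ∞ := by
    have := hν.le_volume S
    rw [Measure.smul_apply, smul_eq_mul] at this
    exact ne_top_of_le_ne_top (by finiteness) this
  have h2 := hν.volume_le S
  rw [Measure.smul_apply, smul_eq_mul] at h2
  have := ENNReal.toReal_mono (by finiteness) h2
  rwa [ENNReal.toReal_mul, ENNReal.toReal_ofReal hM] at this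

/-- A tent over the cube, with Lipschitz constant one. -/
noncomputable def Cube.bump (Q : Cube n) (u : Eu n) : ℝ :=
  max 0 (√(n : ℝ) * Q.side - ‖u - Q.center‖)

lemma Cube.bump_nonneg (Q : Cube n) (u : Eu n) : 0 ≤ Q.bump u := le_max_left _ _

lemma Cube.continuous_bump (Q : Cube n) : Continuous Q.bump := by unfold Cube.bump; fun_prop

lemma Cube.abs_bump_sub_le (Q : Cube n) (u v : Eu n) : |Q.bump u - Q.bump v| ≤ ‖u - v‖ := by
  rw [Cube.bump, Cube.bump, max_comm, max_comm 0]
  refine (abs_max_sub_max_le_abs _ _ _).trans ?_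
  rw [sub_sub_sub_cancel_left]
  refine (abs_norm_sub_norm_le (v - Q.center) (u - Q.center)).trans ?_
  rw [sub_sub_sub_cancel_right, norm_sub_rev]

lemma Cube.bump_eq_zero {Q : Cube n} {u : Eu n} (hu : √(n : ℝ) * Q.side ≤ ‖u - Q.center‖) :
    Q.bump u = 0 := max_eq_left (by linarith)

lemma Cube.norm_sub_center_le {Q : Cube n} {u : Eu n} (hQ : 0 ≤ Q.side) (hu : u ∈ Q.base) :
    ‖u - Q.center‖ ≤ √(n : ℝ) * (Q.side / 2) :=
  norm_le_of_coord (by positivity) fun i => by simpa using Cube.abs_sub_center_le hu i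

lemma Cube.integrable_bump (Q : Cube n) (ν : Measure (Eu n)) [IsLocallyFiniteMeasure ν] :
    Integrable Q.bump ν := by
  refine Q.continuous_bump.integrable_of_hasCompactSupport ?_
  refine HasCompactSupport.intro (isCompact_closedBall Q.center (√(n : ℝ) * Q.side)) fun u hu => ?_
  refine Cube.bump_eq_zero ?_
  rw [Metric.mem_closedBall, dist_eq_norm, not_le] at hu
  exact hu.le

lemma Cube.le_integral_bump (hn : 0 < n) {Q : Cube n} (hQ : 0 < Q.side) :
    Q.side ^ (n + 1) / 2 ≤ ∫ u, Q.bump u := by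
  have hσ := one_le_sqrt_dim hn
  calc Q.side ^ (n + 1) / 2 = ∫ _u in Q.base, Q.side / 2 := by
        rw [setIntegral_const, Q.volume_real_base hQ.le, smul_eq_mul, pow_succ]; ring
    _ ≤ ∫ u in Q.base, Q.bump u := by
        refine setIntegral_mono_on (integrableOn_of_continuous continuous_const
          Q.isCompact_window (Cube.base_subset_window hQ.le)) (Q.integrable_bump _).integrableOn
          Q.measurableSet_base fun u hu => ?_
        refine le_trans ?_ (le_max_right _ _)
        have := Cube.norm_sub_center_le hQ.le hu
        nlinarith
    _ ≤ ∫ u, Q.bump u :=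
        setIntegral_le_integral (Q.integrable_bump _) (ae_of_all _ Q.bump_nonneg)

/-- The mean density of `ν` near the cube. -/
noncomputable def dens (Q : Cube n) (ν : Measure (Eu n)) : ℝ :=
  (∫ u, Q.bump u ∂ν) / ∫ u, Q.bump u

/-- The oscillation of the density of `ν` in the window of the cube: the best constant in the
comparison of `ν` with the mean density, tested against Lipschitz functions. -/
noncomputable def osc (Q : Cube n) (ν : Measure (Eu n)) : ℝ :=
  sInf {τ : ℝ | 0 ≤ τ ∧ ∀ h : Eu n → ℝ, LipschitzWith 1 h → tsupport h ⊆ Q.window →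
    |∫ u, h u ∂ν - dens Q ν * ∫ u, h u| ≤ τ * Q.side ^ (n + 1)}

lemma osc_nonneg (Q : Cube n) (ν : Measure (Eu n)) : 0 ≤ osc Q ν :=
  Real.sInf_nonneg fun _ h => h.1

lemma dens_nonneg (Q : Cube n) (ν : Measure (Eu n)) : 0 ≤ dens Q ν :=
  div_nonneg (integral_nonneg Q.bump_nonneg) (integral_nonneg Q.bump_nonneg)

section Osc

variable {lip : ℝ≥0} {M : ℝ} {A : Eu n → Eu k} {ν : Measure (Eu n)}

lemma dens_le (hn : 0 < n) (hν : IsGraphPair lip M A ν) {Q : Cube n} (hQ : 0 < Q.side) :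
    dens Q ν ≤ M := by
  have h1 := Cube.le_integral_bump hn hQ
  rw [dens, div_le_iff₀ (lt_of_lt_of_le (by positivity) h1)]
  have := hν.integral_le Q.bump_nonneg (S := univ) (Q.integrable_bump volume).integrableOn
  simpa using this

lemma abs_le_of_lipschitz_window (hn : 0 < n) {Q : Cube n} (hQ : 0 < Q.side) {h : Eu n → ℝ}
    (hh : LipschitzWith 1 h) (hs : tsupport h ⊆ Q.window) {u : Eu n} (hu : u ∈ Q.window) :
    |h u| ≤ 11 * √(n : ℝ) * Q.side := by
  have hσ := one_le_sqrt_dim hn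
  let v : Eu n := Q.center + (6 * √(n : ℝ) * Q.side) • unitVec ⟨0, hn⟩
  have hv : dist v Q.center = 6 * √(n : ℝ) * Q.side := by
    rw [dist_eq_norm, add_sub_cancel_left, norm_smul]
    simp [abs_of_pos hQ]
  have hv0 : h v = 0 := by
    refine image_eq_zero_of_notMem_tsupport fun hv' => ?_
    have := hs hv'
    rw [Cube.window, Metric.mem_closedBall, hv] at this
    nlinarith [mul_pos (by linarith : 0 < √(n : ℝ)) hQ]
  have h1 := hh.dist_le_mul u v
  rw [hv0, Real.dist_eq, sub_zero, NNReal.coe_one, one_mul] at h1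
  have h2 := dist_triangle_right u v Q.center
  rw [Cube.window, Metric.mem_closedBall] at hu
  rw [hv] at h2
  linarith

lemma integral_abs_lipschitz_window_le (hn : 0 < n) {Q : Cube n} (hQ : 0 < Q.side) {h : Eu n → ℝ}
    (hh : LipschitzWith 1 h) (hs : tsupport h ⊆ Q.window) :
    ∫ u in Q.window, |h u| ≤
      11 * √(n : ℝ) * ((5 * √(n : ℝ)) ^ n * ballVol n) * Q.side ^ (n + 1) := by
  have h1 : ∫ u in Q.window, |h u| ≤ ∫ _u in Q.window, 11 * √(n : ℝ) * Q.side :=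
    setIntegral_mono_on (integrableOn_of_continuous hh.continuous.abs Q.isCompact_window subset_rfl)
      (integrableOn_of_continuous continuous_const Q.isCompact_window subset_rfl)
      Q.measurableSet_window fun u hu => abs_le_of_lipschitz_window hn hQ hh hs hu
  rw [setIntegral_const_window Q hQ.le] at h1
  refine h1.trans (le_of_eq ?_)
  rw [pow_succ]; ring

lemma abs_integral_le_window {h : Eu n → ℝ} {Q : Cube n} (ν : Measure (Eu n))
    (hs : tsupport h ⊆ Q.window) : |∫ u, h u ∂ν| ≤ ∫ u in Q.window, |h u| ∂ν := by
  rw [← setIntegral_eq_integral_of_forall_compl_eq_zero (s := Q.window) fun u hu =>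
    image_eq_zero_of_notMem_tsupport fun h' => hu (hs h')]
  exact abs_integral_le_integral_abs

lemma osc_set_nonempty (hn : 0 < n) (hν : IsGraphPair lip M A ν) {Q : Cube n} (hQ : 0 < Q.side) :
    2 * M * (11 * √(n : ℝ) * ((5 * √(n : ℝ)) ^ n * ballVol n)) ∈
    {τ : ℝ | 0 ≤ τ ∧ ∀ h : Eu n → ℝ, LipschitzWith 1 h → tsupport h ⊆ Q.window →
      |∫ u, h u ∂ν - dens Q ν * ∫ u, h u| ≤ τ * Q.side ^ (n + 1)} := by
  have hbv := ballVol_pos (n := n)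
  have hM := hν.one_le
  refine ⟨by positivity, fun h hh hs => ?_⟩
  have h1 := integral_abs_lipschitz_window_le hn hQ hh hs
  have h2 := abs_integral_le_window ν hs
  have h3 := abs_integral_le_window volume hs
  have h4 := hν.integral_le (fun u => abs_nonneg (h u))
    (integrableOn_of_continuous hh.continuous.abs Q.isCompact_window subset_rfl)
  have h5 := dens_le hn hν hQ
  have h6 := dens_nonneg Q ν
  calc _ ≤ |∫ u, h u ∂ν| + dens Q ν * |∫ u, h u| := by
        rw [← abs_of_nonneg h6, ← abs_mul, abs_of_nonneg h6]; exact abs_sub _ _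
    _ ≤ M * (∫ u in Q.window, |h u|) + M * ∫ u in Q.window, |h u| := by
        gcongr
        exact h2.trans h4
    _ ≤ M * (11 * √(n : ℝ) * ((5 * √(n : ℝ)) ^ n * ballVol n) * Q.side ^ (n + 1)) +
        M * (11 * √(n : ℝ) * ((5 * √(n : ℝ)) ^ n * ballVol n) * Q.side ^ (n + 1)) := by gcongr
    _ = _ := by ring

lemma osc_le (hn : 0 < n) (hν : IsGraphPair lip M A ν) {Q : Cube n} (hQ : 0 < Q.side) :
    osc Q ν ≤ 2 * M * (11 * √(n : ℝ) * ((5 * √(n : ℝ)) ^ n * ballVol n)) :=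
  csInf_le ⟨0, fun _ h => h.1⟩ (osc_set_nonempty hn hν hQ)

lemma abs_integral_sub_dens_le_one (hn : 0 < n) (hν : IsGraphPair lip M A ν) {Q : Cube n}
    (hQ : 0 < Q.side) {h : Eu n → ℝ} (hh : LipschitzWith 1 h) (hs : tsupport h ⊆ Q.window) :
    |∫ u, h u ∂ν - dens Q ν * ∫ u, h u| ≤ osc Q ν * Q.side ^ (n + 1) := by
  rw [← div_le_iff₀ (by positivity)]
  refine le_csInf ⟨_, osc_set_nonempty hn hν hQ⟩ fun τ hτ => ?_
  rw [div_le_iff₀ (by positivity)]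
  exact hτ.2 h hh hs

lemma abs_integral_sub_dens_le (hn : 0 < n) (hν : IsGraphPair lip M A ν) {Q : Cube n}
    (hQ : 0 < Q.side) {h : Eu n → ℝ} {K : ℝ} (hK : 0 ≤ K) (hh : ∀ u v, |h u - h v| ≤ K * ‖u - v‖)
    (hs : ∀ u ∉ Q.window, h u = 0) :
    |∫ u, h u ∂ν - dens Q ν * ∫ u, h u| ≤ K * (osc Q ν * Q.side ^ (n + 1)) := by
  have hlim : ∀ K' : ℝ, 0 < K' → K ≤ K' →
      |∫ u, h u ∂ν - dens Q ν * ∫ u, h u| ≤ K' * (osc Q ν * Q.side ^ (n + 1)) := fun K' hK' hKK' => by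
    let g : Eu n → ℝ := fun u => K'⁻¹ * h u
    have hg : LipschitzWith 1 g := LipschitzWith.of_dist_le_mul fun u v => by
      rw [Real.dist_eq, ← mul_sub, abs_mul, abs_of_pos (inv_pos.2 hK'), NNReal.coe_one, one_mul,
        inv_mul_le_iff₀ hK', dist_eq_norm]
      exact (hh u v).trans (mul_le_mul_of_nonneg_right hKK' (norm_nonneg _))
    have hgs : tsupport g ⊆ Q.window := closure_minimal (fun u hu => by
      by_contra hu'
      exact hu (by simp [g, hs u hu'])) Metric.isClosed_closedBall
    have := abs_integral_sub_dens_le_one hn hν hQ hg hgs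
    simp only [g, integral_const_mul] at this
    have h2 : K'⁻¹ * (∫ u, h u ∂ν) - dens Q ν * (K'⁻¹ * ∫ u, h u) =
        K'⁻¹ * (∫ u, h u ∂ν - dens Q ν * ∫ u, h u) := by ring
    rwa [h2, abs_mul, abs_of_pos (inv_pos.2 hK'), inv_mul_le_iff₀ hK'] at this
  rcases hK.eq_or_lt with h0 | h0
  · have hX : 0 ≤ osc Q ν * Q.side ^ (n + 1) := mul_nonneg (osc_nonneg Q ν) (by positivity)
    rw [← h0, zero_mul]
    refine le_of_forall_pos_le_add fun ε hε => ?_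
    rw [zero_add]
    refine (hlim (ε / (osc Q ν * Q.side ^ (n + 1) + 1)) (by positivity) (by
      rw [← h0]; positivity)).trans ?_
    rw [div_mul_eq_mul_div, div_le_iff₀ (by positivity)]
    nlinarith
  · exact hlim K h0 le_rfl

/-- The oscillation of the density is controlled by `α`: on functions of `x̃`, flat measures act
like multiples of Lebesgue measure. -/
lemma exists_osc_le_alpha (n k : ℕ) (hn : 0 < n) (lip : ℝ≥0) (M : ℝ) :
    ∃ C : ℝ, 0 < C ∧ ∀ (A : Eu n → Eu k) (ν : Measure (Eu n)), IsGraphPair lip M A ν →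
      ∀ Q : Cube n, 0 < Q.side → ∀ c : ℝ, 10 * √(n : ℝ) < c →
      ENNReal.ofReal (osc Q ν) ≤ ENNReal.ofReal C * alphaCoeff c (ν.map (graphMap A)) Q := by
  have hbv := ballVol_pos (n := n)
  set w : ℝ := 11 * √(n : ℝ) * ((5 * √(n : ℝ)) ^ n * ballVol n) with hw
  have hw0 : 0 ≤ w := by positivity
  refine ⟨1 + 2 * w, by positivity, fun A ν hν Q hQ c hc => ?_⟩
  have hG : Continuous (graphMap A) := (lipschitz_graphMap hν.lipschitz).continuous
  have hσ := one_le_sqrt_dim hn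
  set X : ℝ≥0∞ := ENNReal.ofReal (osc Q ν * Q.side ^ (n + 1)) / ENNReal.ofReal (1 + 2 * w) with hX
  have hC0 : ENNReal.ofReal (1 + 2 * w) ≠ 0 := by
    rw [Ne, ENNReal.ofReal_eq_zero, not_le]; positivity
  have key : ∀ (t : ℝ≥0) (L : AffineSubspace ℝ (Eu (n + k))), IsPlane n L →
      X ≤ lipDist (Q.cyl c k) (ν.map (graphMap A))
        (t • (μHE[n] : Measure (Eu (n + k))).restrict (L : Set (Eu (n + k)))) := by
    intro t L hL
    set D := lipDist (Q.cyl c k) (ν.map (graphMap A))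
        (t • (μHE[n] : Measure (Eu (n + k))).restrict (L : Set (Eu (n + k)))) with hD
    -- there is nothing to prove when the supremum over the test functions is infinite
    rcases eq_or_ne D ∞ with hDtop | hDtop
    · rw [hDtop]; exact le_top
    set x := D.toReal with hx
    have hx0 : 0 ≤ x := ENNReal.toReal_nonneg
    obtain ⟨κ, hκ⟩ := exists_integral_plane_eq hL
    -- test functions of the form `y ↦ h (tilde y)` see the plane as the multiple `t * κ` of Lebesgue measure
    have htest : ∀ h : Eu n → ℝ, LipschitzWith 1 h → tsupport h ⊆ Q.window →
        |∫ u, h u ∂ν - t * κ * ∫ u, h u| ≤ x := by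
      intro h hh hs
      have hg : LipschitzWith 1 fun y : Eu (n + k) => h (tilde y) := by
        simpa [Function.comp_def] using hh.comp (lipschitz_tilde (n := n) (k := k))
      have hgs : tsupport (fun y : Eu (n + k) => h (tilde y)) ⊆ Q.cyl c k := by
        refine (closure_minimal (fun y hy => ?_)
          ((isClosed_tsupport h).preimage continuous_tilde)).trans fun y hy => ?_
        · exact subset_tsupport h hy
        · have h1 : tilde y ∈ Q.window := hs hy
          refine Metric.closedBall_subset_closedBall ?_ h1
          gcongr
          linarith
      have h1 : ENNReal.ofReal |∫ y, h (tilde y) ∂(ν.map (graphMap A)) -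
          ∫ y, h (tilde y) ∂(t • (μHE[n] : Measure (Eu (n + k))).restrict
            (L : Set (Eu (n + k))))| ≤ D :=
        le_iSup_of_le (fun y : Eu (n + k) => h (tilde y)) (le_iSup₂_of_le hg hgs le_rfl)
      rw [integral_map (f := fun y => h (tilde y)) hG.measurable.aemeasurable
        (hh.continuous.comp continuous_tilde).aestronglyMeasurable,
        integral_smul_nnreal_measure, hκ] at h1
      simp only [graphMap, tilde_join] at h1
      have h2 := (ENNReal.ofReal_le_iff_le_toReal hDtop).1 h1
      rwa [NNReal.smul_def, smul_eq_mul, ← mul_assoc] at h2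
    -- the bump function as a test: the mean density is close to `t * κ`
    have hdens : |dens Q ν - t * κ| ≤ 2 * x / Q.side ^ (n + 1) := by
      have h1 := Cube.le_integral_bump hn hQ
      have hb0 : 0 < ∫ u, Q.bump u := lt_of_lt_of_le (by positivity) h1
      have hbs : tsupport Q.bump ⊆ Q.window := closure_minimal (fun u hu => by
        by_contra hu'
        refine hu (Cube.bump_eq_zero ?_)
        rw [Cube.window, Metric.mem_closedBall, dist_eq_norm, not_le] at hu'
        nlinarith [mul_pos (by linarith : 0 < √(n : ℝ)) hQ]) Metric.isClosed_closedBall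
      have h2 := htest Q.bump (LipschitzWith.of_dist_le_mul fun u v => by
        simpa [Real.dist_eq, dist_eq_norm] using Q.abs_bump_sub_le u v) hbs
      have h3 : ∫ u, Q.bump u ∂ν - t * κ * ∫ u, Q.bump u =
          (dens Q ν - t * κ) * ∫ u, Q.bump u := by
        rw [dens]; field_simp
      rw [h3, abs_mul, abs_of_pos hb0] at h2
      rw [le_div_iff₀ (by positivity)]
      nlinarith [abs_nonneg (dens Q ν - t * κ)]
    have hosc : osc Q ν ≤ x * (1 + 2 * w) / Q.side ^ (n + 1) := by
      refine csInf_le ⟨0, fun _ h => h.1⟩ ⟨by positivity, fun h hh hs => ?_⟩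
      have h1 := htest h hh hs
      have h2 := (abs_integral_le_window volume hs).trans
        (integral_abs_lipschitz_window_le hn hQ hh hs)
      rw [← hw] at h2
      calc |∫ u, h u ∂ν - dens Q ν * ∫ u, h u|
          = |(∫ u, h u ∂ν - t * κ * ∫ u, h u) - (dens Q ν - t * κ) * ∫ u, h u| := by
            congr 1; ring
        _ ≤ |∫ u, h u ∂ν - t * κ * ∫ u, h u| + |(dens Q ν - t * κ) * ∫ u, h u| := abs_sub _ _
        _ ≤ x + 2 * x / Q.side ^ (n + 1) * (w * Q.side ^ (n + 1)) := by
            rw [abs_mul]; gcongr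
        _ = _ := by field_simp
    have h1 : osc Q ν * Q.side ^ (n + 1) ≤ x * (1 + 2 * w) := by
      rwa [le_div_iff₀ (by positivity)] at hosc
    refine ENNReal.div_le_of_le_mul ?_
    calc _ ≤ ENNReal.ofReal (x * (1 + 2 * w)) := ENNReal.ofReal_le_ofReal h1
      _ = _ := by rw [ENNReal.ofReal_mul hx0, hx, ENNReal.ofReal_toReal hDtop]
  have hX2 : X ≤ ⨅ (t : ℝ≥0) (L : AffineSubspace ℝ (Eu (n + k))) (_ : IsPlane n L),
      lipDist (Q.cyl c k) (ν.map (graphMap A))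
        (t • (μHE[n] : Measure (Eu (n + k))).restrict (L : Set (Eu (n + k)))) :=
    le_iInf fun t => le_iInf₂ fun L hL => key t L hL
  have hs0 : ENNReal.ofReal Q.side ^ (n + 1) ≠ 0 := pow_ne_zero _ (by simpa using hQ)
  calc ENNReal.ofReal (osc Q ν)
      = ENNReal.ofReal (1 + 2 * w) * ((ENNReal.ofReal Q.side ^ (n + 1))⁻¹ * X) := by
        rw [hX, ENNReal.ofReal_mul (osc_nonneg Q ν), ENNReal.ofReal_pow hQ.le, div_eq_mul_inv]
        calc ENNReal.ofReal (osc Q ν) = ENNReal.ofReal (osc Q ν) *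
              (ENNReal.ofReal (1 + 2 * w) * (ENNReal.ofReal (1 + 2 * w))⁻¹) *
              (ENNReal.ofReal Q.side ^ (n + 1) * (ENNReal.ofReal Q.side ^ (n + 1))⁻¹) := by
              rw [ENNReal.mul_inv_cancel hC0 (by finiteness),
                ENNReal.mul_inv_cancel hs0 (by finiteness), mul_one, mul_one]
          _ = _ := by ring
    _ ≤ _ := by
        rw [alphaCoeff]
        gcongr

end Osc

/-! ### Comparison with the flat model -/

/-- The linear map with slopes `s`. -/
noncomputable def lin (s : Fin n → Eu k) (u : Eu n) : Eu k := ∑ i, u i • s i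

lemma lin_sub (s : Fin n → Eu k) (u v : Eu n) : lin s u - lin s v = lin s (u - v) := by
  simp only [lin, ← Finset.sum_sub_distrib, ← sub_smul, PiLp.sub_apply]

lemma lin_neg (s : Fin n → Eu k) (u : Eu n) : lin s (-u) = -lin s u := by
  simp [lin]

lemma norm_lin_le (s : Fin n → Eu k) (u : Eu n) : ‖lin s u‖ ≤ (∑ i, ‖s i‖) * ‖u‖ := by
  rw [lin, Finset.sum_mul]
  refine (norm_sum_le _ _).trans (Finset.sum_le_sum fun i _ => ?_)
  rw [norm_smul, mul_comm]
  exact mul_le_mul_of_nonneg_left (PiLp.norm_apply_le u i) (norm_nonneg _)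

lemma norm_lin_sub_lin_le (s t : Fin n → Eu k) (u : Eu n) :
    ‖lin s u - lin t u‖ ≤ (∑ i, ‖s i - t i‖) * ‖u‖ := by
  have : lin s u - lin t u = lin (fun i => s i - t i) u := by
    simp only [lin, ← Finset.sum_sub_distrib, ← smul_sub]
  rw [this]
  exact norm_lin_le _ _

@[fun_prop] lemma continuous_lin (s : Fin n → Eu k) : Continuous (lin s) := by
  unfold lin; fun_prop

lemma affPart_sub_eq_lin {A : Eu n → Eu k} {Q : Cube n} (hQ : 0 < Q.side) (hA : Continuous A)
    (u v : Eu n) : affPart Q A u - affPart Q A v = lin (slope Q A) (u - v) := by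
  rw [affPart_sub_affPart hQ hA, lin]
  rfl

lemma affErr_sub {A : Eu n → Eu k} {Q : Cube n} (hQ : 0 < Q.side) (hA : Continuous A)
    (u v : Eu n) : affErr Q A u - affErr Q A v = A u - A v - lin (slope Q A) (u - v) := by
  rw [← affPart_sub_eq_lin hQ hA, affErr, affErr]; abel

lemma sum_norm_slope_le {lip : ℝ≥0} {A : Eu n → Eu k} {Q : Cube n} (hQ : 0 < Q.side)
    (hA : LipschitzWith lip A) : ∑ i, ‖slope Q A i‖ ≤ n * lip := by
  calc _ ≤ ∑ _i : Fin n, (lip : ℝ) :=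
        Finset.sum_le_sum fun i _ => norm_slope_le_of_lipschitz hQ hA i
    _ = _ := by simp

/-- The deviation of the pair `(A, ν)` from being flat in the window of the cube: oscillation of the
density plus mean distance from the graph to its affine approximation. -/
noncomputable def gam (Q : Cube n) (A : Eu n → Eu k) (ν : Measure (Eu n)) : ℝ :=
  osc Q ν + (∫ u in Q.window, ‖affErr Q A u‖) / Q.side ^ (n + 1)

lemma integral_affErr_nonneg (Q : Cube n) (A : Eu n → Eu k) :
    0 ≤ ∫ u in Q.window, ‖affErr Q A u‖ := integral_nonneg fun _ => norm_nonneg _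

lemma gam_nonneg {Q : Cube n} (hQ : 0 < Q.side) (A : Eu n → Eu k) (ν : Measure (Eu n)) :
    0 ≤ gam Q A ν :=
  add_nonneg (osc_nonneg _ _) (div_nonneg (integral_affErr_nonneg _ _) (by positivity))

lemma osc_le_gam {Q : Cube n} (hQ : 0 < Q.side) (A : Eu n → Eu k) (ν : Measure (Eu n)) :
    osc Q ν ≤ gam Q A ν :=
  le_add_of_nonneg_right (div_nonneg (integral_affErr_nonneg _ _) (by positivity))

lemma integral_affErr_le_gam {Q : Cube n} (hQ : 0 < Q.side) (A : Eu n → Eu k) (ν : Measure (Eu n)) :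
    ∫ u in Q.window, ‖affErr Q A u‖ ≤ gam Q A ν * Q.side ^ (n + 1) := by
  rw [← div_le_iff₀ (by positivity)]
  exact le_add_of_nonneg_left (osc_nonneg _ _)

lemma affErr_lin {Q : Cube n} (hQ : 0 < Q.side) (s : Fin n → Eu k) (u : Eu n) :
    affErr Q (lin s) u = 0 := by
  have := affPart_eq_of_affine hQ s 0 u
  simp only [add_zero] at this
  rw [affErr, sub_eq_zero]
  exact this.symm

lemma slope_lin {Q : Cube n} (hQ : 0 < Q.side) (s : Fin n → Eu k) (i : Fin n) :
    slope Q (lin s) i = s i := by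
  have := slope_eq_of_affine hQ s 0 i
  simp only [add_zero] at this
  exact this

lemma gam_lin_le {Q : Cube n} (hQ : 0 < Q.side) (s : Fin n → Eu k) (A : Eu n → Eu k)
    (ν : Measure (Eu n)) : gam Q (lin s) ν ≤ gam Q A ν := by
  rw [gam]
  simp only [affErr_lin hQ, norm_zero, integral_zero, zero_div, add_zero]
  exact osc_le_gam hQ A ν

lemma exists_gam_le (n k : ℕ) (hn : 0 < n) (lip : ℝ≥0) (M : ℝ) :
    ∃ C : ℝ, 0 < C ∧ ∀ (A : Eu n → Eu k) (ν : Measure (Eu n)), IsGraphPair lip M A ν →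
      ∀ Q : Cube n, 0 < Q.side → gam Q A ν ≤ C := by
  have hbv := ballVol_pos (n := n)
  set w : ℝ := (5 * √(n : ℝ)) ^ n * ballVol n with hw
  set e : ℝ := (1 + n * (12 * √(n : ℝ))) * w * (10 * √(n : ℝ)) * lip with he
  refine ⟨|2 * M * (11 * √(n : ℝ) * w)| + w * e + 1, by positivity, fun A ν hν Q hQ => ?_⟩
  have h1 : ∫ u in Q.window, ‖affErr Q A u‖ ≤ ∫ _u in Q.window, e * Q.side :=
    setIntegral_mono_on (integrableOn_of_continuous
      (continuous_affErr hQ hν.lipschitz.continuous).norm Q.isCompact_window subset_rfl)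
      (integrableOn_of_continuous continuous_const Q.isCompact_window subset_rfl)
      Q.measurableSet_window fun u hu => norm_affErr_le hν.lipschitz hQ hu
  rw [setIntegral_const_window Q hQ.le, ← hw] at h1
  have h2 : (∫ u in Q.window, ‖affErr Q A u‖) / Q.side ^ (n + 1) ≤ w * e := by
    rw [div_le_iff₀ (by positivity)]
    exact h1.trans (le_of_eq (by rw [pow_succ]; ring))
  have h3 := (osc_le hn hν hQ).trans (le_abs_self _)
  rw [gam]
  linarith

lemma continuous_of_lip {Φ : Eu n → Eu k → ℝ} {L : ℝ}
    (hΦ : ∀ y v y' v', |Φ y v - Φ y' v'| ≤ L * (‖y - y'‖ + ‖v - v'‖)) :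
    Continuous fun q : Eu n × Eu k => Φ q.1 q.2 := by
  refine continuous_iff_continuousAt.2 fun q => ?_
  rw [ContinuousAt, tendsto_iff_dist_tendsto_zero]
  have h : Tendsto (fun p : Eu n × Eu k => L * (‖p.1 - q.1‖ + ‖p.2 - q.2‖)) (𝓝 q) (𝓝 0) := by
    have : Continuous fun p : Eu n × Eu k => L * (‖p.1 - q.1‖ + ‖p.2 - q.2‖) := by fun_prop
    simpa using this.tendsto q
  exact squeeze_zero (fun _ => dist_nonneg) (fun p => by rw [Real.dist_eq]; exact hΦ _ _ _ _) h

lemma integrable_of_window {g : Eu n → ℝ} (hg : Continuous g) {Q : Cube n}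
    (hs : ∀ y ∉ Q.window, g y = 0) (ν : Measure (Eu n)) [IsLocallyFiniteMeasure ν] :
    Integrable g ν :=
  hg.integrable_of_hasCompactSupport (HasCompactSupport.intro Q.isCompact_window hs)

/-- Integrals of Lipschitz functions over the graph, against those over its affine approximation
with the mean density. -/
lemma exists_flat_approx (n k : ℕ) (hn : 0 < n) (lip : ℝ≥0) (M : ℝ) :
    ∃ C : ℝ, 0 ≤ C ∧ ∀ (A : Eu n → Eu k) (ν : Measure (Eu n)), IsGraphPair lip M A ν →
      ∀ Q : Cube n, 0 < Q.side → ∀ (Φ : Eu n → Eu k → ℝ) (L : ℝ), 0 ≤ L →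
      (∀ y v y' v', |Φ y v - Φ y' v'| ≤ L * (‖y - y'‖ + ‖v - v'‖)) →
      (∀ y ∉ Q.window, ∀ v, Φ y v = 0) →
      |∫ y, Φ y (A y) ∂ν - dens Q ν * ∫ y, Φ y (affPart Q A y)| ≤
        C * L * (gam Q A ν * Q.side ^ (n + 1)) := by
  refine ⟨(1 + n * lip) + |M|, by positivity, fun A ν hν Q hQ Φ L hL hΦ hs => ?_⟩
  have := hν.isLocallyFiniteMeasure
  have hM : |M| = M := abs_of_nonneg (zero_le_one.trans hν.one_le)
  have hA := hν.lipschitz.continuous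
  have ha := continuous_affPart hQ hA
  have hc := continuous_of_lip hΦ
  have hc1 : Continuous fun y => Φ y (A y) := hc.comp (continuous_id.prodMk hA)
  have hc2 : Continuous fun y => Φ y (affPart Q A y) := hc.comp (continuous_id.prodMk ha)
  have hs1 := fun y hy => hs y hy (A y)
  have hs2 := fun y hy => hs y hy (affPart Q A y)
  -- replacing `A` by its affine approximation costs the mean approximation error
  have h1 : |∫ y, Φ y (A y) ∂ν - ∫ y, Φ y (affPart Q A y) ∂ν| ≤
      M * L * (gam Q A ν * Q.side ^ (n + 1)) := by
    rw [← integral_sub (integrable_of_window hc1 hs1 ν) (integrable_of_window hc2 hs2 ν),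
      ← setIntegral_eq_integral_of_forall_compl_eq_zero (s := Q.window) fun u hu => by
        rw [hs1 u hu, hs2 u hu, sub_zero]]
    have hi : IntegrableOn (fun u => L * ‖affErr Q A u‖) Q.window :=
      integrableOn_of_continuous (continuous_const.mul (continuous_affErr hQ hA).norm)
        Q.isCompact_window subset_rfl
    calc _ ≤ ∫ y in Q.window, |Φ y (A y) - Φ y (affPart Q A y)| ∂ν := abs_integral_le_integral_abs
      _ ≤ ∫ y in Q.window, L * ‖affErr Q A y‖ ∂ν := by
          refine integral_mono ?_ ?_ fun y => ?_
          · exact integrableOn_of_continuous (hc1.sub hc2).abs Q.isCompact_window subset_rfl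
          · exact integrableOn_of_continuous (continuous_const.mul (continuous_affErr hQ hA).norm)
              Q.isCompact_window subset_rfl
          · refine (hΦ _ _ _ _).trans (le_of_eq ?_)
            rw [sub_self, norm_zero, zero_add, affErr]
      _ ≤ M * ∫ y in Q.window, L * ‖affErr Q A y‖ := hν.integral_le (fun y => by positivity) hi
      _ ≤ _ := by
          rw [integral_const_mul, ← mul_assoc]
          have := integral_affErr_le_gam hQ A ν
          have := hν.one_le
          gcongr
  -- replacing `ν` by its mean density costs the oscillation of the density
  have h2 : |∫ y, Φ y (affPart Q A y) ∂ν - dens Q ν * ∫ y, Φ y (affPart Q A y)| ≤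
      (1 + n * lip) * L * (gam Q A ν * Q.side ^ (n + 1)) := by
    refine (abs_integral_sub_dens_le hn hν hQ (K := (1 + n * lip) * L) (by positivity)
      (fun u v => ?_) hs2).trans ?_
    · refine (hΦ _ _ _ _).trans ?_
      rw [affPart_sub_eq_lin hQ hA]
      have h3 := norm_lin_le (slope Q A) (u - v)
      have h4 := sum_norm_slope_le hQ hν.lipschitz
      have h5 := mul_le_mul_of_nonneg_right h4 (norm_nonneg (u - v))
      calc L * (‖u - v‖ + ‖lin (slope Q A) (u - v)‖) ≤ L * (‖u - v‖ + n * lip * ‖u - v‖) := by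
            gcongr; linarith
        _ = _ := by ring
    · have := osc_le_gam hQ A ν
      gcongr
  rw [hM]
  calc _ = |(∫ y, Φ y (A y) ∂ν - ∫ y, Φ y (affPart Q A y) ∂ν) +
        (∫ y, Φ y (affPart Q A y) ∂ν - dens Q ν * ∫ y, Φ y (affPart Q A y))| := by congr 1; ring
    _ ≤ _ := abs_add_le _ _
    _ ≤ _ := add_le_add h1 h2
    _ = _ := by ring

/-! ### Neighbouring cubes -/

lemma Cube.closedBall_subset_window {Q Q' : Cube n}
    (hd : dist Q'.center Q.center + 2 * √(n : ℝ) * Q'.side ≤ 5 * √(n : ℝ) * Q.side) :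
    Metric.closedBall Q'.center (2 * √(n : ℝ) * Q'.side) ⊆ Q.window :=
  Metric.closedBall_subset_closedBall' (by linarith)

/-- The mean slope over `Q'` is exact on the affine approximation over `Q`, so that the difference of
the slopes is the slope of the approximation error. -/
lemma norm_slope_sub_slope_le {A : Eu n → Eu k} (hA : Continuous A) (ν : Measure (Eu n))
    {Q Q' : Cube n} (hQ : 0 < Q.side) (hQ' : 0 < Q'.side)
    (hd : dist Q'.center Q.center + 2 * √(n : ℝ) * Q'.side ≤ 5 * √(n : ℝ) * Q.side)
    (hs : Q.side ≤ 2 * Q'.side) (i : Fin n) :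
    ‖slope Q' A i - slope Q A i‖ ≤ 2 ^ (n + 2) * gam Q A ν := by
  have hσ : 1 ≤ √(n : ℝ) := one_le_sqrt_dim (by have := i.2; omega)
  have hw := Cube.closedBall_subset_window hd
  have h1 : slope Q' A i - slope Q A i = slope Q' (affErr Q A) i := by
    have h2 : slope Q' (affPart Q A) i = slope Q A i := by
      have h3 : affPart Q A = fun u => ∑ i, u i • slope Q A i + affPart Q A 0 := by
        ext1 u
        rw [← sub_eq_iff_eq_add, affPart_sub_eq_lin hQ hA, sub_zero, lin]
      rw [h3, slope_eq_of_affine hQ']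
    rw [← h2, ← slope_sub hQ' hA (continuous_affPart hQ hA)]
    rfl
  have hb : ∀ u ∈ Q'.base, ‖u - Q'.center‖ ≤ √(n : ℝ) * (Q'.side / 2) := fun u hu =>
    Cube.norm_sub_center_le hQ'.le hu
  rw [h1]
  refine (norm_slope_le hQ' (continuous_affErr hQ hA) Q.isCompact_window
    (fun u hu => hw ?_) i (fun u hu => hw ?_)).trans ?_
  · rw [Metric.mem_closedBall, dist_eq_norm]
    exact (hb u hu).trans (by nlinarith)
  · rw [Metric.mem_closedBall, dist_eq_norm]
    have h3 : ‖(Q'.side • unitVec i : Eu n)‖ = Q'.side := by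
      rw [norm_smul, Real.norm_of_nonneg hQ'.le]; simp
    have h4 := norm_add_le (u - Q'.center) (Q'.side • unitVec i)
    have h5 := hb u hu
    rw [show u + Q'.side • unitVec i - Q'.center = u - Q'.center + Q'.side • unitVec i by abel]
    nlinarith
  · have h3 := integral_affErr_le_gam hQ A ν
    have h4 : Q.side ^ (n + 1) ≤ 2 ^ (n + 1) * Q'.side ^ (n + 1) := by
      rw [← mul_pow]; gcongr
    have h5 := gam_nonneg hQ A ν
    rw [div_mul_eq_mul_div, div_le_iff₀ (by positivity)]
    calc 2 * ∫ u in Q.window, ‖affErr Q A u‖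
        ≤ 2 * (gam Q A ν * (2 ^ (n + 1) * Q'.side ^ (n + 1))) := by
          have := mul_le_mul_of_nonneg_left h4 h5
          linarith
      _ = _ := by ring

lemma abs_dens_sub_dens_le {lip : ℝ≥0} {M : ℝ} {A : Eu n → Eu k} {ν : Measure (Eu n)} (hn : 0 < n)
    (hν : IsGraphPair lip M A ν) {Q Q' : Cube n} (hQ : 0 < Q.side) (hQ' : 0 < Q'.side)
    (hd : dist Q'.center Q.center + 2 * √(n : ℝ) * Q'.side ≤ 5 * √(n : ℝ) * Q.side)
    (hs : Q.side ≤ 2 * Q'.side) :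
    |dens Q' ν - dens Q ν| ≤ 2 ^ (n + 2) * gam Q A ν := by
  have hσ := one_le_sqrt_dim hn
  have hw := Cube.closedBall_subset_window hd
  have h1 := Cube.le_integral_bump hn hQ'
  have hb0 : 0 < ∫ u, Q'.bump u := lt_of_lt_of_le (by positivity) h1
  have h2 := abs_integral_sub_dens_le hn hν hQ (h := Q'.bump) zero_le_one (fun u v => by
    rw [one_mul]; exact Q'.abs_bump_sub_le u v) fun u hu => by
      refine Cube.bump_eq_zero ?_
      by_contra h
      refine hu (hw ?_)
      rw [Metric.mem_closedBall, dist_eq_norm]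
      nlinarith
  have h3 : ∫ u, Q'.bump u ∂ν - dens Q ν * ∫ u, Q'.bump u =
      (dens Q' ν - dens Q ν) * ∫ u, Q'.bump u := by
    rw [dens, dens]; field_simp
  rw [h3, abs_mul, abs_of_pos hb0, one_mul] at h2
  have h4 : Q.side ^ (n + 1) ≤ 2 ^ (n + 1) * Q'.side ^ (n + 1) := by
    rw [← mul_pow]; gcongr
  have h5 := osc_nonneg Q ν
  have h6 : |dens Q' ν - dens Q ν| * (Q'.side ^ (n + 1) / 2) ≤
      osc Q ν * (2 ^ (n + 1) * Q'.side ^ (n + 1)) :=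
    (mul_le_mul_of_nonneg_left h1 (abs_nonneg _)).trans
      (h2.trans (mul_le_mul_of_nonneg_left h4 h5))
  have h7 : |dens Q' ν - dens Q ν| ≤ 2 ^ (n + 2) * osc Q ν := by
    have : 0 < Q'.side ^ (n + 1) / 2 := by positivity
    refine le_of_mul_le_mul_right (h6.trans (le_of_eq ?_)) this
    ring
  exact h7.trans (mul_le_mul_of_nonneg_left (osc_le_gam hQ A ν) (by positivity))

/-! ### Cancellation at a single scale -/

lemma IsPiece.continuous {B ℓ : ℝ} {H : Eu n → Eu k → ℝ} (hH : IsPiece n k B ℓ H) :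
    Continuous fun q : Eu n × Eu k => H q.1 q.2 := continuous_of_lip hH.lip

lemma IsPiece.continuous_comp {X : Type*} [TopologicalSpace X] {B ℓ : ℝ} {H : Eu n → Eu k → ℝ}
    (hH : IsPiece n k B ℓ H) {f : X → Eu n} {g : X → Eu k} (hf : Continuous f)
    (hg : Continuous g) : Continuous fun x => H (f x) (g x) :=
  hH.continuous.comp (hf.prodMk hg)

lemma integrable_of_closedBall {g : Eu n → ℝ} (hg : Continuous g) {z : Eu n} {r : ℝ}
    (hs : ∀ y, r < ‖z - y‖ → g y = 0) (ν : Measure (Eu n)) [IsLocallyFiniteMeasure ν] :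
    Integrable g ν := by
  refine hg.integrable_of_hasCompactSupport
    (HasCompactSupport.intro (isCompact_closedBall z r) fun y hy => hs y ?_)
  rwa [Metric.mem_closedBall, dist_comm, dist_eq_norm, not_le] at hy

lemma abs_integral_le_of_closedBall {g : Eu n → ℝ} {z : Eu n} {r b : ℝ} (hr : 0 ≤ r)
    (hs : ∀ y, r < ‖z - y‖ → g y = 0) (hb : ∀ y, ‖z - y‖ ≤ r → |g y| ≤ b) :
    |∫ y, g y| ≤ b * (r ^ n * ballVol n) := by
  rw [← setIntegral_eq_integral_of_forall_compl_eq_zero (s := Metric.closedBall z r) fun y hy => by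
    rw [Metric.mem_closedBall, dist_comm, dist_eq_norm, not_le] at hy
    exact hs y hy]
  have := norm_setIntegral_le_of_norm_le_const (μ := (volume : Measure (Eu n)))
    (s := Metric.closedBall z r) (f := g) (C := b) measure_closedBall_lt_top fun y hy => by
      rw [Metric.mem_closedBall, dist_comm, dist_eq_norm] at hy
      exact hb y hy
  rwa [volume_real_closedBall _ hr] at this

/-- Integrals of one kernel piece at two nearby points: the difference is governed by the deviation
from flatness at the scale of the piece, since for a flat measure the integral depends on the point
only through its height above the plane. -/
lemma exists_far_le (n k : ℕ) (hn : 0 < n) (lip : ℝ≥0) (M B : ℝ) (hB : 0 ≤ B) :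
    ∃ C : ℝ, 0 ≤ C ∧ ∀ (A : Eu n → Eu k) (ν : Measure (Eu n)), IsGraphPair lip M A ν →
      ∀ Q : Cube n, 0 < Q.side → ∀ H : Eu n → Eu k → ℝ, IsPiece n k B Q.side H →
      ∀ x ∈ Q.base, ∀ z, ‖x - z‖ ≤ √(n : ℝ) * Q.side / 4 →
      |∫ y, H (x - y) (A x - A y) ∂ν - ∫ y, H (z - y) (A z - A y) ∂ν| ≤
        C * (‖x - z‖ / Q.side * gam Q A ν + ‖affErr Q A x - affErr Q A z‖ / Q.side) := by
  obtain ⟨C, hC, hflat⟩ := exists_flat_approx n k hn lip M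
  have hbv := ballVol_pos (n := n)
  have hσ := one_le_sqrt_dim hn
  set w : ℝ := (3 / 2 * √(n : ℝ)) ^ n * ballVol n with hw
  refine ⟨C * (B * (1 + lip)) + |M| * (B * w), by positivity, fun A ν hν Q hQ H hH x hx z hz => ?_⟩
  have := hν.isLocallyFiniteMeasure
  have hA := hν.lipschitz.continuous
  have ha := continuous_affPart hQ hA
  have hM : |M| = M := abs_of_nonneg (zero_le_one.trans hν.one_le)
  set ℓ := Q.side with hℓ
  have hg := gam_nonneg hQ A ν
  have hxc := Cube.norm_sub_center_le hQ.le hx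
  have hint : ∀ (v : Eu n) (a : Eu n → Eu k), Continuous a → ∀ (ρ : Measure (Eu n))
      [IsLocallyFiniteMeasure ρ], Integrable (fun y => H (v - y) (A v - a y)) ρ := by
    intro v a ha ρ _
    refine integrable_of_closedBall (z := v) (r := 3 / 2 * √(n : ℝ) * ℓ)
      (hH.continuous_comp (by fun_prop) (by fun_prop)) (fun y hy => hH.supp _ _ hy) ρ
  -- the second differences of `H` bound the Lipschitz constant of this test function, with the gain
  -- `‖x - z‖ / ℓ`
  have h1 := hflat A ν hν Q hQ (fun y v => H (x - y) (A x - v) - H (z - y) (A z - v))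
    (B / ℓ ^ (n + 2) * ((1 + lip) * ‖x - z‖)) (by positivity) (fun y v y' v' => by
      have h := hH.lip₂ (z - y') (A z - v') (x - z) (A x - A z) (y' - y) (v' - v)
      rw [show z - y' + (x - z) + (y' - y) = x - y by abel,
        show A z - v' + (A x - A z) + (v' - v) = A x - v by abel,
        show z - y' + (x - z) = x - y' by abel, show A z - v' + (A x - A z) = A x - v' by abel,
        show z - y' + (y' - y) = z - y by abel, show A z - v' + (v' - v) = A z - v by abel] at h
      have hl := hν.lipschitz.dist_le_mul x z
      rw [dist_eq_norm, dist_eq_norm] at hl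
      rw [norm_sub_rev y y', norm_sub_rev v v']
      calc _ = |H (x - y) (A x - v) - H (x - y') (A x - v') -
            (H (z - y) (A z - v) - H (z - y') (A z - v'))| := by congr 1; ring
        _ ≤ _ := h
        _ ≤ _ := by
          refine mul_le_mul_of_nonneg_right (mul_le_mul_of_nonneg_left ?_ (by positivity))
            (by positivity)
          linarith) (fun y hy v => by
      rw [Cube.window, Metric.mem_closedBall, dist_eq_norm, not_le] at hy
      have h3 : ‖y - Q.center‖ ≤ ‖x - y‖ + ‖x - Q.center‖ := by
        rw [show y - Q.center = (x - Q.center) - (x - y) by abel, add_comm]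
        exact norm_sub_le _ _
      have h4 : ‖x - y‖ ≤ ‖x - z‖ + ‖z - y‖ := by
        rw [show x - y = (x - z) + (z - y) by abel]; exact norm_add_le _ _
      have h5 : 0 < √(n : ℝ) * ℓ := by positivity
      rw [← hℓ] at hy hxc
      rw [hH.supp _ _ (by nlinarith), hH.supp _ _ (by nlinarith), sub_zero])
  rw [integral_sub (hint x A hA ν) (hint z A hA ν), integral_sub (hint x _ ha volume)
    (hint z _ ha volume)] at h1
  -- translated to the origin, the flat model depends on `v` only through the height `affErr Q A v`
  have htr : ∀ v : Eu n, ∫ y, H (v - y) (A v - affPart Q A y) =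
      ∫ u, H u (affErr Q A v + lin (slope Q A) u) := fun v => by
    rw [← integral_sub_left_eq_self (fun u => H u (affErr Q A v + lin (slope Q A) u)) volume v]
    congr 1 with y
    congr 1
    rw [← affPart_sub_eq_lin hQ hA, affErr]; abel
  rw [htr, htr] at h1
  have hint2 : ∀ v : Eu n, Integrable fun u => H u (affErr Q A v + lin (slope Q A) u) := fun v =>
    integrable_of_closedBall (z := 0) (r := 3 / 2 * √(n : ℝ) * ℓ)
      (hH.continuous_comp (by fun_prop) (by fun_prop))
      (fun y hy => hH.supp _ _ (by rwa [zero_sub, norm_neg] at hy)) _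
  have h2 : |(∫ u, H u (affErr Q A x + lin (slope Q A) u)) -
      ∫ u, H u (affErr Q A z + lin (slope Q A) u)| ≤
      B * w * (‖affErr Q A x - affErr Q A z‖ / ℓ) := by
    rw [← integral_sub (hint2 x) (hint2 z)]
    refine (abs_integral_le_of_closedBall (z := 0) (r := 3 / 2 * √(n : ℝ) * ℓ)
      (b := B / ℓ ^ (n + 1) * ‖affErr Q A x - affErr Q A z‖) (by positivity) (fun y hy => ?_)
      fun y _ => ?_).trans (le_of_eq ?_)
    · rw [zero_sub, norm_neg] at hy
      rw [hH.supp _ _ hy, hH.supp _ _ hy, sub_zero]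
    · refine (hH.lip _ _ _ _).trans (le_of_eq ?_)
      rw [sub_self, norm_zero, zero_add, add_sub_add_right_eq_sub]
    · rw [hw, mul_pow _ ℓ, pow_succ]; field_simp
  have hd0 := dens_nonneg Q ν
  have hd1 := dens_le hn hν hQ
  set X := (∫ u, H u (affErr Q A x + lin (slope Q A) u)) -
      ∫ u, H u (affErr Q A z + lin (slope Q A) u) with hX
  set Y := ∫ y, H (x - y) (A x - A y) ∂ν - ∫ y, H (z - y) (A z - A y) ∂ν with hY
  have h3 : |dens Q ν * X| ≤ M * (B * w * (‖affErr Q A x - affErr Q A z‖ / ℓ)) := by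
    rw [abs_mul, abs_of_nonneg hd0]
    exact mul_le_mul hd1 h2 (abs_nonneg _) (hd0.trans hd1)
  have h4 : C * (B / ℓ ^ (n + 2) * ((1 + lip) * ‖x - z‖)) * (gam Q A ν * ℓ ^ (n + 1)) =
      C * (B * (1 + lip)) * (‖x - z‖ / ℓ * gam Q A ν) := by
    rw [pow_succ ℓ (n + 1)]; field_simp
  rw [h4] at h1
  have h5 : |Y| ≤ |Y - dens Q ν * X| + |dens Q ν * X| := by
    calc |Y| = |Y - dens Q ν * X + dens Q ν * X| := by congr 1; ring
      _ ≤ _ := abs_add_le _ _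
  have p1 : 0 ≤ ‖x - z‖ / ℓ * gam Q A ν := by positivity
  have p2 : 0 ≤ ‖affErr Q A x - affErr Q A z‖ / ℓ := by positivity
  rw [hM]
  calc |Y| ≤ C * (B * (1 + lip)) * (‖x - z‖ / ℓ * gam Q A ν) +
        M * (B * w * (‖affErr Q A x - affErr Q A z‖ / ℓ)) := by linarith
    _ ≤ _ := by
        have hM0 : 0 ≤ M := hd0.trans hd1
        have q1 : 0 ≤ C * (B * (1 + lip)) * (‖affErr Q A x - affErr Q A z‖ / ℓ) := by positivity
        have q2 : 0 ≤ M * (B * w) * (‖x - z‖ / ℓ * gam Q A ν) := by positivity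
        nlinarith

/-- A weighted kernel piece is compared with a flat model, in which the slope and the density are
arbitrary. The factor `p z - p y` makes it small when the weight varies slowly. -/
lemma exists_near_le (n k : ℕ) (hn : 0 < n) (lip : ℝ≥0) (M B : ℝ) (hB : 0 ≤ B) :
    ∃ C : ℝ, 0 ≤ C ∧ ∀ (A : Eu n → Eu k) (ν : Measure (Eu n)), IsGraphPair lip M A ν →
      ∀ Q : Cube n, 0 < Q.side → ∀ H : Eu n → Eu k → ℝ, IsPiece n k B Q.side H →
      ∀ (p : Eu n → ℝ) (Λ : ℝ), 0 ≤ Λ → (∀ u v, |p u - p v| ≤ Λ * ‖u - v‖) →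
      ∀ z ∈ Q.base, ∀ (c : ℝ) (s : Fin n → Eu k),
      |∫ y, (p z - p y) * H (z - y) (A z - A y) ∂ν -
        c * ∫ y, (p z - p y) * H (z - y) (lin s (z - y))| ≤
        C * Λ * Q.side * (gam Q A ν + ‖affErr Q A z‖ / Q.side + |dens Q ν - c| +
          ∑ i, ‖slope Q A i - s i‖) := by
  obtain ⟨C, hC, hflat⟩ := exists_flat_approx n k hn lip M
  have hbv := ballVol_pos (n := n)
  have hσ := one_le_sqrt_dim hn
  set τ : ℝ := 3 / 2 * √(n : ℝ) with hτ
  have hτ1 : 1 ≤ τ := by rw [hτ]; linarith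
  set w : ℝ := τ ^ n * ballVol n with hw
  have hw0 : 0 < w := by positivity
  refine ⟨C * (B * (τ + 1)) + |M| * (w * τ * B * τ) + w * τ * B, by positivity,
    fun A ν hν Q hQ H hH p Λ hΛ hp z hz c s => ?_⟩
  have := hν.isLocallyFiniteMeasure
  have hA := hν.lipschitz.continuous
  have ha := continuous_affPart hQ hA
  have hM : |M| = M := abs_of_nonneg (zero_le_one.trans hν.one_le)
  set ℓ := Q.side with hℓ
  have hg := gam_nonneg hQ A ν
  have hzc := Cube.norm_sub_center_le hQ.le hz
  have hpc : Continuous p := by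
    refine (LipschitzWith.of_dist_le_mul (K := ⟨Λ, hΛ⟩) fun u v => ?_).continuous
    rw [Real.dist_eq, dist_eq_norm]; exact hp u v
  have hp' : ∀ y, ‖z - y‖ ≤ τ * ℓ → |p z - p y| ≤ Λ * (τ * ℓ) := fun y hy =>
    (hp z y).trans (mul_le_mul_of_nonneg_left hy hΛ)
  have hΦ1 : ∀ y v y' v', ‖z - y‖ ≤ τ * ℓ →
      |(p z - p y) * H (z - y) (A z - v) - (p z - p y') * H (z - y') (A z - v')| ≤
        B * (τ + 1) * Λ / ℓ ^ n * (‖y - y'‖ + ‖v - v'‖) := by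
    intro y v y' v' hy
    have h1 := hH.lip (z - y) (A z - v) (z - y') (A z - v')
    rw [sub_sub_sub_cancel_left, sub_sub_sub_cancel_left, norm_sub_rev y', norm_sub_rev v'] at h1
    have h2 := hH.bound (z - y') (A z - v')
    have h3 := hp y' y
    rw [norm_sub_rev] at h3
    calc _ = |(p z - p y) * (H (z - y) (A z - v) - H (z - y') (A z - v')) +
          (p y' - p y) * H (z - y') (A z - v')| := by congr 1; ring
      _ ≤ |p z - p y| * |H (z - y) (A z - v) - H (z - y') (A z - v')| +
          |p y' - p y| * |H (z - y') (A z - v')| := by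
          rw [← abs_mul, ← abs_mul]; exact abs_add_le _ _
      _ ≤ Λ * (τ * ℓ) * (B / ℓ ^ (n + 1) * (‖y - y'‖ + ‖v - v'‖)) +
          Λ * ‖y - y'‖ * (B / ℓ ^ n) := by
          refine add_le_add (mul_le_mul (hp' y hy) h1 (abs_nonneg _) (by positivity))
            (mul_le_mul h3 h2 (abs_nonneg _) (by positivity))
      _ = B * Λ / ℓ ^ n * (τ * (‖y - y'‖ + ‖v - v'‖) + ‖y - y'‖) := by
          rw [pow_succ]; field_simp
      _ ≤ B * Λ / ℓ ^ n * (τ * (‖y - y'‖ + ‖v - v'‖) + (‖y - y'‖ + ‖v - v'‖)) := by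
          gcongr
          linarith [norm_nonneg (v - v')]
      _ = _ := by ring
  -- the graph against its own flat model
  have h1 := hflat A ν hν Q hQ (fun y v => (p z - p y) * H (z - y) (A z - v))
    (B * (τ + 1) * Λ / ℓ ^ n) (by positivity) (fun y v y' v' => by
      by_cases hy : ‖z - y‖ ≤ τ * ℓ
      · exact hΦ1 y v y' v' hy
      by_cases hy' : ‖z - y'‖ ≤ τ * ℓ
      · rw [abs_sub_comm, norm_sub_rev y, norm_sub_rev v]
        exact hΦ1 y' v' y v hy'
      · rw [hH.supp _ _ (not_le.1 hy), hH.supp _ _ (not_le.1 hy'), mul_zero, mul_zero, sub_zero,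
          abs_zero]
        positivity) (fun y hy v => by
      rw [Cube.window, Metric.mem_closedBall, dist_eq_norm, not_le] at hy
      have h3 : ‖y - Q.center‖ ≤ ‖z - y‖ + ‖z - Q.center‖ := by
        rw [show y - Q.center = (z - Q.center) - (z - y) by abel, add_comm]
        exact norm_sub_le _ _
      have h5 : 0 < √(n : ℝ) * ℓ := by positivity
      rw [← hℓ] at hy hzc
      rw [hH.supp _ _ (by nlinarith), mul_zero])
  have hdec : ∀ y, A z - affPart Q A y = affErr Q A z + lin (slope Q A) (z - y) := fun y => by
    rw [← affPart_sub_eq_lin hQ hA, affErr]; abel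
  simp only [hdec] at h1
  have hint : ∀ a : Eu n → Eu k, Continuous a →
      Integrable fun y => (p z - p y) * H (z - y) (a y) := fun a ha =>
    integrable_of_closedBall (g := fun y => (p z - p y) * H (z - y) (a y)) (z := z)
      (r := τ * ℓ) ((continuous_const.sub hpc).mul (hH.continuous_comp (by fun_prop) ha)) (fun y hy => by rw [hH.supp _ _ hy, mul_zero]) _
  set I := ∫ y, (p z - p y) * H (z - y) (A z - A y) ∂ν with hI
  set X := ∫ y, (p z - p y) * H (z - y) (affErr Q A z + lin (slope Q A) (z - y)) with hX
  set Y := ∫ y, (p z - p y) * H (z - y) (lin s (z - y)) with hY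
  set σs := ∑ i, ‖slope Q A i - s i‖ with hσs
  have hσ0 : 0 ≤ σs := Finset.sum_nonneg fun i _ => norm_nonneg _
  have hsupp : ∀ (a : Eu n → Eu k) y, τ * ℓ < ‖z - y‖ → (p z - p y) * H (z - y) (a y) = 0 :=
    fun a y hy => by rw [hH.supp _ _ hy, mul_zero]
  -- moving the flat model to the slopes `s` and to height zero
  have h2 : |X - Y| ≤ w * τ * B * τ * Λ * ℓ * (‖affErr Q A z‖ / ℓ + σs) := by
    rw [hX, hY, ← integral_sub (hint (fun y => affErr Q A z + lin (slope Q A) (z - y))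
      (by fun_prop)) (hint (fun y => lin s (z - y)) (by fun_prop))]
    refine (abs_integral_le_of_closedBall (z := z) (r := τ * ℓ)
      (b := Λ * (τ * ℓ) * (B / ℓ ^ (n + 1) * (‖affErr Q A z‖ + σs * (τ * ℓ)))) (by positivity)
      (fun y hy => ?_) fun y hy => ?_).trans ?_
    · rw [hsupp (fun y => affErr Q A z + lin (slope Q A) (z - y)) y hy,
        hsupp (fun y => lin s (z - y)) y hy, sub_zero]
    · rw [← mul_sub, abs_mul]
      refine mul_le_mul (hp' y hy) ((hH.lip _ _ _ _).trans ?_) (abs_nonneg _) (by positivity)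
      rw [sub_self, norm_zero, zero_add]
      refine mul_le_mul_of_nonneg_left ?_ (by positivity)
      rw [add_sub_assoc]
      refine (norm_add_le _ _).trans (add_le_add le_rfl ((norm_lin_sub_lin_le _ _ _).trans ?_))
      exact mul_le_mul_of_nonneg_left hy hσ0
    · have h3 : Λ * (τ * ℓ) * (B / ℓ ^ (n + 1) * (‖affErr Q A z‖ + σs * (τ * ℓ))) *
          ((τ * ℓ) ^ n * ballVol n) = w * τ * B * Λ * ℓ * (‖affErr Q A z‖ / ℓ + σs * τ) := by
        rw [hw, mul_pow τ ℓ, pow_succ]; field_simp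
      rw [h3]
      have h4 : 0 ≤ ‖affErr Q A z‖ / ℓ := by positivity
      calc w * τ * B * Λ * ℓ * (‖affErr Q A z‖ / ℓ + σs * τ)
          ≤ w * τ * B * Λ * ℓ * (τ * (‖affErr Q A z‖ / ℓ) + σs * τ) := by
            refine mul_le_mul_of_nonneg_left ?_ (by positivity)
            nlinarith
        _ = _ := by ring
  -- the size of the flat model, for the change of density from `dens Q ν` to `c`
  have h3 : |Y| ≤ w * τ * B * Λ * ℓ := by
    refine (abs_integral_le_of_closedBall (z := z) (r := τ * ℓ)
      (b := Λ * (τ * ℓ) * (B / ℓ ^ n)) (by positivity)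
      (fun y hy => hsupp (fun y => lin s (z - y)) y hy) fun y hy => ?_).trans (le_of_eq ?_)
    · rw [abs_mul]
      exact mul_le_mul (hp' y hy) (hH.bound _ _) (abs_nonneg _) (by positivity)
    · rw [hw, mul_pow τ ℓ]; field_simp
  have hd0 := dens_nonneg Q ν
  have hd1 := dens_le hn hν hQ
  have hM0 : 0 ≤ M := hd0.trans hd1
  have h4 : C * (B * (τ + 1) * Λ / ℓ ^ n) * (gam Q A ν * ℓ ^ (n + 1)) =
      C * (B * (τ + 1)) * Λ * ℓ * gam Q A ν := by
    rw [pow_succ]; field_simp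
  rw [h4] at h1
  set e := ‖affErr Q A z‖ / ℓ with he
  have he0 : 0 ≤ e := by positivity
  set δ := |dens Q ν - c| with hδ
  have hδ0 : 0 ≤ δ := abs_nonneg _
  rw [hM]
  calc |I - c * Y| = |(I - dens Q ν * X) + dens Q ν * (X - Y) + (dens Q ν - c) * Y| := by
        congr 1; ring
    _ ≤ |I - dens Q ν * X| + dens Q ν * |X - Y| + δ * |Y| := by
        rw [hδ, ← abs_mul (dens Q ν - c), ← abs_of_nonneg hd0, ← abs_mul, abs_of_nonneg hd0]
        exact (abs_add_le _ _).trans (add_le_add (abs_add_le _ _) le_rfl)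
    _ ≤ C * (B * (τ + 1)) * Λ * ℓ * gam Q A ν +
        M * (w * τ * B * τ * Λ * ℓ * (e + σs)) + δ * (w * τ * B * Λ * ℓ) := by
        refine add_le_add (add_le_add h1 (mul_le_mul hd1 h2 (abs_nonneg _) hM0))
          (mul_le_mul_of_nonneg_left h3 hδ0)
    _ = C * (B * (τ + 1)) * Λ * ℓ * gam Q A ν +
        M * (w * τ * B * τ) * Λ * ℓ * (e + σs) + w * τ * B * Λ * ℓ * δ := by ring
    _ ≤ C * (B * (τ + 1)) * Λ * ℓ * (gam Q A ν + e + δ + σs) +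
        M * (w * τ * B * τ) * Λ * ℓ * (gam Q A ν + e + δ + σs) +
        w * τ * B * Λ * ℓ * (gam Q A ν + e + δ + σs) := by
        refine add_le_add (add_le_add ?_ ?_) ?_ <;>
        · refine mul_le_mul_of_nonneg_left ?_ (by positivity)
          linarith
    _ = _ := by ring

/-! ### The dyadic tower over a point -/

/-- The coordinates, in the lattice of step `2⁻ʲ`, of the dyadic cube that contains `z`. -/
noncomputable def idx (j : ℤ) (z : Eu n) : Fin n → ℤ := fun i => ⌊z i * (2 : ℝ) ^ j⌋

/-- The dyadic cube of side `2⁻ʲ` that contains `z`. -/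
noncomputable def dyad (j : ℤ) (z : Eu n) : Cube n := dyadic j (idx j z)

@[simp] lemma dyadic_side (j : ℤ) (q : Fin n → ℤ) : (dyadic j q).side = (2 : ℝ) ^ (-j) := rfl

@[simp] lemma dyad_side (j : ℤ) (z : Eu n) : (dyad j z).side = (2 : ℝ) ^ (-j) := rfl

lemma mem_dyadic_iff {j : ℤ} {q : Fin n → ℤ} {z : Eu n} :
    z ∈ (dyadic j q).base ↔ idx j z = q := by
  have h2 : (0 : ℝ) < 2 ^ j := by positivity
  have h3 : (2 : ℝ) ^ (-j) * 2 ^ j = 1 := by rw [← zpow_add₀ two_ne_zero]; simp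
  have key : ∀ i, (((2 : ℝ) ^ (-j) * (q i : ℝ) ≤ z i ∧
      z i < (2 : ℝ) ^ (-j) * (q i : ℝ) + (2 : ℝ) ^ (-j)) ↔ ⌊z i * (2 : ℝ) ^ j⌋ = q i) := fun i => by
    have e1 : (2 : ℝ) ^ (-j) * (q i : ℝ) * 2 ^ j = q i := by rw [mul_right_comm, h3, one_mul]
    rw [Int.floor_eq_iff, ← mul_le_mul_iff_left₀ h2, ← mul_lt_mul_iff_left₀ (b := z i) h2, add_mul,
      e1, h3]
  rw [funext_iff]
  exact forall_congr' key

lemma mem_dyad (j : ℤ) (z : Eu n) : z ∈ (dyad j z).base := mem_dyadic_iff.2 rfl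

lemma measurable_idx (j : ℤ) : Measurable (idx j : Eu n → Fin n → ℤ) := by
  refine measurable_pi_iff.2 fun i => ?_
  have : Measurable fun z : Eu n => z i * (2 : ℝ) ^ j :=
    Continuous.measurable (by fun_prop)
  exact this.floor

lemma norm_sub_center_dyad_le (j : ℤ) (z : Eu n) :
    ‖z - (dyad j z).center‖ ≤ √(n : ℝ) * ((2 : ℝ) ^ (-j) / 2) :=
  Cube.norm_sub_center_le (Q := dyad j z) (by rw [dyad_side]; positivity) (mem_dyad j z)

/-- The difference of the flat models attached to two cubes. -/
noncomputable def gap (A : Eu n → Eu k) (ν : Measure (Eu n)) (Q Q' : Cube n) : ℝ :=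
  |dens Q ν - dens Q' ν| + ∑ i, ‖slope Q A i - slope Q' A i‖

lemma gap_self (A : Eu n → Eu k) (ν : Measure (Eu n)) (Q : Cube n) : gap A ν Q Q = 0 := by
  simp [gap]

lemma gap_triangle (A : Eu n → Eu k) (ν : Measure (Eu n)) (Q Q' Q'' : Cube n) :
    gap A ν Q Q'' ≤ gap A ν Q Q' + gap A ν Q' Q'' := by
  have h1 := abs_sub_le (dens Q ν) (dens Q' ν) (dens Q'' ν)
  have h2 : ∑ i, ‖slope Q A i - slope Q'' A i‖ ≤
      ∑ i, ‖slope Q A i - slope Q' A i‖ + ∑ i, ‖slope Q' A i - slope Q'' A i‖ := by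
    rw [← Finset.sum_add_distrib]
    exact Finset.sum_le_sum fun i _ => norm_sub_le_norm_sub_add_norm_sub _ _ _
  simp only [gap]
  linarith

lemma sum_norm_slope_sub_le_gap (A : Eu n → Eu k) (ν : Measure (Eu n)) (Q Q' : Cube n) :
    ∑ i, ‖slope Q A i - slope Q' A i‖ ≤ gap A ν Q Q' :=
  le_add_of_nonneg_left (abs_nonneg _)

section Tower

variable {lip : ℝ≥0} {M : ℝ} {A : Eu n → Eu k} {ν : Measure (Eu n)}

lemma gap_le (hn : 0 < n) (hν : IsGraphPair lip M A ν) {Q Q' : Cube n} (hQ : 0 < Q.side)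
    (hQ' : 0 < Q'.side)
    (hd : dist Q'.center Q.center + 2 * √(n : ℝ) * Q'.side ≤ 5 * √(n : ℝ) * Q.side)
    (hs : Q.side ≤ 2 * Q'.side) :
    gap A ν Q' Q ≤ (1 + n) * 2 ^ (n + 2) * gam Q A ν := by
  have h1 := abs_dens_sub_dens_le hn hν hQ hQ' hd hs
  have h2 : ∑ i, ‖slope Q' A i - slope Q A i‖ ≤ ∑ _i : Fin n, 2 ^ (n + 2) * gam Q A ν :=
    Finset.sum_le_sum fun i _ =>
      norm_slope_sub_slope_le hν.lipschitz.continuous ν hQ hQ' hd hs i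
  rw [Finset.sum_const, Finset.card_univ, Fintype.card_fin, nsmul_eq_mul] at h2
  rw [gap]
  linarith

lemma gap_dyad_le_of_near (hn : 0 < n) (hν : IsGraphPair lip M A ν) (j : ℤ) {x z : Eu n}
    (hxz : ‖x - z‖ ≤ 2 * √(n : ℝ) * (2 : ℝ) ^ (-j)) :
    gap A ν (dyad j z) (dyad j x) ≤ (1 + n) * 2 ^ (n + 2) * gam (dyad j x) A ν := by
  refine gap_le hn hν (by rw [dyad_side]; positivity) (by rw [dyad_side]; positivity) ?_
    (by rw [dyad_side, dyad_side]; linarith [show (0 : ℝ) < 2 ^ (-j) by positivity])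
  have h1 := norm_sub_center_dyad_le j x
  have h2 := norm_sub_center_dyad_le j z
  have h3 : dist (dyad j z).center (dyad j x).center ≤
      ‖z - (dyad j z).center‖ + ‖x - z‖ + ‖x - (dyad j x).center‖ := by
    rw [dist_eq_norm, show (dyad j z).center - (dyad j x).center =
      -(z - (dyad j z).center) + -(x - z) + (x - (dyad j x).center) by abel]
    refine (norm_add_le _ _).trans (add_le_add ((norm_add_le _ _).trans ?_) le_rfl)
    rw [norm_neg, norm_neg]
  simp only [dyad_side]
  nlinarith

lemma gap_dyad_succ_le (hn : 0 < n) (hν : IsGraphPair lip M A ν) (j : ℤ) (z : Eu n) :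
    gap A ν (dyad (j + 1) z) (dyad j z) ≤ (1 + n) * 2 ^ (n + 2) * gam (dyad j z) A ν := by
  have hs : (2 : ℝ) ^ (-(j + 1)) = 2 ^ (-j) / 2 := by
    rw [neg_add, zpow_add₀ two_ne_zero, zpow_neg_one, div_eq_mul_inv]
  have h0 : (0 : ℝ) < 2 ^ (-j) := by positivity
  refine gap_le hn hν (by rw [dyad_side]; positivity) (by rw [dyad_side]; positivity) ?_
    (by rw [dyad_side, dyad_side, hs]; linarith)
  have h1 := norm_sub_center_dyad_le j z
  have h2 := norm_sub_center_dyad_le (j + 1) z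
  have h3 : dist (dyad (j + 1) z).center (dyad j z).center ≤
      ‖z - (dyad (j + 1) z).center‖ + ‖z - (dyad j z).center‖ := by
    rw [dist_comm, dist_eq_norm, show (dyad j z).center - (dyad (j + 1) z).center =
      (z - (dyad (j + 1) z).center) - (z - (dyad j z).center) by abel]
    exact norm_sub_le _ _
  have h4 : 0 ≤ √(n : ℝ) * 2 ^ (-j) := by positivity
  simp only [dyad_side, hs] at *
  nlinarith

/-- Telescoping over the intermediate generations. -/
lemma gap_dyad_add_le (hn : 0 < n) (hν : IsGraphPair lip M A ν) (j : ℤ) (z : Eu n) (i : ℕ) :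
    gap A ν (dyad (j + i) z) (dyad j z) ≤
      (1 + n) * 2 ^ (n + 2) * ∑ l ∈ Finset.range i, gam (dyad (j + l) z) A ν := by
  induction i with
  | zero => simp [gap_self]
  | succ i ih =>
    rw [Finset.sum_range_succ, mul_add]
    have h1 := gap_dyad_succ_le hn hν (j + i) z
    have h2 := gap_triangle A ν (dyad (j + (i + 1 : ℕ)) z) (dyad (j + i) z) (dyad j z)
    rw [show j + ((i + 1 : ℕ) : ℤ) = j + i + 1 by push_cast; ring] at h2 ⊢
    linarith

end Tower

/-- The deviation of `(A, ν)` from flatness at the point `z` and the scale `2⁻ʲ`. -/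
noncomputable def jones (A : Eu n → Eu k) (ν : Measure (Eu n)) (j : ℤ) (z : Eu n) : ℝ :=
  gam (dyad j z) A ν + ‖affErr (dyad j z) A z‖ / (2 : ℝ) ^ (-j)

lemma gam_dyad_nonneg (A : Eu n → Eu k) (ν : Measure (Eu n)) (j : ℤ) (z : Eu n) :
    0 ≤ gam (dyad j z) A ν := gam_nonneg (by rw [dyad_side]; positivity) A ν

lemma jones_nonneg (A : Eu n → Eu k) (ν : Measure (Eu n)) (j : ℤ) (z : Eu n) :
    0 ≤ jones A ν j z :=
  add_nonneg (gam_dyad_nonneg A ν j z) (by positivity)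

lemma gam_dyad_le_jones (A : Eu n → Eu k) (ν : Measure (Eu n)) (j : ℤ) (z : Eu n) :
    gam (dyad j z) A ν ≤ jones A ν j z := le_add_of_nonneg_right (by positivity)

lemma measurable_jones {A : Eu n → Eu k} (hA : Continuous A) (ν : Measure (Eu n)) (j : ℤ) :
    Measurable (jones A ν j) := by
  have h1 : Measurable fun q : Fin n → ℤ => gam (dyadic j q) A ν := measurable_of_countable _
  have h2 : Measurable fun p : (Fin n → ℤ) × Eu n => ‖affErr (dyadic j p.1) A p.2‖ :=
    measurable_from_prod_countable_right fun q => (continuous_affErr (Q := dyadic j q)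
      (by rw [dyadic_side]; positivity) hA).norm.measurable
  exact (h1.comp (measurable_idx j)).add
    ((h2.comp ((measurable_idx j).prodMk measurable_id)).div_const _)

/-- The square integral of the deviation at a fixed scale is controlled by the sum of the squares of
the coefficients `α` and `β` over the cubes of that scale. -/
lemma exists_lintegral_jones_le (n k : ℕ) (hn : 0 < n) (lip : ℝ≥0) (M : ℝ) (hM : 1 ≤ M) :
    ∃ C : ℝ, 0 < C ∧ ∀ (A : Eu n → Eu k) (ν : Measure (Eu n)), IsGraphPair lip M A ν →
      ∀ c : ℝ, 10 * √(n : ℝ) < c → ∀ j : ℤ,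
      ∫⁻ z, ENNReal.ofReal (jones A ν j z) ^ 2 ≤
        ENNReal.ofReal C * ∑' q : Fin n → ℤ,
          (alphaCoeff c (ν.map (graphMap A)) (dyadic j q) ^ 2 +
            betaCoeff c 2 (ν.map (graphMap A)) (dyadic j q) ^ 2) *
          (ν.map (graphMap A)) ((dyadic j q).vset k) := by
  obtain ⟨Ca, hCa, hα⟩ := exists_osc_le_alpha n k hn lip M
  obtain ⟨Cb, hCb, hβ⟩ := exists_affErr_le_beta n k lip M hM
  have hbv := ballVol_pos (n := n)
  set w : ℝ := (5 * √(n : ℝ)) ^ n * ballVol n with hw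
  have hw0 : 0 ≤ w := by positivity
  refine ⟨M * (4 * Ca ^ 2 + (4 * w + 2) * Cb), by positivity, fun A ν hν c hc j => ?_⟩
  have hG : Continuous (graphMap A) := (lipschitz_graphMap hν.lipschitz).continuous
  have hA := hν.lipschitz.continuous
  set μ := ν.map (graphMap A) with hμ
  have hcover : (univ : Set (Eu n)) = ⋃ q : Fin n → ℤ, (dyadic j q).base := by
    ext z; simp [mem_dyadic_iff]
  have hdisj : Pairwise (Function.onFun Disjoint fun q : Fin n → ℤ => (dyadic j q).base) := by
    intro q q' hqq'
    rw [Function.onFun, Set.disjoint_left]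
    intro z hz hz'
    exact hqq' ((mem_dyadic_iff.1 hz).symm.trans (mem_dyadic_iff.1 hz'))
  rw [← setLIntegral_univ, hcover, lintegral_iUnion (fun q => (dyadic j q).measurableSet_base) hdisj,
    ← ENNReal.tsum_mul_left]
  refine ENNReal.tsum_le_tsum fun q => ?_
  set Q := dyadic j q with hQdef
  have hQ : 0 < Q.side := by rw [hQdef, dyadic_side]; positivity
  set S := ∫ u in Q.window, ‖affErr Q A u‖ ^ 2 with hS
  have hS0 : 0 ≤ S := integral_nonneg fun _ => sq_nonneg _
  set Y := S / Q.side ^ (n + 2) with hY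
  have hY0 : 0 ≤ Y := by positivity
  have hint : IntegrableOn (fun u => ‖affErr Q A u‖ ^ 2) Q.window :=
    integrableOn_of_continuous ((continuous_affErr hQ hA).norm.pow 2) Q.isCompact_window subset_rfl
  have hgam : gam Q A ν ^ 2 ≤ 2 * osc Q ν ^ 2 + 2 * (w * Y) := by
    have h1 := sq_setIntegral_le (f := fun u => ‖affErr Q A u‖) (S := Q.window)
      Q.isCompact_window.measure_lt_top.ne
      (integrableOn_of_continuous (continuous_affErr hQ hA).norm Q.isCompact_window subset_rfl) hint
    rw [Q.volume_real_window hQ.le] at h1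
    have h2 : ((∫ u in Q.window, ‖affErr Q A u‖) / Q.side ^ (n + 1)) ^ 2 ≤ w * Y := by
      rw [div_pow, div_le_iff₀ (by positivity)]
      refine h1.trans (le_of_eq ?_)
      rw [hY, ← hS, ← hw]
      field_simp
      ring
    rw [gam]
    nlinarith [sq_nonneg (osc Q ν - (∫ u in Q.window, ‖affErr Q A u‖) / Q.side ^ (n + 1))]
  have hpt : ∀ z ∈ Q.base, ENNReal.ofReal (jones A ν j z) ^ 2 ≤
      ENNReal.ofReal (4 * osc Q ν ^ 2 + 4 * w * Y) +
        ENNReal.ofReal (2 / Q.side ^ 2 * ‖affErr Q A z‖ ^ 2) := fun z hz => by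
    have hd : dyad j z = Q := by rw [dyad, mem_dyadic_iff.1 hz]
    rw [← ENNReal.ofReal_pow (jones_nonneg A ν j z), ← ENNReal.ofReal_add (by positivity)
      (by positivity)]
    refine ENNReal.ofReal_le_ofReal ?_
    rw [jones, hd]
    change (gam Q A ν + ‖affErr Q A z‖ / Q.side) ^ 2 ≤ _
    have h1 : 2 / Q.side ^ 2 * ‖affErr Q A z‖ ^ 2 = 2 * (‖affErr Q A z‖ / Q.side) ^ 2 := by
      rw [div_pow]; ring
    rw [h1]
    nlinarith [sq_nonneg (gam Q A ν - ‖affErr Q A z‖ / Q.side)]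
  have hvol : volume Q.base ≤ ENNReal.ofReal M * μ (Q.vset k) := by
    have h1 : μ (Q.vset k) = ν Q.base := by
      have h2 : MeasurableSet (Q.vset k) := measurable_tilde Q.measurableSet_base
      rw [hμ, Measure.map_apply hG.measurable h2]
      congr 1
      ext u
      change tilde (graphMap A u) ∈ Q.base ↔ _
      rw [graphMap, tilde_join]
    rw [h1]
    have := hν.volume_le Q.base
    rwa [Measure.smul_apply, smul_eq_mul] at this
  calc ∫⁻ z in Q.base, ENNReal.ofReal (jones A ν j z) ^ 2
      ≤ ∫⁻ z in Q.base, (ENNReal.ofReal (4 * osc Q ν ^ 2 + 4 * w * Y) +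
        ENNReal.ofReal (2 / Q.side ^ 2 * ‖affErr Q A z‖ ^ 2)) :=
        setLIntegral_mono' Q.measurableSet_base hpt
    _ = ENNReal.ofReal (4 * osc Q ν ^ 2 + 4 * w * Y) * volume Q.base +
        ∫⁻ z in Q.base, ENNReal.ofReal (2 / Q.side ^ 2 * ‖affErr Q A z‖ ^ 2) := by
        rw [lintegral_add_left measurable_const, setLIntegral_const]
    _ ≤ ENNReal.ofReal (4 * osc Q ν ^ 2 + 4 * w * Y) * volume Q.base +
        ENNReal.ofReal (2 * Y) * volume Q.base := by
        gcongr
        rw [← ofReal_integral_eq_lintegral_ofReal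
          ((hint.mono_set (Cube.base_subset_window hQ.le)).const_mul _)
          (ae_of_all _ fun z => by positivity), Q.volume_base, ← ENNReal.ofReal_pow hQ.le,
          ← ENNReal.ofReal_mul (by positivity), integral_const_mul]
        refine ENNReal.ofReal_le_ofReal ?_
        have h1 : ∫ z in Q.base, ‖affErr Q A z‖ ^ 2 ≤ S :=
          setIntegral_mono_set hint (ae_of_all _ fun _ => sq_nonneg _)
            (LE.le.eventuallyLE (Cube.base_subset_window hQ.le))
        calc 2 / Q.side ^ 2 * ∫ z in Q.base, ‖affErr Q A z‖ ^ 2 ≤ 2 / Q.side ^ 2 * S := by gcongr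
          _ = _ := by rw [hY, pow_add]; field_simp
    _ = ENNReal.ofReal (4 * osc Q ν ^ 2 + (4 * w + 2) * Y) * volume Q.base := by
        rw [← add_mul, ← ENNReal.ofReal_add (by positivity) (by positivity)]
        congr 2; ring
    _ ≤ ENNReal.ofReal ((4 * Ca ^ 2 + (4 * w + 2) * Cb)) * (alphaCoeff c μ Q ^ 2 +
        betaCoeff c 2 μ Q ^ 2) * (ENNReal.ofReal M * μ (Q.vset k)) := by
        refine mul_le_mul' ?_ hvol
        have h1 := hα A ν hν Q hQ c hc
        have h2 := hβ A ν hν Q hQ c hc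
        rw [← hμ] at h1 h2
        rw [← hS, ← hY] at h2
        have h3 : ENNReal.ofReal (osc Q ν ^ 2) ≤
            ENNReal.ofReal (Ca ^ 2) * alphaCoeff c μ Q ^ 2 := by
          rw [ENNReal.ofReal_pow (osc_nonneg _ _), ENNReal.ofReal_pow hCa.le, ← mul_pow]
          exact pow_le_pow_left' h1 2
        rw [ENNReal.ofReal_add (by positivity) (by positivity),
          ENNReal.ofReal_mul (by norm_num : (0 : ℝ) ≤ 4),
          ENNReal.ofReal_mul (by positivity : (0 : ℝ) ≤ 4 * w + 2), mul_add]
        refine add_le_add ?_ ?_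
        · calc _ ≤ ENNReal.ofReal 4 * (ENNReal.ofReal (Ca ^ 2) * alphaCoeff c μ Q ^ 2) := by gcongr
            _ = ENNReal.ofReal (4 * Ca ^ 2) * alphaCoeff c μ Q ^ 2 := by
                rw [← mul_assoc, ← ENNReal.ofReal_mul (by norm_num)]
            _ ≤ _ := by
                gcongr
                exact le_add_of_nonneg_right (by positivity)
        · calc _ ≤ ENNReal.ofReal (4 * w + 2) * (ENNReal.ofReal Cb * betaCoeff c 2 μ Q ^ 2) := by
                gcongr
            _ = ENNReal.ofReal ((4 * w + 2) * Cb) * betaCoeff c 2 μ Q ^ 2 := by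
                rw [← mul_assoc, ← ENNReal.ofReal_mul (by positivity)]
            _ ≤ _ := by
                gcongr
                exact le_add_of_nonneg_left (by positivity)
    _ = _ := by
        rw [ENNReal.ofReal_mul (by positivity)]; ring

/-! ### Weighted integrals at small scales -/

/-- The integral of a kernel piece over the graph, at the point above `z`. -/
noncomputable def pieceInt (H : Eu n → Eu k → ℝ) (A : Eu n → Eu k) (ν : Measure (Eu n))
    (z : Eu n) : ℝ := ∫ y, H (z - y) (A z - A y) ∂ν

section Antisymm

variable {B ℓ : ℝ} {H : Eu n → Eu k → ℝ} {A : Eu n → Eu k} {p : Eu n → ℝ} {x : Eu n} {r : ℝ}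

lemma IsPiece.integrable_prod (hH : IsPiece n k B ℓ H) (hA : Continuous A) (hp : Continuous p)
    (hps : ∀ z, r < ‖z - x‖ → p z = 0) (ν ρ : Measure (Eu n)) [IsLocallyFiniteMeasure ν]
    [IsLocallyFiniteMeasure ρ] :
    Integrable (fun q : Eu n × Eu n => p q.1 * H (q.1 - q.2) (A q.1 - A q.2)) (ν.prod ρ) := by
  have hc : Continuous fun q : Eu n × Eu n => p q.1 * H (q.1 - q.2) (A q.1 - A q.2) :=
    (hp.comp continuous_fst).mul (hH.continuous_comp (by fun_prop) (by fun_prop))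
  refine hc.integrable_of_hasCompactSupport (HasCompactSupport.intro
    ((isCompact_closedBall x r).prod (isCompact_closedBall x (r + 3 / 2 * √(n : ℝ) * ℓ)))
    fun q hq => ?_)
  simp only [mem_prod, Metric.mem_closedBall, not_and_or, not_le, dist_eq_norm] at hq
  by_cases h1 : r < ‖q.1 - x‖
  · rw [hps _ h1, zero_mul]
  · have h2 := hq.resolve_left h1
    have h3 : ‖q.2 - x‖ ≤ ‖q.1 - x‖ + ‖q.1 - q.2‖ := by
      rw [show q.2 - x = (q.1 - x) - (q.1 - q.2) by abel]; exact norm_sub_le _ _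
    rw [hH.supp _ _ (by linarith), mul_zero]

lemma IsPiece.integrable_prod_sub (hH : IsPiece n k B ℓ H) (hA : Continuous A) (hp : Continuous p)
    (hps : ∀ z, r < ‖z - x‖ → p z = 0) (ν ρ : Measure (Eu n)) [IsLocallyFiniteMeasure ν]
    [IsLocallyFiniteMeasure ρ] :
    Integrable (fun q : Eu n × Eu n => (p q.1 - p q.2) * H (q.1 - q.2) (A q.1 - A q.2))
      (ν.prod ρ) := by
  have h1 := (hH.integrable_prod hA hp hps ν ρ).add (hH.integrable_prod hA hp hps ρ ν).swap
  refine h1.congr (ae_of_all _ fun q => ?_)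
  simp only [Pi.add_apply, Function.comp_apply, Prod.fst_swap, Prod.snd_swap]
  rw [← neg_sub q.1 q.2, ← neg_sub (A q.1) (A q.2), hH.odd]
  ring

/-- Symmetrisation of the double integral of an odd kernel. -/
lemma IsPiece.integral_weight (hH : IsPiece n k B ℓ H) (hA : Continuous A) (hp : Continuous p)
    (hps : ∀ z, r < ‖z - x‖ → p z = 0) (ν : Measure (Eu n)) [IsLocallyFiniteMeasure ν] :
    ∫ z, ∫ y, (p z - p y) * H (z - y) (A z - A y) ∂ν ∂ν = 2 * ∫ z, p z * pieceInt H A ν z ∂ν := by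
  have hG := hH.integrable_prod hA hp hps ν ν
  have hG' : Integrable (fun q : Eu n × Eu n => p q.2 * H (q.2 - q.1) (A q.2 - A q.1))
    (ν.prod ν) := hG.swap
  have h0 : ∀ z, ∫ y, p z * H (z - y) (A z - A y) ∂ν = p z * pieceInt H A ν z := fun z => by
    rw [integral_const_mul]; rfl
  have h1 : ∫ z, ∫ y, p z * H (z - y) (A z - A y) ∂ν ∂ν = ∫ z, p z * pieceInt H A ν z ∂ν := by
    simp only [h0]
  have h2 : ∫ z, ∫ y, p y * H (y - z) (A y - A z) ∂ν ∂ν = ∫ z, p z * pieceInt H A ν z ∂ν := by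
    rw [← h1]
    exact integral_integral_swap (f := fun z y => p y * H (y - z) (A y - A z)) hG.swap
  rw [two_mul]
  nth_rewrite 1 [← h1]
  rw [← h2, integral_integral (f := fun z y => (p z - p y) * H (z - y) (A z - A y))
    (hH.integrable_prod_sub hA hp hps ν ν), integral_integral
    (f := fun z y => p z * H (z - y) (A z - A y)) hG, integral_integral
    (f := fun z y => p y * H (y - z) (A y - A z)) hG', ← integral_add hG hG']
  refine integral_congr_ae (ae_of_all _ fun q => ?_)
  simp only
  rw [← neg_sub q.1 q.2, ← neg_sub (A q.1) (A q.2), hH.odd]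
  ring

end Antisymm

lemma ofReal_abs_integral_le {f R : Eu n → ℝ} {S : Set (Eu n)} (hS : MeasurableSet S)
    {ν : Measure (Eu n)} (h0 : ∀ z ∉ S, f z = 0) (h1 : ∀ z ∈ S, |f z| ≤ R z) :
    ENNReal.ofReal |∫ z, f z ∂ν| ≤ ∫⁻ z in S, ENNReal.ofReal (R z) ∂ν := by
  rw [← setIntegral_eq_integral_of_forall_compl_eq_zero h0]
  refine (Real.enorm_eq_ofReal_abs _).symm.trans_le ((enorm_integral_le_lintegral_enorm _).trans
    (setLIntegral_mono' hS fun z hz => ?_))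
  rw [Real.enorm_eq_ofReal_abs]
  exact ENNReal.ofReal_le_ofReal (h1 z hz)

/-- The linear functions with the same slopes form an admissible pair with the same measure. -/
lemma IsGraphPair.lin {lip : ℝ≥0} {M : ℝ} {A : Eu n → Eu k} {ν : Measure (Eu n)}
    (hν : IsGraphPair lip M A ν) {s : Fin n → Eu k} {lip' : ℝ≥0} (hs : ∑ i, ‖s i‖ ≤ lip') :
    IsGraphPair lip' M (LipGraph.lin s) ν where
  lipschitz := LipschitzWith.of_dist_le_mul fun u v => by
    rw [dist_eq_norm, dist_eq_norm, lin_sub]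
    exact (norm_lin_le _ _).trans (mul_le_mul_of_nonneg_right hs (norm_nonneg _))
  one_le := hν.one_le
  le_volume := hν.le_volume
  volume_le := hν.volume_le

/-- An odd kernel integrates to zero over a linear graph. -/
lemma IsPiece.pieceInt_lin {B ℓ : ℝ} {H : Eu n → Eu k → ℝ} (hH : IsPiece n k B ℓ H)
    (s : Fin n → Eu k) (z : Eu n) : pieceInt H (lin s) volume z = 0 := by
  simp only [pieceInt, lin_sub]
  rw [integral_sub_left_eq_self (fun u => H u (lin s u)) volume z]
  have h : ∫ u, H u (lin s u) = -∫ u, H u (lin s u) := by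
    nth_rewrite 1 [← integral_neg_eq_self (fun u => H u (lin s u)) volume]
    rw [← integral_neg]
    refine integral_congr_ae (ae_of_all _ fun u => ?_)
    simp only
    rw [lin_neg, hH.odd]
  linarith

lemma IsGraphPair.setLIntegral_le {lip : ℝ≥0} {M : ℝ} {A : Eu n → Eu k} {ν : Measure (Eu n)}
    (hν : IsGraphPair lip M A ν) (S : Set (Eu n)) (f : Eu n → ℝ≥0∞) :
    ∫⁻ z in S, f z ∂ν ≤ ENNReal.ofReal M * ∫⁻ z in S, f z := by
  calc _ ≤ ∫⁻ z in S, f z ∂(ENNReal.ofReal M • volume) :=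
        lintegral_mono' (Measure.restrict_mono subset_rfl hν.le_volume) le_rfl
    _ = _ := by rw [Measure.restrict_smul, lintegral_smul_measure, smul_eq_mul]

lemma zpow_neg_add_natCast (j : ℤ) (i : ℕ) : (2 : ℝ) ^ (-(j + i)) = 2 ^ (-j) / 2 ^ i := by
  rw [neg_add, zpow_add₀ two_ne_zero, zpow_neg _ (i : ℤ), zpow_natCast, div_eq_mul_inv]

/-- A piece of small scale, integrated against a slowly varying weight. Antisymmetrising the double
integral brings in the factor `p z - p y`; the flat models with the slopes and the density of one
fixed cube `Q₀` then cancel, by oddness, so that only the deviations from them are left. -/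
lemma exists_weighted_le (n k : ℕ) (hn : 0 < n) (lip : ℝ≥0) (M B : ℝ) (hB : 0 ≤ B) :
    ∃ C : ℝ, 0 ≤ C ∧ ∀ (A : Eu n → Eu k) (ν : Measure (Eu n)), IsGraphPair lip M A ν →
      ∀ (j : ℤ) (i : ℕ), 1 ≤ i → ∀ H : Eu n → Eu k → ℝ, IsPiece n k B (2 ^ (-(j + i))) H →
      ∀ (p : Eu n → ℝ) (Λ : ℝ), 0 ≤ Λ → (∀ u v, |p u - p v| ≤ Λ * ‖u - v‖) → ∀ x,
      (∀ z, √(n : ℝ) * 2 ^ (-j) / 4 < ‖z - x‖ → p z = 0) →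
      ENNReal.ofReal |∫ z, p z * pieceInt H A ν z ∂ν| ≤ ENNReal.ofReal (C * Λ * 2 ^ (-(j + i))) *
        ∫⁻ z in Metric.closedBall x (√(n : ℝ) * 2 ^ (-j)),
          ENNReal.ofReal (∑ l ∈ Finset.range (i + 1), jones A ν (j + l) z + jones A ν j x) := by
  obtain ⟨C₁, hC₁, near₁⟩ := exists_near_le n k hn lip M B hB
  -- the second bound is applied to the linear graph with the slopes of `Q₀`, whose Lipschitz constant
  -- is at most `n * lip`
  obtain ⟨C₂, hC₂, near₂⟩ := exists_near_le n k hn (n * lip) M B hB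
  set κ : ℝ := (1 + n) * 2 ^ (n + 2) with hκ
  have hκ1 : 1 ≤ κ := by
    have h1 : (1 : ℝ) ≤ 2 ^ (n + 2) := one_le_pow₀ (by norm_num)
    rw [hκ]; nlinarith [show (0 : ℝ) ≤ n from Nat.cast_nonneg n]
  refine ⟨|M| * (C₁ + C₂) * κ, by positivity, fun A ν hν j i hi H hH p Λ hΛ hp x hps => ?_⟩
  have := hν.isLocallyFiniteMeasure
  have hM : |M| = M := abs_of_nonneg (zero_le_one.trans hν.one_le)
  have hM0 : 0 ≤ M := zero_le_one.trans hν.one_le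
  have hA := hν.lipschitz.continuous
  set ℓ : ℝ := 2 ^ (-(j + i)) with hℓ
  set ℓ₀ : ℝ := 2 ^ (-j) with hℓ₀
  have hℓ0 : 0 < ℓ := by rw [hℓ]; positivity
  have hℓ00 : 0 < ℓ₀ := by rw [hℓ₀]; positivity
  have hℓℓ : ℓ ≤ ℓ₀ / 2 := by
    rw [hℓ, zpow_neg_add_natCast, ← hℓ₀]
    gcongr
    calc (2 : ℝ) = 2 ^ 1 := by norm_num
      _ ≤ 2 ^ i := pow_le_pow_right₀ (by norm_num) hi
  have hpc : Continuous p := by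
    refine (LipschitzWith.of_dist_le_mul (K := ⟨Λ, hΛ⟩) fun u v => ?_).continuous
    rw [Real.dist_eq, dist_eq_norm]; exact hp u v
  set Q₀ := dyad j x with hQ₀
  have hQ₀s : 0 < Q₀.side := by rw [hQ₀, dyad_side]; positivity
  set s := slope Q₀ A with hs
  set c := dens Q₀ ν with hc
  have hslip : ∑ i, ‖s i‖ ≤ ((n * lip : ℝ≥0) : ℝ) := by
    push_cast; exact sum_norm_slope_le hQ₀s hν.lipschitz
  have hν' := hν.lin hslip
  set S := Metric.closedBall x (√(n : ℝ) * ℓ₀) with hS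
  set R : Eu n → ℝ := fun z => ∑ l ∈ Finset.range (i + 1), jones A ν (j + l) z + jones A ν j x
    with hR
  have hR0 : ∀ z, 0 ≤ R z := fun z =>
    add_nonneg (Finset.sum_nonneg fun l _ => jones_nonneg _ _ _ _) (jones_nonneg _ _ _ _)
  -- all the integrands vanish for `z` outside `S`
  have hout : ∀ (a : Eu n → Eu n → Eu k) (z : Eu n), z ∉ S → ∀ y,
      (p z - p y) * H (z - y) (a z y) = 0 := fun a z hz y => by
    rw [hS, Metric.mem_closedBall, dist_eq_norm, not_le] at hz
    have hσ : 0 ≤ √(n : ℝ) := Real.sqrt_nonneg _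
    by_cases hy : 3 / 2 * √(n : ℝ) * ℓ < ‖z - y‖
    · rw [hH.supp _ _ hy, mul_zero]
    · rw [not_lt] at hy
      have h1 : ‖z - x‖ ≤ ‖z - y‖ + ‖y - x‖ := by
        rw [show z - x = (z - y) + (y - x) by abel]; exact norm_add_le _ _
      have h2 : √(n : ℝ) * ℓ ≤ √(n : ℝ) * (ℓ₀ / 2) := by gcongr
      have h3 : 0 ≤ √(n : ℝ) * ℓ₀ := by positivity
      rw [hps z (by nlinarith), hps y (by nlinarith), sub_zero, zero_mul]
  -- the flat model at the scale of the piece is compared with that of `Q₀`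
  have hgap : ∀ z ∈ S, gam (dyad (j + i) z) A ν + ‖affErr (dyad (j + i) z) A z‖ / ℓ +
      gap A ν (dyad (j + i) z) Q₀ ≤ κ * R z := fun z hz => by
    rw [hS, Metric.mem_closedBall, dist_comm, dist_eq_norm] at hz
    have h1 := gap_dyad_add_le hn hν j z i
    have h2 := gap_dyad_le_of_near hn hν j (x := x) (z := z) (by
      rw [← hℓ₀]; nlinarith [show 0 ≤ √(n : ℝ) * ℓ₀ by positivity])
    have h3 := gap_triangle A ν (dyad (j + i) z) (dyad j z) Q₀
    have h4 : ∑ l ∈ Finset.range i, gam (dyad (j + l) z) A ν ≤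
        ∑ l ∈ Finset.range i, jones A ν (j + l) z :=
      Finset.sum_le_sum fun l _ => gam_dyad_le_jones _ _ _ _
    have h5 := gam_dyad_le_jones A ν j x
    have h6 : gam (dyad (j + i) z) A ν + ‖affErr (dyad (j + i) z) A z‖ / ℓ =
        jones A ν (j + i) z := rfl
    have h7 := jones_nonneg A ν (j + i) z
    rw [h6]
    rw [← hκ] at h1 h2
    have h8 := mul_le_mul_of_nonneg_left h4 (zero_le_one.trans hκ1)
    have h9 := mul_le_mul_of_nonneg_left h5 (zero_le_one.trans hκ1)
    simp only [hR, Finset.sum_range_succ]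
    nlinarith
  -- `F` is the actual integrand, `F₀` the flat model, and `F₁` has the flat slopes but the actual measure
  set F : Eu n → ℝ := fun z => ∫ y, (p z - p y) * H (z - y) (A z - A y) ∂ν with hF
  set F₀ : Eu n → ℝ := fun z => ∫ y, (p z - p y) * H (z - y) (lin s (z - y)) with hF₀
  set F₁ : Eu n → ℝ := fun z => ∫ y, (p z - p y) * H (z - y) (lin s (z - y)) ∂ν with hF₁
  have e1 : ∀ z ∈ S, |F z - c * F₀ z| ≤ C₁ * κ * Λ * ℓ * R z := fun z hz => by
    refine (near₁ A ν hν (dyad (j + i) z) (by rw [dyad_side]; positivity) H hH p Λ hΛ hp z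
      (mem_dyad _ _) c s).trans ?_
    have h := hgap z hz
    simp only [gap] at h
    change C₁ * Λ * ℓ * _ ≤ _
    calc _ ≤ C₁ * Λ * ℓ * (κ * R z) := by
          refine mul_le_mul_of_nonneg_left ?_ (by positivity)
          simp only [dyad_side]
          linarith
      _ = _ := by ring
  have e2 : ∀ z ∈ S, |F₁ z - c * F₀ z| ≤ C₂ * κ * Λ * ℓ * R z := fun z hz => by
    have hside : 0 < (dyad (j + i) z).side := by rw [dyad_side]; positivity
    have h1 := near₂ (lin s) ν hν' (dyad (j + i) z) hside H hH p Λ hΛ hp z (mem_dyad _ _) c s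
    simp only [lin_sub] at h1
    refine h1.trans ?_
    have h := hgap z hz
    have h2 := gam_lin_le hside s A ν
    have h3 : |dens (dyad (j + i) z) ν - c| ≤ gap A ν (dyad (j + i) z) Q₀ :=
      le_add_of_nonneg_right (Finset.sum_nonneg fun _ _ => norm_nonneg _)
    have h4 : 0 ≤ ‖affErr (dyad (j + i) z) A z‖ / ℓ := by positivity
    simp only [affErr_lin hside, slope_lin hside, sub_self, norm_zero, zero_div, add_zero,
      Finset.sum_const_zero]
    change C₂ * Λ * ℓ * _ ≤ _
    calc _ ≤ C₂ * Λ * ℓ * (κ * R z) := by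
          refine mul_le_mul_of_nonneg_left ?_ (by positivity)
          linarith
      _ = _ := by ring
  have hprod : ∀ (ρ τ : Measure (Eu n)) [IsLocallyFiniteMeasure ρ] [IsLocallyFiniteMeasure τ],
      Integrable (fun q : Eu n × Eu n => (p q.1 - p q.2) * H (q.1 - q.2) (lin s (q.1 - q.2)))
        (ρ.prod τ) := fun ρ τ _ _ => by
    have := hH.integrable_prod_sub (continuous_lin s) hpc hps ρ τ
    simpa only [lin_sub] using this
  have iF : Integrable F ν := (hH.integrable_prod_sub hA hpc hps ν ν).integral_prod_left
  have iF₀ : Integrable F₀ ν := (hprod ν volume).integral_prod_left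
  have iF₀' : Integrable F₀ := (hprod volume volume).integral_prod_left
  have iF₁ : Integrable F₁ := (hprod volume ν).integral_prod_left
  -- antisymmetrisation in `(z, y)`
  have hsum : 2 * ∫ z, p z * pieceInt H A ν z ∂ν = ∫ z, F z ∂ν :=
    (hH.integral_weight hA hpc hps ν).symm
  -- `∫ F ∂ν` is close to `c * ∫ F₀ ∂ν = c * ∫ F₁`, which is close to `c ^ 2 * ∫ F₀ = 0`
  have hzero : ∫ z, F₀ z = 0 := by
    have := hH.integral_weight (continuous_lin s) hpc hps volume
    simpa only [lin_sub, hH.pieceInt_lin, mul_zero, integral_zero] using this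
  have hswap : ∫ z, F₀ z ∂ν = ∫ z, F₁ z := by
    rw [hF₀, integral_integral_swap (f := fun z y => (p z - p y) * H (z - y) (lin s (z - y)))
      (hprod ν volume)]
    refine integral_congr_ae (ae_of_all _ fun y => integral_congr_ae (ae_of_all _ fun z => ?_))
    simp only
    rw [← neg_sub y z, lin_neg, hH.odd]
    ring
  have t1 : ENNReal.ofReal |∫ z, (F z - c * F₀ z) ∂ν| ≤
      ENNReal.ofReal (M * (C₁ * κ * Λ * ℓ)) * ∫⁻ z in S, ENNReal.ofReal (R z) := by
    refine (ofReal_abs_integral_le (R := fun z => C₁ * κ * Λ * ℓ * R z)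
      Metric.isClosed_closedBall.measurableSet (fun z hz => ?_) e1).trans ?_
    · simp only [hF, hF₀, hout (fun z y => A z - A y) z hz, hout (fun z y => lin s (z - y)) z hz,
        integral_zero, mul_zero, sub_zero]
    · refine (hν.setLIntegral_le _ _).trans (le_of_eq ?_)
      simp only [ENNReal.ofReal_mul (by positivity : 0 ≤ C₁ * κ * Λ * ℓ)]
      rw [lintegral_const_mul' _ _ (by finiteness), ← mul_assoc, ← ENNReal.ofReal_mul hM0]
  have t2 : ENNReal.ofReal |∫ z, (F₁ z - c * F₀ z)| ≤
      ENNReal.ofReal (C₂ * κ * Λ * ℓ) * ∫⁻ z in S, ENNReal.ofReal (R z) := by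
    refine (ofReal_abs_integral_le (R := fun z => C₂ * κ * Λ * ℓ * R z)
      Metric.isClosed_closedBall.measurableSet (fun z hz => ?_) e2).trans (le_of_eq ?_)
    · simp only [hF₁, hF₀, hout (fun z y => lin s (z - y)) z hz,
        integral_zero, mul_zero, sub_zero]
    · simp only [ENNReal.ofReal_mul (by positivity : 0 ≤ C₂ * κ * Λ * ℓ)]
      rw [lintegral_const_mul' _ _ (by finiteness)]
  rw [integral_sub iF (iF₀.const_mul c), integral_const_mul, hswap, ← hsum] at t1
  rw [integral_sub iF₁ (iF₀'.const_mul c), integral_const_mul, hzero, mul_zero, sub_zero] at t2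
  have hc0 : 0 ≤ c := dens_nonneg _ _
  have hcM : c ≤ M := dens_le hn hν hQ₀s
  set N := ∫ z, p z * pieceInt H A ν z ∂ν with hN
  set T := ∫ z, F₁ z with hT
  have h1 : |N| ≤ |2 * N - c * T| + M * |T| := by
    have h2 : |2 * N| ≤ |2 * N - c * T| + |c * T| := by
      calc |2 * N| = |(2 * N - c * T) + c * T| := by congr 1; ring
        _ ≤ _ := abs_add_le _ _
    have h3 : |c * T| ≤ M * |T| := by
      rw [abs_mul, abs_of_nonneg hc0]; gcongr
    rw [abs_mul, abs_two] at h2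
    linarith [abs_nonneg N]
  calc ENNReal.ofReal |N| ≤ ENNReal.ofReal |2 * N - c * T| + ENNReal.ofReal M * ENNReal.ofReal |T| := by
        rw [← ENNReal.ofReal_mul hM0, ← ENNReal.ofReal_add (abs_nonneg _) (by positivity)]
        exact ENNReal.ofReal_le_ofReal h1
    _ ≤ ENNReal.ofReal (M * (C₁ * κ * Λ * ℓ)) * (∫⁻ z in S, ENNReal.ofReal (R z)) +
        ENNReal.ofReal M * (ENNReal.ofReal (C₂ * κ * Λ * ℓ) *
          ∫⁻ z in S, ENNReal.ofReal (R z)) := by gcongr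
    _ = _ := by
        rw [← mul_assoc (ENNReal.ofReal M), ← ENNReal.ofReal_mul hM0, ← add_mul,
          ← ENNReal.ofReal_add (by positivity) (by positivity), hM]
        congr 2; ring

/-! ### Differences at large scales -/

lemma exists_jones_le (n k : ℕ) (hn : 0 < n) (lip : ℝ≥0) (M : ℝ) :
    ∃ C : ℝ, 0 < C ∧ ∀ (A : Eu n → Eu k) (ν : Measure (Eu n)), IsGraphPair lip M A ν →
      ∀ (j : ℤ) (z : Eu n), jones A ν j z ≤ C ∧
        ∀ u ∈ (dyad j z).window, ‖affErr (dyad j z) A u‖ / 2 ^ (-j) ≤ C := by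
  have hbv := ballVol_pos (n := n)
  obtain ⟨C, hC, h⟩ := exists_gam_le n k hn lip M
  set D : ℝ := (1 + n * (12 * √(n : ℝ))) * ((5 * √(n : ℝ)) ^ n * ballVol n) *
      (10 * √(n : ℝ)) * lip with hD
  refine ⟨C + D, by positivity, fun A ν hν j z => ?_⟩
  have hs : 0 < (dyad j z).side := by rw [dyad_side]; positivity
  have key : ∀ u ∈ (dyad j z).window, ‖affErr (dyad j z) A u‖ / 2 ^ (-j) ≤ D := fun u hu => by
    rw [div_le_iff₀ (by positivity)]
    exact norm_affErr_le hν.lipschitz hs hu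
  have h1 := h A ν hν (dyad j z) hs
  exact ⟨add_le_add h1 (key z (Cube.base_subset_window hs.le (mem_dyad j z))),
    fun u hu => (key u hu).trans (by linarith)⟩

/-- Differences of the integrals of a large piece at two nearby points. -/
lemma exists_far_dyad_le (n k : ℕ) (hn : 0 < n) (lip : ℝ≥0) (M B : ℝ) (hB : 0 ≤ B) :
    ∃ C : ℝ, 0 ≤ C ∧ ∀ (A : Eu n → Eu k) (ν : Measure (Eu n)), IsGraphPair lip M A ν →
      ∀ (j : ℤ) (i : ℕ) (H : Eu n → Eu k → ℝ), IsPiece n k B (2 ^ (-(j - i))) H →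
      ∀ x z : Eu n, ‖x - z‖ ≤ √(n : ℝ) * 2 ^ (-j) / 4 →
      |pieceInt H A ν x - pieceInt H A ν z| ≤ C / 2 ^ i *
        (∑ l ∈ Finset.range (i + 1), jones A ν (j - l) x +
          ‖affErr (dyad j x) A z‖ / 2 ^ (-j)) := by
  obtain ⟨C, hC, far⟩ := exists_far_le n k hn lip M B hB
  set κ : ℝ := (1 + n) * 2 ^ (n + 2) with hκ
  have hσ := one_le_sqrt_dim hn
  have hκ0 : 0 ≤ κ := by positivity
  refine ⟨C * (√(n : ℝ) + 1 + κ * √(n : ℝ)), by positivity, fun A ν hν j i H hH x z hxz => ?_⟩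
  have hA := hν.lipschitz.continuous
  set ℓ : ℝ := 2 ^ (-j) with hℓ
  have hℓ0 : 0 < ℓ := by rw [hℓ]; positivity
  set Q := dyad (j - i) x with hQdef
  have hQs : Q.side = ℓ * 2 ^ i := by
    rw [hQdef, dyad_side, neg_sub, sub_eq_add_neg, add_comm, zpow_add₀ two_ne_zero, zpow_natCast]
  have hi1 : (1 : ℝ) ≤ 2 ^ i := one_le_pow₀ (by norm_num)
  have hQ : 0 < Q.side := by rw [hQs]; positivity
  have hxz4 : ‖x - z‖ / ℓ ≤ √(n : ℝ) := by
    rw [div_le_iff₀ hℓ0]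
    nlinarith [show 0 ≤ √(n : ℝ) * ℓ by positivity]
  set J := ∑ l ∈ Finset.range (i + 1), jones A ν (j - l) x with hJ
  have hJ0 : 0 ≤ J := Finset.sum_nonneg fun l _ => jones_nonneg _ _ _ _
  have hgam : gam Q A ν ≤ J := by
    refine (gam_dyad_le_jones A ν (j - i) x).trans ?_
    exact Finset.single_le_sum (f := fun l : ℕ => jones A ν (j - l) x)
      (fun l _ => jones_nonneg _ _ _ _) (Finset.self_mem_range_succ i)
  have hj0 : jones A ν j x ≤ J := by
    have := Finset.single_le_sum (f := fun l : ℕ => jones A ν (j - l) x)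
      (fun l _ => jones_nonneg _ _ _ _) (Finset.mem_range.2 (Nat.succ_pos i))
    simpa using this
  have he0 : ‖affErr (dyad j x) A x‖ / ℓ ≤ J :=
    (le_add_of_nonneg_left (gam_dyad_nonneg A ν j x)).trans hj0
  -- telescoping between the generations `j - i` and `j`
  have hgap : gap A ν (dyad j x) Q ≤ κ * J := by
    have h1 := gap_dyad_add_le hn hν (j - i) x i
    rw [sub_add_cancel] at h1
    refine h1.trans (mul_le_mul_of_nonneg_left ?_ hκ0)
    rw [hJ, ← Finset.sum_range_reflect, Finset.sum_range_succ']
    refine le_add_of_le_of_nonneg (Finset.sum_le_sum fun l hl => ?_) (jones_nonneg _ _ _ _)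
    have hl' := Finset.mem_range.1 hl
    rw [show j - i + ((i - 1 - l : ℕ) : ℤ) = j - ((l + 1 : ℕ) : ℤ) by omega]
    exact gam_dyad_le_jones _ _ _ _
  have hd : affErr Q A x - affErr Q A z = affErr (dyad j x) A x - affErr (dyad j x) A z +
      (lin (slope (dyad j x) A) (x - z) - lin (slope Q A) (x - z)) := by
    rw [affErr_sub hQ hA, affErr_sub (by rw [dyad_side]; positivity) hA]; abel
  have hn1 : ‖affErr Q A x - affErr Q A z‖ ≤ ‖affErr (dyad j x) A x‖ + ‖affErr (dyad j x) A z‖ +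
      κ * J * ‖x - z‖ := by
    rw [hd]
    refine (norm_add_le _ _).trans (add_le_add (norm_sub_le _ _) ?_)
    refine (norm_lin_sub_lin_le _ _ _).trans ?_
    exact mul_le_mul_of_nonneg_right ((sum_norm_slope_sub_le_gap A ν _ _).trans hgap)
      (norm_nonneg _)
  have hxz' : ‖x - z‖ ≤ √(n : ℝ) * Q.side / 4 := by
    refine hxz.trans ?_
    rw [hQs]
    have : ℓ ≤ ℓ * 2 ^ i := le_mul_of_one_le_right hℓ0.le hi1
    gcongr
  have hpi : IsPiece n k B Q.side H := hH
  refine (far A ν hν Q hQ H hpi x (mem_dyad _ _) z hxz').trans ?_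
  have e1 : ‖x - z‖ / Q.side = ‖x - z‖ / ℓ / 2 ^ i := by rw [hQs, div_div]
  have e2 : ‖affErr Q A x - affErr Q A z‖ / Q.side ≤
      (J + ‖affErr (dyad j x) A z‖ / ℓ + κ * J * √(n : ℝ)) / 2 ^ i := by
    rw [hQs, ← div_div]
    gcongr
    calc ‖affErr Q A x - affErr Q A z‖ / ℓ ≤ (‖affErr (dyad j x) A x‖ + ‖affErr (dyad j x) A z‖ +
          κ * J * ‖x - z‖) / ℓ := by gcongr
      _ = ‖affErr (dyad j x) A x‖ / ℓ + ‖affErr (dyad j x) A z‖ / ℓ +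
          κ * J * (‖x - z‖ / ℓ) := by rw [add_div, add_div]; ring
      _ ≤ _ := by gcongr
  set e := ‖affErr (dyad j x) A z‖ / ℓ with he
  have hee : 0 ≤ e := by positivity
  calc C * (‖x - z‖ / Q.side * gam Q A ν + ‖affErr Q A x - affErr Q A z‖ / Q.side)
      ≤ C * (√(n : ℝ) / 2 ^ i * J + (J + e + κ * J * √(n : ℝ)) / 2 ^ i) := by
        refine mul_le_mul_of_nonneg_left (add_le_add ?_ e2) hC
        rw [e1]
        have := gam_nonneg hQ A ν
        gcongr
    _ = C / 2 ^ i * ((√(n : ℝ) + 1 + κ * √(n : ℝ)) * J + e) := by ring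
    _ ≤ C / 2 ^ i * ((√(n : ℝ) + 1 + κ * √(n : ℝ)) * J +
        (√(n : ℝ) + 1 + κ * √(n : ℝ)) * e) := by
        gcongr
        have : 0 ≤ κ * √(n : ℝ) := by positivity
        nlinarith
    _ = _ := by ring

/-! ### Smooth truncations -/

/-- The kernel truncated smoothly at distance `ε`. -/
noncomputable def trunc (K : Eu (n + k) → ℝ) (φ : ℝ → ℝ) (ε : ℝ) (u : Eu n) (v : Eu k) : ℝ :=
  φ (‖u‖ / ε) * K (join u v)

section Trunc

variable {φ : ℝ → ℝ} {K : Eu (n + k) → ℝ} {ε : ℝ}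

lemma trunc_eq_zero (hφ : IsProfile n φ) (hε : 0 < ε) {u : Eu n}
    (hu : ‖u‖ < 2.1 * √(n : ℝ) * ε) (v : Eu k) : trunc K φ ε u v = 0 := by
  rw [trunc, hφ.eq_zero (by positivity) (by rwa [div_lt_iff₀ hε]), zero_mul]

lemma trunc_eq (hφ : IsProfile n φ) (hε : 0 < ε) {u : Eu n}
    (hu : 3 * √(n : ℝ) * ε ≤ ‖u‖) (v : Eu k) : trunc K φ ε u v = K (join u v) := by
  rw [trunc, hφ.eq_one (by rwa [le_div_iff₀ hε]), one_mul]

lemma trunc_sub_trunc (K : Eu (n + k) → ℝ) (φ : ℝ → ℝ) (ε : ℝ) (u : Eu n) (v : Eu k) :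
    trunc K φ ε u v - trunc K φ (2 * ε) u v = piece K φ ε u v := by
  rw [trunc, trunc, piece]; ring

lemma join_ne_zero {u : Eu n} (hu : u ≠ 0) (v : Eu k) : join u v ≠ 0 := fun h => hu (by
  have := congrArg tilde h
  rw [tilde_join] at this
  rw [this]; ext; simp [tilde])

lemma IsKernel.odd_join (hK : IsKernel n k K) {u : Eu n} (hu : u ≠ 0) (v : Eu k) :
    K (join (-u) (-v)) = -K (join u v) := by
  rw [join_neg, hK.1 _ (join_ne_zero hu v)]

lemma piece_eq_kernel (hφ : IsProfile n φ) {r : ℝ} (hr : 0 < r) {u : Eu n}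
    (h1 : 3 * √(n : ℝ) * r ≤ ‖u‖) (h2 : ‖u‖ < 4.2 * √(n : ℝ) * r) (v : Eu k) :
    piece K φ r u v = K (join u v) := by
  rw [piece, hφ.eq_one (by rwa [le_div_iff₀ hr]), hφ.eq_zero (by positivity), sub_zero, mul_one]
  rw [div_lt_iff₀ (by positivity)]; linarith

lemma continuousAt_kernel (hφ : IsProfile n φ) (hn : 0 < n) (hK : IsKernel n k K) {u : Eu n}
    (hu : u ≠ 0) (v : Eu k) : ContinuousAt (fun q : Eu n × Eu k => K (join q.1 q.2)) (u, v) := by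
  obtain ⟨B, -, hp⟩ := exists_isPiece hφ hn hK
  have hσ := one_le_sqrt_dim hn
  have hu0 : 0 < ‖u‖ := norm_pos_iff.2 hu
  set r : ℝ := ‖u‖ / (3.5 * √(n : ℝ)) with hr
  have hr0 : 0 < r := by positivity
  have hru : ‖u‖ = 3.5 * √(n : ℝ) * r := by rw [hr]; field_simp
  refine (hp r hr0).continuous.continuousAt.congr ?_
  have hsr : 0 < √(n : ℝ) * r := by positivity
  have h1 : ∀ᶠ q : Eu n × Eu k in 𝓝 (u, v), ‖q.1‖ ∈ Ioo (3 * √(n : ℝ) * r) (4.2 * √(n : ℝ) * r) :=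
    (continuous_fst.norm.tendsto (u, v)).eventually_mem (Ioo_mem_nhds (by
      simp only; rw [hru]; nlinarith) (by simp only; rw [hru]; nlinarith))
  filter_upwards [h1] with q hq
  exact piece_eq_kernel hφ hr0 hq.1.le hq.2 q.2

lemma continuous_trunc (hφ : IsProfile n φ) (hn : 0 < n) (hK : IsKernel n k K) (hε : 0 < ε) :
    Continuous fun q : Eu n × Eu k => trunc K φ ε q.1 q.2 := by
  have hσ := one_le_sqrt_dim hn
  refine continuous_iff_continuousAt.2 fun q => ?_
  by_cases hq : ‖q.1‖ < 2.1 * √(n : ℝ) * ε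
  · refine (continuousAt_const (y := (0 : ℝ))).congr ?_
    filter_upwards [(isOpen_lt continuous_fst.norm continuous_const).mem_nhds hq] with p hp
    exact (trunc_eq_zero hφ hε hp p.2).symm
  · have hq0 : q.1 ≠ 0 := norm_pos_iff.1 (lt_of_lt_of_le (by positivity) (not_lt.1 hq))
    refine ContinuousAt.mul ?_ (continuousAt_kernel hφ hn hK hq0 q.2)
    have h1 : Continuous fun u : Eu n => φ ‖u‖ := (hφ.contDiff_norm hn).continuous
    have h2 : (fun q : Eu n × Eu k => φ (‖q.1‖ / ε)) =
        (fun u : Eu n => φ ‖u‖) ∘ fun q : Eu n × Eu k => ε⁻¹ • q.1 := by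
      ext q
      simp [norm_smul, abs_of_pos hε, div_eq_inv_mul]
    rw [h2]
    exact (h1.comp (by fun_prop)).continuousAt

/-- The odd part of the kernel in the vertical variable decays one order faster. -/
lemma exists_abs_trunc_sub_le (hφ : IsProfile n φ) (hn : 0 < n) (hK : IsKernel n k K)
    (hε : 0 < ε) : ∃ C : ℝ, 0 ≤ C ∧ ∀ ε', ε ≤ ε' → ∀ (u : Eu n) (v : Eu k),
      |trunc K φ ε' u v - trunc K φ ε' u (-v)| ≤ C * ‖v‖ * (1 + ‖u‖) ^ (-((n : ℝ) + 1)) := by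
  obtain ⟨B, hB, hp⟩ := exists_isPiece hφ hn hK
  have hσ := one_le_sqrt_dim hn
  set a : ℝ := 2.1 * √(n : ℝ) * ε with ha
  have ha0 : 0 < a := by positivity
  set t : ℝ := 4 / (3.5 * √(n : ℝ)) with ht
  have ht0 : 0 < t := by positivity
  set s : ℝ := a / (1 + a) with hs
  have hs0 : 0 < s := by positivity
  refine ⟨2 * B / (t * s) ^ (n + 1), by positivity, fun ε' hε' u v => ?_⟩
  have hε'0 := hε.trans_le hε'
  have hrpow : (1 + ‖u‖) ^ (-((n : ℝ) + 1)) = ((1 + ‖u‖) ^ (n + 1))⁻¹ := by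
    rw [Real.rpow_neg (by positivity), ← Nat.cast_succ, Real.rpow_natCast]
  by_cases hu : ‖u‖ < 2.1 * √(n : ℝ) * ε'
  · rw [trunc_eq_zero hφ hε'0 hu, trunc_eq_zero hφ hε'0 hu, sub_zero, abs_zero]
    positivity
  have hu' : a ≤ ‖u‖ := by
    refine le_trans ?_ (not_lt.1 hu)
    rw [ha]; gcongr
  have hu0 : 0 < ‖u‖ := ha0.trans_le hu'
  set r : ℝ := ‖u‖ / (3.5 * √(n : ℝ)) with hr
  have hr0 : 0 < r := by positivity
  have hru : ‖u‖ = 3.5 * √(n : ℝ) * r := by rw [hr]; field_simp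
  have hsr : 0 < √(n : ℝ) * r := by positivity
  have h4r : 4 * r = t * ‖u‖ := by rw [hr, ht]; ring
  have hpk : ∀ w : Eu k, piece K φ r u w = K (join u w) := fun w =>
    piece_eq_kernel hφ hr0 (by nlinarith) (by nlinarith) w
  have h1 := (hp r hr0).lip u v u (-v)
  rw [hpk, hpk, sub_self, norm_zero, zero_add, sub_neg_eq_add, ← two_smul ℝ v, norm_smul, h4r,
    Real.norm_of_nonneg zero_le_two] at h1
  have h2 : s * (1 + ‖u‖) ≤ ‖u‖ := by
    rw [hs, div_mul_eq_mul_div, div_le_iff₀ (by positivity)]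
    nlinarith
  rw [trunc, trunc, ← mul_sub, abs_mul, abs_of_nonneg (hφ.nonneg (by positivity)), hrpow]
  calc _ ≤ 1 * |K (join u v) - K (join u (-v))| := by gcongr; exact hφ.le_one (by positivity)
    _ ≤ B / (t * ‖u‖) ^ (n + 1) * (2 * ‖v‖) := by rw [one_mul]; exact h1
    _ ≤ B / (t * (s * (1 + ‖u‖))) ^ (n + 1) * (2 * ‖v‖) := by gcongr
    _ = _ := by rw [← mul_assoc t, mul_pow (t * s)]; field_simp

end Trunc

/-! ### Convergence of the truncated integrals -/

/-- Outside the ball of radius `ρ`, the graph is horizontal and the measure is Lebesgue measure. -/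
structure FlatOutside (ρ : ℝ) (A : Eu n → Eu k) (ν : Measure (Eu n)) : Prop where
  zero : ∀ u, ρ < ‖u‖ → A u = 0
  restrict : ν.restrict (Metric.closedBall 0 ρ)ᶜ = volume.restrict (Metric.closedBall 0 ρ)ᶜ

/-- The points of the base whose lifts to the graph are at distance less than `R` from the lift
of `z`. -/
def graphBall (A : Eu n → Eu k) (z : Eu n) (R : ℝ) : Set (Eu n) :=
  graphMap A ⁻¹' Metric.ball (graphMap A z) R

lemma mem_graphBall_iff {A : Eu n → Eu k} {z y : Eu n} {R : ℝ} :
    y ∈ graphBall A z R ↔ ‖join (z - y) (A z - A y)‖ < R := by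
  rw [graphBall, mem_preimage, Metric.mem_ball, dist_comm, dist_eq_norm, graphMap, graphMap,
    ← join_sub]

lemma graphBall_subset (A : Eu n → Eu k) (z : Eu n) (R : ℝ) :
    graphBall A z R ⊆ Metric.closedBall z R := fun y hy => by
  rw [Metric.mem_closedBall, dist_comm, dist_eq_norm]
  exact (norm_le_norm_join _ _).trans (mem_graphBall_iff.1 hy).le

lemma measurableSet_graphBall {A : Eu n → Eu k} (hA : Continuous A) (z : Eu n) (R : ℝ) :
    MeasurableSet (graphBall A z R) := by
  have hG : Continuous (graphMap A) := by unfold graphMap; fun_prop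
  exact hG.measurable Metric.isOpen_ball.measurableSet

lemma subset_graphBall {lip : ℝ≥0} {A : Eu n → Eu k} (hA : LipschitzWith lip A) {z : Eu n} {r R : ℝ}
    (hR : (1 + lip) * r < R) : Metric.closedBall z r ⊆ graphBall A z R := fun y hy => by
  rw [Metric.mem_closedBall, dist_comm, dist_eq_norm] at hy
  rw [mem_graphBall_iff]
  have h1 := hA.dist_le_mul z y
  rw [dist_eq_norm, dist_eq_norm] at h1
  have h2 := mul_le_mul_of_nonneg_left hy (show (0 : ℝ) ≤ 1 + lip by positivity)
  have h3 := norm_join_le (z - y) (A z - A y)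
  nlinarith

/-- For large radii the balls of the graph project to balls of the base, because the graph is
horizontal far away. -/
lemma graphBall_eq_ball {lip : ℝ≥0} {A : Eu n → Eu k} (hA : LipschitzWith lip A) {ρ : ℝ}
    (hρ : 0 ≤ ρ) (hz : ∀ u, ρ < ‖u‖ → A u = 0) (z : Eu n) {R : ℝ}
    (hR : (1 + lip) * (ρ + ‖z‖) + ‖A z‖ + 1 ≤ R) :
    graphBall A z R = Metric.ball z √(R ^ 2 - ‖A z‖ ^ 2) ∧
      Metric.closedBall 0 ρ ⊆ Metric.ball z √(R ^ 2 - ‖A z‖ ^ 2) := by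
  set t : ℝ := (1 + lip) * (ρ + ‖z‖) with ht
  have ht1 : ρ + ‖z‖ ≤ t := le_mul_of_one_le_left (by positivity) (by simp)
  have hb := norm_nonneg (A z)
  have ht0 : 0 ≤ t := by positivity
  have hsq : (t + 1) ^ 2 ≤ R ^ 2 - ‖A z‖ ^ 2 := by nlinarith
  have hsub : Metric.closedBall 0 ρ ⊆ Metric.ball z √(R ^ 2 - ‖A z‖ ^ 2) := fun y hy => by
    rw [Metric.mem_closedBall, dist_zero_right] at hy
    rw [Metric.mem_ball, dist_eq_norm]
    have h1 := norm_sub_le y z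
    refine lt_of_lt_of_le (by linarith : ‖y - z‖ < t + 1) (Real.le_sqrt_of_sq_le hsq)
  refine ⟨?_, hsub⟩
  ext y
  by_cases hy : y ∈ Metric.closedBall (0 : Eu n) ρ
  · refine iff_of_true ?_ (hsub hy)
    refine subset_graphBall hA (z := z) (r := ρ + ‖z‖) (by linarith) ?_
    rw [Metric.mem_closedBall, dist_zero_right] at hy
    rw [Metric.mem_closedBall, dist_eq_norm]
    exact (norm_sub_le y z).trans (by linarith)
  · rw [Metric.mem_closedBall, dist_zero_right, not_le] at hy
    rw [mem_graphBall_iff, hz y hy, sub_zero, Metric.mem_ball, dist_comm, dist_eq_norm,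
      Real.lt_sqrt (norm_nonneg _), lt_sub_iff_add_lt, ← norm_join_sq]
    have hR0 : 0 ≤ R := by linarith
    exact (pow_lt_pow_iff_left₀ (norm_nonneg _) hR0 two_ne_zero).symm

/-- The limit of the truncated singular integral over a graph that is horizontal with unit density
outside the ball of radius `ρ`, as an expression in absolutely convergent integrals: the difference
between the graph and the horizontal plane `ℝⁿ × {0}` over that ball, plus the integral over the
whole plane, where only the even part of the kernel in `u` counts. By oddness of `K` this even part
is `2⁻¹ * (trunc K φ ε u (A z) - trunc K φ ε u (-A z))`. -/
noncomputable def truncLim (K : Eu (n + k) → ℝ) (φ : ℝ → ℝ) (A : Eu n → Eu k)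
    (ν : Measure (Eu n)) (ρ ε : ℝ) (z : Eu n) : ℝ :=
  (∫ y in Metric.closedBall 0 ρ, trunc K φ ε (z - y) (A z - A y) ∂ν) -
    (∫ y in Metric.closedBall 0 ρ, trunc K φ ε (z - y) (A z)) +
    2⁻¹ * ∫ u, (trunc K φ ε u (A z) - trunc K φ ε u (-A z))

section Limits

variable {φ : ℝ → ℝ} {K : Eu (n + k) → ℝ} {lip : ℝ≥0} {M ρ : ℝ} {A : Eu n → Eu k}
  {ν : Measure (Eu n)}

lemma continuous_trunc_comp (hφ : IsProfile n φ) (hn : 0 < n) (hK : IsKernel n k K) {ε : ℝ}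
    (hε : 0 < ε) {f : Eu n → Eu n} {g : Eu n → Eu k} (hf : Continuous f) (hg : Continuous g) :
    Continuous fun y => trunc K φ ε (f y) (g y) := by
  have h := continuous_trunc hφ hn hK hε
  exact Continuous.comp (g := fun q : Eu n × Eu k => trunc K φ ε q.1 q.2)
    (f := fun y => (f y, g y)) h (hf.prodMk hg)

lemma integrable_trunc_sub (hφ : IsProfile n φ) (hn : 0 < n) (hK : IsKernel n k K) {ε : ℝ}
    (hε : 0 < ε) (b : Eu k) :
    Integrable fun u : Eu n => trunc K φ ε u b - trunc K φ ε u (-b) := by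
  obtain ⟨C, hC, h⟩ := exists_abs_trunc_sub_le hφ hn hK hε
  have hi := (integrable_one_add_norm (μ := (volume : Measure (Eu n))) (r := (n : ℝ) + 1)
    (by rw [finrank_euclideanSpace, Fintype.card_fin]; linarith)).const_mul (C * ‖b‖)
  refine hi.mono' ((continuous_trunc_comp hφ hn hK hε continuous_id continuous_const).sub
    (continuous_trunc_comp hφ hn hK hε continuous_id continuous_const)).aestronglyMeasurable
    (ae_of_all _ fun u => h ε le_rfl u b)

lemma trunc_neg (hφ : IsProfile n φ) (hn : 0 < n) (hK : IsKernel n k K) {ε : ℝ}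
    (hε : 0 < ε) (u : Eu n) (v : Eu k) : trunc K φ ε (-u) (-v) = -trunc K φ ε u v := by
  have hσ := one_le_sqrt_dim hn
  rcases eq_or_ne u 0 with rfl | hu
  · rw [neg_zero, trunc_eq_zero hφ hε (by rw [norm_zero]; positivity),
      trunc_eq_zero hφ hε (by rw [norm_zero]; positivity), neg_zero]
  · rw [trunc, trunc, norm_neg, hK.odd_join hu, mul_neg]

/-- The truncated integrals over growing balls converge. Beyond `ρ` the graph is horizontal with unit
density, so that it may be replaced there by the horizontal plane; on a centred ball of that plane
only the even part of `u ↦ trunc K φ ε u (A z)` matters, and this part is integrable. -/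
lemma tendsto_trunc (hφ : IsProfile n φ) (hn : 0 < n) (hK : IsKernel n k K)
    (hν : IsGraphPair lip M A ν) (hρ : 0 ≤ ρ) (hF : FlatOutside ρ A ν) {ε : ℝ} (hε : 0 < ε)
    (z : Eu n) :
    Tendsto (fun R => ∫ y in graphBall A z R, trunc K φ ε (z - y) (A z - A y) ∂ν) atTop
      (𝓝 (truncLim K φ A ν ρ ε z)) := by
  have := hν.isLocallyFiniteMeasure
  have hA := hν.lipschitz.continuous
  set b := A z with hb
  set B₀ := Metric.closedBall (0 : Eu n) ρ with hB₀
  have hB₀m : MeasurableSet B₀ := Metric.isClosed_closedBall.measurableSet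
  set g : Eu n → ℝ := fun y => trunc K φ ε (z - y) (b - A y) with hg
  set h : Eu n → ℝ := fun y => trunc K φ ε (z - y) b with hh
  set d : Eu n → ℝ := fun u => trunc K φ ε u b - trunc K φ ε u (-b) with hd
  have hgc : Continuous g := continuous_trunc_comp hφ hn hK hε (by fun_prop) (by fun_prop)
  have hhc : Continuous h := continuous_trunc_comp hφ hn hK hε (by fun_prop) (by fun_prop)
  have hTc : ∀ v : Eu k, Continuous fun u => trunc K φ ε u v := fun v =>
    continuous_trunc_comp hφ hn hK hε continuous_id continuous_const
  have hrad : Tendsto (fun R : ℝ => √(R ^ 2 - ‖b‖ ^ 2)) atTop atTop :=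
    Real.tendsto_sqrt_atTop.comp (tendsto_atTop_add_const_right _ _
      (tendsto_pow_atTop two_ne_zero))
  have hlim : Tendsto (fun R : ℝ => ∫ u in Metric.ball 0 √(R ^ 2 - ‖b‖ ^ 2), d u) atTop
      (𝓝 (∫ u, d u)) :=
    (aecover_ball hrad).integral_tendsto_of_countably_generated
      (integrable_trunc_sub hφ hn hK hε b)
  -- for large `R` the points of the graph at distance less than `R` lie over a ball containing `B₀`
  have key : ∀ R : ℝ, (1 + lip) * (ρ + ‖z‖) + ‖b‖ + 1 ≤ R →
      (∫ y in B₀, g y ∂ν) - (∫ y in B₀, h y) +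
        2⁻¹ * (∫ u in Metric.ball 0 √(R ^ 2 - ‖b‖ ^ 2), d u) = ∫ y in graphBall A z R, g y ∂ν := by
    intro R hR
    obtain ⟨h1, h2⟩ := graphBall_eq_ball hν.lipschitz hρ hF.zero z hR
    rw [h1]
    set r := √(R ^ 2 - ‖b‖ ^ 2) with hr
    have hsplit : ∀ (τ : Measure (Eu n)) [IsLocallyFiniteMeasure τ] (e : Eu n → ℝ),
        Continuous e → ∫ y in Metric.ball z r, e y ∂τ = (∫ y in B₀, e y ∂τ) +
          ∫ y in Metric.ball z r, e y ∂(τ.restrict B₀ᶜ) := fun τ _ e he => by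
      have h3 : IntegrableOn e (Metric.ball z r) τ :=
        integrableOn_of_continuous he (isCompact_closedBall z r) Metric.ball_subset_closedBall
      rw [← integral_inter_add_sdiff hB₀m h3, inter_eq_right.2 h2,
        Measure.restrict_restrict Metric.isOpen_ball.measurableSet, sdiff_eq]
    have h3 : ∫ y in Metric.ball z r, g y ∂(ν.restrict B₀ᶜ) =
        ∫ y in Metric.ball z r, h y ∂(volume.restrict B₀ᶜ) := by
      rw [hF.restrict, Measure.restrict_restrict Metric.isOpen_ball.measurableSet]
      refine setIntegral_congr_fun (Metric.isOpen_ball.measurableSet.inter hB₀m.compl) fun y hy => ?_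
      have hy2 := hy.2
      rw [mem_compl_iff, Metric.mem_closedBall, dist_zero_right, not_le] at hy2
      simp only [hg, hh, hF.zero y hy2, sub_zero]
    have h4 : ∫ y in Metric.ball z r, h y = 2⁻¹ * ∫ u in Metric.ball 0 r, d u := by
      have h5 : ∫ y in Metric.ball z r, h y = ∫ u in Metric.ball 0 r, trunc K φ ε u b := by
        rw [← integral_indicator Metric.isOpen_ball.measurableSet,
          ← integral_indicator Metric.isOpen_ball.measurableSet, ← integral_sub_left_eq_self
          ((Metric.ball 0 r).indicator fun u => trunc K φ ε u b) volume z]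
        refine integral_congr_ae (ae_of_all _ fun y => ?_)
        have : y ∈ Metric.ball z r ↔ z - y ∈ Metric.ball (0 : Eu n) r := by
          rw [Metric.mem_ball, mem_ball_zero_iff, dist_comm, dist_eq_norm]
        by_cases hy : y ∈ Metric.ball z r
        · simp only [indicator_of_mem hy, indicator_of_mem (this.1 hy), hh]
        · simp only [indicator_of_notMem hy, indicator_of_notMem (fun h => hy (this.2 h))]
      have h6 : ∫ u in Metric.ball 0 r, trunc K φ ε u b =
          -∫ u in Metric.ball 0 r, trunc K φ ε u (-b) := by
        rw [← integral_indicator Metric.isOpen_ball.measurableSet,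
          ← integral_indicator Metric.isOpen_ball.measurableSet, ← integral_neg,
          ← integral_neg_eq_self]
        refine integral_congr_ae (ae_of_all _ fun u => ?_)
        have : u ∈ Metric.ball (0 : Eu n) r ↔ -u ∈ Metric.ball (0 : Eu n) r := by
          rw [mem_ball_zero_iff, mem_ball_zero_iff, norm_neg]
        by_cases hy : u ∈ Metric.ball 0 r
        · simp only [indicator_of_mem hy, indicator_of_mem (this.1 hy)]
          have := trunc_neg hφ hn hK hε u (-b)
          rwa [neg_neg] at this
        · simp only [indicator_of_notMem hy, indicator_of_notMem (fun h => hy (this.2 h)), neg_zero]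
      have h7 : ∫ u in Metric.ball 0 r, d u = (∫ u in Metric.ball 0 r, trunc K φ ε u b) -
          ∫ u in Metric.ball 0 r, trunc K φ ε u (-b) :=
        integral_sub (integrableOn_of_continuous (hTc _) (isCompact_closedBall 0 r)
          Metric.ball_subset_closedBall) (integrableOn_of_continuous (hTc _)
          (isCompact_closedBall 0 r) Metric.ball_subset_closedBall)
      rw [h5]
      linarith
    rw [hsplit ν g hgc, h3, ← h4, hsplit volume h hhc]
    ring
  refine Tendsto.congr' ?_ ((hlim.const_mul 2⁻¹).const_add
    ((∫ y in B₀, g y ∂ν) - (∫ y in B₀, h y)))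
  filter_upwards [eventually_ge_atTop ((1 + lip) * (ρ + ‖z‖) + ‖b‖ + 1)] with R hR using key R hR

lemma tendsto_of_supp (hν : IsGraphPair lip M A ν) {g : Eu n → ℝ} {z : Eu n} {r : ℝ}
    (hg : ∀ y, r < ‖z - y‖ → g y = 0) :
    ∀ᶠ R in atTop, ∫ y in graphBall A z R, g y ∂ν = ∫ y, g y ∂ν := by
  filter_upwards [eventually_gt_atTop ((1 + lip) * r)] with R hR
  refine setIntegral_eq_integral_of_forall_compl_eq_zero fun y hy => hg y ?_
  by_contra h
  refine hy (subset_graphBall hν.lipschitz hR ?_)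
  rw [Metric.mem_closedBall, dist_comm, dist_eq_norm]
  exact not_lt.1 h

lemma truncLim_sub (hφ : IsProfile n φ) (hn : 0 < n) (hK : IsKernel n k K)
    (hν : IsGraphPair lip M A ν) (hρ : 0 ≤ ρ) (hF : FlatOutside ρ A ν) {ε : ℝ} (hε : 0 < ε)
    (z : Eu n) :
    truncLim K φ A ν ρ ε z - truncLim K φ A ν ρ (2 * ε) z = pieceInt (piece K φ ε) A ν z := by
  have := hν.isLocallyFiniteMeasure
  have hA := hν.lipschitz.continuous
  obtain ⟨B, -, hp⟩ := exists_isPiece hφ hn hK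
  have h1 := (tendsto_trunc hφ hn hK hν hρ hF hε z).sub
    (tendsto_trunc hφ hn hK hν hρ hF (by positivity : 0 < 2 * ε) z)
  refine tendsto_nhds_unique h1 (tendsto_const_nhds.congr' ?_)
  filter_upwards [tendsto_of_supp hν (g := fun y => piece K φ ε (z - y) (A z - A y)) (z := z)
    (fun y hy => (hp ε hε).supp _ _ hy)] with R hR
  rw [pieceInt, ← hR, ← integral_sub]
  · simp only [trunc_sub_trunc]
  · exact integrableOn_of_continuous (continuous_trunc_comp hφ hn hK hε (by fun_prop)
      (by fun_prop)) (isCompact_closedBall z R) (graphBall_subset A z R)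
  · exact integrableOn_of_continuous (continuous_trunc_comp hφ hn hK (by positivity) (by fun_prop)
      (by fun_prop)) (isCompact_closedBall z R) (graphBall_subset A z R)

lemma tendsto_truncLim_zero (hφ : IsProfile n φ) (hn : 0 < n) (hK : IsKernel n k K)
    {ε : ℝ} (hε : 0 < ε) (z : Eu n) :
    Tendsto (fun N : ℕ => truncLim K φ A ν ρ (2 ^ N * ε) z) atTop (𝓝 0) := by
  have hσ := one_le_sqrt_dim hn
  have hsc : Tendsto (fun N : ℕ => 2.1 * √(n : ℝ) * ((2 : ℝ) ^ N * ε)) atTop atTop :=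
    ((tendsto_pow_atTop_atTop_of_one_lt one_lt_two).atTop_mul_const hε).const_mul_atTop
      (by positivity)
  obtain ⟨C, hC, h⟩ := exists_abs_trunc_sub_le hφ hn hK hε
  have h1 : Tendsto (fun N : ℕ => ∫ u, (trunc K φ (2 ^ N * ε) u (A z) -
      trunc K φ (2 ^ N * ε) u (-A z))) atTop (𝓝 (∫ _u : Eu n, (0 : ℝ))) := by
    refine tendsto_integral_of_dominated_convergence
      (fun u => C * ‖A z‖ * (1 + ‖u‖) ^ (-((n : ℝ) + 1))) (fun N => ?_) ?_ (fun N => ?_) ?_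
    · exact (integrable_trunc_sub hφ hn hK (by positivity) (A z)).aestronglyMeasurable
    · exact (integrable_one_add_norm (by
        rw [finrank_euclideanSpace, Fintype.card_fin]; linarith)).const_mul _
    · refine ae_of_all _ fun u => h _ ?_ u (A z)
      exact le_mul_of_one_le_left hε.le (one_le_pow₀ one_le_two)
    · refine ae_of_all _ fun u => tendsto_const_nhds.congr' ?_
      filter_upwards [hsc.eventually_gt_atTop ‖u‖] with N hN
      rw [trunc_eq_zero hφ (by positivity) hN, trunc_eq_zero hφ (by positivity) hN, sub_zero]
  rw [integral_zero] at h1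
  have h2 : Tendsto (fun N : ℕ => 2⁻¹ * ∫ u, (trunc K φ (2 ^ N * ε) u (A z) -
      trunc K φ (2 ^ N * ε) u (-A z))) atTop (𝓝 0) := by simpa using h1.const_mul 2⁻¹
  refine h2.congr' ?_
  filter_upwards [hsc.eventually_gt_atTop (‖z‖ + ρ)] with N hN
  have h3 : ∀ y ∈ Metric.closedBall (0 : Eu n) ρ, ∀ v : Eu k,
      trunc K φ (2 ^ N * ε) (z - y) v = 0 := fun y hy v => by
    rw [Metric.mem_closedBall, dist_zero_right] at hy
    exact trunc_eq_zero hφ (by positivity) ((norm_sub_le z y).trans_lt (by linarith)) v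
  rw [truncLim, setIntegral_eq_zero_of_forall_eq_zero fun y hy => h3 y hy _,
    setIntegral_eq_zero_of_forall_eq_zero fun y hy => h3 y hy _, sub_zero, zero_add]

/-- The truncated integral is the sum of the integrals of the pieces of larger scales. -/
lemma tendsto_sum_pieceInt (hφ : IsProfile n φ) (hn : 0 < n) (hK : IsKernel n k K)
    (hν : IsGraphPair lip M A ν) (hρ : 0 ≤ ρ) (hF : FlatOutside ρ A ν) {ε : ℝ} (hε : 0 < ε)
    (z : Eu n) :
    Tendsto (fun N : ℕ => ∑ i ∈ Finset.range N, pieceInt (piece K φ (2 ^ i * ε)) A ν z) atTop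
      (𝓝 (truncLim K φ A ν ρ ε z)) := by
  have h1 : ∀ N : ℕ, ∑ i ∈ Finset.range N, pieceInt (piece K φ (2 ^ i * ε)) A ν z =
      truncLim K φ A ν ρ ε z - truncLim K φ A ν ρ (2 ^ N * ε) z := fun N => by
    induction N with
    | zero => simp
    | succ N ih =>
      rw [Finset.sum_range_succ, ih, ← truncLim_sub hφ hn hK hν hρ hF (by positivity) z, pow_succ,
        show (2 : ℝ) ^ N * 2 * ε = 2 * (2 ^ N * ε) by ring]
      ring
  simp only [h1]
  simpa using (tendsto_truncLim_zero (A := A) (ν := ν) (ρ := ρ) hφ hn hK hε z).const_sub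
    (truncLim K φ A ν ρ ε z)

end Limits

/-! ### The boundary layer of a cube -/

lemma prod_update_eq (i : Fin n) (a b : ℝ≥0∞) :
    ∏ j, (if j = i then a else b) = a * b ^ (n - 1) := by
  rw [← Finset.mul_prod_erase _ _ (Finset.mem_univ i), if_pos rfl]
  congr 1
  rw [Finset.prod_congr rfl fun j hj => if_neg (Finset.ne_of_mem_erase hj), Finset.prod_const,
    Finset.card_erase_of_mem (Finset.mem_univ i), Finset.card_univ, Fintype.card_fin]

/-- The points of a cube that a translation moves out of the cube form a thin layer. -/
lemma Cube.volume_diff_shift_le (Q : Cube n) (w : Eu n) :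
    volume {b | b ∈ Q.base ∧ b + w ∉ Q.base} ≤
      ENNReal.ofReal (n * ‖w‖) * ENNReal.ofReal Q.side ^ (n - 1) := by
  set lo : Fin n → ℝ := fun i => if 0 ≤ w i then Q.corner i + Q.side - w i else Q.corner i with hlo
  set T : Fin n → Set (Eu n) := fun i => (WithLp.ofLp : Eu n → Fin n → ℝ) ⁻¹'
    (univ.pi fun j => Ico (if j = i then lo i else Q.corner j)
      (if j = i then lo i + |w i| else Q.corner j + Q.side)) with hT
  have hsub : {b | b ∈ Q.base ∧ b + w ∉ Q.base} ⊆ ⋃ i, T i := by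
    rintro b ⟨hb, hbw⟩
    simp only [Cube.base, mem_ofPred_eq, not_forall] at hbw
    obtain ⟨i, hi⟩ := hbw
    refine mem_iUnion.2 ⟨i, ?_⟩
    simp only [hT, mem_preimage, mem_univ_pi]
    intro j
    have hbj := hb j
    by_cases hji : j = i
    · subst hji
      simp only [if_true, hlo, PiLp.add_apply] at hi ⊢
      rw [not_and_or, not_le, not_lt] at hi
      split_ifs with h0
      · rw [abs_of_nonneg h0]
        constructor
        · rcases hi with hi | hi <;> linarith [hbj.1]
        · linarith [hbj.2]
      · rw [not_le] at h0
        rw [abs_of_neg h0]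
        constructor
        · exact hbj.1
        · rcases hi with hi | hi <;> linarith [hbj.2]
    · simp only [if_neg hji]
      exact hbj
  have hvol : ∀ i, volume (T i) = ENNReal.ofReal |w i| * ENNReal.ofReal Q.side ^ (n - 1) := fun i => by
    rw [hT, (PiLp.volume_preserving_ofLp (Fin n)).measure_preimage
      (MeasurableSet.univ_pi fun i => measurableSet_Ico).nullMeasurableSet, Real.volume_pi_Ico,
      ← prod_update_eq i]
    refine Finset.prod_congr rfl fun j _ => ?_
    split_ifs with h
    · congr 1; ring
    · congr 1; ring
  calc _ ≤ ∑ i, volume (T i) := (measure_mono hsub).trans (measure_iUnion_fintype_le _ _)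
    _ = ENNReal.ofReal (∑ i, |w i|) * ENNReal.ofReal Q.side ^ (n - 1) := by
        rw [ENNReal.ofReal_sum_of_nonneg fun i _ => abs_nonneg _, Finset.sum_mul]
        exact Finset.sum_congr rfl fun i _ => hvol i
    _ ≤ _ := by
        gcongr
        exact sum_abs_coord_le w

/-- The pairs of points at distance at most `r` on both sides of the boundary of a cube fill a layer
of thickness `r`. -/
lemma lintegral_boundary_le (Q : Cube n) {r : ℝ} (hr : 0 ≤ r) :
    ∫⁻ z in Q.base, volume {y | y ∉ Q.base ∧ ‖z - y‖ ≤ r} ≤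
      ENNReal.ofReal (n * r * (r ^ n * ballVol n)) * ENNReal.ofReal Q.side ^ (n - 1) := by
  have hQm := Q.measurableSet_base
  set E : Set (Eu n × Eu n) := {q | q.1 ∈ Q.base ∧ q.1 - q.2 ∉ Q.base ∧ ‖q.2‖ ≤ r} with hE
  have hEm : MeasurableSet E := by
    refine (measurable_fst hQm).inter (MeasurableSet.inter ?_ ?_)
    · exact (measurable_fst.sub measurable_snd) hQm.compl
    · exact (isClosed_le (f := fun q : Eu n × Eu n => ‖q.2‖) (by fun_prop)
        continuous_const).measurableSet
  have h1 : ∀ z ∈ Q.base, volume {y | y ∉ Q.base ∧ ‖z - y‖ ≤ r} = volume (Prod.mk z ⁻¹' E) := by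
    intro z hz
    have h2 : {y | y ∉ Q.base ∧ ‖z - y‖ ≤ r} = (fun y => z - y) ⁻¹' (Prod.mk z ⁻¹' E) := by
      ext y
      simp only [mem_ofPred_eq, hE, mem_preimage, hz, true_and, sub_sub_cancel]
    rw [h2, (Measure.measurePreserving_sub_left volume z).measure_preimage
      (measurable_prodMk_left hEm).nullMeasurableSet]
  have h3 : ∫⁻ z in Q.base, volume {y | y ∉ Q.base ∧ ‖z - y‖ ≤ r} ≤
      (volume.prod volume : Measure (Eu n × Eu n)) E := by
    rw [Measure.prod_apply hEm, setLIntegral_congr_fun hQm h1]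
    exact setLIntegral_le_lintegral _ _
  refine h3.trans ?_
  rw [Measure.prod_apply_symm hEm]
  calc ∫⁻ u, volume ((fun z => (z, u)) ⁻¹' E)
      ≤ ∫⁻ u, (Metric.closedBall (0 : Eu n) r).indicator (fun _ =>
        ENNReal.ofReal (n * r) * ENNReal.ofReal Q.side ^ (n - 1)) u := by
        refine lintegral_mono fun u => ?_
        by_cases hu : ‖u‖ ≤ r
        · rw [indicator_of_mem (by simpa using hu)]
          have h4 : (fun z => (z, u)) ⁻¹' E ⊆ {b | b ∈ Q.base ∧ b + -u ∉ Q.base} := by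
            rintro z ⟨hz, hzu, -⟩
            exact ⟨hz, by rwa [← sub_eq_add_neg]⟩
          refine (measure_mono h4).trans ((Q.volume_diff_shift_le (-u)).trans ?_)
          rw [norm_neg]
          gcongr
        · have h4 : (fun z => (z, u)) ⁻¹' E = ∅ := by
            ext z
            simp only [hE, mem_preimage, mem_ofPred_eq, hu, and_false, mem_empty_iff_false]
          rw [h4, measure_empty]
          exact zero_le
    _ = _ := by
        rw [lintegral_indicator_const Metric.isClosed_closedBall.measurableSet,
          ← ofReal_measureReal measure_closedBall_lt_top.ne, volume_real_closedBall _ hr,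
          ENNReal.ofReal_mul (by positivity : 0 ≤ n * r)]
        ring

/-- The part of the integral of a kernel piece over the graph that comes from outside `D`. -/
noncomputable def outInt (H : Eu n → Eu k → ℝ) (A : Eu n → Eu k) (ν : Measure (Eu n))
    (D : Set (Eu n)) (z : Eu n) : ℝ := ∫ y in Dᶜ, H (z - y) (A z - A y) ∂ν

section Out

variable {B ℓ M : ℝ} {lip : ℝ≥0} {H : Eu n → Eu k → ℝ} {A : Eu n → Eu k} {ν : Measure (Eu n)}

lemma IsPiece.integrable_shift (hH : IsPiece n k B ℓ H) (hA : Continuous A) (ν : Measure (Eu n))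
    [IsLocallyFiniteMeasure ν] (z : Eu n) : Integrable (fun y => H (z - y) (A z - A y)) ν :=
  integrable_of_closedBall (hH.continuous_comp (by fun_prop) (by fun_prop))
    (fun y hy => hH.supp _ _ hy) ν

lemma IsPiece.stronglyMeasurable_outInt (hH : IsPiece n k B ℓ H) (hA : Continuous A)
    [SFinite ν] (D : Set (Eu n)) : StronglyMeasurable (outInt H A ν D) := by
  have h : Continuous fun q : Eu n × Eu n => H (q.1 - q.2) (A q.1 - A q.2) :=
    hH.continuous_comp (by fun_prop) (by fun_prop)
  exact h.stronglyMeasurable.integral_prod_right'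

lemma lintegral_outInt_le (hH : IsPiece n k B ℓ H) (hB : 0 ≤ B) (hℓ : 0 < ℓ)
    (hν : IsGraphPair lip M A ν) (Q : Cube n) :
    ∫⁻ z in Q.base, ENNReal.ofReal |outInt H A ν Q.base z| ∂ν ≤
      ENNReal.ofReal (M ^ 2 * B * n * (3 / 2 * √(n : ℝ)) ^ (n + 1) * ballVol n * ℓ) *
        ENNReal.ofReal Q.side ^ (n - 1) := by
  have hM0 : 0 ≤ M := zero_le_one.trans hν.one_le
  have hbv := ballVol_pos (n := n)
  set r : ℝ := 3 / 2 * √(n : ℝ) * ℓ with hr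
  have hr0 : 0 ≤ r := by positivity
  have h1 : ∀ z, ENNReal.ofReal |outInt H A ν Q.base z| ≤
      ENNReal.ofReal (B / ℓ ^ n * M) * volume {y | y ∉ Q.base ∧ ‖z - y‖ ≤ r} := fun z => by
    have hm : MeasurableSet {y | ‖z - y‖ ≤ r} :=
      (isClosed_le (by fun_prop) continuous_const).measurableSet
    have h2 : outInt H A ν Q.base z =
        ∫ y in Q.baseᶜ ∩ {y | ‖z - y‖ ≤ r}, H (z - y) (A z - A y) ∂ν := by
      rw [outInt, ← setIntegral_eq_of_subset_of_forall_sdiff_eq_zero Q.measurableSet_base.compl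
        inter_subset_left fun y hy => ?_]
      refine hH.supp _ _ ?_
      by_contra h
      exact hy.2 ⟨hy.1, not_lt.1 h⟩
    rw [h2, ← Real.enorm_eq_ofReal_abs]
    refine (enorm_integral_le_lintegral_enorm _).trans ?_
    calc _ ≤ ∫⁻ _y in Q.baseᶜ ∩ {y | ‖z - y‖ ≤ r}, ENNReal.ofReal (B / ℓ ^ n) ∂ν := by
          refine lintegral_mono fun y => ?_
          rw [Real.enorm_eq_ofReal_abs]
          exact ENNReal.ofReal_le_ofReal (hH.bound _ _)
      _ = ENNReal.ofReal (B / ℓ ^ n) * ν (Q.baseᶜ ∩ {y | ‖z - y‖ ≤ r}) := setLIntegral_const _ _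
      _ ≤ ENNReal.ofReal (B / ℓ ^ n) *
          (ENNReal.ofReal M * volume (Q.baseᶜ ∩ {y | ‖z - y‖ ≤ r})) := by
          gcongr
          have := hν.le_volume (Q.baseᶜ ∩ {y | ‖z - y‖ ≤ r})
          rwa [Measure.smul_apply, smul_eq_mul] at this
      _ = _ := by
          rw [ENNReal.ofReal_mul (by positivity), mul_assoc]; rfl
  calc _ ≤ ∫⁻ z in Q.base, ENNReal.ofReal (B / ℓ ^ n * M) *
        volume {y | y ∉ Q.base ∧ ‖z - y‖ ≤ r} ∂ν := lintegral_mono h1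
    _ = ENNReal.ofReal (B / ℓ ^ n * M) *
        ∫⁻ z in Q.base, volume {y | y ∉ Q.base ∧ ‖z - y‖ ≤ r} ∂ν :=
        lintegral_const_mul' _ _ (by finiteness)
    _ ≤ ENNReal.ofReal (B / ℓ ^ n * M) * (ENNReal.ofReal M *
        (ENNReal.ofReal (n * r * (r ^ n * ballVol n)) * ENNReal.ofReal Q.side ^ (n - 1))) := by
        gcongr
        exact (hν.setLIntegral_le _ _).trans (by gcongr; exact lintegral_boundary_le Q hr0)
    _ = _ := by
        rw [← mul_assoc (ENNReal.ofReal M), ← ENNReal.ofReal_mul hM0, ← mul_assoc,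
          ← ENNReal.ofReal_mul (by positivity)]
        congr 2
        rw [hr, mul_pow _ ℓ, pow_succ (3 / 2 * √(n : ℝ))]
        field_simp

lemma integrableOn_outInt (hH : IsPiece n k B ℓ H) (hB : 0 ≤ B) (hℓ : 0 < ℓ)
    (hν : IsGraphPair lip M A ν) (Q : Cube n) : IntegrableOn (outInt H A ν Q.base) Q.base ν := by
  have := hν.isLocallyFiniteMeasure
  refine ⟨(hH.stronglyMeasurable_outInt hν.lipschitz.continuous _).aestronglyMeasurable, ?_⟩
  refine lt_of_le_of_lt ?_ (lt_of_le_of_lt (lintegral_outInt_le hH hB hℓ hν Q) (by finiteness))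
  exact lintegral_mono fun z => (Real.enorm_eq_ofReal_abs _).le

lemma integral_abs_outInt_le (hH : IsPiece n k B ℓ H) (hB : 0 ≤ B) (hℓ : 0 < ℓ)
    (hν : IsGraphPair lip M A ν) (Q : Cube n) (hQ : 0 ≤ Q.side) :
    ∫ z in Q.base, |outInt H A ν Q.base z| ∂ν ≤
      M ^ 2 * B * n * (3 / 2 * √(n : ℝ)) ^ (n + 1) * ballVol n * ℓ * Q.side ^ (n - 1) := by
  have hbv := ballVol_pos (n := n)
  have hM0 : 0 ≤ M := zero_le_one.trans hν.one_le
  have h := lintegral_outInt_le hH hB hℓ hν Q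
  rw [← ENNReal.ofReal_pow hQ, ← ENNReal.ofReal_mul (by positivity),
    ← ofReal_integral_eq_lintegral_ofReal (integrableOn_outInt hH hB hℓ hν Q).abs
    (ae_of_all _ fun z => abs_nonneg _)] at h
  exact (ENNReal.ofReal_le_ofReal_iff (by positivity)).1 h

/-- Since the kernel is odd, the interaction of `D` with itself cancels. -/
lemma integral_outInt_eq (hH : IsPiece n k B ℓ H) (hB : 0 ≤ B) (hℓ : 0 < ℓ)
    (hν : IsGraphPair lip M A ν) (Q : Cube n) (hQ : 0 ≤ Q.side) :
    ∫ z in Q.base, outInt H A ν Q.base z ∂ν = ∫ z in Q.base, pieceInt H A ν z ∂ν := by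
  have := hν.isLocallyFiniteMeasure
  have hA := hν.lipschitz.continuous
  have hfin : IsFiniteMeasure (ν.restrict Q.base) := ⟨by
    rw [Measure.restrict_apply_univ]
    exact (measure_mono (Cube.base_subset_window hQ)).trans_lt Q.isCompact_window.measure_lt_top⟩
  have hint : Integrable (fun q : Eu n × Eu n => H (q.1 - q.2) (A q.1 - A q.2))
      ((ν.restrict Q.base).prod (ν.restrict Q.base)) :=
    Integrable.of_bound (C := B / ℓ ^ n)
      (hH.continuous_comp (by fun_prop) (by fun_prop)).aestronglyMeasurable
      (ae_of_all _ fun q => hH.bound _ _)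
  set S : Eu n → ℝ := fun z => ∫ y in Q.base, H (z - y) (A z - A y) ∂ν with hS
  have hS0 : ∫ z in Q.base, S z ∂ν = 0 := by
    have h1 : ∫ z in Q.base, S z ∂ν = -∫ z in Q.base, S z ∂ν := by
      refine (integral_integral_swap (f := fun z y => H (z - y) (A z - A y)) hint).trans ?_
      rw [← integral_neg]
      refine integral_congr_ae (ae_of_all _ fun y => ?_)
      refine Eq.trans ?_ (integral_neg fun z => H (y - z) (A y - A z))
      refine integral_congr_ae (ae_of_all _ fun z => ?_)
      simp only
      rw [← neg_sub y z, ← neg_sub (A y) (A z), hH.odd]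
    linarith
  have h2 : ∀ z, pieceInt H A ν z = S z + outInt H A ν Q.base z := fun z =>
    (integral_add_compl Q.measurableSet_base (hH.integrable_shift hA ν z)).symm
  simp only [h2]
  rw [integral_add hint.integral_prod_left (integrableOn_outInt hH hB hℓ hν Q), hS0, zero_add]

end Out

/-! ### Truncated integrals and integrals over the complement of a cube -/

section Measurability

variable {B ℓ : ℝ} {H : Eu n → Eu k → ℝ} {A : Eu n → Eu k} {ν : Measure (Eu n)}

lemma IsPiece.stronglyMeasurable_pieceInt (hH : IsPiece n k B ℓ H) (hA : Continuous A)
    [SFinite ν] : StronglyMeasurable (pieceInt H A ν) := by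
  have h : Continuous fun q : Eu n × Eu n => H (q.1 - q.2) (A q.1 - A q.2) :=
    hH.continuous_comp (by fun_prop) (by fun_prop)
  exact h.stronglyMeasurable.integral_prod_right'

lemma integrable_tsum_of_summable {α : Type*} [MeasurableSpace α] {τ : Measure α} {F : ℕ → α → ℝ}
    (hF : ∀ i, Integrable (F i) τ) (hs : Summable fun i => ∫ a, |F i a| ∂τ) :
    Integrable (fun a => ∑' i, F i a) τ := by
  have hlt : ∫⁻ a, ∑' i, ‖F i a‖ₑ ∂τ < ∞ := by
    rw [lintegral_tsum fun i => (hF i).1.enorm]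
    have h1 : ∀ i, ∫⁻ a, ‖F i a‖ₑ ∂τ = ENNReal.ofReal (∫ a, |F i a| ∂τ) := fun i => by
      rw [ofReal_integral_eq_lintegral_ofReal (hF i).abs (ae_of_all _ fun a => abs_nonneg _)]
      simp only [Real.enorm_eq_ofReal_abs]
    simp only [h1]
    rw [← ENNReal.ofReal_tsum_of_nonneg (fun i => integral_nonneg fun a => abs_nonneg _) hs]
    exact ENNReal.ofReal_lt_top
  have hae : ∀ᵐ a ∂τ, Summable fun i => F i a := by
    filter_upwards [ae_lt_top' (AEMeasurable.tsum fun i => (hF i).1.enorm) hlt.ne]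
      with a ha
    refine Summable.of_norm ?_
    have h2 : (∑' i, ((‖F i a‖₊ : ℝ≥0) : ℝ≥0∞)) ≠ ∞ := ha.ne
    exact NNReal.summable_coe.2 (ENNReal.tsum_coe_ne_top_iff_summable.1 h2)
  refine ⟨aestronglyMeasurable_of_tendsto_ae atTop
    (fun N => (integrable_finsetSum (Finset.range N) fun i _ => hF i).1) ?_, ?_⟩
  · filter_upwards [hae] with a ha
    exact ha.hasSum.tendsto_sum_nat
  · refine lt_of_le_of_lt (lintegral_mono_ae ?_) hlt
    filter_upwards [hae] with a ha
    exact enorm_tsum_le_tsum_enorm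

end Measurability

lemma measurableEmbedding_graphMap {A : Eu n → Eu k} (hA : Continuous A) :
    MeasurableEmbedding (graphMap A) := by
  have hG : Continuous (graphMap A) := by unfold graphMap; fun_prop
  exact (Function.LeftInverse.isClosedEmbedding (f := tilde)
    (fun u => by rw [graphMap, tilde_join]) continuous_tilde hG).measurableEmbedding

lemma hasLimInt_map {A : Eu n → Eu k} (hA : Continuous A) {τ : Measure (Eu n)}
    {g : Eu (n + k) → ℝ} {z : Eu n} {l : ℝ}
    (hi : ∀ R, IntegrableOn (fun y => g (graphMap A y)) (graphBall A z R) τ)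
    (hl : Tendsto (fun R => ∫ y in graphBall A z R, g (graphMap A y) ∂τ) atTop (𝓝 l)) :
    HasLimInt (τ.map (graphMap A)) g (graphMap A z) ∧
      limInt (τ.map (graphMap A)) g (graphMap A z) = l := by
  have hG := measurableEmbedding_graphMap hA
  have h1 : ∀ R : ℝ, ∫ y in Metric.ball (graphMap A z) R, g y ∂(τ.map (graphMap A)) =
      ∫ y in graphBall A z R, g (graphMap A y) ∂τ := fun R => hG.setIntegral_map _ _
  have h2 : Tendsto (fun R : ℝ => ∫ y in Metric.ball (graphMap A z) R, g y ∂(τ.map (graphMap A)))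
      atTop (𝓝 l) := by simpa only [h1] using hl
  exact ⟨⟨fun R => hG.integrableOn_map_iff.2 (hi R), l, h2⟩, h2.limUnder_eq⟩

section Limits

variable {φ : ℝ → ℝ} {K : Eu (n + k) → ℝ} {lip : ℝ≥0} {M ρ : ℝ} {A : Eu n → Eu k}
  {ν : Measure (Eu n)}

lemma hasLimInt_smoothTrunc (hφ : IsProfile n φ) (hn : 0 < n) (hK : IsKernel n k K)
    (hν : IsGraphPair lip M A ν) (hρ : 0 ≤ ρ) (hF : FlatOutside ρ A ν) {ε : ℝ} (hε : 0 < ε)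
    (z : Eu n) :
    HasLimInt (ν.map (graphMap A)) (fun y => phiEps φ ε (graphMap A z - y) * K (graphMap A z - y))
      (graphMap A z) ∧
    smoothTrunc K φ (ν.map (graphMap A)) ε (graphMap A z) = truncLim K φ A ν ρ ε z := by
  have := hν.isLocallyFiniteMeasure
  have hA := hν.lipschitz.continuous
  have h1 : ∀ y, phiEps φ ε (graphMap A z - graphMap A y) * K (graphMap A z - graphMap A y) =
      trunc K φ ε (z - y) (A z - A y) := fun y => by
    rw [graphMap, graphMap, ← join_sub, phiEps, tilde_join, trunc]
  refine hasLimInt_map hA (fun R => ?_) ?_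
  · simp only [h1]
    exact integrableOn_of_continuous (continuous_trunc_comp hφ hn hK hε (by fun_prop)
      (by fun_prop)) (isCompact_closedBall z R) (graphBall_subset A z R)
  · simp only [h1]
    exact tendsto_trunc hφ hn hK hν hρ hF hε z

lemma stronglyMeasurable_truncLim (hφ : IsProfile n φ) (hn : 0 < n) (hK : IsKernel n k K)
    (hν : IsGraphPair lip M A ν) (hρ : 0 ≤ ρ) (hF : FlatOutside ρ A ν) {ε : ℝ} (hε : 0 < ε) :
    StronglyMeasurable (truncLim K φ A ν ρ ε) := by
  have := hν.isLocallyFiniteMeasure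
  obtain ⟨B, -, hp⟩ := exists_isPiece hφ hn hK
  refine stronglyMeasurable_of_tendsto atTop (fun N => ?_)
    (tendsto_pi_nhds.2 fun z => tendsto_sum_pieceInt hφ hn hK hν hρ hF hε z)
  exact Finset.stronglyMeasurable_fun_sum _ fun i _ =>
    (hp (2 ^ i * ε) (by positivity)).stronglyMeasurable_pieceInt hν.lipschitz.continuous

lemma trunc_div_two_pow (K : Eu (n + k) → ℝ) (φ : ℝ → ℝ) (ε : ℝ) (N : ℕ) (u : Eu n) (v : Eu k) :
    trunc K φ (ε / 2 ^ N) u v =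
      trunc K φ ε u v + ∑ i ∈ Finset.range N, piece K φ (ε / 2 ^ (i + 1)) u v := by
  induction N with
  | zero => simp
  | succ N ih =>
    have h := trunc_sub_trunc K φ (ε / 2 ^ (N + 1)) u v
    rw [show 2 * (ε / 2 ^ (N + 1)) = ε / 2 ^ N by rw [pow_succ]; field_simp] at h
    rw [Finset.sum_range_succ, ← add_assoc, ← ih]
    linarith

/-- The integral over the complement of a cube, at an interior point: the smooth truncation at the
scale of the cube plus the contributions of the smaller pieces from outside the cube. -/
lemma hasLimInt_outer (hφ : IsProfile n φ) (hn : 0 < n) (hK : IsKernel n k K)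
    (hν : IsGraphPair lip M A ν) (hρ : 0 ≤ ρ) (hF : FlatOutside ρ A ν) {Q : Cube n}
    (hQ : 0 < Q.side) {z : Eu n} {δ : ℝ} (hδ : 0 < δ) (hz : Metric.ball z δ ⊆ Q.base) :
    HasLimInt ((ν.map (graphMap A)).restrict (Q.vset k)ᶜ) (fun y => K (graphMap A z - y))
      (graphMap A z) ∧
    outerInt K (ν.map (graphMap A)) (Q.vset k) (graphMap A z) = truncLim K φ A ν ρ Q.side z +
      ∑' i : ℕ, outInt (piece K φ (Q.side / 2 ^ (i + 1))) A ν Q.base z := by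
  have := hν.isLocallyFiniteMeasure
  have hA := hν.lipschitz.continuous
  have hσ := one_le_sqrt_dim hn
  obtain ⟨B, -, hp⟩ := exists_isPiece hφ hn hK
  set ε := Q.side with hε
  have hzQ : z ∈ Q.base := hz (Metric.mem_ball_self hδ)
  have hfar : ∀ y ∉ Q.base, δ ≤ ‖z - y‖ := fun y hy => by
    by_contra h
    exact hy (hz (by rwa [Metric.mem_ball, dist_comm, dist_eq_norm, ← not_le]))
  have hnear : ∀ y ∈ Q.base, ∀ v : Eu k, trunc K φ ε (z - y) v = 0 := fun y hy v => by
    refine trunc_eq_zero hφ hQ ?_ v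
    have h1 := Cube.norm_sub_center_le hQ.le hzQ
    have h2 := Cube.norm_sub_center_le hQ.le hy
    have h3 : ‖z - y‖ ≤ ‖z - Q.center‖ + ‖y - Q.center‖ := by
      rw [show z - y = (z - Q.center) - (y - Q.center) by abel]; exact norm_sub_le _ _
    rw [← hε] at h1 h2
    nlinarith [show 0 < √(n : ℝ) * ε by positivity]
  obtain ⟨N, hN⟩ : ∃ N : ℕ, 3 * √(n : ℝ) * ε / 2 ^ N < δ := by
    have h1 : Tendsto (fun N : ℕ => 3 * √(n : ℝ) * ε / 2 ^ N) atTop (𝓝 0) :=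
      tendsto_const_nhds.div_atTop (tendsto_pow_atTop_atTop_of_one_lt one_lt_two)
    exact (h1.eventually_lt_const hδ).exists
  have hmap : (ν.map (graphMap A)).restrict (Q.vset k)ᶜ =
      (ν.restrict Q.baseᶜ).map (graphMap A) := by
    have hm : MeasurableSet (Q.vset k)ᶜ := (measurable_tilde Q.measurableSet_base).compl
    rw [Measure.restrict_map (measurableEmbedding_graphMap hA).measurable hm]
    congr 2
    ext u
    change ¬ (tilde (graphMap A u) ∈ Q.base) ↔ u ∉ Q.base
    rw [graphMap, tilde_join]
  have hker : ∀ y ∉ Q.base, K (graphMap A z - graphMap A y) =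
      trunc K φ (ε / 2 ^ N) (z - y) (A z - A y) := fun y hy => by
    rw [graphMap, graphMap, ← join_sub, trunc_eq hφ (by positivity)]
    refine le_trans (le_of_eq ?_) (hN.le.trans (hfar y hy))
    ring
  have hzero : ∀ i, i ∉ Finset.range N →
      outInt (piece K φ (ε / 2 ^ (i + 1))) A ν Q.base z = 0 := fun i hi => by
    refine setIntegral_eq_zero_of_forall_eq_zero fun y hy => ?_
    refine (hp (ε / 2 ^ (i + 1)) (by positivity)).supp _ _ (lt_of_lt_of_le ?_ (hfar y hy))
    have hi' : N ≤ i := not_lt.1 fun h => hi (Finset.mem_range.2 h)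
    calc 3 / 2 * √(n : ℝ) * (4 * (ε / 2 ^ (i + 1))) = 3 * √(n : ℝ) * ε / 2 ^ i := by
          rw [pow_succ]; field_simp; ring
      _ ≤ 3 * √(n : ℝ) * ε / 2 ^ N := by
          gcongr
          norm_num
      _ < δ := hN
  rw [outerInt, hmap]
  have hbc := Q.measurableSet_base.compl
  refine hasLimInt_map hA (fun R => ?_) ?_
  · have h1 : IntegrableOn (fun y => trunc K φ (ε / 2 ^ N) (z - y) (A z - A y)) (graphBall A z R)
        (ν.restrict Q.baseᶜ) :=
      (integrableOn_of_continuous (continuous_trunc_comp hφ hn hK (by positivity) (by fun_prop)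
        (by fun_prop)) (isCompact_closedBall z R) (graphBall_subset A z R)).mono_measure
        Measure.restrict_le_self
    refine h1.congr ?_
    have h2 : ∀ᵐ y ∂((ν.restrict Q.baseᶜ).restrict (graphBall A z R)), y ∈ Q.baseᶜ :=
      ae_restrict_of_ae (ae_restrict_mem hbc)
    filter_upwards [h2] with y hy
    exact (hker y hy).symm
  · rw [tsum_eq_sum hzero]
    have h1 : ∀ i ∈ Finset.range N, Tendsto (fun R => ∫ y in graphBall A z R,
        Q.baseᶜ.indicator (fun y => piece K φ (ε / 2 ^ (i + 1)) (z - y) (A z - A y)) y ∂ν) atTop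
        (𝓝 (outInt (piece K φ (ε / 2 ^ (i + 1))) A ν Q.base z)) := fun i _ => by
      refine tendsto_const_nhds.congr' ?_
      filter_upwards [tendsto_of_supp hν (g := Q.baseᶜ.indicator
        (fun y => piece K φ (ε / 2 ^ (i + 1)) (z - y) (A z - A y))) (z := z)
        (r := 3 / 2 * √(n : ℝ) * (4 * (ε / 2 ^ (i + 1)))) (fun y hy => by
          rw [indicator_apply_eq_zero]
          exact fun _ => (hp (ε / 2 ^ (i + 1)) (by positivity)).supp _ _ hy)] with R hR
      rw [hR, integral_indicator hbc, outInt]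
    refine ((tendsto_trunc hφ hn hK hν hρ hF hQ z).add (tendsto_finsetSum _ h1)).congr fun R => ?_
    have hi1 : IntegrableOn (fun y => trunc K φ ε (z - y) (A z - A y)) (graphBall A z R) ν :=
      integrableOn_of_continuous (continuous_trunc_comp hφ hn hK hQ (by fun_prop)
        (by fun_prop)) (isCompact_closedBall z R) (graphBall_subset A z R)
    have hi2 : ∀ i ∈ Finset.range N, IntegrableOn (Q.baseᶜ.indicator
        (fun y => piece K φ (ε / 2 ^ (i + 1)) (z - y) (A z - A y))) (graphBall A z R) ν :=
      fun i _ => (((hp (ε / 2 ^ (i + 1)) (by positivity)).integrable_shift hA ν z).indicator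
        hbc).integrableOn
    rw [← integral_finsetSum _ hi2, ← integral_add hi1 (integrable_finsetSum _ hi2),
      Measure.restrict_restrict (measurableSet_graphBall hA z R), inter_comm,
      ← Measure.restrict_restrict hbc, ← integral_indicator hbc]
    refine integral_congr_ae (ae_of_all _ fun y => ?_)
    by_cases hy : y ∈ Q.base
    · have hy' : y ∉ Q.baseᶜ := fun h => h hy
      simp only [hnear y hy, indicator_of_notMem hy', Finset.sum_const_zero, add_zero]
    · simp only [indicator_of_mem (mem_compl hy)]
      rw [hker y hy, trunc_div_two_pow]

/-- Almost every point of a cube is an interior point. -/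
lemma ae_interior (hν : IsGraphPair lip M A ν) (Q : Cube n) :
    ∀ᵐ z ∂(ν.restrict Q.base), ∃ δ : ℝ, 0 < δ ∧ Metric.ball z δ ⊆ Q.base := by
  have hconv : Convex ℝ Q.base := by
    intro u hu v hv a b ha hb hab i
    have h1 := hu i
    have h2 := hv i
    simp only [PiLp.add_apply, PiLp.smul_apply, smul_eq_mul]
    have e : ∀ t : ℝ, t = a * t + b * t := fun t => by rw [← add_mul, hab, one_mul]
    constructor
    · rw [e (Q.corner i)]
      exact add_le_add (mul_le_mul_of_nonneg_left h1.1 ha) (mul_le_mul_of_nonneg_left h2.1 hb)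
    · rw [e (Q.corner i + Q.side)]
      rcases ha.eq_or_lt with h0 | h0
      · have hb1 : b = 1 := by linarith
        rw [← h0, hb1]; linarith [h2.2]
      · exact add_lt_add_of_lt_of_le (mul_lt_mul_of_pos_left h1.2 h0)
          (mul_le_mul_of_nonneg_left h2.2.le hb)
  have h0 : ν (frontier Q.base) = 0 := by
    have := hν.le_volume (frontier Q.base)
    rw [Measure.smul_apply, hconv.addHaar_frontier volume, smul_zero] at this
    exact le_antisymm this zero_le
  have h1 : ∀ᵐ z ∂(ν.restrict Q.base), z ∉ frontier Q.base :=
    ae_restrict_of_ae (measure_eq_zero_iff_ae_notMem.1 h0)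
  filter_upwards [h1, ae_restrict_mem Q.measurableSet_base] with z hz hzQ
  have hzi : z ∈ interior Q.base := by
    by_contra h
    exact hz ⟨subset_closure hzQ, h⟩
  obtain ⟨δ, hδ, hb⟩ := Metric.isOpen_iff.1 isOpen_interior z hzi
  exact ⟨δ, hδ, hb.trans interior_subset⟩

end Limits

/-! ### Means over cubes -/

lemma summable_succ_div_two_pow : Summable fun i : ℕ => ((i : ℝ) + 2) / 2 ^ i := by
  have h1 := summable_pow_mul_geometric_of_norm_lt_one 1 (r := (1 / 2 : ℝ)) (by norm_num)
  have h2 := (summable_geometric_two).mul_left 2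
  refine (h1.add h2).congr fun i => ?_
  rw [pow_one, one_div, inv_pow]; ring

/-- Differences of the truncated integrals at two points whose distance is at most comparable with
the truncation radius. -/
lemma exists_truncLim_sub_le (n k : ℕ) (hn : 0 < n) (lip : ℝ≥0) (M : ℝ) {φ : ℝ → ℝ}
    (hφ : IsProfile n φ) {K : Eu (n + k) → ℝ} (hK : IsKernel n k K) :
    ∃ C : ℝ, 0 ≤ C ∧ ∀ (A : Eu n → Eu k) (ν : Measure (Eu n)), IsGraphPair lip M A ν →
      ∀ ρ : ℝ, 0 ≤ ρ → FlatOutside ρ A ν → ∀ (j : ℤ) (x z : Eu n),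
      ‖x - z‖ ≤ √(n : ℝ) * 2 ^ (-j) / 4 →
      ENNReal.ofReal |truncLim K φ A ν ρ (2 ^ (-j) / 4) x - truncLim K φ A ν ρ (2 ^ (-j) / 4) z| ≤
        ∑' i : ℕ, ENNReal.ofReal (C / 2 ^ i *
          (∑ l ∈ Finset.range (i + 1), jones A ν (j - l) x +
            ‖affErr (dyad j x) A z‖ / 2 ^ (-j))) := by
  obtain ⟨B, hB, hp⟩ := exists_isPiece hφ hn hK
  obtain ⟨C, hC, far⟩ := exists_far_dyad_le n k hn lip M B (by linarith)
  refine ⟨C, hC, fun A ν hν ρ hρ hF j x z hxz => ?_⟩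
  set ε : ℝ := 2 ^ (-j) / 4 with hε
  have hε0 : 0 < ε := by rw [hε]; positivity
  have hpc : ∀ i : ℕ, IsPiece n k B (2 ^ (-(j - i))) (piece K φ (2 ^ i * ε)) := fun i => by
    have h := hp (2 ^ i * ε) (by positivity)
    rwa [show 4 * (2 ^ i * ε) = (2 : ℝ) ^ (-(j - i)) by
      rw [neg_sub, sub_eq_add_neg, zpow_add₀ two_ne_zero, zpow_natCast, hε]; ring] at h
  have hlim := (tendsto_sum_pieceInt hφ hn hK hν hρ hF hε0 x).sub
    (tendsto_sum_pieceInt hφ hn hK hν hρ hF hε0 z)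
  refine le_of_tendsto' (ENNReal.tendsto_ofReal hlim.abs) fun N => ?_
  rw [← Finset.sum_sub_distrib]
  calc _ ≤ ENNReal.ofReal (∑ i ∈ Finset.range N, |pieceInt (piece K φ (2 ^ i * ε)) A ν x -
        pieceInt (piece K φ (2 ^ i * ε)) A ν z|) :=
        ENNReal.ofReal_le_ofReal (Finset.abs_sum_le_sum_abs _ _)
    _ = ∑ i ∈ Finset.range N, ENNReal.ofReal |pieceInt (piece K φ (2 ^ i * ε)) A ν x -
        pieceInt (piece K φ (2 ^ i * ε)) A ν z| :=
        ENNReal.ofReal_sum_of_nonneg fun i _ => abs_nonneg _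
    _ ≤ ∑ i ∈ Finset.range N, ENNReal.ofReal (C / 2 ^ i *
          (∑ l ∈ Finset.range (i + 1), jones A ν (j - l) x +
            ‖affErr (dyad j x) A z‖ / 2 ^ (-j))) :=
        Finset.sum_le_sum fun i _ => ENNReal.ofReal_le_ofReal
          (far A ν hν j i _ (hpc i) x z hxz)
    _ ≤ _ := ENNReal.sum_le_tsum _

lemma exists_truncLim_sub_le_const (n k : ℕ) (hn : 0 < n) (lip : ℝ≥0) (M : ℝ) {φ : ℝ → ℝ}
    (hφ : IsProfile n φ) {K : Eu (n + k) → ℝ} (hK : IsKernel n k K) :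
    ∃ C : ℝ, 0 ≤ C ∧ ∀ (A : Eu n → Eu k) (ν : Measure (Eu n)), IsGraphPair lip M A ν →
      ∀ ρ : ℝ, 0 ≤ ρ → FlatOutside ρ A ν → ∀ (j : ℤ) (x z : Eu n),
      ‖x - z‖ ≤ √(n : ℝ) * 2 ^ (-j) / 4 →
      |truncLim K φ A ν ρ (2 ^ (-j) / 4) x - truncLim K φ A ν ρ (2 ^ (-j) / 4) z| ≤ C := by
  obtain ⟨C, hC, h⟩ := exists_truncLim_sub_le n k hn lip M hφ hK
  obtain ⟨C₁, hC₁, h₁⟩ := exists_jones_le n k hn lip M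
  refine ⟨∑' i : ℕ, C * C₁ * (((i : ℝ) + 2) / 2 ^ i), tsum_nonneg fun i => by positivity,
    fun A ν hν ρ hρ hF j x z hxz => ?_⟩
  rw [← ENNReal.ofReal_le_ofReal_iff (tsum_nonneg fun i => by positivity),
    ENNReal.ofReal_tsum_of_nonneg (fun i => by positivity)
    (summable_succ_div_two_pow.mul_left _)]
  refine (h A ν hν ρ hρ hF j x z hxz).trans (ENNReal.tsum_le_tsum fun i =>
    ENNReal.ofReal_le_ofReal ?_)
  have hσ := one_le_sqrt_dim hn
  have hz : z ∈ (dyad j x).window := by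
    rw [Cube.window, Metric.mem_closedBall, dist_eq_norm, dyad_side]
    have h2 := norm_sub_center_dyad_le j x
    have h3 : ‖z - (dyad j x).center‖ ≤ ‖x - (dyad j x).center‖ + ‖x - z‖ := by
      rw [show z - (dyad j x).center = (x - (dyad j x).center) - (x - z) by abel]
      exact norm_sub_le _ _
    nlinarith [show 0 < √(n : ℝ) * 2 ^ (-j) by positivity]
  have h4 := (h₁ A ν hν j x).2 z hz
  have h5 : ∑ l ∈ Finset.range (i + 1), jones A ν (j - l) x ≤ (i + 1) * C₁ := by
    calc _ ≤ ∑ _l ∈ Finset.range (i + 1), C₁ :=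
          Finset.sum_le_sum fun l _ => (h₁ A ν hν (j - l) x).1
      _ = _ := by simp
  calc _ ≤ C / 2 ^ i * ((i + 1) * C₁ + C₁) := by gcongr
    _ = _ := by ring

lemma Cube.corner_mem {Q : Cube n} (hQ : 0 < Q.side) : Q.corner ∈ Q.base := fun i =>
  ⟨le_rfl, by linarith⟩

lemma Cube.norm_sub_le {Q : Cube n} (hQ : 0 ≤ Q.side) {x z : Eu n} (hx : x ∈ Q.base)
    (hz : z ∈ Q.base) : ‖x - z‖ ≤ √(n : ℝ) * Q.side := by
  refine norm_le_of_coord hQ fun i => ?_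
  have h1 := hx i
  have h2 := hz i
  rw [PiLp.sub_apply, abs_le]
  constructor <;> linarith [h1.1, h1.2, h2.1, h2.2]

section Means

variable {φ : ℝ → ℝ} {K : Eu (n + k) → ℝ} {lip : ℝ≥0} {M ρ : ℝ} {A : Eu n → Eu k}
  {ν : Measure (Eu n)}

lemma IsGraphPair.isFiniteMeasure_restrict (hν : IsGraphPair lip M A ν) (Q : Cube n)
    (hQ : 0 ≤ Q.side) : IsFiniteMeasure (ν.restrict Q.base) := by
  have := hν.isLocallyFiniteMeasure
  refine ⟨?_⟩
  rw [Measure.restrict_apply_univ]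
  exact (measure_mono (Cube.base_subset_window hQ)).trans_lt Q.isCompact_window.measure_lt_top

lemma integrableOn_truncLim (hφ : IsProfile n φ) (hn : 0 < n) (hK : IsKernel n k K)
    (hν : IsGraphPair lip M A ν) (hρ : 0 ≤ ρ) (hF : FlatOutside ρ A ν) {Q : Cube n} {j : ℤ}
    (hQ : Q.side = 2 ^ (-j) / 4) : IntegrableOn (truncLim K φ A ν ρ Q.side) Q.base ν := by
  obtain ⟨C, hC, h⟩ := exists_truncLim_sub_le_const n k hn lip M hφ hK
  have hQ0 : 0 < Q.side := by rw [hQ]; positivity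
  have := hν.isFiniteMeasure_restrict Q hQ0.le
  refine Integrable.of_bound (C := |truncLim K φ A ν ρ Q.side Q.corner| + C)
    (stronglyMeasurable_truncLim hφ hn hK hν hρ hF hQ0).aestronglyMeasurable ?_
  filter_upwards [ae_restrict_mem Q.measurableSet_base] with z hz
  have h1 := h A ν hν ρ hρ hF j z Q.corner (by
    refine (Cube.norm_sub_le hQ0.le hz (Cube.corner_mem hQ0)).trans (le_of_eq ?_)
    rw [hQ]; ring)
  rw [← hQ] at h1
  rw [Real.norm_eq_abs]
  have h2 := abs_sub_abs_le_abs_sub (truncLim K φ A ν ρ Q.side z)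
    (truncLim K φ A ν ρ Q.side Q.corner)
  linarith

lemma exists_integral_abs_outInt_le (hφ : IsProfile n φ) (hn : 0 < n) (hK : IsKernel n k K)
    (M : ℝ) : ∃ C : ℝ, 0 ≤ C ∧ ∀ (lip : ℝ≥0) (A : Eu n → Eu k) (ν : Measure (Eu n)),
      IsGraphPair lip M A ν → ∀ (Q : Cube n), 0 < Q.side → ∀ i : ℕ,
      IntegrableOn (outInt (piece K φ (Q.side / 2 ^ (i + 1))) A ν Q.base) Q.base ν ∧
      ∫ z in Q.base, |outInt (piece K φ (Q.side / 2 ^ (i + 1))) A ν Q.base z| ∂ν ≤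
        C * Q.side ^ n * (1 / 2) ^ i := by
  obtain ⟨B, hB, hp⟩ := exists_isPiece hφ hn hK
  have hbv := ballVol_pos (n := n)
  refine ⟨M ^ 2 * B * n * (3 / 2 * √(n : ℝ)) ^ (n + 1) * ballVol n * 2, by positivity,
    fun lip A ν hν Q hQ i => ?_⟩
  have hH := hp (Q.side / 2 ^ (i + 1)) (by positivity)
  refine ⟨integrableOn_outInt hH (by linarith) (by positivity) hν Q,
    (integral_abs_outInt_le hH (by linarith) (by positivity) hν Q hQ.le).trans (le_of_eq ?_)⟩
  have h1 : Q.side ^ n = Q.side * Q.side ^ (n - 1) := by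
    rw [← pow_succ', Nat.sub_add_cancel hn]
  rw [h1, one_div, inv_pow, pow_succ 2 i]
  field_simp
  ring

/-- Integral over a cube of the integral over its complement. -/
lemma setIntegral_outer (hφ : IsProfile n φ) (hn : 0 < n) (hK : IsKernel n k K)
    (hν : IsGraphPair lip M A ν) (hρ : 0 ≤ ρ) (hF : FlatOutside ρ A ν) {Q : Cube n} {j : ℤ}
    (hQ : Q.side = 2 ^ (-j) / 4) :
    IntegrableOn (fun z => outerInt K (ν.map (graphMap A)) (Q.vset k) (graphMap A z)) Q.base ν ∧
    ∫ z in Q.base, outerInt K (ν.map (graphMap A)) (Q.vset k) (graphMap A z) ∂ν =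
      (∫ z in Q.base, truncLim K φ A ν ρ Q.side z ∂ν) +
      ∑' i : ℕ, ∫ z in Q.base, pieceInt (piece K φ (Q.side / 2 ^ (i + 1))) A ν z ∂ν := by
  have hQ0 : 0 < Q.side := by rw [hQ]; positivity
  obtain ⟨B, hB, hp⟩ := exists_isPiece hφ hn hK
  obtain ⟨C, hC, hout⟩ := exists_integral_abs_outInt_le hφ hn hK M
  have hi := fun i => (hout lip A ν hν Q hQ0 i).1
  have hs : Summable fun i : ℕ =>
      ∫ z in Q.base, |outInt (piece K φ (Q.side / 2 ^ (i + 1))) A ν Q.base z| ∂ν :=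
    Summable.of_nonneg_of_le (fun i => integral_nonneg fun z => abs_nonneg _)
      (fun i => (hout lip A ν hν Q hQ0 i).2) (summable_geometric_two.mul_left _)
  have hae : (fun z => outerInt K (ν.map (graphMap A)) (Q.vset k) (graphMap A z))
      =ᵐ[ν.restrict Q.base] fun z => truncLim K φ A ν ρ Q.side z +
        ∑' i : ℕ, outInt (piece K φ (Q.side / 2 ^ (i + 1))) A ν Q.base z := by
    filter_upwards [ae_interior hν Q] with z hz
    obtain ⟨δ, hδ, hb⟩ := hz
    exact (hasLimInt_outer hφ hn hK hν hρ hF hQ0 hδ hb).2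
  have i1 := integrableOn_truncLim hφ hn hK hν hρ hF hQ
  have i2 := integrable_tsum_of_summable hi hs
  refine ⟨(i1.add i2).congr hae.symm, ?_⟩
  rw [integral_congr_ae hae, integral_add i1 i2,
    ← integral_tsum_of_summable_integral_norm hi (by simpa only [Real.norm_eq_abs] using hs)]
  congr 2 with i
  exact integral_outInt_eq (hp (Q.side / 2 ^ (i + 1)) (by positivity)) (by linarith)
    (by positivity) hν Q hQ0.le

lemma graphMap_preimage_vset (A : Eu n → Eu k) (Q : Cube n) :
    graphMap A ⁻¹' Q.vset k = Q.base := by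
  ext u
  change tilde (graphMap A u) ∈ Q.base ↔ u ∈ Q.base
  rw [graphMap, tilde_join]

/-- The mean over a v-cube, in terms of integrals over the base. -/
lemma cubeMean_eq (hφ : IsProfile n φ) (hn : 0 < n) (hK : IsKernel n k K)
    (hν : IsGraphPair lip M A ν) (hρ : 0 ≤ ρ) (hF : FlatOutside ρ A ν) {Q : Cube n} {j : ℤ}
    (hQ : Q.side = 2 ^ (-j) / 4) :
    cubeMean K (ν.map (graphMap A)) (Q.vset k) = (ν.real Q.base)⁻¹ *
      ((∫ z in Q.base, truncLim K φ A ν ρ Q.side z ∂ν) +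
      ∑' i : ℕ, ∫ z in Q.base, pieceInt (piece K φ (Q.side / 2 ^ (i + 1))) A ν z ∂ν) := by
  have hG := measurableEmbedding_graphMap hν.lipschitz.continuous
  rw [cubeMean, hG.setIntegral_map, Measure.real, hG.map_apply, graphMap_preimage_vset,
    (setIntegral_outer hφ hn hK hν hρ hF hQ).2, Measure.real]

/-- The limits and the integrals over v-cubes that define the martingale exist. -/
lemma wellDefined_outer (hφ : IsProfile n φ) (hn : 0 < n) (hK : IsKernel n k K)
    (hν : IsGraphPair lip M A ν) (hρ : 0 ≤ ρ) (hF : FlatOutside ρ A ν) {Q : Cube n} {j : ℤ}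
    (hQ : Q.side = 2 ^ (-j) / 4) :
    (∀ᵐ z ∂((ν.map (graphMap A)).restrict (Q.vset k)),
      HasLimInt ((ν.map (graphMap A)).restrict (Q.vset k)ᶜ) (fun y => K (z - y)) z) ∧
    IntegrableOn (outerInt K (ν.map (graphMap A)) (Q.vset k)) (Q.vset k)
      (ν.map (graphMap A)) := by
  have hQ0 : 0 < Q.side := by rw [hQ]; positivity
  have hG := measurableEmbedding_graphMap hν.lipschitz.continuous
  have hm : MeasurableSet (Q.vset k) := measurable_tilde Q.measurableSet_base
  constructor
  · rw [Measure.restrict_map hG.measurable hm, hG.ae_map_iff, graphMap_preimage_vset]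
    filter_upwards [ae_interior hν Q] with z hz
    obtain ⟨δ, hδ, hb⟩ := hz
    exact (hasLimInt_outer hφ hn hK hν hρ hF hQ0 hδ hb).1
  · rw [hG.integrableOn_map_iff, graphMap_preimage_vset]
    exact (setIntegral_outer hφ hn hK hν hρ hF hQ).1

end Means

/-! ### Averages over the translates of a cube -/

/-- The corners `a` of the cubes of side `s` that contain `x`. -/
def corners (s : ℝ) (x : Eu n) : Set (Eu n) := {a | x ∈ (Cube.mk a s).base}

/-- The reciprocal of the mass of the cube with corner `a` and side `s`. -/
noncomputable def recipMass (ν : Measure (Eu n)) (s : ℝ) (a : Eu n) : ℝ :=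
  (ν.real (Cube.mk a s).base)⁻¹

/-- The density of the average, over all the cubes of side `s` that contain `x`, of the normalized
restrictions of `ν` to these cubes (up to the factor `s ^ n`). -/
noncomputable def avgWeight (ν : Measure (Eu n)) (s : ℝ) (x z : Eu n) : ℝ :=
  ∫ a in corners s x, (corners s z).indicator (recipMass ν s) a

lemma mem_base_iff_sub {s : ℝ} {a x : Eu n} :
    x ∈ (Cube.mk a s).base ↔ x - a ∈ (Cube.mk (0 : Eu n) s).base := by
  refine forall_congr' fun i => ?_
  simp only [PiLp.sub_apply, PiLp.zero_apply, zero_add, sub_nonneg, sub_lt_iff_lt_add']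

lemma measurableSet_base_prod (s : ℝ) :
    MeasurableSet {q : Eu n × Eu n | q.2 ∈ (Cube.mk q.1 s).base} := by
  have h : {q : Eu n × Eu n | q.2 ∈ (Cube.mk q.1 s).base} =
      (fun q => q.2 - q.1) ⁻¹' (Cube.mk (0 : Eu n) s).base := by
    ext q
    exact mem_base_iff_sub
  rw [h]
  exact (measurable_snd.sub measurable_fst) (Cube.measurableSet_base _)

lemma corners_eq_preimage (s : ℝ) (x : Eu n) :
    corners s x = (fun a => x - a) ⁻¹' (Cube.mk (0 : Eu n) s).base := by
  ext a
  exact mem_base_iff_sub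

lemma measurableSet_corners (s : ℝ) (x : Eu n) : MeasurableSet (corners s x) := by
  rw [corners_eq_preimage]
  exact (measurable_const.sub measurable_id) (Cube.measurableSet_base _)

lemma volume_corners (s : ℝ) (x : Eu n) : volume (corners s x) = ENNReal.ofReal s ^ n := by
  rw [corners_eq_preimage, (Measure.measurePreserving_sub_left volume x).measure_preimage
    (Cube.measurableSet_base _).nullMeasurableSet, Cube.volume_base]

lemma volume_real_corners {s : ℝ} (hs : 0 ≤ s) (x : Eu n) :
    (volume : Measure (Eu n)).real (corners s x) = s ^ n := by
  rw [Measure.real, volume_corners, ENNReal.toReal_pow, ENNReal.toReal_ofReal hs]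

lemma isFiniteMeasure_restrict_corners (s : ℝ) (x : Eu n) :
    IsFiniteMeasure (volume.restrict (corners s x)) :=
  ⟨by rw [Measure.restrict_apply_univ, volume_corners]; finiteness⟩

lemma volume_corners_diff_le (s : ℝ) (x z : Eu n) :
    volume (corners s x \ corners s z) ≤
      ENNReal.ofReal (n * ‖x - z‖) * ENNReal.ofReal s ^ (n - 1) := by
  have h : corners s x \ corners s z = (fun a => x - a) ⁻¹'
      {b | b ∈ (Cube.mk (0 : Eu n) s).base ∧ b + (z - x) ∉ (Cube.mk (0 : Eu n) s).base} := by
    ext a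
    simp only [corners_eq_preimage, Set.mem_sdiff, mem_preimage, mem_ofPred_eq]
    rw [show x - a + (z - x) = z - a by abel]
  have hm : MeasurableSet
      {b | b ∈ (Cube.mk (0 : Eu n) s).base ∧ b + (z - x) ∉ (Cube.mk (0 : Eu n) s).base} :=
    (Cube.measurableSet_base _).inter
      ((measurable_id.add measurable_const) (Cube.measurableSet_base _).compl)
  rw [h, (Measure.measurePreserving_sub_left volume x).measure_preimage hm.nullMeasurableSet,
    norm_sub_rev]
  exact Cube.volume_diff_shift_le _ _

section Averages

variable {φ : ℝ → ℝ} {K : Eu (n + k) → ℝ} {lip : ℝ≥0} {M ρ s : ℝ} {A : Eu n → Eu k}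
  {ν : Measure (Eu n)}

lemma measurable_recipMass [SFinite ν] (s : ℝ) : Measurable (recipMass ν s) :=
  (measurable_measure_prodMk_left (ν := ν) (measurableSet_base_prod s)).ennreal_toReal.inv

lemma recipMass_nonneg (ν : Measure (Eu n)) (s : ℝ) (a : Eu n) : 0 ≤ recipMass ν s a :=
  inv_nonneg.2 measureReal_nonneg

lemma IsGraphPair.measureReal_base_pos (hν : IsGraphPair lip M A ν) {Q : Cube n}
    (hQ : 0 < Q.side) : 0 < ν.real Q.base := by
  have hM : 0 < M := zero_lt_one.trans_le hν.one_le
  have h := hν.volume_real_le (S := Q.base) (by rw [Q.volume_base]; finiteness)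
  rw [Q.volume_real_base hQ.le] at h
  by_contra! h0
  have : 0 < Q.side ^ n := by positivity
  nlinarith

lemma recipMass_le (hν : IsGraphPair lip M A ν) (hs : 0 < s) (a : Eu n) :
    recipMass ν s a ≤ M / s ^ n := by
  have h0 := hν.measureReal_base_pos (Q := ⟨a, s⟩) hs
  have h := hν.volume_real_le (S := (Cube.mk a s).base) (by rw [Cube.volume_base]; finiteness)
  rw [Cube.volume_real_base _ hs.le] at h
  rw [recipMass, inv_le_iff_one_le_mul₀ h0, div_mul_eq_mul_div, one_le_div (by positivity)]
  exact h

lemma abs_recipMass_le (hν : IsGraphPair lip M A ν) (hs : 0 < s) (a : Eu n) :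
    |recipMass ν s a| ≤ M / s ^ n := by
  rw [abs_of_nonneg (recipMass_nonneg _ _ _)]
  exact recipMass_le hν hs a

lemma avgWeight_nonneg (ν : Measure (Eu n)) (s : ℝ) (x z : Eu n) : 0 ≤ avgWeight ν s x z :=
  integral_nonneg fun a => indicator_nonneg (fun a _ => recipMass_nonneg ν s a) a

lemma integrableOn_indicator_recipMass (hν : IsGraphPair lip M A ν) (hs : 0 < s) (x z : Eu n) :
    IntegrableOn ((corners s z).indicator (recipMass ν s)) (corners s x) := by
  have := hν.isLocallyFiniteMeasure
  have := isFiniteMeasure_restrict_corners s x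
  refine (Integrable.of_bound (C := M / s ^ n) (measurable_recipMass s).aestronglyMeasurable
    (ae_of_all _ fun a => abs_recipMass_le hν hs a)).indicator (measurableSet_corners s z)

lemma avgWeight_le (hν : IsGraphPair lip M A ν) (hs : 0 < s) (x z : Eu n) :
    avgWeight ν s x z ≤ M := by
  have hM : 0 ≤ M := zero_le_one.trans hν.one_le
  have := isFiniteMeasure_restrict_corners s x
  calc _ ≤ ∫ _a in corners s x, M / s ^ n := by
        refine integral_mono (integrableOn_indicator_recipMass hν hs x z)
          (integrable_const _) fun a => ?_
        exact indicator_apply_le' (fun _ => recipMass_le hν hs a) fun _ => by positivity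
    _ = M := by
        rw [setIntegral_const, volume_real_corners hs.le, smul_eq_mul]
        field_simp

lemma avgWeight_eq_zero (hs : 0 ≤ s) {x z : Eu n} (h : √(n : ℝ) * s < ‖z - x‖) :
    avgWeight ν s x z = 0 := by
  refine setIntegral_eq_zero_of_forall_eq_zero fun a ha => indicator_of_notMem (fun hz => ?_) _
  exact absurd (Cube.norm_sub_le (Q := ⟨a, s⟩) hs hz ha) (not_le.2 h)

/-- The weights vary slowly: the sets of corners of the cubes containing `u` and `v` differ by a thin
layer. -/
lemma avgWeight_sub_le (hν : IsGraphPair lip M A ν) (hn : 0 < n) (hs : 0 < s) (x u v : Eu n) :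
    avgWeight ν s x u - avgWeight ν s x v ≤ M * n / s * ‖u - v‖ := by
  have hM : 0 ≤ M := zero_le_one.trans hν.one_le
  have hmd : MeasurableSet (corners s u \ corners s v) :=
    (measurableSet_corners s u).diff (measurableSet_corners s v)
  have hfin : volume (corners s u \ corners s v) ≠ ∞ :=
    ((measure_mono sdiff_subset).trans_lt (by rw [volume_corners]; finiteness)).ne
  have hint : IntegrableOn (fun _ : Eu n => M / s ^ n) (corners s u \ corners s v) :=
    integrableOn_const hfin
  rw [avgWeight, avgWeight, ← integral_sub (integrableOn_indicator_recipMass hν hs x u)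
    (integrableOn_indicator_recipMass hν hs x v)]
  calc _ ≤ ∫ a in corners s x, (corners s u \ corners s v).indicator (fun _ => M / s ^ n) a := by
        refine integral_mono ((integrableOn_indicator_recipMass hν hs x u).sub
          (integrableOn_indicator_recipMass hν hs x v))
          (hint.integrable_indicator hmd).integrableOn fun a => ?_
        have h0 := recipMass_nonneg ν s a
        have h1 := recipMass_le hν hs a
        by_cases hu : a ∈ corners s u <;> by_cases hv : a ∈ corners s v <;>
          simp [hu, hv, h0, h1]
    _ ≤ ∫ a, (corners s u \ corners s v).indicator (fun _ => M / s ^ n) a :=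
        setIntegral_le_integral (hint.integrable_indicator hmd)
          (ae_of_all _ fun a => indicator_nonneg (fun _ _ => by positivity) a)
    _ = (volume : Measure (Eu n)).real (corners s u \ corners s v) * (M / s ^ n) := by
        rw [integral_indicator hmd, setIntegral_const, smul_eq_mul]
    _ ≤ (n * ‖u - v‖ * s ^ (n - 1)) * (M / s ^ n) := by
        gcongr
        refine ENNReal.toReal_le_of_le_ofReal (by positivity) ?_
        refine (volume_corners_diff_le s u v).trans (le_of_eq ?_)
        rw [← ENNReal.ofReal_pow hs.le, ← ENNReal.ofReal_mul (by positivity)]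
    _ = _ := by
        rw [show s ^ n = s ^ (n - 1) * s by rw [← pow_succ, Nat.sub_add_cancel hn]]
        field_simp

lemma abs_avgWeight_sub_le (hν : IsGraphPair lip M A ν) (hn : 0 < n) (hs : 0 < s) (x u v : Eu n) :
    |avgWeight ν s x u - avgWeight ν s x v| ≤ M * n / s * ‖u - v‖ := by
  rw [abs_le]
  have h1 := avgWeight_sub_le hν hn hs x u v
  have h2 := avgWeight_sub_le hν hn hs x v u
  rw [norm_sub_rev] at h2
  constructor <;> linarith

lemma mem_corners_subset (hs : 0 ≤ s) {x a : Eu n} (ha : a ∈ corners s x) :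
    (Cube.mk a s).base ⊆ Metric.closedBall x (√(n : ℝ) * s) := fun z hz => by
  rw [Metric.mem_closedBall, dist_eq_norm]
  exact Cube.norm_sub_le (Q := ⟨a, s⟩) hs hz ha

/-- Averaging the means over the cubes that contain `x` is integrating against a weight. -/
lemma integral_recipMass_mul (hν : IsGraphPair lip M A ν) (hs : 0 < s) (x : Eu n)
    {g : Eu n → ℝ} (hg : IntegrableOn g (Metric.closedBall x (√(n : ℝ) * s)) ν) :
    IntegrableOn (fun a => recipMass ν s a * ∫ z in (Cube.mk a s).base, g z ∂ν) (corners s x) ∧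
    ∫ a in corners s x, recipMass ν s a * ∫ z in (Cube.mk a s).base, g z ∂ν =
      ∫ z in Metric.closedBall x (√(n : ℝ) * s), avgWeight ν s x z * g z ∂ν := by
  have := hν.isLocallyFiniteMeasure
  have := isFiniteMeasure_restrict_corners s x
  set S := Metric.closedBall x (√(n : ℝ) * s) with hS
  set F : Eu n → Eu n → ℝ := fun a z => (corners s z).indicator (recipMass ν s) a * g z with hF
  have hw : IntegrableOn (recipMass ν s) (corners s x) :=
    Integrable.of_bound (C := M / s ^ n) (measurable_recipMass s).aestronglyMeasurable
      (ae_of_all _ fun a => abs_recipMass_le hν hs a)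
  have hint : Integrable (fun q : Eu n × Eu n => F q.1 q.2)
      ((volume.restrict (corners s x)).prod (ν.restrict S)) := by
    refine ((hw.mul_prod hg).indicator (measurableSet_base_prod s)).congr (ae_of_all _ fun q => ?_)
    by_cases h : q.2 ∈ (Cube.mk q.1 s).base
    · simp only [hF]
      rw [indicator_of_mem (s := {q : Eu n × Eu n | q.2 ∈ (Cube.mk q.1 s).base}) h,
        indicator_of_mem (s := corners s q.2) h]
    · simp only [hF]
      rw [indicator_of_notMem (s := {q : Eu n × Eu n | q.2 ∈ (Cube.mk q.1 s).base}) h,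
        indicator_of_notMem (s := corners s q.2) h, zero_mul]
  have h1 : ∀ a ∈ corners s x, ∫ z in S, F a z ∂ν =
      recipMass ν s a * ∫ z in (Cube.mk a s).base, g z ∂ν := fun a ha => by
    have h2 : ∀ z, F a z = (Cube.mk a s).base.indicator (fun z => recipMass ν s a * g z) z :=
      fun z => by
        by_cases h : z ∈ (Cube.mk a s).base
        · rw [indicator_of_mem h]
          simp only [hF]
          rw [indicator_of_mem (s := corners s z) h]
        · rw [indicator_of_notMem h]
          simp only [hF]
          rw [indicator_of_notMem (s := corners s z) h, zero_mul]
    simp only [h2]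
    rw [setIntegral_indicator (Cube.measurableSet_base _),
      inter_eq_right.2 (mem_corners_subset hs.le ha), integral_const_mul]
  have hmem : ∀ᵐ a ∂(volume.restrict (corners s x)), ∫ z in S, F a z ∂ν =
      recipMass ν s a * ∫ z in (Cube.mk a s).base, g z ∂ν := by
    filter_upwards [ae_restrict_mem (measurableSet_corners s x)] with a ha using h1 a ha
  refine ⟨hint.integral_prod_left.congr hmem, ?_⟩
  rw [← integral_congr_ae hmem, integral_integral_swap (f := F) hint]
  refine integral_congr_ae (ae_of_all _ fun z => ?_)
  simp only [hF, avgWeight]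
  rw [integral_mul_const]

end Averages

lemma gridPoint_zero (m : ℤ) : gridPoint m (0 : Fin n → ℤ) = 0 := by
  ext i
  simp [gridPoint]

/-- Only one cube of each translated lattice contains a given point. -/
lemma martingale_eq (K : Eu (n + k) → ℝ) (μ : Measure (Eu (n + k))) {m : ℤ} {a : Eu n}
    {x : Eu (n + k)} (hx : x ∈ (cubeAt m a).vset k) :
    martingale K μ m a x = cubeMean K μ ((cubeAt m a).vset k) := by
  have h2 : (0 : ℝ) < 2 ^ (-m) := by positivity
  rw [martingale, tsum_eq_single 0, gridPoint_zero, add_zero, indicator_of_mem hx]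
  intro q hq
  refine indicator_of_notMem (fun h => hq ?_) _
  ext i
  have h3 : a i ≤ tilde x i ∧ tilde x i < a i + 2 ^ (-m) := hx i
  have h4 : a i + 2 ^ (-m) * (q i : ℝ) ≤ tilde x i ∧
      tilde x i < a i + 2 ^ (-m) * (q i : ℝ) + 2 ^ (-m) := h i
  have h5 : (2 : ℝ) ^ (-m) * (q i : ℝ) < 2 ^ (-m) * 1 := by linarith [h3.2, h4.1]
  have h6 : (2 : ℝ) ^ (-m) * (-1) < 2 ^ (-m) * (q i : ℝ) := by linarith [h3.1, h4.2]
  have h7 : (q i : ℝ) < 1 := lt_of_mul_lt_mul_left h5 h2.le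
  have h8 : (-1 : ℝ) < q i := lt_of_mul_lt_mul_left h6 h2.le
  have h9 : q i < 1 := by exact_mod_cast h7
  have h10 : -1 < q i := by exact_mod_cast h8
  change q i = 0
  omega

section AverageMean

variable {φ : ℝ → ℝ} {K : Eu (n + k) → ℝ} {lip : ℝ≥0} {M ρ s B ℓ : ℝ} {A : Eu n → Eu k}
  {ν : Measure (Eu n)} {H : Eu n → Eu k → ℝ}

lemma IsPiece.integrableOn_pieceInt (hH : IsPiece n k B ℓ H)
    (hν : IsGraphPair lip M A ν) (x : Eu n) (R : ℝ) :
    IntegrableOn (pieceInt H A ν) (Metric.closedBall x R) ν := by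
  have := hν.isLocallyFiniteMeasure
  have hA := hν.lipschitz.continuous
  have hfin : IsFiniteMeasure (ν.restrict (Metric.closedBall x R)) :=
    ⟨by rw [Measure.restrict_apply_univ]; exact (isCompact_closedBall x R).measure_lt_top⟩
  set S' := Metric.closedBall x (R + 3 / 2 * √(n : ℝ) * ℓ) with hS'
  have hfin' : IsFiniteMeasure (ν.restrict S') :=
    ⟨by rw [Measure.restrict_apply_univ]; exact (isCompact_closedBall x _).measure_lt_top⟩
  have hint : Integrable (fun q : Eu n × Eu n => H (q.1 - q.2) (A q.1 - A q.2))
      ((ν.restrict (Metric.closedBall x R)).prod (ν.restrict S')) :=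
    Integrable.of_bound (C := B / ℓ ^ n)
      (hH.continuous_comp (by fun_prop) (by fun_prop)).aestronglyMeasurable
      (ae_of_all _ fun q => hH.bound _ _)
  refine hint.integral_prod_left.congr ?_
  filter_upwards [ae_restrict_mem Metric.isClosed_closedBall.measurableSet] with z hz
  refine setIntegral_eq_integral_of_forall_compl_eq_zero fun y hy => hH.supp _ _ ?_
  rw [hS', Metric.mem_closedBall, dist_eq_norm, not_le] at hy
  rw [Metric.mem_closedBall, dist_eq_norm] at hz
  have h := norm_sub_le (z - x) (z - y)
  rw [show z - x - (z - y) = y - x by abel] at h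
  linarith

/-- The averaged mean over the cubes that contain a point, compared with the truncated integral
at that point. -/
lemma average_cubeMean (hφ : IsProfile n φ) (hn : 0 < n) (hK : IsKernel n k K)
    (hν : IsGraphPair lip M A ν) (hρ : 0 ≤ ρ) (hF : FlatOutside ρ A ν) {j : ℤ}
    (hs : s = 2 ^ (-j) / 4) (x : Eu n) :
    IntegrableOn (fun a => cubeMean K (ν.map (graphMap A)) ((Cube.mk a s).vset k)) (corners s x) ∧
    truncLim K φ A ν ρ s x - (s ^ n)⁻¹ *
        ∫ a in corners s x, cubeMean K (ν.map (graphMap A)) ((Cube.mk a s).vset k) =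
      (s ^ n)⁻¹ * ((∫ z in Metric.closedBall x (√(n : ℝ) * s), avgWeight ν s x z *
          (truncLim K φ A ν ρ s x - truncLim K φ A ν ρ s z) ∂ν) -
        ∑' i : ℕ, ∫ z, avgWeight ν s x z * pieceInt (piece K φ (s / 2 ^ (i + 1))) A ν z ∂ν) := by
  have := hν.isLocallyFiniteMeasure
  have hs0 : 0 < s := by rw [hs]; positivity
  have := isFiniteMeasure_restrict_corners s x
  have hM : 0 ≤ M := zero_le_one.trans hν.one_le
  obtain ⟨B, hB, hp⟩ := exists_isPiece hφ hn hK
  obtain ⟨C, hC, hout⟩ := exists_integral_abs_outInt_le hφ hn hK M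
  obtain ⟨C', hC', hT⟩ := exists_truncLim_sub_le_const n k hn lip M hφ hK
  set S := Metric.closedBall x (√(n : ℝ) * s) with hS
  have hfin : IsFiniteMeasure (ν.restrict S) :=
    ⟨by rw [Measure.restrict_apply_univ]; exact (isCompact_closedBall x _).measure_lt_top⟩
  set T := truncLim K φ A ν ρ s with hTdef
  have hTm : StronglyMeasurable T := stronglyMeasurable_truncLim hφ hn hK hν hρ hF hs0
  set h : ℕ → Eu n → ℝ := fun i => pieceInt (piece K φ (s / 2 ^ (i + 1))) A ν with hh
  have hpi : ∀ i : ℕ, IsPiece n k B (4 * (s / 2 ^ (i + 1))) (piece K φ (s / 2 ^ (i + 1))) :=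
    fun i => hp _ (by positivity)
  have hTx : IntegrableOn (fun z => T x - T z) S ν := by
    refine Integrable.of_bound (C := C')
      (stronglyMeasurable_const.sub hTm).aestronglyMeasurable ?_
    filter_upwards [ae_restrict_mem Metric.isClosed_closedBall.measurableSet] with z hz
    rw [Real.norm_eq_abs, hTdef, hs]
    refine hT A ν hν ρ hρ hF j x z ?_
    rw [hS, Metric.mem_closedBall, dist_comm, dist_eq_norm, hs] at hz
    rwa [mul_div_assoc]
  have h0 := integral_recipMass_mul hν hs0 x hTx
  have hi := fun i => integral_recipMass_mul hν hs0 x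
    ((hpi i).integrableOn_pieceInt hν x (√(n : ℝ) * s))
  set F : ℕ → Eu n → ℝ := fun i a => recipMass ν s a * ∫ z in (Cube.mk a s).base, h i z ∂ν with hFd
  have hFb : ∀ i a, |F i a| ≤ M * C * (1 / 2) ^ i := fun i a => by
    have h1 := hout lip A ν hν ⟨a, s⟩ hs0 i
    have h2 := integral_outInt_eq (hpi i) (by linarith) (by positivity) hν ⟨a, s⟩ hs0.le
    have h3 : |∫ z in (Cube.mk a s).base, h i z ∂ν| ≤ C * s ^ n * (1 / 2) ^ i := by
      rw [hh]
      simp only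
      rw [← h2]
      exact (abs_integral_le_integral_abs).trans h1.2
    rw [hFd]
    simp only
    rw [abs_mul]
    calc _ ≤ M / s ^ n * (C * s ^ n * (1 / 2) ^ i) :=
          mul_le_mul (abs_recipMass_le hν hs0 a) h3 (abs_nonneg _) (by positivity)
      _ = _ := by field_simp
  have hsum : Summable fun i => ∫ a in corners s x, |F i a| := by
    refine Summable.of_nonneg_of_le (fun i => integral_nonneg fun a => abs_nonneg _) (fun i => ?_)
      (summable_geometric_two.mul_left (s ^ n * (M * C)))
    calc _ ≤ ∫ _a in corners s x, M * C * (1 / 2) ^ i :=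
          integral_mono (hi i).1.abs (integrable_const _) fun a => hFb i a
      _ = _ := by rw [setIntegral_const, volume_real_corners hs0.le, smul_eq_mul]; ring
  have hFt : IntegrableOn (fun a => ∑' i, F i a) (corners s x) :=
    integrable_tsum_of_summable (fun i => (hi i).1) hsum
  -- the mean over each translate, with `T x` split off; its integral over the corners gives the claim
  have hmean : ∀ᵐ a ∂(volume.restrict (corners s x)),
      T x - (recipMass ν s a * ∫ z in (Cube.mk a s).base, (T x - T z) ∂ν) + ∑' i, F i a =
        cubeMean K (ν.map (graphMap A)) ((Cube.mk a s).vset k) := by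
    filter_upwards [ae_restrict_mem (measurableSet_corners s x)] with a ha
    have hpos := hν.measureReal_base_pos (Q := ⟨a, s⟩) hs0
    have hTi := integrableOn_truncLim hφ hn hK hν hρ hF (Q := ⟨a, s⟩) hs
    have := hν.isFiniteMeasure_restrict ⟨a, s⟩ hs0.le
    rw [cubeMean_eq hφ hn hK hν hρ hF (Q := ⟨a, s⟩) hs, integral_sub (integrable_const _) hTi,
      setIntegral_const, smul_eq_mul, mul_add, mul_sub, recipMass, inv_mul_cancel_left₀ hpos.ne']
    simp only [hFd, recipMass, tsum_mul_left, hh, hTdef]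
    ring
  have e1 : IntegrableOn (fun a => T x - recipMass ν s a *
      ∫ z in (Cube.mk a s).base, (T x - T z) ∂ν) (corners s x) := (integrable_const _).sub h0.1
  have hpw : ∀ i, ∫ a in corners s x, F i a = ∫ z, avgWeight ν s x z * h i z ∂ν := fun i => by
    rw [hFd]
    simp only
    rw [(hi i).2]
    refine setIntegral_eq_integral_of_forall_compl_eq_zero fun z hz => ?_
    rw [Metric.mem_closedBall, dist_eq_norm, not_le] at hz
    rw [avgWeight_eq_zero hs0.le hz, zero_mul]
  have e2 : ∫ a in corners s x, ∑' i, F i a = ∑' i, ∫ z, avgWeight ν s x z * h i z ∂ν := by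
    rw [← tsum_congr hpw]
    exact (integral_tsum_of_summable_integral_norm (fun i => (hi i).1)
      (by simpa only [Real.norm_eq_abs] using hsum)).symm
  refine ⟨(e1.add hFt).congr hmean, ?_⟩
  rw [← integral_congr_ae hmean, integral_add e1 hFt, integral_sub (integrable_const _) h0.1, h0.2,
    setIntegral_const, volume_real_corners hs0.le, smul_eq_mul, e2]
  have : (s ^ n)⁻¹ * s ^ n = 1 := inv_mul_cancel₀ (by positivity)
  linear_combination (-T x) * this

/-- The martingale averages, in terms of integrals over the base. -/
lemma avgMartingale_eq (m : ℤ) (x : Eu (n + k)) :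
    avgMartingale K (ν.map (graphMap A)) m x = (((2 : ℝ) ^ (-m)) ^ n)⁻¹ *
      ∫ a in corners (2 ^ (-m)) (tilde x),
        cubeMean K (ν.map (graphMap A)) ((Cube.mk a (2 ^ (-m))).vset k) := by
  rw [avgMartingale]
  congr 1
  · rw [← zpow_natCast, ← zpow_mul, ← zpow_neg]; ring_nf
  · exact setIntegral_congr_fun (measurableSet_corners (2 ^ (-m)) (tilde x)) fun a ha =>
      martingale_eq _ _ ha

lemma integrableOn_martingale (hφ : IsProfile n φ) (hn : 0 < n) (hK : IsKernel n k K)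
    (hν : IsGraphPair lip M A ν) (hρ : 0 ≤ ρ) (hF : FlatOutside ρ A ν) (m : ℤ)
    (x : Eu (n + k)) : IntegrableOn (fun a : Eu n => martingale K (ν.map (graphMap A)) m a x)
      {a | x ∈ (cubeAt m a).vset k} := by
  have hs : (2 : ℝ) ^ (-m) = 2 ^ (-(m - 2)) / 4 := by
    rw [show -(m - 2) = -m + 2 by ring, zpow_add₀ two_ne_zero]; norm_num
  refine ((average_cubeMean hφ hn hK hν hρ hF hs (tilde x)).1).congr_fun (fun a ha => ?_)
    (measurableSet_corners (2 ^ (-m)) (tilde x))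
  exact (martingale_eq _ _ ha).symm

end AverageMean

/-! ### The pointwise bound for the square function -/

lemma tsum_half_pow_add (l : ℕ) :
    ∑' i : ℕ, (if l ≤ i then (2⁻¹ : ℝ≥0∞) ^ i else 0) = 2 * 2⁻¹ ^ l := by
  rw [← (add_left_injective l).tsum_eq (f := fun i => if l ≤ i then (2⁻¹ : ℝ≥0∞) ^ i else 0)]
  · simp only [le_add_iff_nonneg_left, zero_le, if_true, pow_add]
    rw [ENNReal.tsum_mul_right, ENNReal.tsum_geometric, ENNReal.one_sub_inv_two, inv_inv]
  · intro i hi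
    have h : l ≤ i := by
      by_contra h
      exact hi (if_neg h)
    exact ⟨i - l, Nat.sub_add_cancel h⟩

lemma tsum_half_pow_mul_sum (a : ℕ → ℝ≥0∞) :
    ∑' i : ℕ, (2⁻¹ : ℝ≥0∞) ^ i * ∑ l ∈ Finset.range (i + 1), a l =
      2 * ∑' l : ℕ, 2⁻¹ ^ l * a l := by
  have h : ∀ i : ℕ, (2⁻¹ : ℝ≥0∞) ^ i * ∑ l ∈ Finset.range (i + 1), a l =
      ∑' l : ℕ, (if l ≤ i then (2⁻¹ : ℝ≥0∞) ^ i else 0) * a l := fun i => by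
    rw [tsum_eq_sum (s := Finset.range (i + 1)) fun l hl => ?_, Finset.mul_sum]
    · refine Finset.sum_congr rfl fun l hl => ?_
      rw [if_pos (Nat.lt_succ_iff.1 (Finset.mem_range.1 hl))]
    · rw [if_neg fun h => hl (Finset.mem_range.2 (Nat.lt_succ_iff.2 h)), zero_mul]
  simp only [h]
  rw [ENNReal.tsum_comm, ← ENNReal.tsum_mul_left]
  refine tsum_congr fun l => ?_
  rw [ENNReal.tsum_mul_right, tsum_half_pow_add, mul_assoc]

lemma tsum_half_pow_mul_sum_succ_le (a : ℕ → ℝ≥0∞) :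
    ∑' i : ℕ, (2⁻¹ : ℝ≥0∞) ^ i * ∑ l ∈ Finset.range (i + 1 + 1), a l ≤
      4 * ∑' l : ℕ, 2⁻¹ ^ l * a l := by
  have h2 : (2 : ℝ≥0∞) * 2⁻¹ = 1 := ENNReal.mul_inv_cancel (by norm_num) (by norm_num)
  calc _ = 2 * ∑' i : ℕ, (2⁻¹ : ℝ≥0∞) ^ (i + 1) * ∑ l ∈ Finset.range (i + 1 + 1), a l := by
        rw [← ENNReal.tsum_mul_left]
        refine tsum_congr fun i => ?_
        rw [pow_succ', ← mul_assoc, ← mul_assoc, h2, one_mul]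
    _ ≤ 2 * ∑' i : ℕ, (2⁻¹ : ℝ≥0∞) ^ i * ∑ l ∈ Finset.range (i + 1), a l := by
        gcongr 2 * ?_
        exact ENNReal.tsum_comp_le_tsum_of_injective (add_left_injective 1)
          fun i : ℕ => (2⁻¹ : ℝ≥0∞) ^ i * ∑ l ∈ Finset.range (i + 1), a l
    _ = _ := by rw [tsum_half_pow_mul_sum, ← mul_assoc]; norm_num

lemma ofReal_div_two_pow {c : ℝ} (hc : 0 ≤ c) (i : ℕ) :
    ENNReal.ofReal (c / 2 ^ i) = ENNReal.ofReal c * 2⁻¹ ^ i := by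
  rw [div_eq_mul_inv, ENNReal.ofReal_mul hc, ← inv_pow, ENNReal.ofReal_pow (by norm_num),
    ENNReal.ofReal_inv_of_pos two_pos, ENNReal.ofReal_ofNat]

lemma volume_closedBall_mul (x : Eu n) {c L : ℝ} (hc : 0 ≤ c) (hL : 0 ≤ L) :
    volume (Metric.closedBall x (c * L)) =
      ENNReal.ofReal (c ^ n * ballVol n) * ENNReal.ofReal L ^ n := by
  have hbv := ballVol_pos (n := n)
  rw [← ofReal_measureReal measure_closedBall_lt_top.ne, volume_real_closedBall _ (by positivity),
    ← ENNReal.ofReal_pow hL, ← ENNReal.ofReal_mul (by positivity)]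
  congr 1; ring

lemma lintegral_affErr_le (hn : 0 < n) {A : Eu n → Eu k} (hA : Continuous A)
    (ν : Measure (Eu n)) (j : ℤ) (x : Eu n) {s : ℝ} (hs : s = 2 ^ (-j) / 4) :
    ∫⁻ z in Metric.closedBall x (√(n : ℝ) * s),
        ENNReal.ofReal (‖affErr (dyad j x) A z‖ / 2 ^ (-j)) ≤
      ENNReal.ofReal (jones A ν j x) * ENNReal.ofReal (2 ^ (-j)) ^ n := by
  have hL : (0 : ℝ) < 2 ^ (-j) := by positivity
  have hside : 0 < (dyad j x).side := by rw [dyad_side]; exact hL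
  have hsub : Metric.closedBall x (√(n : ℝ) * s) ⊆ (dyad j x).window := by
    refine Metric.closedBall_subset_closedBall' ?_
    have h := norm_sub_center_dyad_le j x
    rw [dist_eq_norm, dyad_side, hs]
    nlinarith [show 0 < √(n : ℝ) * 2 ^ (-j) by have := one_le_sqrt_dim hn; positivity]
  have hint : IntegrableOn (fun z => ‖affErr (dyad j x) A z‖ / 2 ^ (-j)) (dyad j x).window :=
    ((continuous_affErr hside hA).norm.div_const _).continuousOn.integrableOn_compact
      (Cube.isCompact_window _)
  calc _ ≤ ∫⁻ z in (dyad j x).window, ENNReal.ofReal (‖affErr (dyad j x) A z‖ / 2 ^ (-j)) :=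
        lintegral_mono_set hsub
    _ = ENNReal.ofReal (∫ z in (dyad j x).window, ‖affErr (dyad j x) A z‖ / 2 ^ (-j)) :=
        (ofReal_integral_eq_lintegral_ofReal hint (ae_of_all _ fun z => by positivity)).symm
    _ ≤ ENNReal.ofReal (jones A ν j x * (2 ^ (-j)) ^ n) := by
        refine ENNReal.ofReal_le_ofReal ?_
        rw [integral_div, div_le_iff₀ hL]
        refine (integral_affErr_le_gam hside A ν).trans ?_
        rw [dyad_side, mul_assoc, ← pow_succ]
        gcongr
        exact gam_dyad_le_jones A ν j x
    _ = _ := by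
        rw [ENNReal.ofReal_mul (jones_nonneg A ν j x), ENNReal.ofReal_pow hL.le]

/-- The part of the comparison that comes from the scales larger than the truncation radius. -/
lemma exists_far_part_le (n k : ℕ) (hn : 0 < n) (lip : ℝ≥0) (M : ℝ) (hM : 1 ≤ M) {φ : ℝ → ℝ}
    (hφ : IsProfile n φ) {K : Eu (n + k) → ℝ} (hK : IsKernel n k K) :
    ∃ C : ℝ≥0∞, C ≠ ∞ ∧ ∀ (A : Eu n → Eu k) (ν : Measure (Eu n)), IsGraphPair lip M A ν →
      ∀ ρ : ℝ, 0 ≤ ρ → FlatOutside ρ A ν → ∀ (j : ℤ) (x : Eu n) (s : ℝ), s = 2 ^ (-j) / 4 →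
      ENNReal.ofReal |∫ z in Metric.closedBall x (√(n : ℝ) * s), avgWeight ν s x z *
          (truncLim K φ A ν ρ s x - truncLim K φ A ν ρ s z) ∂ν| ≤
        C * ENNReal.ofReal (2 ^ (-j)) ^ n *
          ∑' l : ℕ, 2⁻¹ ^ l * ENNReal.ofReal (jones A ν (j - l) x) := by
  obtain ⟨C, hC, hT⟩ := exists_truncLim_sub_le n k hn lip M hφ hK
  have hσ := one_le_sqrt_dim hn
  have hM0 : 0 ≤ M := by linarith
  set V := ENNReal.ofReal ((√(n : ℝ) / 4) ^ n * ballVol n) with hV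
  refine ⟨ENNReal.ofReal M * ENNReal.ofReal M * ENNReal.ofReal C * (V + 1) * 2,
    by finiteness, fun A ν hν ρ hρ hF j x s hs => ?_⟩
  have hs0 : 0 < s := by rw [hs]; positivity
  have hA := hν.lipschitz.continuous
  set L : ℝ := 2 ^ (-j) with hL
  set S := Metric.closedBall x (√(n : ℝ) * s) with hS
  have hSm : MeasurableSet S := Metric.isClosed_closedBall.measurableSet
  set J : ℕ → ℝ≥0∞ := fun l => ENNReal.ofReal (jones A ν (j - l) x) with hJ
  set e : Eu n → ℝ≥0∞ := fun z => ENNReal.ofReal (‖affErr (dyad j x) A z‖ / L) with he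
  have hem : Measurable e := (((continuous_affErr (Q := dyad j x)
    (by rw [dyad_side]; positivity) hA).norm.div_const _).measurable).ennreal_ofReal
  have hpt : ∀ z ∈ S, ENNReal.ofReal |truncLim K φ A ν ρ s x - truncLim K φ A ν ρ s z| ≤
      ∑' i : ℕ, ENNReal.ofReal C * 2⁻¹ ^ i * (∑ l ∈ Finset.range (i + 1), J l + e z) := by
    intro z hz
    rw [hS, Metric.mem_closedBall, dist_comm, dist_eq_norm, hs] at hz
    have h := hT A ν hν ρ hρ hF j x z (by rwa [mul_div_assoc])
    rw [← hL, ← hs] at h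
    refine h.trans (le_of_eq (tsum_congr fun i => ?_))
    rw [ENNReal.ofReal_mul (by positivity), ofReal_div_two_pow hC, ENNReal.ofReal_add
      (Finset.sum_nonneg fun l _ => jones_nonneg _ _ _ _) (by positivity),
      ENNReal.ofReal_sum_of_nonneg fun l _ => jones_nonneg _ _ _ _]
  have hvol : volume S = V * ENNReal.ofReal L ^ n := by
    rw [hS, hs, hV, ← volume_closedBall_mul x (by positivity) (by positivity : 0 ≤ L)]
    congr 2; ring
  have he1 : ∫⁻ z in S, e z ≤ J 0 * ENNReal.ofReal L ^ n := by
    rw [show J 0 = ENNReal.ofReal (jones A ν j x) by simp [hJ]]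
    exact lintegral_affErr_le hn hA ν j x hs
  have hmeas : ∀ i : ℕ, Measurable fun z =>
      ENNReal.ofReal C * 2⁻¹ ^ i * (∑ l ∈ Finset.range (i + 1), J l + e z) := fun i =>
    (hem.const_add _).const_mul _
  calc ENNReal.ofReal |∫ z in S, avgWeight ν s x z *
          (truncLim K φ A ν ρ s x - truncLim K φ A ν ρ s z) ∂ν|
      ≤ ∫⁻ z in S, ENNReal.ofReal M *
          ENNReal.ofReal |truncLim K φ A ν ρ s x - truncLim K φ A ν ρ s z| ∂ν := by
        rw [← Real.enorm_eq_ofReal_abs]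
        refine (enorm_integral_le_lintegral_enorm _).trans (lintegral_mono fun z => ?_)
        rw [Real.enorm_eq_ofReal_abs, abs_mul, abs_of_nonneg (avgWeight_nonneg ν s x z),
          ENNReal.ofReal_mul (avgWeight_nonneg ν s x z)]
        gcongr
        exact avgWeight_le hν hs0 x z
    _ ≤ ENNReal.ofReal M * ∫⁻ z in S, ENNReal.ofReal M *
          ENNReal.ofReal |truncLim K φ A ν ρ s x - truncLim K φ A ν ρ s z| :=
        hν.setLIntegral_le _ _
    _ ≤ ENNReal.ofReal M * ∫⁻ z in S, ENNReal.ofReal M *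
          ∑' i : ℕ, ENNReal.ofReal C * 2⁻¹ ^ i * (∑ l ∈ Finset.range (i + 1), J l + e z) := by
        gcongr 1
        refine setLIntegral_mono' hSm fun z hz => ?_
        gcongr
        exact hpt z hz
    _ = ENNReal.ofReal M * (ENNReal.ofReal M * ∑' i : ℕ, ENNReal.ofReal C * 2⁻¹ ^ i *
          ((∑ l ∈ Finset.range (i + 1), J l) * volume S + ∫⁻ z in S, e z)) := by
        rw [lintegral_const_mul' _ _ ENNReal.ofReal_ne_top, lintegral_tsum fun i =>
          (hmeas i).aemeasurable]
        congr 2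
        refine tsum_congr fun i => ?_
        rw [lintegral_const_mul _ (hem.const_add _), lintegral_add_left measurable_const,
          setLIntegral_const]
    _ ≤ ENNReal.ofReal M * (ENNReal.ofReal M * ∑' i : ℕ, ENNReal.ofReal C * 2⁻¹ ^ i *
          ((∑ l ∈ Finset.range (i + 1), J l) * (V * ENNReal.ofReal L ^ n) +
            (∑ l ∈ Finset.range (i + 1), J l) * ENNReal.ofReal L ^ n)) := by
        rw [hvol]
        gcongr with i
        refine he1.trans ?_
        gcongr
        exact Finset.single_le_sum (f := J) (fun _ _ => zero_le) (Finset.mem_range.2 i.succ_pos)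
    _ = ENNReal.ofReal M * (ENNReal.ofReal M * (ENNReal.ofReal C * (V + 1) *
          ENNReal.ofReal L ^ n * ∑' i : ℕ, 2⁻¹ ^ i * ∑ l ∈ Finset.range (i + 1), J l)) := by
        congr 2
        rw [← ENNReal.tsum_mul_left]
        refine tsum_congr fun i => ?_
        ring
    _ = _ := by rw [tsum_half_pow_mul_sum]; ring

/-- The part of the comparison that comes from the scales smaller than the truncation radius. -/
lemma exists_near_part_le (n k : ℕ) (hn : 0 < n) (lip : ℝ≥0) (M : ℝ) (hM : 1 ≤ M) {φ : ℝ → ℝ}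
    (hφ : IsProfile n φ) {K : Eu (n + k) → ℝ} (hK : IsKernel n k K) :
    ∃ C : ℝ≥0∞, C ≠ ∞ ∧ ∀ (A : Eu n → Eu k) (ν : Measure (Eu n)), IsGraphPair lip M A ν →
      ∀ (j : ℤ) (x : Eu n) (s : ℝ), s = 2 ^ (-j) / 4 →
      ENNReal.ofReal |∑' i : ℕ, ∫ z, avgWeight ν s x z *
          pieceInt (piece K φ (s / 2 ^ (i + 1))) A ν z ∂ν| ≤
        C * ((∑' l : ℕ, 2⁻¹ ^ l * ∫⁻ z in Metric.closedBall x (√(n : ℝ) * 2 ^ (-j)),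
            ENNReal.ofReal (jones A ν (j + l) z)) +
          ENNReal.ofReal (2 ^ (-j)) ^ n * ENNReal.ofReal (jones A ν j x)) := by
  obtain ⟨B, hB, hp⟩ := exists_isPiece hφ hn hK
  obtain ⟨C, hC, hw⟩ := exists_weighted_le n k hn lip M B (by linarith)
  have hσ := one_le_sqrt_dim hn
  have hM0 : 0 ≤ M := by linarith
  set V := ENNReal.ofReal (√(n : ℝ) ^ n * ballVol n) with hV
  refine ⟨ENNReal.ofReal (2 * C * M * n) * (4 + 2 * V),
    by finiteness, fun A ν hν j x s hs => ?_⟩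
  have hs0 : 0 < s := by rw [hs]; positivity
  have hA := hν.lipschitz.continuous
  set L : ℝ := 2 ^ (-j) with hL
  have hL0 : 0 < L := by positivity
  set S := Metric.closedBall x (√(n : ℝ) * L) with hS
  set a : ℕ → ℝ≥0∞ := fun l => ∫⁻ z in S, ENNReal.ofReal (jones A ν (j + l) z) with ha
  have hvol : volume S = V * ENNReal.ofReal L ^ n := volume_closedBall_mul x (by positivity) hL0.le
  have hJm : ∀ i : ℤ, Measurable fun z => ENNReal.ofReal (jones A ν i z) := fun i =>
    (measurable_jones hA ν i).ennreal_ofReal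
  have hterm : ∀ i : ℕ, ENNReal.ofReal |∫ z, avgWeight ν s x z *
      pieceInt (piece K φ (s / 2 ^ (i + 1))) A ν z ∂ν| ≤ ENNReal.ofReal (2 * C * M * n) *
        (2⁻¹ ^ i * ∑ l ∈ Finset.range (i + 1 + 1), a l +
          2⁻¹ ^ i * (ENNReal.ofReal (jones A ν j x) * (V * ENNReal.ofReal L ^ n))) := fun i => by
    have hH := hp (s / 2 ^ (i + 1)) (by positivity)
    have hℓ : 4 * (s / 2 ^ (i + 1)) = (2 : ℝ) ^ (-(j + ((i + 1 : ℕ) : ℤ))) := by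
      rw [zpow_neg_add_natCast, ← hL, hs]; ring
    rw [hℓ] at hH
    refine (hw A ν hν j (i + 1) (by omega) _ hH (avgWeight ν s x) (M * n / s) (by positivity)
      (abs_avgWeight_sub_le hν hn hs0 x) x fun z hz => avgWeight_eq_zero hs0.le ?_).trans ?_
    · rwa [hs, ← mul_div_assoc]
    · have hc : C * (M * n / s) * 2 ^ (-(j + ((i + 1 : ℕ) : ℤ))) = 2 * C * M * n / 2 ^ i := by
        rw [zpow_neg_add_natCast, ← hL, show L = 4 * s by rw [hs]; ring, pow_succ]
        field_simp
        ring
      rw [hc, ofReal_div_two_pow (by positivity), ← hL, ← hS]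
      have hlint : ∫⁻ z in S, ENNReal.ofReal (∑ l ∈ Finset.range (i + 1 + 1), jones A ν (j + l) z +
          jones A ν j x) = ∑ l ∈ Finset.range (i + 1 + 1), a l +
            ENNReal.ofReal (jones A ν j x) * (V * ENNReal.ofReal L ^ n) := by
        have h1 : ∀ z, ENNReal.ofReal (∑ l ∈ Finset.range (i + 1 + 1), jones A ν (j + l) z +
            jones A ν j x) = ∑ l ∈ Finset.range (i + 1 + 1), ENNReal.ofReal (jones A ν (j + l) z) +
              ENNReal.ofReal (jones A ν j x) := fun z => by
          rw [ENNReal.ofReal_add (Finset.sum_nonneg fun l _ => jones_nonneg _ _ _ _)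
            (jones_nonneg _ _ _ _), ENNReal.ofReal_sum_of_nonneg fun l _ => jones_nonneg _ _ _ _]
        simp only [h1]
        rw [lintegral_add_right _ measurable_const, setLIntegral_const, hvol,
          lintegral_finsetSum _ fun l _ => hJm _]
      rw [hlint]
      exact le_of_eq (by ring)
  calc _ ≤ ∑' i : ℕ, ENNReal.ofReal |∫ z, avgWeight ν s x z *
          pieceInt (piece K φ (s / 2 ^ (i + 1))) A ν z ∂ν| := by
        simp only [← Real.enorm_eq_ofReal_abs]
        exact enorm_tsum_le_tsum_enorm
    _ ≤ ENNReal.ofReal (2 * C * M * n) *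
        ((∑' i : ℕ, 2⁻¹ ^ i * ∑ l ∈ Finset.range (i + 1 + 1), a l) +
          2 * (ENNReal.ofReal (jones A ν j x) * (V * ENNReal.ofReal L ^ n))) := by
        refine (ENNReal.tsum_le_tsum hterm).trans (le_of_eq ?_)
        rw [ENNReal.tsum_mul_left, ENNReal.tsum_add, ENNReal.tsum_mul_right,
          ENNReal.tsum_geometric, ENNReal.one_sub_inv_two, inv_inv]
    _ ≤ ENNReal.ofReal (2 * C * M * n) * (4 * (∑' l : ℕ, 2⁻¹ ^ l * a l) +
          2 * (ENNReal.ofReal (jones A ν j x) * (V * ENNReal.ofReal L ^ n))) := by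
        gcongr
        exact tsum_half_pow_mul_sum_succ_le a
    _ ≤ ENNReal.ofReal (2 * C * M * n) * (4 * ((∑' l : ℕ, 2⁻¹ ^ l * a l) +
          ENNReal.ofReal L ^ n * ENNReal.ofReal (jones A ν j x)) + 2 * V *
          ((∑' l : ℕ, 2⁻¹ ^ l * a l) + ENNReal.ofReal L ^ n * ENNReal.ofReal (jones A ν j x))) := by
        refine mul_le_mul_right (add_le_add ?_ ?_) _
        · gcongr
          exact le_self_add
        · calc _ = 2 * V * (ENNReal.ofReal L ^ n * ENNReal.ofReal (jones A ν j x)) := by ring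
            _ ≤ _ := by gcongr; exact le_add_self
    _ = _ := by ring

/-- The terms of the square function are bounded by averages of the deviations from flatness, with
geometric decay in the difference of the scales. -/
lemma exists_truncLim_sub_average_le (n k : ℕ) (hn : 0 < n) (lip : ℝ≥0) (M : ℝ) (hM : 1 ≤ M)
    {φ : ℝ → ℝ} (hφ : IsProfile n φ) {K : Eu (n + k) → ℝ} (hK : IsKernel n k K) :
    ∃ C : ℝ≥0∞, C ≠ ∞ ∧ ∀ (A : Eu n → Eu k) (ν : Measure (Eu n)), IsGraphPair lip M A ν →
      ∀ ρ : ℝ, 0 ≤ ρ → FlatOutside ρ A ν → ∀ (j : ℤ) (x : Eu n) (s : ℝ), s = 2 ^ (-j) / 4 →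
      ENNReal.ofReal |truncLim K φ A ν ρ s x - (s ^ n)⁻¹ *
          ∫ a in corners s x, cubeMean K (ν.map (graphMap A)) ((Cube.mk a s).vset k)| ≤
        C * ∑' l : ℕ, 2⁻¹ ^ l * (ENNReal.ofReal (jones A ν (j - l) x) +
          (ENNReal.ofReal (2 ^ (-j)) ^ n)⁻¹ *
            ∫⁻ z in Metric.closedBall x (√(n : ℝ) * 2 ^ (-j)),
              ENNReal.ofReal (jones A ν (j + l) z)) := by
  obtain ⟨C₁, hC₁, far⟩ := exists_far_part_le n k hn lip M hM hφ hK
  obtain ⟨C₂, hC₂, near⟩ := exists_near_part_le n k hn lip M hM hφ hK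
  refine ⟨4 ^ n * (C₁ + C₂), by finiteness, fun A ν hν ρ hρ hF j x s hs => ?_⟩
  have h1 := far A ν hν ρ hρ hF j x s hs
  have h2 := near A ν hν j x s hs
  rw [(average_cubeMean hφ hn hK hν hρ hF hs x).2]
  set X := ∫ z in Metric.closedBall x (√(n : ℝ) * s), avgWeight ν s x z *
          (truncLim K φ A ν ρ s x - truncLim K φ A ν ρ s z) ∂ν
  set Y := ∑' i : ℕ, ∫ z, avgWeight ν s x z *
          pieceInt (piece K φ (s / 2 ^ (i + 1))) A ν z ∂ν
  set L : ℝ := 2 ^ (-j) with hL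
  have hL0 : 0 < L := by positivity
  have hs0 : 0 < s := by rw [hs]; positivity
  set E := ENNReal.ofReal L ^ n with hE
  have hE0 : E ≠ 0 := by
    rw [hE]; exact pow_ne_zero _ (by simpa using hL0)
  have hET : E ≠ ∞ := by rw [hE]; finiteness
  have hEs : ENNReal.ofReal (s ^ n)⁻¹ = 4 ^ n * E⁻¹ := by
    rw [show (s ^ n)⁻¹ = 4 ^ n * (L ^ n)⁻¹ by rw [hs, div_pow]; field_simp,
      ENNReal.ofReal_mul (by positivity), ENNReal.ofReal_inv_of_pos (by positivity),
      ENNReal.ofReal_pow (by norm_num), ENNReal.ofReal_pow hL0.le, ENNReal.ofReal_ofNat]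
  set a : ℕ → ℝ≥0∞ := fun l => ENNReal.ofReal (jones A ν (j - l) x) with ha
  set b : ℕ → ℝ≥0∞ := fun l => ∫⁻ z in Metric.closedBall x (√(n : ℝ) * L),
    ENNReal.ofReal (jones A ν (j + l) z) with hb
  have ha0 : ENNReal.ofReal (jones A ν j x) ≤ ∑' l : ℕ, 2⁻¹ ^ l * a l := by
    refine le_trans (le_of_eq ?_) (ENNReal.le_tsum 0)
    simp [ha]
  calc ENNReal.ofReal |(s ^ n)⁻¹ * (X - Y)|
      ≤ 4 ^ n * E⁻¹ * (ENNReal.ofReal |X| + ENNReal.ofReal |Y|) := by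
        rw [abs_mul, abs_of_pos (by positivity), ENNReal.ofReal_mul (by positivity), hEs,
          ← ENNReal.ofReal_add (abs_nonneg _) (abs_nonneg _)]
        gcongr
        exact abs_sub X Y
    _ ≤ 4 ^ n * E⁻¹ * (C₁ * E * (∑' l : ℕ, 2⁻¹ ^ l * a l) +
          C₂ * ((∑' l : ℕ, 2⁻¹ ^ l * b l) + E * ∑' l : ℕ, 2⁻¹ ^ l * a l)) := by
        gcongr
        exact h2.trans (by gcongr)
    _ = (E⁻¹ * E) * (4 ^ n * (C₁ + C₂) * ∑' l : ℕ, 2⁻¹ ^ l * a l) +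
          4 ^ n * C₂ * (E⁻¹ * ∑' l : ℕ, 2⁻¹ ^ l * b l) := by ring
    _ ≤ 4 ^ n * (C₁ + C₂) * (∑' l : ℕ, 2⁻¹ ^ l * a l) +
          4 ^ n * (C₁ + C₂) * (E⁻¹ * ∑' l : ℕ, 2⁻¹ ^ l * b l) := by
        rw [ENNReal.inv_mul_cancel hE0 hET, one_mul]
        gcongr
        exact le_add_self
    _ = _ := by
        rw [← mul_add, ← ENNReal.tsum_mul_left, ← ENNReal.tsum_add]
        congr 1
        refine tsum_congr fun l => ?_
        ring

/-! ### The square integral of the majorant -/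

lemma mul_le_sq_add_sq (a b : ℝ≥0∞) : a * b ≤ a ^ 2 + b ^ 2 := by
  rcases le_total a b with h | h
  · calc a * b ≤ b * b := by gcongr
      _ = b ^ 2 := (sq b).symm
      _ ≤ _ := le_add_self
  · calc a * b ≤ a * a := by gcongr
      _ = a ^ 2 := (sq a).symm
      _ ≤ _ := le_self_add

lemma add_sq_le_four_mul (a b : ℝ≥0∞) : (a + b) ^ 2 ≤ 4 * (a ^ 2 + b ^ 2) := by
  calc (a + b) ^ 2 = a ^ 2 + b ^ 2 + 2 * (a * b) := by ring
    _ ≤ a ^ 2 + b ^ 2 + 2 * (a ^ 2 + b ^ 2) := by gcongr; exact mul_le_sq_add_sq a b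
    _ = 3 * (a ^ 2 + b ^ 2) := by ring
    _ ≤ _ := by gcongr; norm_num

lemma tsum_half_pow : ∑' l : ℕ, (2⁻¹ : ℝ≥0∞) ^ l = 2 := by
  rw [ENNReal.tsum_geometric, ENNReal.one_sub_inv_two, inv_inv]

/-- The Cauchy–Schwarz inequality with geometric weights. -/
lemma sq_tsum_half_pow_le (a : ℕ → ℝ≥0∞) :
    (∑' l : ℕ, 2⁻¹ ^ l * a l) ^ 2 ≤ 4 * ∑' l : ℕ, 2⁻¹ ^ l * a l ^ 2 := by
  calc (∑' l : ℕ, 2⁻¹ ^ l * a l) ^ 2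
      = ∑' l : ℕ, ∑' i : ℕ, (2⁻¹ : ℝ≥0∞) ^ l * 2⁻¹ ^ i * (a l * a i) := by
        rw [sq, ← ENNReal.tsum_mul_right]
        refine tsum_congr fun l => ?_
        rw [← ENNReal.tsum_mul_left]
        refine tsum_congr fun i => ?_
        ring
    _ ≤ ∑' l : ℕ, ∑' i : ℕ, (2⁻¹ : ℝ≥0∞) ^ l * 2⁻¹ ^ i * (a l ^ 2 + a i ^ 2) := by
        refine ENNReal.tsum_le_tsum fun l => ENNReal.tsum_le_tsum fun i => ?_
        gcongr
        exact mul_le_sq_add_sq _ _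
    _ = ∑' l : ℕ, ((2⁻¹ : ℝ≥0∞) ^ l * a l ^ 2 * 2 +
          2⁻¹ ^ l * ∑' i : ℕ, (2⁻¹ : ℝ≥0∞) ^ i * a i ^ 2) := by
        refine tsum_congr fun l => ?_
        have h : (2⁻¹ : ℝ≥0∞) ^ l * a l ^ 2 * 2 =
            ∑' i : ℕ, 2⁻¹ ^ l * a l ^ 2 * 2⁻¹ ^ i := by
          rw [ENNReal.tsum_mul_left, tsum_half_pow]
        rw [h, ← ENNReal.tsum_mul_left, ← ENNReal.tsum_add]
        refine tsum_congr fun i => ?_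
        ring
    _ = _ := by
        rw [ENNReal.tsum_add, ENNReal.tsum_mul_right, ENNReal.tsum_mul_right, tsum_half_pow]
        ring

lemma sq_setLIntegral_le {g : Eu n → ℝ≥0∞} (hg : Measurable g) (S : Set (Eu n)) :
    (∫⁻ z in S, g z) ^ 2 ≤ 2 * volume S * ∫⁻ z in S, g z ^ 2 := by
  have hg2 : Measurable fun z => g z ^ 2 := hg.pow_const 2
  calc (∫⁻ z in S, g z) ^ 2 = ∫⁻ z in S, ∫⁻ y in S, g z * g y := by
        simp only [lintegral_const_mul _ hg]
        rw [lintegral_mul_const _ hg, sq]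
    _ ≤ ∫⁻ z in S, ∫⁻ y in S, (g z ^ 2 + g y ^ 2) := by
        gcongr with z y
        exact mul_le_sq_add_sq _ _
    _ = ∫⁻ z in S, (g z ^ 2 * volume S + ∫⁻ y in S, g y ^ 2) := by
        refine lintegral_congr fun z => ?_
        rw [lintegral_add_left measurable_const, setLIntegral_const]
    _ = _ := by
        rw [lintegral_add_right _ measurable_const, lintegral_mul_const _ hg2, setLIntegral_const]
        ring

/-- The indicator of the pairs of points at distance at most `r`, times `g`. -/
lemma measurable_closeby {g : Eu n → ℝ≥0∞} (hg : Measurable g) (r : ℝ) :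
    Measurable fun q : Eu n × Eu n =>
      (Metric.closedBall q.1 r).indicator g q.2 := by
  have h : MeasurableSet {q : Eu n × Eu n | dist q.2 q.1 ≤ r} :=
    (isClosed_le (by fun_prop) continuous_const).measurableSet
  exact (hg.comp measurable_snd).indicator h

lemma measurable_setLIntegral_closedBall {g : Eu n → ℝ≥0∞} (hg : Measurable g) (r : ℝ) :
    Measurable fun x => ∫⁻ z in Metric.closedBall x r, g z := by
  have h : Measurable fun x => ∫⁻ z, (Metric.closedBall x r).indicator g z :=
    (measurable_closeby hg r).lintegral_prod_right'
  simpa only [lintegral_indicator Metric.isClosed_closedBall.measurableSet] using h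

lemma lintegral_setLIntegral_closedBall {g : Eu n → ℝ≥0∞} (hg : Measurable g) {c L : ℝ}
    (hc : 0 ≤ c) (hL : 0 ≤ L) :
    ∫⁻ x, ∫⁻ z in Metric.closedBall x (c * L), g z =
      ENNReal.ofReal (c ^ n * ballVol n) * ENNReal.ofReal L ^ n * ∫⁻ z, g z := by
  have h1 : ∀ x, ∫⁻ z in Metric.closedBall x (c * L), g z =
      ∫⁻ z, (Metric.closedBall x (c * L)).indicator g z := fun x =>
    (lintegral_indicator Metric.isClosed_closedBall.measurableSet _).symm
  simp only [h1]
  rw [lintegral_lintegral_swap (f := fun x z => (Metric.closedBall x (c * L)).indicator g z)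
    (measurable_closeby hg _).aemeasurable, ← lintegral_const_mul _ hg]
  refine lintegral_congr fun z => ?_
  have h2 : ∀ x, (Metric.closedBall x (c * L)).indicator g z =
      (Metric.closedBall z (c * L)).indicator (fun _ => g z) x := fun x => by
    by_cases h : dist z x ≤ c * L
    · rw [indicator_of_mem (by exact h), indicator_of_mem (by rwa [Metric.mem_closedBall, dist_comm])]
    · rw [indicator_of_notMem (by exact h),
        indicator_of_notMem (by rwa [Metric.mem_closedBall, dist_comm])]
  simp only [h2]
  rw [lintegral_indicator_const Metric.isClosed_closedBall.measurableSet,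
    volume_closedBall_mul z hc hL, mul_comm]

/-- Averages over balls are bounded on `L²`. -/
lemma lintegral_sq_average_le {g : Eu n → ℝ≥0∞} (hg : Measurable g) {c L : ℝ}
    (hc : 0 ≤ c) (hL : 0 < L) :
    ∫⁻ x, ((ENNReal.ofReal L ^ n)⁻¹ * ∫⁻ z in Metric.closedBall x (c * L), g z) ^ 2 ≤
      2 * ENNReal.ofReal (c ^ n * ballVol n) ^ 2 * ∫⁻ z, g z ^ 2 := by
  set V := ENNReal.ofReal (c ^ n * ballVol n) with hV
  set E := ENNReal.ofReal L ^ n with hE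
  have hE0 : E ≠ 0 := by rw [hE]; exact pow_ne_zero _ (by simpa using hL)
  have hET : E ≠ ∞ := by rw [hE]; finiteness
  calc _ ≤ ∫⁻ x, E⁻¹ ^ 2 * (2 * (V * E)) * ∫⁻ z in Metric.closedBall x (c * L), g z ^ 2 := by
        refine lintegral_mono fun x => ?_
        rw [mul_pow, mul_assoc (E⁻¹ ^ 2)]
        gcongr
        rw [hV, hE, ← volume_closedBall_mul x hc hL.le]
        exact sq_setLIntegral_le hg _
    _ = E⁻¹ ^ 2 * (2 * (V * E)) * (V * E * ∫⁻ z, g z ^ 2) := by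
        rw [lintegral_const_mul _ (measurable_setLIntegral_closedBall (hg.pow_const 2) _),
          lintegral_setLIntegral_closedBall (hg.pow_const 2) hc hL.le]
    _ = (E⁻¹ * E) ^ 2 * (2 * V ^ 2 * ∫⁻ z, g z ^ 2) := by ring
    _ = _ := by rw [ENNReal.inv_mul_cancel hE0 hET, one_pow, one_mul]

/-- The majorant of the terms of the square function. -/
noncomputable def majorant (A : Eu n → Eu k) (ν : Measure (Eu n)) (j : ℤ) (x : Eu n) : ℝ≥0∞ :=
  ∑' l : ℕ, 2⁻¹ ^ l * (ENNReal.ofReal (jones A ν (j - l) x) +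
    (ENNReal.ofReal (2 ^ (-j)) ^ n)⁻¹ * ∫⁻ z in Metric.closedBall x (√(n : ℝ) * 2 ^ (-j)),
      ENNReal.ofReal (jones A ν (j + l) z))

section Majorant

variable {A : Eu n → Eu k} {ν : Measure (Eu n)}

lemma measurable_majorant_term (hA : Continuous A) (ν : Measure (Eu n)) (j : ℤ) (l : ℕ) :
    Measurable fun x => ENNReal.ofReal (jones A ν (j - l) x) +
      (ENNReal.ofReal (2 ^ (-j)) ^ n)⁻¹ * ∫⁻ z in Metric.closedBall x (√(n : ℝ) * 2 ^ (-j)),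
        ENNReal.ofReal (jones A ν (j + l) z) :=
  (measurable_jones hA ν _).ennreal_ofReal.add ((measurable_setLIntegral_closedBall
    (measurable_jones hA ν _).ennreal_ofReal _).const_mul _)

lemma measurable_majorant (hA : Continuous A) (ν : Measure (Eu n)) (j : ℤ) :
    Measurable (majorant A ν j) :=
  Measurable.tsum fun l => (measurable_majorant_term hA ν j l).const_mul _

lemma lintegral_sq_majorant_le (hA : Continuous A) (ν : Measure (Eu n)) (j : ℤ) :
    ∫⁻ x, majorant A ν j x ^ 2 ≤ ∑' l : ℕ, 16 * 2⁻¹ ^ l *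
      ((∫⁻ x, ENNReal.ofReal (jones A ν (j - l) x) ^ 2) +
        2 * ENNReal.ofReal (√(n : ℝ) ^ n * ballVol n) ^ 2 *
          ∫⁻ x, ENNReal.ofReal (jones A ν (j + l) x) ^ 2) := by
  have hJ : ∀ i : ℤ, Measurable fun x => ENNReal.ofReal (jones A ν i x) := fun i =>
    (measurable_jones hA ν i).ennreal_ofReal
  calc _ ≤ ∫⁻ x, 4 * ∑' l : ℕ, 2⁻¹ ^ l * (ENNReal.ofReal (jones A ν (j - l) x) +
          (ENNReal.ofReal (2 ^ (-j)) ^ n)⁻¹ * ∫⁻ z in Metric.closedBall x (√(n : ℝ) * 2 ^ (-j)),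
            ENNReal.ofReal (jones A ν (j + l) z)) ^ 2 :=
        lintegral_mono fun x => sq_tsum_half_pow_le _
    _ = ∑' l : ℕ, 4 * (2⁻¹ ^ l * ∫⁻ x, (ENNReal.ofReal (jones A ν (j - l) x) +
          (ENNReal.ofReal (2 ^ (-j)) ^ n)⁻¹ * ∫⁻ z in Metric.closedBall x (√(n : ℝ) * 2 ^ (-j)),
            ENNReal.ofReal (jones A ν (j + l) z)) ^ 2) := by
        rw [lintegral_const_mul' _ _ (by norm_num), lintegral_tsum fun l =>
          (((measurable_majorant_term hA ν j l).pow_const 2).const_mul _).aemeasurable,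
          ← ENNReal.tsum_mul_left]
        refine tsum_congr fun l => ?_
        rw [lintegral_const_mul _ ((measurable_majorant_term hA ν j l).pow_const 2)]
    _ ≤ _ := by
        refine ENNReal.tsum_le_tsum fun l => ?_
        calc _ ≤ 4 * (2⁻¹ ^ l * ∫⁻ x, 4 * (ENNReal.ofReal (jones A ν (j - l) x) ^ 2 +
              ((ENNReal.ofReal (2 ^ (-j)) ^ n)⁻¹ *
                ∫⁻ z in Metric.closedBall x (√(n : ℝ) * 2 ^ (-j)),
                  ENNReal.ofReal (jones A ν (j + l) z)) ^ 2)) := by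
              gcongr with x
              exact add_sq_le_four_mul _ _
          _ = 16 * 2⁻¹ ^ l * ((∫⁻ x, ENNReal.ofReal (jones A ν (j - l) x) ^ 2) +
              ∫⁻ x, ((ENNReal.ofReal (2 ^ (-j)) ^ n)⁻¹ *
                ∫⁻ z in Metric.closedBall x (√(n : ℝ) * 2 ^ (-j)),
                  ENNReal.ofReal (jones A ν (j + l) z)) ^ 2) := by
              rw [lintegral_const_mul' _ _ (by norm_num),
                lintegral_add_left ((hJ _).pow_const 2)]
              ring
          _ ≤ _ := by
              gcongr
              exact lintegral_sq_average_le (hJ _) (by positivity) (by positivity)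

/-- The majorants are square summable as soon as the deviations from flatness are. -/
lemma tsum_lintegral_sq_majorant_le (hA : Continuous A) (ν : Measure (Eu n)) :
    ∑' j : ℤ, ∫⁻ x, majorant A ν j x ^ 2 ≤
      32 * (1 + 2 * ENNReal.ofReal (√(n : ℝ) ^ n * ballVol n) ^ 2) *
        ∑' j : ℤ, ∫⁻ x, ENNReal.ofReal (jones A ν j x) ^ 2 := by
  set V := 2 * ENNReal.ofReal (√(n : ℝ) ^ n * ballVol n) ^ 2 with hV
  set I : ℤ → ℝ≥0∞ := fun j => ∫⁻ x, ENNReal.ofReal (jones A ν j x) ^ 2 with hI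
  calc _ ≤ ∑' j : ℤ, ∑' l : ℕ, 16 * 2⁻¹ ^ l * (I (j - l) + V * I (j + l)) :=
        ENNReal.tsum_le_tsum fun j => lintegral_sq_majorant_le hA ν j
    _ = ∑' l : ℕ, 2⁻¹ ^ l * (16 * ((1 + V) * ∑' j : ℤ, I j)) := by
        rw [ENNReal.tsum_comm]
        refine tsum_congr fun l => ?_
        rw [ENNReal.tsum_mul_left, ENNReal.tsum_add, ENNReal.tsum_mul_left,
          show ∑' j : ℤ, I (j - l) = ∑' j, I j from (Equiv.subRight (l : ℤ)).tsum_eq I,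
          show ∑' j : ℤ, I (j + l) = ∑' j, I j from (Equiv.addRight (l : ℤ)).tsum_eq I]
        ring
    _ = _ := by rw [ENNReal.tsum_mul_right, tsum_half_pow]; ring

end Majorant

/-! ### The norm of the square function -/

lemma Cube.scale_one (Q : Cube n) : Q.scale 1 = Q := by
  obtain ⟨a, s⟩ := Q
  have h : (WithLp.toLp 2 fun i => (Cube.mk a s).center i - 1 * s / 2 : Eu n) = a := by
    ext i
    simp [Cube.center]
  rw [Cube.scale, h, one_mul]

lemma eLpNorm_squareFun_sq (K : Eu (n + k) → ℝ) (φ : ℝ → ℝ) (μ : Measure (Eu (n + k))) :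
    eLpNorm (squareFun K φ μ) 2 μ ^ 2 = ∫⁻ x, ∑' m : ℤ, ENNReal.ofReal
      |smoothTrunc K φ μ ((2 : ℝ) ^ (-m)) x - avgMartingale K μ m x| ^ 2 ∂μ := by
  have h := eLpNorm_nnreal_pow_eq_lintegral (μ := μ) (f := squareFun K φ μ) (p := 2) two_ne_zero
  simp only [NNReal.coe_ofNat, ENNReal.coe_ofNat, ENNReal.rpow_ofNat, enorm_eq_self] at h
  rw [h]
  refine lintegral_congr fun x => ?_
  rw [squareFun, ← ENNReal.rpow_natCast, ← ENNReal.rpow_mul]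
  norm_num
  exact tsum_congr fun m => by rw [← sq_abs, ENNReal.ofReal_pow (abs_nonneg _)]

section Final

variable {φ : ℝ → ℝ} {K : Eu (n + k) → ℝ} {lip : ℝ≥0} {M ρ : ℝ} {A : Eu n → Eu k}
  {ν : Measure (Eu n)}

lemma zpow_neg_eq_sub_two (m : ℤ) : (2 : ℝ) ^ (-m) = 2 ^ (-(m - 2)) / 4 := by
  rw [show -(m - 2) = -m + 2 by ring, zpow_add₀ two_ne_zero]; norm_num

lemma wellDefined_map (hφ : IsProfile n φ) (hn : 0 < n) (hK : IsKernel n k K)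
    (hν : IsGraphPair lip M A ν) (hρ : 0 ≤ ρ) (hF : FlatOutside ρ A ν) :
    WellDefined K φ A (ν.map (graphMap A)) := by
  refine ⟨fun x hx ε hε => ?_, fun m a => ?_, fun m x => ?_⟩
  · have h := (hasLimInt_smoothTrunc hφ hn hK hν hρ hF hε (tilde x)).1
    rwa [graphMap_tilde hx] at h
  · exact wellDefined_outer hφ hn hK hν hρ hF (Q := cubeAt m a) (zpow_neg_eq_sub_two m)
  · exact integrableOn_martingale hφ hn hK hν hρ hF m x

/-- The square function estimate over the base of the graph. -/
lemma exists_eLpNorm_squareFun_le (n k : ℕ) (hn : 0 < n) (lip : ℝ≥0) (M : ℝ) (hM : 1 ≤ M)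
    {φ : ℝ → ℝ} (hφ : IsProfile n φ) {K : Eu (n + k) → ℝ} (hK : IsKernel n k K) :
    ∃ C : ℝ≥0∞, C ≠ ∞ ∧ ∀ (A : Eu n → Eu k) (ν : Measure (Eu n)), IsGraphPair lip M A ν →
      ∀ ρ : ℝ, 0 ≤ ρ → FlatOutside ρ A ν →
      eLpNorm (squareFun K φ (ν.map (graphMap A))) 2 (ν.map (graphMap A)) ^ 2 ≤
        C * ∑' j : ℤ, ∫⁻ x, ENNReal.ofReal (jones A ν j x) ^ 2 := by
  obtain ⟨C, hC, hpt⟩ := exists_truncLim_sub_average_le n k hn lip M hM hφ hK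
  refine ⟨ENNReal.ofReal M * C ^ 2 *
    (32 * (1 + 2 * ENNReal.ofReal (√(n : ℝ) ^ n * ballVol n) ^ 2)), by finiteness,
    fun A ν hν ρ hρ hF => ?_⟩
  have hA := hν.lipschitz.continuous
  have hterm : ∀ (m : ℤ) (x : Eu n), ENNReal.ofReal
      |smoothTrunc K φ (ν.map (graphMap A)) ((2 : ℝ) ^ (-m)) (graphMap A x) -
        avgMartingale K (ν.map (graphMap A)) m (graphMap A x)| ^ 2 ≤
      C ^ 2 * majorant A ν (m - 2) x ^ 2 := fun m x => by
    rw [(hasLimInt_smoothTrunc hφ hn hK hν hρ hF (by positivity) x).2, avgMartingale_eq,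
      show tilde (graphMap A x) = x by rw [graphMap, tilde_join], ← mul_pow]
    gcongr
    exact hpt A ν hν ρ hρ hF (m - 2) x _ (zpow_neg_eq_sub_two m)
  rw [eLpNorm_squareFun_sq, (measurableEmbedding_graphMap hA).lintegral_map]
  calc _ ≤ ∫⁻ x, ∑' m : ℤ, C ^ 2 * majorant A ν (m - 2) x ^ 2 ∂ν :=
        lintegral_mono fun x => ENNReal.tsum_le_tsum fun m => hterm m x
    _ ≤ ENNReal.ofReal M * ∫⁻ x, ∑' m : ℤ, C ^ 2 * majorant A ν (m - 2) x ^ 2 := by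
        simpa only [Measure.restrict_univ] using hν.setLIntegral_le univ
          (fun x => ∑' m : ℤ, C ^ 2 * majorant A ν (m - 2) x ^ 2)
    _ = ENNReal.ofReal M * (C ^ 2 * ∑' j : ℤ, ∫⁻ x, majorant A ν j x ^ 2) := by
        rw [lintegral_tsum fun m =>
          (((measurable_majorant hA ν _).pow_const 2).const_mul _).aemeasurable]
        congr 1
        rw [← ENNReal.tsum_mul_left,
          ← (Equiv.subRight (2 : ℤ)).tsum_eq fun j : ℤ => C ^ 2 * ∫⁻ x, majorant A ν j x ^ 2]
        refine tsum_congr fun m => ?_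
        rw [lintegral_const_mul _ ((measurable_majorant hA ν _).pow_const 2)]
        rfl
    _ ≤ ENNReal.ofReal M * (C ^ 2 * (32 * (1 + 2 * ENNReal.ofReal (√(n : ℝ) ^ n * ballVol n) ^ 2) *
          ∑' j : ℤ, ∫⁻ x, ENNReal.ofReal (jones A ν j x) ^ 2)) := by
        gcongr
        exact tsum_lintegral_sq_majorant_le hA ν
    _ = _ := by ring

/-- A graph measure with the standard density off a cube is flat outside a ball. -/
lemma exists_flatOutside {f : Eu (n + k) → ℝ} (hA : LipschitzWith lip A) {P : Cube n}
    (hP : 0 < P.side) (hsupp : Function.support A ⊆ P.base)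
    (hf : ∀ x ∈ graph A, x ∉ P.vset k → f x = 1) :
    ∃ ρ, 0 ≤ ρ ∧ FlatOutside ρ A ((graphMeasure A f).map tilde) := by
  set ρ : ℝ := ‖P.center‖ + √(n : ℝ) * (P.side / 2) with hρ
  have hout : ∀ u, ρ < ‖u‖ → u ∉ P.base := fun u hu h => by
    have h1 := Cube.norm_sub_center_le hP.le h
    have h2 := norm_le_norm_add_norm_sub P.center u
    rw [norm_sub_rev] at h2
    linarith
  have hzero : ∀ u, ρ < ‖u‖ → A u = 0 := fun u hu => by
    by_contra h
    exact hout u hu (hsupp h)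
  have hmem : ∀ u : Eu n, u ∈ (Metric.closedBall (0 : Eu n) ρ)ᶜ → ρ < ‖u‖ := fun u hu => by
    rwa [mem_compl_iff, Metric.mem_closedBall, dist_zero_right, not_le] at hu
  exact ⟨ρ, by positivity, hzero, map_tilde_graphMeasure_restrict hA
    Metric.isClosed_closedBall.measurableSet.compl (fun u hu => hzero u (hmem u hu))
    fun x hx hxu => hf x hx (hout _ (hmem _ hxu))⟩

end Final

end LipGraph

theorem theorem3p1 (n k : ℕ) (hn : 0 < n) (hk : 0 < k)
    (φ : ℝ → ℝ) (hφ : LipGraph.IsProfile n φ)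
    (K : LipGraph.Eu (n + k) → ℝ) (hK : LipGraph.IsKernel n k K)
    (C₀ : ℝ) (hC₀ : 0 < C₀) (lip : ℝ≥0) :
    ∃ C₁ C₂ : ℝ, 0 < C₁ ∧ 0 < C₂ ∧
      ∀ cΓ : ℝ, 10 * √(n : ℝ) * (1 + lip) < cΓ →
      ∀ P : LipGraph.Cube n, 0 < P.side →
      ∀ A : LipGraph.Eu n → LipGraph.Eu k, LipschitzWith lip A →
        Function.support A ⊆ P.base →
      ∀ f : LipGraph.Eu (n + k) → ℝ, Measurable f →
        (∀ x ∈ LipGraph.graph A, x ∉ P.vset k → f x = 1) →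
        (∀ x ∈ LipGraph.graph A, x ∈ P.vset k → C₀⁻¹ ≤ f x ∧ f x ≤ C₀) →
      ∀ μ : Measure (LipGraph.Eu (n + k)), μ = LipGraph.graphMeasure A f →
        LipGraph.WellDefined K φ A μ ∧
        eLpNorm (LipGraph.squareFun K φ μ) 2 μ ^ 2 ≤
          ENNReal.ofReal C₁ * ∑' (m : ℤ) (q : Fin n → ℤ),
            (LipGraph.alphaCoeff cΓ μ ((LipGraph.dyadic m q).scale C₂) ^ 2 +
              LipGraph.betaCoeff cΓ 2 μ (LipGraph.dyadic m q) ^ 2) *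
            μ ((LipGraph.dyadic m q).vset k) := by
  set c : ℝ := max C₀ 1 with hc
  have hc1 : 1 ≤ c := le_max_right _ _
  have hM : 1 ≤ c * (1 + lip) ^ n := by
    have : (1 : ℝ) ≤ (1 + lip) ^ n := one_le_pow₀ (by simp)
    nlinarith
  obtain ⟨C, hC, hW⟩ := LipGraph.exists_eLpNorm_squareFun_le n k hn lip _ hM hφ hK
  obtain ⟨C', hC', hJ⟩ := LipGraph.exists_lintegral_jones_le n k hn lip _ hM
  refine ⟨C.toReal * C' + 1, 1, by positivity, one_pos, ?_⟩
  rintro cΓ hcΓ P hP A hA hsupp f hf hf1 hf2 _ rfl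
  have hfc : ∀ x ∈ LipGraph.graph A, c⁻¹ ≤ f x ∧ f x ≤ c := fun x hx => by
    by_cases h : x ∈ P.vset k
    · exact ⟨(inv_anti₀ hC₀ (le_max_left _ _)).trans (hf2 x hx h).1,
        (hf2 x hx h).2.trans (le_max_left _ _)⟩
    · rw [hf1 x hx h]
      exact ⟨inv_le_one_of_one_le₀ hc1, hc1⟩
  have hν := LipGraph.isGraphPair_graphMeasure hA hf hc1 hfc
  obtain ⟨ρ, hρ, hF⟩ := LipGraph.exists_flatOutside hA hP hsupp hf1
  set ν := (LipGraph.graphMeasure A f).map LipGraph.tilde with hνdef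
  have hμ : LipGraph.graphMeasure A f = ν.map (LipGraph.graphMap A) :=
    (LipGraph.map_graphMap_map_tilde hA).symm
  have hcΓ' : 10 * √(n : ℝ) < cΓ := by
    refine lt_of_le_of_lt (le_mul_of_one_le_right (by positivity) ?_) hcΓ
    simp
  rw [hμ]
  refine ⟨LipGraph.wellDefined_map hφ hn hK hν hρ hF, ?_⟩
  simp only [LipGraph.Cube.scale_one]
  refine (hW A ν hν ρ hρ hF).trans ?_
  refine (mul_le_mul_right (ENNReal.tsum_le_tsum fun j => hJ A ν hν cΓ hcΓ' j) C).trans ?_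
  rw [ENNReal.tsum_mul_left, ← mul_assoc]
  gcongr
  rw [← ENNReal.ofReal_toReal hC, ← ENNReal.ofReal_mul ENNReal.toReal_nonneg,
    ENNReal.toReal_ofReal ENNReal.toReal_nonneg]
  exact ENNReal.ofReal_le_ofReal (by linarith)
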